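/- Let $A$ be a symmetric algebra over a field $k$: a finite-dimensional $k$-algebra with a symmetric, associative, non-degenerate bilinear form $\langle\cdot,\cdot\rangle$, and let $\sum_j e_j\otimes f_j\in A\otimes A$ be the Casimir element, $\sum_j\langle e_j,x\rangle f_j=x$ for all $x\in A$. Write $a_{i,j}=a_i\otimes a_{i+1}\otimes\cdots\otimes a_j$. *Bar resolution, cochains.* Let $\bar A=A/k\cdot 1$, let $d(a_0\otimes\cdots\otimes a_{r+1})=\sum_{i=0}^{r}(-1)^i a_0\otimes\cdots\otimes a_ia_{i+1}\otimes\cdots\otimes a_{r+1}$ be the differential of the normalized bar resolution with terms $A\otimes\bar A^{\otimes r}\otimes A$, augmented by the multiplication $A\otimes A\to A$, and let $\Omega^0(A)=A$ and $\Omega^p(A)=\ker\big(d\colon A\otimes\bar A^{\otimes p-1}\otimes A\to A\otimes \bar A^{\otimes p-2}\otimes A\big)$ for $p\ge1$ (with target $A$ if $p=1$). Let $C^m(A,\Omega^p(A))$ be the normalized Hochschild cochains with values in $\Omega^p(A)$, with cohomology $\mathrm{HH}^m(A,\Omega^p(A))=\mathrm{Ext}^m_{A^e}(A,\Omega^p(A))$.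 For $f\in C^m(A,\Omega^p(A))$ and $g\in C^l(A,\Omega^q(A))$ put $$f\bullet g=\sum_{i=1}^{m}(-1)^{p+q+(i-1)(q-l-1)}\,d\big((f\otimes \mathrm{id}^{\otimes q})(\mathrm{id}^{\otimes i-1}\otimes g\otimes\mathrm{id}^{\otimes m-i})\otimes 1\big)+\sum_{i=1}^{q}(-1)^{p+q+i(p-m-1)}\,d\big((\mathrm{id}^{\otimes i}\otimes f\otimes\mathrm{id}^{\otimes q-i})(g\otimes\mathrm{id}^{\otimes m-1})\otimes 1\big),$$ $$[f,g]=f\bullet g-(-1)^{(m-p-1)(l-q-1)}g\bullet f .$$ *Singular Hochschild cohomology.* $\mathrm{HH}_{\mathrm{sg}}^i(A,A)$ is the colimit of the spaces $\mathrm{HH}^m(A,\Omega^p(A))$, $m-p=i$, $m>0$, along the maps $\mathrm{HH}^m(A,\Omega^p(A))\to\mathrm{HH}^{m+1}(A,\Omega^{p+1}(A))$ induced by $\theta(f)(a_{1,m+1})=(-1)^p d(f(a_{1,m})\otimes a_{m+1}\otimes 1)$. *Operations.* $\mathrm{Tor}_r^{A^e}(A,A)$ is the homology of the Hochschild complex with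 terms $A\otimes A^{\otimes r}$. On it, $f\cap(a_0\otimes\cdots\otimes a_r)=a_0f(a_{1,m})\otimes a_{m+1,r}$ for $f$ of degree $m\le r$, and $B$ is the Connes operator $B(a_{0,r})=\sum_{i=0}^r(-1)^{ir}\big(1\otimes a_{i,r}\otimes a_{0,i-1}+a_i\otimes 1\otimes a_{i+1,r}\otimes a_{0,i-1}\big)$. For $m\ge 1$ the operator $\Delta\colon\mathrm{HH}^m(A,A)\to\mathrm{HH}^{m-1}(A,A)$ is the graded dual of $B$: $$\langle a_0,\Delta(f)(a_{1,m-1})\rangle=(-1)^m\sum_{i=0}^{m-1}(-1)^{i(m-1)}\langle 1,f(a_{i,m-1}\otimes a_{0,i-1})\rangle .$$ For $m\ge1$ and $r\ge 1$ let $$\kappa(a_0\otimes\cdots\otimes a_r)(b_{1,m})=\sum_j d(e_ja_0\otimes a_{1,r}\otimes f_j\otimes b_{1,m}\otimes 1).$$ **Proposition.** Let $m\ge1$, $n\ge2$ and $n-m\ge1$. The formulas above induce well-defined maps on (co)homology; $\kappa$ induces isomorphisms $$\kappa\colon\mathrm{Tor}_{n-1}^{A^e}(A,A)\cong\mathrm{Ext}^1_{A^e}(A,\Omega^{n+1}(A)),\qquad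 \kappa\colon\mathrm{Tor}_{n-m}^{A^e}(A,A)\cong\mathrm{Ext}^m_{A^e}(A,\Omega^{n+1}(A));$$ the canonical maps $$\mathrm{Ext}^1_{A^e}(A,\Omega^{n+1}(A))\to\mathrm{HH}_{\mathrm{sg}}^{-n}(A,A),\qquad \mathrm{Ext}^m_{A^e}(A,\Omega^{n+1}(A))\to\mathrm{HH}_{\mathrm{sg}}^{m-n-1}(A,A)$$ are isomorphisms; and the bracket induces compatible maps $$[\cdot,\cdot]\colon\mathrm{HH}^m(A,A)\otimes\mathrm{Ext}^1_{A^e}(A,\Omega^{n+1}(A))\to\mathrm{Ext}^m_{A^e}(A,\Omega^{n+1}(A)),\qquad [\cdot,\cdot]\colon\mathrm{HH}^m(A,A)\otimes\mathrm{HH}_{\mathrm{sg}}^{-n}(A,A)\to\mathrm{HH}_{\mathrm{sg}}^{m-n-1}(A,A).$$ Under these isomorphisms both brackets correspond to the map $\{\cdot,\cdot\}\colon\mathrm{HH}^m(A,A)\otimes\mathrm{Tor}_{n-1}^{A^e}(A,A)\to\mathrm{Tor}_{n-m}^{A^e}(A,A)$, $$\{f,\alpha\}=(-1)^m\Delta(f)\cap\alpha+f\cap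 B(\alpha)+(-1)^{m+1}B(f\cap\alpha),$$ that is, $[f,\kappa(\alpha)]=\kappa(\{f,\alpha\})$ for all $f\in\mathrm{HH}^m(A,A)$ and $\alpha\in\mathrm{Tor}_{n-1}^{A^e}(A,A)$. -/

import Mathlib

open scoped TensorProduct DirectSum

noncomputable section

namespace SingHoch

/-! ### Linear maps on the tensor algebra, and block products

The tensor powers `A^{⊗ n}` over `k` are the homogeneous components of the tensor algebra of the
`k`-module `A`; the word `a₀ ⊗ ⋯ ⊗ aₙ₋₁` is `TensorAlgebra.tprod k A n a`. -/

section Words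

variable {k A : Type*} [Field k] [Ring A] [Algebra k A]

/-- The linear map on `⨁ₙ A^{⊗ n}` with prescribed multilinear components. -/
def ofWords {X : Type*} [AddCommGroup X] [Module k X]
    (φ : ∀ n : ℕ, MultilinearMap k (fun _ : Fin n => A) X) : TensorAlgebra k A →ₗ[k] X :=
  (DirectSum.toModule k ℕ X fun n => PiTensorProduct.lift (φ n)) ∘ₗ
    (TensorAlgebra.equivDirectSum (R := k) (M := A)).toLinearMap

theorem ofWords_tprod {X : Type*} [AddCommGroup X] [Module k X]
    (φ : ∀ n : ℕ, MultilinearMap k (fun _ : Fin n => A) X) (n : ℕ) (a : Fin n → A) :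
    ofWords φ (TensorAlgebra.tprod k A n a) = φ n a := by
  have h : (TensorAlgebra.equivDirectSum (R := k) (M := A)) (TensorAlgebra.tprod k A n a) =
      DirectSum.of (fun n => ⨂[k]^n A) n (PiTensorProduct.tprod k a) :=
    TensorAlgebra.toDirectSum_tensorPower_tprod a
  simp only [ofWords, LinearMap.comp_apply, AlgEquiv.toLinearMap_apply]
  rw [h, ← DirectSum.lof_eq_of k, DirectSum.toModule_lof, PiTensorProduct.lift.tprod]

/-- A multilinear map in `m` variables, as a linear map on `⨁ₙ A^{⊗ n}` (zero for `n ≠ m`). -/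
def onWords {X : Type*} [AddCommGroup X] [Module k X] (m : ℕ)
    (f : MultilinearMap k (fun _ : Fin m => A) X) : TensorAlgebra k A →ₗ[k] X :=
  ofWords fun n => if h : m = n then f.domDomCongr (finCongr h) else 0

theorem onWords_tprod {X : Type*} [AddCommGroup X] [Module k X] (m : ℕ)
    (f : MultilinearMap k (fun _ : Fin m => A) X) (a : Fin m → A) :
    onWords m f (TensorAlgebra.tprod k A m a) = f a := by
  rw [onWords, ofWords_tprod, dif_pos rfl]
  rfl

/-- Splitting `N` places into a first block of length `j`, a block of length `m` and the rest. -/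
def splitEquiv {j m N : ℕ} (h : j + m ≤ N) : (Fin j ⊕ Fin m) ⊕ Fin (N - (j + m)) ≃ Fin N :=
  (Equiv.sumCongr finSumFinEquiv (Equiv.refl _)).trans
    (finSumFinEquiv.trans (finCongr (Nat.add_sub_cancel' h)))

/-- `id^{⊗ j} ⊗ g ⊗ id^{⊗ (N - j - m)}` on words of length `N`:
`a₀ ⊗ ⋯ ⊗ a_{N-1} ↦ (a₀ ⊗ ⋯ ⊗ a_{j-1}) · g(a_j, …, a_{j+m-1}) · (a_{j+m} ⊗ ⋯ ⊗ a_{N-1})`, where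
`g` and the result are in an algebra `R` under the tensor algebra (zero if `N < j + m`). -/
def block {R : Type*} [Ring R] [Algebra k R] (π : TensorAlgebra k A →ₐ[k] R) {m : ℕ} (j N : ℕ)
    (g : MultilinearMap k (fun _ : Fin m => A) R) : MultilinearMap k (fun _ : Fin N => A) R :=
  if h : j + m ≤ N then
    ((LinearMap.mul' k R).compMultilinearMap
      (MultilinearMap.domCoprod
        ((LinearMap.mul' k R).compMultilinearMap
          (MultilinearMap.domCoprod
            (π.toLinearMap.compMultilinearMap (TensorAlgebra.tprod k A j)) g))
        (π.toLinearMap.compMultilinearMap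
          (TensorAlgebra.tprod k A (N - (j + m)))))).domDomCongr (splitEquiv h)
  else 0

theorem block_apply {R : Type*} [Ring R] [Algebra k R] (π : TensorAlgebra k A →ₐ[k] R)
    {m j N : ℕ} (h : j + m ≤ N) (g : MultilinearMap k (fun _ : Fin m => A) R) (a : Fin N → A) :
    block π j N g a =
      π (TensorAlgebra.tprod k A j fun t => a ⟨t, by omega⟩) *
        g (fun t => a ⟨j + t, by omega⟩) *
        π (TensorAlgebra.tprod k A (N - (j + m)) fun t => a ⟨j + m + t, by omega⟩) := by
  simp only [block, dif_pos h, MultilinearMap.domDomCongr_apply,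
    LinearMap.compMultilinearMap_apply, MultilinearMap.domCoprod_apply, LinearMap.mul'_apply,
    AlgHom.toLinearMap_apply]
  rfl

/-- Multiplication of two neighbours, `(a, b) ↦ ab`, as a multilinear map into words of length 1. -/
def mulWord : MultilinearMap k (fun _ : Fin 2 => A) (TensorAlgebra k A) :=
  (TensorAlgebra.ι k).compMultilinearMap (MultilinearMap.mkPiAlgebraFin k 2 A)

/-- `a₀ ⊗ ⋯ ⊗ a_{N-1} ↦ a₀ ⊗ ⋯ ⊗ a_i a_{i+1} ⊗ ⋯ ⊗ a_{N-1}`. -/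
def contract (i N : ℕ) : MultilinearMap k (fun _ : Fin N => A) (TensorAlgebra k A) :=
  block (AlgHom.id k (TensorAlgebra k A)) i N mulWord

end Words

/-! ### The normalized bar resolution -/

section Bar

variable (k A : Type*) [Field k] [Ring A] [Algebra k A]

/-- The words with a factor `1` in an interior place. -/
def unitWords : Set (TensorAlgebra k A) :=
  {t | ∃ (n : ℕ) (a : Fin n → A) (i : Fin n),
    0 < (i : ℕ) ∧ (i : ℕ) + 1 < n ∧ a i = 1 ∧ TensorAlgebra.tprod k A n a = t}

variable {k A}

theorem tprod_mul {n l : ℕ} (a : Fin n → A) (b : Fin l → A) :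
    TensorAlgebra.tprod k A n a * TensorAlgebra.tprod k A l b =
      TensorAlgebra.tprod k A (n + l) (Fin.append a b) := by
  simp only [TensorAlgebra.tprod_apply]
  rw [List.ofFn_comp' a, List.ofFn_comp' b, List.ofFn_comp' (Fin.append a b),
    List.ofFn_fin_append, List.map_append, List.prod_append]

theorem ι_eq_tprod (x : A) :
    TensorAlgebra.ι k x = TensorAlgebra.tprod k A 1 (fun _ => x) := by
  simp [TensorAlgebra.tprod_apply]

theorem mul_unitWords (x : A) {t : TensorAlgebra k A} (ht : t ∈ unitWords k A) :
    TensorAlgebra.ι k x * t ∈ unitWords k A := by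
  obtain ⟨n, a, i, h0, h1, hi, rfl⟩ := ht
  refine ⟨1 + n, Fin.append (fun _ => x) a, Fin.natAdd 1 i, ?_, ?_, ?_, ?_⟩
  · simp
  · simp; omega
  · simpa using hi
  · rw [ι_eq_tprod, tprod_mul]

theorem unitWords_mul (x : A) {t : TensorAlgebra k A} (ht : t ∈ unitWords k A) :
    t * TensorAlgebra.ι k x ∈ unitWords k A := by
  obtain ⟨n, a, i, h0, h1, hi, rfl⟩ := ht
  refine ⟨n + 1, Fin.append a (fun _ => x), Fin.castAdd 1 i, ?_, ?_, ?_, ?_⟩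
  · simpa using h0
  · simp
  · simpa using hi
  · rw [ι_eq_tprod, tprod_mul]

theorem mul_span_unitWords (s : TensorAlgebra k A) :
    ∀ t ∈ Submodule.span k (unitWords k A), s * t ∈ Submodule.span k (unitWords k A) := by
  induction s using TensorAlgebra.induction with
  | algebraMap r =>
    intro t ht
    rw [← Algebra.smul_def]
    exact Submodule.smul_mem _ r ht
  | ι x =>
    intro t ht
    induction ht using Submodule.span_induction with
    | mem t ht => exact Submodule.subset_span (mul_unitWords x ht)
    | zero => simp
    | add t u _ _ h1 h2 => rw [mul_add]; exact add_mem h1 h2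
    | smul r t _ h => rw [mul_smul_comm]; exact Submodule.smul_mem _ r h
  | mul a b ha hb => intro t ht; rw [mul_assoc]; exact ha _ (hb _ ht)
  | add a b ha hb => intro t ht; rw [add_mul]; exact add_mem (ha _ ht) (hb _ ht)

theorem span_unitWords_mul (s : TensorAlgebra k A) :
    ∀ t ∈ Submodule.span k (unitWords k A), t * s ∈ Submodule.span k (unitWords k A) := by
  induction s using TensorAlgebra.induction with
  | algebraMap r =>
    intro t ht
    rw [← Algebra.commutes, ← Algebra.smul_def]
    exact Submodule.smul_mem _ r ht
  | ι x =>
    intro t ht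
    induction ht using Submodule.span_induction with
    | mem t ht => exact Submodule.subset_span (unitWords_mul x ht)
    | zero => simp
    | add t u _ _ h1 h2 => rw [add_mul]; exact add_mem h1 h2
    | smul r t _ h => rw [smul_mul_assoc]; exact Submodule.smul_mem _ r h
  | mul a b ha hb => intro t ht; rw [← mul_assoc]; exact hb _ (ha _ ht)
  | add a b ha hb => intro t ht; rw [mul_add]; exact add_mem (ha _ ht) (hb _ ht)

variable (k A)

/-- The `k`-span of the words with a factor `1` in an interior place; it is a two-sided ideal. -/
def degenerate : Ideal (TensorAlgebra k A) :=
  { (Submodule.span k (unitWords k A)) with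
    smul_mem' := fun s t ht => mul_span_unitWords s t ht }

instance : (degenerate k A).IsTwoSided := ⟨fun s ht => span_unitWords_mul s _ ht⟩

/-- Words modulo those with a factor `1` in an interior place. With `Ā = A / k·1`, the component of
words of length `r + 2` is the `r`-th term `A ⊗ Ā^{⊗ r} ⊗ A` of the normalized bar resolution, the
component of length `1` is `A`. The multiplication is concatenation of words. -/
abbrev Bar : Type _ := TensorAlgebra k A ⧸ degenerate k A

/-- The projection from words to normalized words. -/
abbrev toBar : TensorAlgebra k A →ₐ[k] Bar k A := Ideal.Quotient.mkₐ k (degenerate k A)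

variable {k A}

/-- A linear map on words that kills the words with an interior `1`, on normalized words. -/
def liftBar {X : Type*} [AddCommGroup X] [Module k X] (φ : TensorAlgebra k A →ₗ[k] X)
    (h : ∀ t ∈ unitWords k A, φ t = 0) : Bar k A →ₗ[k] X :=
  (Submodule.liftQ ((degenerate k A).restrictScalars k) φ
    (fun t ht => by
      have ht' : t ∈ Submodule.span k (unitWords k A) := ht
      exact (Submodule.span_le (p := LinearMap.ker φ)).2 h ht')) ∘ₗ
    (Submodule.Quotient.restrictScalarsEquiv k (degenerate k A)).symm.toLinearMap

theorem liftBar_toBar {X : Type*} [AddCommGroup X] [Module k X] (φ : TensorAlgebra k A →ₗ[k] X)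
    (h : ∀ t ∈ unitWords k A, φ t = 0) (t : TensorAlgebra k A) :
    liftBar φ h (toBar k A t) = φ t := rfl

theorem toBar_eq_zero {n : ℕ} (a : Fin n → A) (i : ℕ) (h0 : 0 < i) (h1 : i + 1 < n)
    (hi : a ⟨i, by omega⟩ = 1) : toBar k A (TensorAlgebra.tprod k A n a) = 0 :=
  Ideal.Quotient.eq_zero_iff_mem.2 (Submodule.subset_span ⟨n, a, ⟨i, by omega⟩, h0, h1, hi, rfl⟩)


theorem tprod_congr {n l : ℕ} (h : n = l) (a : Fin n → A) (b : Fin l → A)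
    (hab : ∀ (i : ℕ) (hi : i < n), a ⟨i, hi⟩ = b ⟨i, h ▸ hi⟩) :
    TensorAlgebra.tprod k A n a = TensorAlgebra.tprod k A l b := by
  subst h
  congr 1
  funext i
  exact hab i i.2

theorem append_apply {A : Type*} {n l : ℕ} (a : Fin n → A) (b : Fin l → A) (i : ℕ) (hi : i < n + l) :
    Fin.append a b ⟨i, hi⟩ = if h : i < n then a ⟨i, h⟩ else b ⟨i - n, by omega⟩ := by
  split_ifs with h
  · exact Fin.append_left a b ⟨i, h⟩
  · have := Fin.append_right a b ⟨i - n, by omega⟩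
    rw [← this]
    congr 1
    ext
    simp
    omega

theorem contract_apply (i N : ℕ) (h : i + 2 ≤ N) (a : Fin N → A) :
    contract (k := k) i N a = TensorAlgebra.tprod k A (N - 1) fun t =>
      if (t : ℕ) < i then a ⟨t, by omega⟩
      else if (t : ℕ) = i then a ⟨i, by omega⟩ * a ⟨i + 1, by omega⟩
      else a ⟨t + 1, by omega⟩ := by
  have hm : ∀ b : Fin 2 → A, mulWord (k := k) b =
      TensorAlgebra.tprod k A 1 (fun _ => b 0 * b 1) := by
    intro b
    rw [← ι_eq_tprod]
    simp [mulWord]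
  rw [contract, block_apply _ h, hm, AlgHom.id_apply, AlgHom.id_apply, tprod_mul, tprod_mul]
  refine tprod_congr (by omega) _ _ ?_
  intro t ht
  rw [append_apply]
  split_ifs with h1 h2 h3 h4 h5
  all_goals try (rw [append_apply]; split_ifs)
  all_goals first
    | rfl
    | (exfalso; simp only at *; omega)
    | (congr 2; simp only; omega)

/-- The differential of the normalized bar resolution (augmented by the multiplication of `A`):
`d(a₀ ⊗ ⋯ ⊗ a_{r+1}) = ∑_{i=0}^{r} (-1)^i a₀ ⊗ ⋯ ⊗ a_i a_{i+1} ⊗ ⋯ ⊗ a_{r+1}`, on words. -/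
def barWords : TensorAlgebra k A →ₗ[k] Bar k A :=
  ofWords fun N => ∑ i ∈ Finset.range (N - 1),
    (-1 : k) ^ i • (toBar k A).toLinearMap.compMultilinearMap (contract i N)

theorem barWords_unitWords (t : TensorAlgebra k A) (ht : t ∈ unitWords k A) :
    barWords t = 0 := by
  obtain ⟨n, a, ⟨p, hp⟩, h0, h1, hi, rfl⟩ := ht
  simp only at h0 h1
  rw [barWords, ofWords_tprod]
  simp only [sum_apply, smul_apply,
    LinearMap.compMultilinearMap_apply, AlgHom.toLinearMap_apply]
  have hne : ∀ i ∈ Finset.range (n - 1), i ∉ ({p - 1, p} : Finset ℕ) →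
      (-1 : k) ^ i • toBar k A (contract i n a) = 0 := by
    intro i hin hnot
    simp only [Finset.mem_range, Finset.mem_insert, Finset.mem_singleton, not_or] at hin hnot
    rw [contract_apply i n (by omega)]
    rcases lt_or_gt_of_ne hnot.2 with hlt | hgt
    · rw [toBar_eq_zero _ (p - 1) (by omega) (by omega), smul_zero]
      rw [if_neg (by simp only; omega), if_neg (by simp only; omega), ← hi]
      congr 2
      simp only
      omega
    · rw [toBar_eq_zero _ p (by omega) (by omega), smul_zero]
      rw [if_pos (by simp only; omega), ← hi]
  rw [← Finset.sum_subset (s₁ := {p - 1, p}) (fun i hi => by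
    simp only [Finset.mem_range, Finset.mem_insert, Finset.mem_singleton] at *; omega) hne,
    Finset.sum_pair (by omega)]
  have he : contract (k := k) (p - 1) n a = contract p n a := by
    rw [contract_apply (p - 1) n (by omega), contract_apply p n (by omega)]
    refine tprod_congr rfl _ _ fun t ht => ?_
    simp only
    split_ifs with c1 c2 c3 c4 c5
    all_goals first
      | rfl
      | (exfalso; omega)
      | skip
    · have e1 : a ⟨p - 1 + 1, by omega⟩ = 1 := by rw [← hi]; congr 2; omega
      rw [e1, mul_one]; congr 2; omega
    · have e1 : a ⟨p, by omega⟩ = 1 := hi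
      rw [e1, one_mul]; congr 2; omega
  rw [he, ← add_smul]
  obtain ⟨q, rfl⟩ : ∃ q, p = q + 1 := ⟨p - 1, by omega⟩
  simp [pow_succ]

/-- The differential of the (augmented) normalized bar resolution. -/
def barD : Bar k A →ₗ[k] Bar k A := liftBar barWords barWords_unitWords


theorem barD_toBar (t : TensorAlgebra k A) : barD (toBar k A t) = barWords t := rfl

/-- `(a, a₀ ⊗ ⋯ ⊗ aₙ) ↦ a a₀ ⊗ ⋯ ⊗ aₙ` -/
def leftWords : A →ₗ[k] TensorAlgebra k A →ₗ[k] TensorAlgebra k A :=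
  ((LinearMap.mul k (TensorAlgebra k A)) ∘ₗ TensorAlgebra.ι k).compr₂ (ofWords (contract 0))

/-- `(b, a₀ ⊗ ⋯ ⊗ aₙ) ↦ a₀ ⊗ ⋯ ⊗ aₙ b` -/
def rightWords : A →ₗ[k] TensorAlgebra k A →ₗ[k] TensorAlgebra k A :=
  ((LinearMap.mul k (TensorAlgebra k A)).flip ∘ₗ TensorAlgebra.ι k).compr₂
    (ofWords fun N => contract (N - 2) N)

theorem leftWords_unitWords (x : A) (t : TensorAlgebra k A) (ht : t ∈ unitWords k A) :
    toBar k A (leftWords x t) = 0 := by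
  obtain ⟨n, a, ⟨p, hp⟩, h0, h1, hi, rfl⟩ := ht
  simp only at h0 h1
  have : leftWords x (TensorAlgebra.tprod k A n a) =
      contract 0 (1 + n) (Fin.append (fun _ => x) a) := by
    rw [← ofWords_tprod (fun N => contract (k := k) (A := A) 0 N), ← tprod_mul, ← ι_eq_tprod]
    rfl
  rw [this, contract_apply 0 (1 + n) (by omega)]
  refine toBar_eq_zero _ p h0 (by omega) ?_
  rw [if_neg (by simp only; omega), if_neg (by simp only; omega), append_apply,
    dif_neg (by simp only; omega), ← hi]
  congr 2

theorem rightWords_unitWords (x : A) (t : TensorAlgebra k A) (ht : t ∈ unitWords k A) :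
    toBar k A (rightWords x t) = 0 := by
  obtain ⟨n, a, ⟨p, hp⟩, h0, h1, hi, rfl⟩ := ht
  simp only at h0 h1
  have : rightWords x (TensorAlgebra.tprod k A n a) =
      contract (n + 1 - 2) (n + 1) (Fin.append a (fun _ => x)) := by
    rw [← ofWords_tprod (fun N => contract (k := k) (A := A) (N - 2) N), ← tprod_mul, ← ι_eq_tprod]
    rfl
  rw [this, contract_apply _ (n + 1) (by omega)]
  refine toBar_eq_zero _ p h0 (by omega) ?_
  rw [if_pos (by simp only; omega), append_apply, dif_pos (by simp only; omega), ← hi]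

/-- The left action of `A` on normalized words. -/
def barLeft : A →ₗ[k] Module.End k (Bar k A) where
  toFun x := liftBar ((toBar k A).toLinearMap ∘ₗ leftWords x) (leftWords_unitWords x)
  map_add' x y := by
    refine LinearMap.ext fun t => ?_
    obtain ⟨t, rfl⟩ := Ideal.Quotient.mk_surjective t
    change toBar k A (leftWords (x + y) t) =
      toBar k A (leftWords x t) + toBar k A (leftWords y t)
    simp
  map_smul' c x := by
    refine LinearMap.ext fun t => ?_
    obtain ⟨t, rfl⟩ := Ideal.Quotient.mk_surjective t
    change toBar k A (leftWords (c • x) t) = c • toBar k A (leftWords x t)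
    simp

/-- The right action of `A` on normalized words. -/
def barRight : A →ₗ[k] Module.End k (Bar k A) where
  toFun x := liftBar ((toBar k A).toLinearMap ∘ₗ rightWords x) (rightWords_unitWords x)
  map_add' x y := by
    refine LinearMap.ext fun t => ?_
    obtain ⟨t, rfl⟩ := Ideal.Quotient.mk_surjective t
    change toBar k A (rightWords (x + y) t) =
      toBar k A (rightWords x t) + toBar k A (rightWords y t)
    simp
  map_smul' c x := by
    refine LinearMap.ext fun t => ?_
    obtain ⟨t, rfl⟩ := Ideal.Quotient.mk_surjective t
    change toBar k A (rightWords (c • x) t) = c • toBar k A (rightWords x t)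
    simp

variable (k A)

/-- Normalized words of length `n`. -/
def barLength (n : ℕ) : Submodule k (Bar k A) :=
  Submodule.span k (Set.range fun a : Fin n → A => toBar k A (TensorAlgebra.tprod k A n a))

/-- `Ω̄^p(A)`, the kernel of `d : A ⊗ Ā^{⊗ (p-1)} ⊗ A → A ⊗ Ā^{⊗ (p-2)} ⊗ A` for `p ≥ 2`, of the
multiplication `A ⊗ A → A` for `p = 1`, and `A` for `p = 0`. -/
def Omega (p : ℕ) : Submodule k (Bar k A) := barLength k A (p + 1) ⊓ LinearMap.ker barD

end Bar

/-! ### Subquotients -/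

section Subquotient

variable {k C : Type*} [Field k] [AddCommGroup C] [Module k C]

/-- The (co)homology space `Z / (B ∩ Z)` of (co)cycles modulo (co)boundaries. -/
def Subquotient (Z B : Submodule k C) : Type _ := Z ⧸ B.submoduleOf Z

instance (Z B : Submodule k C) : AddCommGroup (Subquotient Z B) :=
  inferInstanceAs (AddCommGroup (Z ⧸ B.submoduleOf Z))

instance (Z B : Submodule k C) : Module k (Subquotient Z B) :=
  inferInstanceAs (Module k (Z ⧸ B.submoduleOf Z))

/-- The class of a (co)cycle. -/
def Subquotient.mk {Z : Submodule k C} (B : Submodule k C) : Z →ₗ[k] Subquotient Z B :=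
  (B.submoduleOf Z).mkQ

end Subquotient

/-! ### Hochschild cohomology

The coefficients are a subbimodule `U` of a `k`-module `M` with a left and a right action of `A`.
We use normalized cochains: multilinear maps that vanish when an argument is `1`. -/

section Cohomology

variable {k A M : Type*} [Field k] [Ring A] [Algebra k A] [AddCommGroup M] [Module k M]

/-- The normalized Hochschild `m`-cochains with values in `U`. -/
def cochains (A : Type*) [Ring A] [Algebra k A] (U : Submodule k M) (m : ℕ) :
    Submodule k (MultilinearMap k (fun _ : Fin m => A) M) where
  carrier := {f | (∀ a, f a ∈ U) ∧ ∀ a, (∃ i, a i = 1) → f a = 0}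
  add_mem' hf hg := ⟨fun a => U.add_mem (hf.1 a) (hg.1 a), fun a h => by
    rw [add_apply, hf.2 a h, hg.2 a h, add_zero]⟩
  zero_mem' := ⟨fun _ => U.zero_mem, fun _ _ => rfl⟩
  smul_mem' c f hf := ⟨fun a => U.smul_mem c (hf.1 a), fun a h => by
    rw [smul_apply, hf.2 a h, smul_zero]⟩

/-- The Hochschild differential `δ(f)(a₁, …, a_{m+1}) = a₁ f(a₂, …, a_{m+1}) +
∑_{i=1}^{m} (-1)^i f(a₁, …, a_i a_{i+1}, …, a_{m+1}) + (-1)^{m+1} f(a₁, …, a_m) a_{m+1}`. -/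
def delta (L R : A →ₗ[k] Module.End k M) (m : ℕ) :
    MultilinearMap k (fun _ : Fin m => A) M →ₗ[k] MultilinearMap k (fun _ : Fin (m + 1) => A) M where
  toFun f :=
    LinearMap.uncurryLeft (M := fun _ : Fin (m + 1) => A)
      { toFun := fun x => (L x).compMultilinearMap f
        map_add' := fun x y => by ext; simp
        map_smul' := fun c x => by ext; simp } +
    ∑ i : Fin m, (-1 : k) ^ ((i : ℕ) + 1) •
      (onWords m f).compMultilinearMap (contract (i : ℕ) (m + 1)) +
    (-1 : k) ^ (m + 1) •
      MultilinearMap.uncurryRight (M := fun _ : Fin (m + 1) => A) (R.flip.compMultilinearMap f)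
  map_add' f g := by
    have h : ∀ (i : Fin m) (a : Fin (m + 1) → A), onWords m (f + g) (contract (i : ℕ) (m + 1) a) =
        onWords m f (contract (i : ℕ) (m + 1) a) + onWords m g (contract (i : ℕ) (m + 1) a) := by
      intro i a
      rw [contract_apply _ _ (by omega)]
      exact (onWords_tprod m (f + g) _).trans
        (congrArg₂ (· + ·) (onWords_tprod m f _) (onWords_tprod m g _)).symm
    ext a
    simp only [add_apply, sum_apply, smul_apply, LinearMap.compMultilinearMap_apply,
      LinearMap.uncurryLeft_apply, MultilinearMap.uncurryRight_apply, LinearMap.coe_mk,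
      AddHom.coe_mk, map_add, LinearMap.add_apply, LinearMap.flip_apply, h, smul_add, Finset.sum_add_distrib]
    abel
  map_smul' c f := by
    have h : ∀ (i : Fin m) (a : Fin (m + 1) → A), onWords m (c • f) (contract (i : ℕ) (m + 1) a) =
        c • onWords m f (contract (i : ℕ) (m + 1) a) := by
      intro i a
      rw [contract_apply _ _ (by omega)]
      exact (onWords_tprod m (c • f) _).trans (congrArg (c • ·) (onWords_tprod m f _)).symm
    ext a
    simp only [add_apply, sum_apply, smul_apply, LinearMap.compMultilinearMap_apply,
      LinearMap.uncurryLeft_apply, MultilinearMap.uncurryRight_apply, LinearMap.coe_mk,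
      AddHom.coe_mk, map_smul, LinearMap.smul_apply, LinearMap.flip_apply, h, smul_add, Finset.smul_sum, smul_comm c,
      RingHom.id_apply]

theorem delta_apply (L R : A →ₗ[k] Module.End k M) (m : ℕ)
    (f : MultilinearMap k (fun _ : Fin m => A) M) (a : Fin (m + 1) → A) :
    delta L R m f a = L (a 0) (f (Fin.tail a)) +
      ∑ i : Fin m, (-1 : k) ^ ((i : ℕ) + 1) • f (fun t =>
        if (t : ℕ) < i then a t.castSucc
        else if (t : ℕ) = i then a i.castSucc * a i.succ else a t.succ) +
      (-1 : k) ^ (m + 1) • R (a (Fin.last m)) (f (Fin.init a)) := by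
  have h : ∀ i : Fin m, onWords m f (contract (i : ℕ) (m + 1) a) = f (fun t =>
        if (t : ℕ) < i then a t.castSucc
        else if (t : ℕ) = i then a i.castSucc * a i.succ else a t.succ) := by
    intro i
    rw [contract_apply _ _ (by omega)]
    exact onWords_tprod m f _
  simp only [delta, LinearMap.coe_mk, AddHom.coe_mk, add_apply, sum_apply, smul_apply,
    LinearMap.compMultilinearMap_apply, LinearMap.uncurryLeft_apply,
    MultilinearMap.uncurryRight_apply, LinearMap.flip_apply, h]


/-- The Hochschild `m`-cocycles with values in `U`. -/
def cocycles (U : Submodule k M) (L R : A →ₗ[k] Module.End k M) (m : ℕ) :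
    Submodule k (MultilinearMap k (fun _ : Fin m => A) M) :=
  cochains A U m ⊓ LinearMap.ker (delta L R m)

/-- The Hochschild `m`-coboundaries with values in `U`. -/
def coboundaries (U : Submodule k M) (L R : A →ₗ[k] Module.End k M) :
    ∀ m : ℕ, Submodule k (MultilinearMap k (fun _ : Fin m => A) M)
  | 0 => ⊥
  | m + 1 => (cochains A U m).map (delta L R m)

end Cohomology

section Groups

variable (k A : Type*) [Field k] [Ring A] [Algebra k A]

/-- The cocycles `Z^m(A, A)`. -/
abbrev ZA (m : ℕ) : Submodule k (MultilinearMap k (fun _ : Fin m => A) A) :=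
  cocycles ⊤ (LinearMap.mul k A) (LinearMap.mul k A).flip m

/-- The coboundaries `B^m(A, A)`. -/
abbrev BA (m : ℕ) : Submodule k (MultilinearMap k (fun _ : Fin m => A) A) :=
  coboundaries ⊤ (LinearMap.mul k A) (LinearMap.mul k A).flip m

/-- Hochschild cohomology `HH^m(A, A)`. -/
abbrev HH (m : ℕ) : Type _ := Subquotient (ZA k A m) (BA k A m)

/-- The cocycles `Z^m(A, Ω̄^p(A))`. -/
abbrev ZOmega (m p : ℕ) : Submodule k (MultilinearMap k (fun _ : Fin m => A) (Bar k A)) :=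
  cocycles (Omega k A p) barLeft barRight m

/-- The coboundaries `B^m(A, Ω̄^p(A))`. -/
abbrev BOmega (m p : ℕ) : Submodule k (MultilinearMap k (fun _ : Fin m => A) (Bar k A)) :=
  coboundaries (Omega k A p) barLeft barRight m

/-- `HH^m(A, Ω̄^p(A)) = Ext^m_{A^e}(A, Ω̄^p(A))`. -/
abbrev HHOmega (m p : ℕ) : Type _ :=
  Subquotient (ZOmega k A m p) (BOmega k A m p)

variable {k A}

/-- The inclusion of cocycles into cochains. -/
def omegaCochain {m p : ℕ} (f : ZOmega k A m p) : cochains A (Omega k A p) m := ⟨f.1, f.2.1⟩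

/-- A cochain with values in `A`, as a cochain with values in `Ω̄^0(A) = A`. -/
def algCochain {m : ℕ} (f : ZA k A m) : cochains A (Omega k A 0) m :=
  ⟨((toBar k A).toLinearMap ∘ₗ TensorAlgebra.ι k).compMultilinearMap f.1, by
    constructor
    · intro a
      refine ⟨Submodule.subset_span ⟨fun _ => f.1 a, ?_⟩, ?_⟩
      · change toBar k A (TensorAlgebra.tprod k A 1 _) = toBar k A (TensorAlgebra.ι k (f.1 a))
        rw [ι_eq_tprod]
      · change barWords (TensorAlgebra.ι k (f.1 a)) = 0
        rw [ι_eq_tprod, barWords, ofWords_tprod]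
        simp
    · intro a h
      simp [f.2.1.2 a h]⟩

end Groups

/-! ### The bracket -/

section Bracket

variable {k A : Type*} [Field k] [Ring A] [Algebra k A]

theorem block_unitWords {m p : ℕ} (j : ℕ) (f : cochains A (Omega k A p) m)
    (t : TensorAlgebra k A) (ht : t ∈ unitWords k A) :
    ofWords (fun N => block (toBar k A) j N f.1) t = 0 := by
  obtain ⟨n, a, ⟨i, hi'⟩, h0, h1, hi, rfl⟩ := ht
  simp only at h0 h1
  rw [ofWords_tprod]
  by_cases h : j + m ≤ n
  · rw [block_apply _ h]
    by_cases hblock : j ≤ i ∧ i < j + m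
    · rw [f.2.2 _ ⟨⟨i - j, by omega⟩, by rw [← hi]; congr 2; simp only; omega⟩]
      simp
    · have key : ∀ y ∈ barLength k A (p + 1),
          toBar k A (TensorAlgebra.tprod k A j fun t => a ⟨t, by omega⟩) * y *
            toBar k A (TensorAlgebra.tprod k A (n - (j + m)) fun t => a ⟨j + m + t, by omega⟩) =
            0 := by
        intro y hy
        induction hy using Submodule.span_induction with
        | mem y hy =>
          obtain ⟨b, rfl⟩ := hy
          simp only
          rw [← map_mul, ← map_mul, tprod_mul, tprod_mul]
          by_cases hij : i < j
          · refine toBar_eq_zero _ i h0 (by omega) ?_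
            rw [append_apply, dif_pos (by omega), append_apply, dif_pos hij]
            exact hi
          · refine toBar_eq_zero _ (i - m + (p + 1)) (by omega) (by omega) ?_
            rw [append_apply, dif_neg (by omega), ← hi]
            congr 2
            simp only
            omega
        | zero => simp
        | add y z _ _ hy hz => rw [mul_add, add_mul, hy, hz, add_zero]
        | smul c y _ hy => rw [mul_smul_comm, smul_mul_assoc, hy, smul_zero]
      exact key _ (f.2.1 _).1
  · rw [block, dif_neg h]
    rfl

/-- `id^{⊗ j} ⊗ f ⊗ id^{⊗ s}` on normalized words of length `j + m + s`, for every `s`. -/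
def insertAt {m p : ℕ} (j : ℕ) (f : cochains A (Omega k A p) m) : Bar k A →ₗ[k] Bar k A :=
  liftBar (ofWords fun N => block (toBar k A) j N f.1) (block_unitWords j f)

/-- `x ↦ d(x ⊗ 1)` -/
def dOne : Bar k A →ₗ[k] Bar k A :=
  barD ∘ₗ LinearMap.mulRight k (toBar k A (TensorAlgebra.ι k 1))

/-- The product `f • g` of `f ∈ C^m(A, Ω̄^p)` and `g ∈ C^n(A, Ω̄^q)`, on `N = m + n - 1` arguments:
`∑_{i=1}^{m} (-1)^{p+q+(i-1)(q-n-1)} d((f ⊗ id^{⊗ q})(id^{⊗ (i-1)} ⊗ g ⊗ id^{⊗ (m-i)}) ⊗ 1)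
 + ∑_{i=1}^{q} (-1)^{p+q+i(p-m-1)} d((id^{⊗ i} ⊗ f ⊗ id^{⊗ (q-i)})(g ⊗ id^{⊗ (m-1)}) ⊗ 1)`.
The exponents are written with natural numbers of the same parity. -/
def bullet {m p n q : ℕ} (f : cochains A (Omega k A p) m) (g : cochains A (Omega k A q) n) (N : ℕ) :
    MultilinearMap k (fun _ : Fin N => A) (Bar k A) :=
  ∑ i ∈ Finset.Icc 1 m, (-1 : k) ^ (p + q + (i - 1) * (q + n + 1)) •
    (dOne ∘ₗ insertAt 0 f).compMultilinearMap (block (toBar k A) (i - 1) N g.1) +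
  ∑ i ∈ Finset.Icc 1 q, (-1 : k) ^ (p + q + i * (p + m + 1)) •
    (dOne ∘ₗ insertAt i f).compMultilinearMap (block (toBar k A) 0 N g.1)

/-- The bracket `[f, g] = f • g - (-1)^{(m-p-1)(n-q-1)} g • f` of `f ∈ C^m(A, Ω̄^p)` and
`g ∈ C^n(A, Ω̄^q)`, on `N = m + n - 1` arguments. -/
def bracket {m p n q : ℕ} (f : cochains A (Omega k A p) m) (g : cochains A (Omega k A q) n) (N : ℕ) :
    MultilinearMap k (fun _ : Fin N => A) (Bar k A) :=
  bullet f g N - (-1 : k) ^ ((m + p + 1) * (n + q + 1)) • bullet g f N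

/-- The connecting map `θ(f)(a₁, …, a_{m+1}) = (-1)^p d(f(a₁, …, a_m) ⊗ a_{m+1} ⊗ 1)` for
`f ∈ C^m(A, Ω̄^p)`, with values in `Ω̄^{p+1}`. -/
def theta {m p : ℕ} (f : cochains A (Omega k A p) m) :
    MultilinearMap k (fun _ : Fin (m + 1) => A) (Bar k A) :=
  (-1 : k) ^ p • dOne.compMultilinearMap (block (toBar k A) 0 (m + 1) f.1)

end Bracket

/-! ### Singular Hochschild cohomology -/

section Singular

variable (k A : Type*) [Field k] [Ring A] [Algebra k A]

/-- The pairs `(m, p)` with `m > 0` and `m - p = i`. -/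
abbrev SgIndex (i : ℤ) : Type := {x : ℕ × ℕ // 0 < x.1 ∧ (x.1 : ℤ) - x.2 = i}

/-- The index `(m + 1, p + 1)`. -/
def SgIndex.next {i : ℤ} (x : SgIndex i) : SgIndex i :=
  ⟨(x.1.1 + 1, x.1.2 + 1), by
    refine ⟨Nat.succ_pos _, ?_⟩
    have := x.2.2
    push_cast
    omega⟩

/-- The relations `[f] ∼ [θ(f)]` that define the colimit. -/
def sgRelations (i : ℤ) : Submodule k (⨁ x : SgIndex i, HHOmega k A x.1.1 x.1.2) :=
  Submodule.span k {u | ∃ (x : SgIndex i) (f : ZOmega k A x.1.1 x.1.2)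
    (g : ZOmega k A (x.1.1 + 1) (x.1.2 + 1)), g.1 = theta (omegaCochain f) ∧
      u = DirectSum.lof k (SgIndex i) (fun x => HHOmega k A x.1.1 x.1.2) x (Subquotient.mk _ f) -
        DirectSum.lof k (SgIndex i) (fun x => HHOmega k A x.1.1 x.1.2) x.next
          (Subquotient.mk _ g)}

/-- Singular Hochschild cohomology `HH_sg^i(A, A)`, the colimit of
`⋯ → HH^m(A, Ω̄^p(A)) → HH^{m+1}(A, Ω̄^{p+1}(A)) → ⋯` over `m - p = i`, `m > 0`, along `θ`. -/
def HHsg (i : ℤ) : Type _ :=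
  (⨁ x : SgIndex i, HHOmega k A x.1.1 x.1.2) ⧸ sgRelations k A i

instance (i : ℤ) : AddCommGroup (HHsg k A i) :=
  inferInstanceAs (AddCommGroup (_ ⧸ sgRelations k A i))

instance (i : ℤ) : Module k (HHsg k A i) :=
  inferInstanceAs (Module k (_ ⧸ sgRelations k A i))

variable {k A}

/-- The canonical map `HH^m(A, Ω̄^p(A)) → HH_sg^i(A, A)` for `m > 0` and `m - p = i`. -/
def toSg (m p : ℕ) (i : ℤ) (hm : 0 < m) (h : (m : ℤ) - p = i) : HHOmega k A m p →ₗ[k] HHsg k A i :=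
  (sgRelations k A i).mkQ ∘ₗ
    DirectSum.lof k (SgIndex i) (fun x => HHOmega k A x.1.1 x.1.2) ⟨(m, p), hm, h⟩

end Singular

/-! ### Hochschild homology, cap product and the Connes operator -/

section Homology

variable (k A : Type*) [Field k] [Ring A] [Algebra k A]

/-- The Hochschild chains `C_r(A, A) = A ⊗ A^{⊗ r}`. -/
def chains (r : ℕ) : Submodule k (TensorAlgebra k A) :=
  Submodule.span k (Set.range fun a : Fin (r + 1) → A => TensorAlgebra.tprod k A (r + 1) a)

/-- The Hochschild boundary `∂(a₀ ⊗ ⋯ ⊗ a_r) =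
∑_{i=0}^{r-1} (-1)^i a₀ ⊗ ⋯ ⊗ a_i a_{i+1} ⊗ ⋯ ⊗ a_r + (-1)^r a_r a₀ ⊗ a₁ ⊗ ⋯ ⊗ a_{r-1}`
(zero for `r = 0`), on words of length `N = r + 1`. -/
def boundary : TensorAlgebra k A →ₗ[k] TensorAlgebra k A :=
  ofWords fun N => ∑ i ∈ Finset.range (N - 1), (-1 : k) ^ i • contract i N +
    (-1 : k) ^ (N - 1) • (contract 0 N).domDomCongr (finRotate N ^ (N - 1))

/-- The cycles `Z_r(A, A)`. -/
def cycles (r : ℕ) : Submodule k (TensorAlgebra k A) :=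
  chains k A r ⊓ LinearMap.ker (boundary k A)

/-- The boundaries `B_r(A, A)`. -/
def boundaries (r : ℕ) : Submodule k (TensorAlgebra k A) := (chains k A (r + 1)).map (boundary k A)

/-- Hochschild homology `HH_r(A, A) = Tor_r^{A^e}(A, A)`. -/
abbrev HHhom (r : ℕ) : Type _ := Subquotient (cycles k A r) (boundaries k A r)

/-- The Connes operator `B(a₀ ⊗ ⋯ ⊗ a_r) =
∑_{i=0}^{r} (-1)^{ir} (1 ⊗ a_i ⊗ ⋯ ⊗ a_r ⊗ a₀ ⊗ ⋯ ⊗ a_{i-1} +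
a_i ⊗ 1 ⊗ a_{i+1} ⊗ ⋯ ⊗ a_r ⊗ a₀ ⊗ ⋯ ⊗ a_{i-1})`, on words of length `N = r + 1`. -/
def connesB : TensorAlgebra k A →ₗ[k] TensorAlgebra k A :=
  ofWords fun N => ∑ i ∈ Finset.range N, (-1 : k) ^ (i * (N - 1)) •
    ((LinearMap.mulLeft k (TensorAlgebra.ι k 1)).compMultilinearMap (TensorAlgebra.tprod k A N) +
      block (AlgHom.id k (TensorAlgebra k A)) 0 N
        ((LinearMap.mulRight k (TensorAlgebra.ι k 1)).compMultilinearMap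
          (TensorAlgebra.tprod k A 1))).domDomCongr (finRotate N ^ i)

variable {k A}

/-- The cap product `f ∩ (a₀ ⊗ ⋯ ⊗ a_r) = a₀ f(a₁, …, a_m) ⊗ a_{m+1} ⊗ ⋯ ⊗ a_r`, for `m ≤ r`. -/
def cap {m : ℕ} (f : MultilinearMap k (fun _ : Fin m => A) A) :
    TensorAlgebra k A →ₗ[k] TensorAlgebra k A :=
  ofWords fun N => block (AlgHom.id k (TensorAlgebra k A)) 0 N
    (LinearMap.uncurryLeft (M := fun _ : Fin (m + 1) => A)
      { toFun := fun x => (TensorAlgebra.ι k ∘ₗ LinearMap.mulLeft k x).compMultilinearMap f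
        map_add' := fun x y => by ext; simp [add_mul]
        map_smul' := fun c x => by ext; simp })

end Homology

/-! ### Symmetric algebras -/

section Symmetric

variable {k A : Type*} [Field k] [Ring A] [Algebra k A]

/-- A symmetric, associative and non-degenerate inner product on `A`. -/
structure IsSymmetrizing (form : LinearMap.BilinForm k A) : Prop where
  symm : ∀ a b, form a b = form b a
  assoc : ∀ a b c, form (a * b) c = form a (b * c)
  nondegenerate : form.Nondegenerate

/-- The functional `a₀ ⊗ a₁ ⊗ ⋯ ⊗ a_m ↦ ⟨a₀, f(a₁, …, a_m)⟩` on `C_m(A, A)` that corresponds to a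
cochain `f ∈ C^m(A, A)`. -/
def pairing (form : LinearMap.BilinForm k A) {m : ℕ}
    (f : MultilinearMap k (fun _ : Fin m => A) A) : TensorAlgebra k A →ₗ[k] k :=
  onWords (m + 1) (LinearMap.uncurryLeft (M := fun _ : Fin (m + 1) => A)
    { toFun := fun x => (form x).compMultilinearMap f
      map_add' := fun x y => by ext; simp
      map_smul' := fun c x => by ext; simp })

variable [FiniteDimensional k A]

/-- The operator `Δ : C^m(A, A) → C^{m-1}(A, A)`, `m ≥ 1`, the graded dual of the Connes operator:
the functional of `Δ(f)` is `x ↦ (-1)^m (functional of f)(B x)`, that is,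
`⟨a₀, Δ(f)(a₁, …, a_{m-1})⟩ =
(-1)^m ∑_{i=0}^{m-1} (-1)^{i(m-1)} ⟨1, f(a_i, …, a_{m-1}, a₀, …, a_{i-1})⟩`
for normalized `f`. -/
def bvDelta {form : LinearMap.BilinForm k A} (hf : IsSymmetrizing form) {m : ℕ}
    (f : MultilinearMap k (fun _ : Fin m => A) A) : MultilinearMap k (fun _ : Fin (m - 1) => A) A :=
  ((form.toDual hf.nondegenerate).symm.toLinearMap ∘ₗ
    (((LinearMap.mul k (TensorAlgebra k A)).flip.compl₂ (TensorAlgebra.ι k)).compr₂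
      ((-1 : k) ^ m • (pairing form f ∘ₗ connesB k A)))).compMultilinearMap
    (TensorAlgebra.tprod k A (m - 1))

/-- The Casimir element `∑ e_i ⊗ f_i`, the preimage of `id` under
`A ⊗ A → End(A)`, `a ⊗ b ↦ (x ↦ ⟨a, x⟩ b)`. -/
def casimir {form : LinearMap.BilinForm k A} (hf : IsSymmetrizing form) : A ⊗[k] A :=
  (TensorProduct.congr (form.toDual hf.nondegenerate) (LinearEquiv.refl k A)).symm
    ((dualTensorHomEquiv k A A).symm LinearMap.id)

/-- The cochain `κ(a₀ ⊗ ⋯ ⊗ a_r)(b₁, …, b_m) =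
∑ d(e_i a₀ ⊗ a₁ ⊗ ⋯ ⊗ a_r ⊗ f_i ⊗ b₁ ⊗ ⋯ ⊗ b_m ⊗ 1)` with values in `Ω̄^{r+m+1}(A)`. -/
def kappa {form : LinearMap.BilinForm k A} (hf : IsSymmetrizing form) (m : ℕ)
    (z : TensorAlgebra k A) : MultilinearMap k (fun _ : Fin m => A) (Bar k A) :=
  (dOne ∘ₗ LinearMap.mulLeft k (toBar k A (TensorProduct.lift
      (((LinearMap.mul k (TensorAlgebra k A)) ∘ₗ leftWords.flip z).compl₂ (TensorAlgebra.ι k))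
      (casimir hf)))).compMultilinearMap
    ((toBar k A).toLinearMap.compMultilinearMap (TensorAlgebra.tprod k A m))

end Symmetric

/-! ### Induced maps -/

section Induced

variable {k C C₁ C₂ : Type*} [Field k] [AddCommGroup C] [Module k C] [AddCommGroup C₁] [Module k C₁]
  [AddCommGroup C₂] [Module k C₂]

/-- `Φ` is the map `[z] ↦ [φ(z)]` (in particular `φ` takes cycles to cycles). -/
def Induces {Z₁ B₁ : Submodule k C₁} {Z B : Submodule k C} (φ : Z₁ → C)
    (Φ : Subquotient Z₁ B₁ →ₗ[k] Subquotient Z B) : Prop :=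
  ∀ z : Z₁, ∃ h : φ z ∈ Z, Φ (Subquotient.mk _ z) = Subquotient.mk _ ⟨φ z, h⟩

/-- `Φ` is the bilinear map `([z], [w]) ↦ [φ(z, w)]`. -/
def Induces₂ {Z₁ B₁ : Submodule k C₁} {Z₂ B₂ : Submodule k C₂} {Z B : Submodule k C}
    (φ : Z₁ → Z₂ → C) (Φ : Subquotient Z₁ B₁ →ₗ[k] Subquotient Z₂ B₂ →ₗ[k]
      Subquotient Z B) : Prop :=
  ∀ (z : Z₁) (w : Z₂), ∃ h : φ z w ∈ Z,
    Φ (Subquotient.mk _ z) (Subquotient.mk _ w) = Subquotient.mk _ ⟨φ z w, h⟩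

end Induced

end SingHoch

end

open SingHoch

open scoped TensorProduct DirectSum

noncomputable section

set_option linter.unusedSectionVars false

namespace SingHoch

variable {k A X Y M ι : Type*} [Field k] [Ring A] [Algebra k A] [AddCommGroup X] [Module k X]
  [AddCommGroup Y] [Module k Y] [AddCommGroup M] [Module k M] [Fintype ι]
  {form : LinearMap.BilinForm k A} {e f : ι → A} {m n p l q r N : ℕ} {F : List A → A}
  {φ W : List A → X} {z : TensorAlgebra k A} {x : Bar k A}
local notation "ε" => (-1 : k)
local notation "Multi" m:max X:max => MultilinearMap k (fun _ : Fin m => A) X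
local notation "CΩ" p:max m:max => cochains A (Omega k A p) m

/-! ### Functions on lists and their bar differential -/

/-! The argument has three layers.

Acyclicity. The form of a symmetric algebra makes each bimodule A ⊗ Ā^p ⊗ A acyclic for Hochschild
cohomology in positive degrees; the contracting homotopy is built from the Casimir element
(`delta_contractCochain`). Hence the connecting map θ of 0 → Ω^{p+1} → A ⊗ Ā^p ⊗ A → Ω^p → 0 is
injective from degree 1 on and surjective even from degree 0 to degree 1 (`theta_injective`,
`theta_surjective`). All stages of the colimit are then isomorphic to it when i ≤ 1
(`toSg_bijective`). The Casimir map a₀ ⊗ ⋯ ⊗ a_r ↦ ∑ e a₀ ⊗ a₁ ⊗ ⋯ ⊗ a_r ⊗ f identifies chains,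
modulo those with a unit behind the first place, with the invariants of A ⊗ Ā^r ⊗ A, and it carries
∂ to d (`barD_casimirMap`, `exists_casimirMap_eq`, `mem_unitChains_of_casimirMap_eq_zero`). The
degenerate chains are acyclic (`exists_boundary_of_mem_unitChains`). Since κ in degree m + 1 is θ of
κ in degree m (`theta_kappaCochain`), this makes κ an isomorphism.

The bracket. Let I_f be the signed sum of all insertions of f into a normalized word and H_f the
insertion in front. Up to sign, f • g is I_f H_g + H_f I_g − H_f H_g followed by d(− ⊗ 1); this is
the part of I_f I_g that does not keep the first letter. As d commutes with I_f up to the insertion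
of δf (`barD_insertSum`), the graded commutator satisfies δ[f, g] = [f, δg] for a cocycle f
(`delta_bracket`), and [f, θg] = θ[f, g] when f has values in A (`bracket_theta`). So the bracket
passes to cohomology and to the colimit.

The comparison. For a cocycle f and a cycle z, the bracket [f, κ(z)] and κ of f ∩ Bz ± B(f ∩' z) ±
Δ(f) ∩' z, where ∩' takes the last letters of a chain, differ by an explicit coboundary. Its
primitive is a combination of three sums over rotations of the chain between the two letters of a
Casimir pair (`rotCap_homotopy`, `insertCap_homotopy`, `cycleCap_homotopy`). Each sum telescopes
because f is a cocycle, d² = 0, and a letter next to one member of a Casimir pair may be moved to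
the other. What survives are the terms in which some block of letters is empty: those of the
bracket, of f ∩ B, of B(f ∩' −), of Δ(f) ∩' −, and one family that cancels between two of the sums
(`bracketHomotopy_boundary`). Finally ∩' is homotopic to ± ∩ (`boundary_capHomotopy`).

All formulas are computed for functions on lists. Multilinear maps are zero at lists of the wrong
length, so that one can sum over all splittings of a list and use induction instead of index
arithmetic. -/

/-- The alternating sum of a function over the lists obtained by multiplying two neighbours. -/
def mergeSum : (List A → X) → List A → X
  | _, [] => 0
  | _, [_] => 0
  | φ, a :: b :: l => φ ((a * b) :: l) - mergeSum (fun t => φ (a :: t)) (b :: l)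

/-- The sum over all ways to split a list into two. -/
def splitSum : (List A → List A → X) → List A → X
  | F, [] => F [] []
  | F, a :: l => F [] (a :: l) + splitSum (fun p q => F (a :: p) q) l

/-- The sum over all ways to split a list into a list, a letter and a list. -/
def letterSum : (List A → A → List A → X) → List A → X
  | _, [] => 0
  | H, a :: l => H [] a l + letterSum (fun p c q => H (a :: p) c q) l

/-- The value at the first letter and the remaining list, zero for the empty list. -/
def onHead (H : A → List A → X) : List A → X
  | [] => 0
  | a :: q => H a q

/-- The value at the list without the last letter and the last letter, zero for the empty list. -/
def onLast : (List A → A → X) → List A → X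
  | _, [] => 0
  | H, [a] => H [] a
  | H, a :: b :: p => onLast (fun t c => H (a :: t) c) (b :: p)

@[simp] theorem mergeSum_nil (φ : List A → X) : mergeSum φ [] = 0 := rfl
@[simp] theorem mergeSum_singleton (φ : List A → X) (a : A) : mergeSum φ [a] = 0 := rfl
theorem mergeSum_cons_cons (φ : List A → X) (a b : A) (l : List A) :
    mergeSum φ (a :: b :: l) = φ ((a * b) :: l) - mergeSum (fun t => φ (a :: t)) (b :: l) := rfl

theorem mergeSum_cons (φ : List A → X) (a : A) (l : List A) : mergeSum φ (a :: l) =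
      onHead (fun b q => φ ((a * b) :: q)) l - mergeSum (fun t => φ (a :: t)) l := by
  cases l <;> simp [mergeSum, onHead]

@[simp] theorem splitSum_nil (F : List A → List A → X) : splitSum F [] = F [] [] := rfl
theorem splitSum_cons (F : List A → List A → X) (a : A) (l : List A) :
    splitSum F (a :: l) = F [] (a :: l) + splitSum (fun p q => F (a :: p) q) l := rfl
@[simp] theorem letterSum_nil (H : List A → A → List A → X) : letterSum H [] = 0 := rfl
theorem letterSum_cons (H : List A → A → List A → X) (a : A) (l : List A) :
    letterSum H (a :: l) = H [] a l + letterSum (fun p c q => H (a :: p) c q) l := rfl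
@[simp] theorem onHead_nil (H : A → List A → X) : onHead H [] = 0 := rfl
@[simp] theorem onHead_cons (H : A → List A → X) (a : A) (q : List A) :
    onHead H (a :: q) = H a q := rfl
@[simp] theorem onLast_nil (H : List A → A → X) : onLast H [] = 0 := rfl
@[simp] theorem onLast_singleton (H : List A → A → X) (a : A) : onLast H [a] = H [] a := rfl
theorem onLast_cons_cons (H : List A → A → X) (a b : A) (p : List A) :
    onLast H (a :: b :: p) = onLast (fun t c => H (a :: t) c) (b :: p) := rfl

@[simp] theorem onLast_append_singleton (H : List A → A → X) (p : List A) (a : A) :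
    onLast H (p ++ [a]) = H p a := by
  induction p generalizing H with
  | nil => rfl
  | cons b p ih =>
    cases p with
    | nil => rfl
    | cons c p => exact ih _

theorem onLast_cons_append (H : List A → A → X) (a : A) (l : List A) :
    onLast H (a :: l) = if l = [] then H [] a else onLast (fun t c => H (a :: t) c) l := by
  cases l <;> simp [onLast]

theorem mergeSum_add (φ ψ : List A → X) (l : List A) :
    mergeSum (fun t => φ t + ψ t) l = mergeSum φ l + mergeSum ψ l := by
  induction l generalizing φ ψ with
  | nil => simp
  | cons a l ih =>
    cases l with
    | nil => simp
    | cons b l => simp only [mergeSum_cons_cons, ih]; abel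

theorem mergeSum_zero (l : List A) : mergeSum (fun _ => (0 : X)) l = 0 := by
  induction l with
  | nil => rfl
  | cons a l ih =>
    cases l with
    | nil => rfl
    | cons b l => simp [mergeSum_cons_cons, ih]

theorem splitSum_add (F G : List A → List A → X) (l : List A) :
    splitSum (fun p q => F p q + G p q) l = splitSum F l + splitSum G l := by
  induction l generalizing F G with
  | nil => rfl
  | cons a l ih => simp only [splitSum_cons, ih]; abel

theorem splitSum_zero (l : List A) : splitSum (fun _ _ => (0 : X)) l = 0 := by
  induction l with
  | nil => rfl
  | cons a l ih => simp [splitSum_cons, ih]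

theorem letterSum_add (F G : List A → A → List A → X) (l : List A) :
    letterSum (fun p c q => F p c q + G p c q) l = letterSum F l + letterSum G l := by
  induction l generalizing F G with
  | nil => simp
  | cons a l ih => simp only [letterSum_cons, ih]; abel

theorem letterSum_zero (l : List A) : letterSum (fun _ _ _ => (0 : X)) l = 0 := by
  induction l with
  | nil => rfl
  | cons a l ih => simp [letterSum_cons, ih]

theorem map_mergeSum (h : X →+ Y) (φ : List A → X) (l : List A) :
    h (mergeSum φ l) = mergeSum (fun t => h (φ t)) l := by
  induction l generalizing φ with
  | nil => simp
  | cons a l ih =>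
    cases l with
    | nil => simp
    | cons b l => simp only [mergeSum_cons_cons, map_sub, ih]

theorem map_splitSum (h : X →+ Y) (F : List A → List A → X) (l : List A) :
    h (splitSum F l) = splitSum (fun p q => h (F p q)) l := by
  induction l generalizing F with
  | nil => simp
  | cons a l ih => simp only [splitSum_cons, map_add, ih]

theorem map_letterSum (h : X →+ Y) (F : List A → A → List A → X) (l : List A) :
    h (letterSum F l) = letterSum (fun p c q => h (F p c q)) l := by
  induction l generalizing F with
  | nil => simp
  | cons a l ih => simp only [letterSum_cons, map_add, ih]

theorem map_onHead (h : X →+ Y) (H : A → List A → X) (l : List A) :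
    h (onHead H l) = onHead (fun a q => h (H a q)) l := by cases l <;> simp

theorem map_onLast (h : X →+ Y) (H : List A → A → X) (l : List A) :
    h (onLast H l) = onLast (fun p c => h (H p c)) l := by
  rcases List.eq_nil_or_concat' l with rfl | ⟨p, a, rfl⟩ <;> simp

theorem linear_mergeSum (ψ : X →ₗ[k] Y) (F : List A → X) (l : List A) :
    ψ (mergeSum F l) = mergeSum (fun t => ψ (F t)) l := map_mergeSum ψ.toAddMonoidHom F l

theorem linear_splitSum (ψ : X →ₗ[k] Y) (F : List A → List A → X) (l : List A) :
    ψ (splitSum F l) = splitSum (fun p q => ψ (F p q)) l := map_splitSum ψ.toAddMonoidHom F l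

theorem linear_letterSum (ψ : X →ₗ[k] Y) (F : List A → A → List A → X) (l : List A) :
    ψ (letterSum F l) = letterSum (fun p c q => ψ (F p c q)) l := map_letterSum ψ.toAddMonoidHom F l

theorem linear_onHead (ψ : X →ₗ[k] Y) (F : A → List A → X) (l : List A) :
    ψ (onHead F l) = onHead (fun p q => ψ (F p q)) l := map_onHead ψ.toAddMonoidHom F l

theorem linear_onLast (ψ : X →ₗ[k] Y) (F : List A → A → X) (l : List A) :
    ψ (onLast F l) = onLast (fun p q => ψ (F p q)) l := map_onLast ψ.toAddMonoidHom F l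

theorem mergeSum_finsum (s : Finset ι) (H : ι → List A → X) (l : List A) :
    mergeSum (fun t => ∑ i ∈ s, H i t) l = ∑ i ∈ s, mergeSum (H i) l := by
  classical
  induction s using Finset.induction_on with
  | empty => simp [mergeSum_zero]
  | insert i s hi ih => simp only [Finset.sum_insert hi, mergeSum_add, ih]

theorem onHead_finsum (s : Finset ι) (H : ι → A → List A → X) (l : List A) :
    onHead (fun a t => ∑ i ∈ s, H i a t) l = ∑ i ∈ s, onHead (H i) l := by cases l <;> simp

theorem onLast_finsum (s : Finset ι) (H : ι → List A → A → X) (l : List A) :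
    onLast (fun t a => ∑ i ∈ s, H i t a) l = ∑ i ∈ s, onLast (H i) l := by
  rcases List.eq_nil_or_concat' l with rfl | ⟨t, c, rfl⟩ <;> simp

theorem splitSum_congr {F G : List A → List A → X} {l : List A}
    (h : ∀ p q, p ++ q = l → F p q = G p q) : splitSum F l = splitSum G l := by
  induction l generalizing F G with
  | nil => exact h [] [] rfl
  | cons a l ih =>
    rw [splitSum_cons, splitSum_cons, h [] (a :: l) rfl]
    congr 1
    exact ih fun p q hpq => h (a :: p) q (by simp [hpq])

theorem letterSum_congr {F G : List A → A → List A → X} {l : List A}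
    (h : ∀ p c q, p ++ c :: q = l → F p c q = G p c q) : letterSum F l = letterSum G l := by
  induction l generalizing F G with
  | nil => rfl
  | cons a l ih =>
    rw [letterSum_cons, letterSum_cons, h [] a l rfl]
    congr 1
    exact ih fun p c q hpq => h (a :: p) c q (by simp [hpq])

theorem mergeSum_congr {φ ψ : List A → X} {l : List A}
    (h : ∀ t : List A, t.length + 1 = l.length → φ t = ψ t) : mergeSum φ l = mergeSum ψ l := by
  induction l generalizing φ ψ with
  | nil => rfl
  | cons a l ih =>
    cases l with
    | nil => rfl
    | cons b l =>
      rw [mergeSum_cons_cons, mergeSum_cons_cons, h _ (by simp)]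
      congr 1
      exact ih fun t ht => h _ (by simpa using ht)

theorem onHead_congr {F G : A → List A → X} {l : List A} (h : ∀ c q, c :: q = l → F c q = G c q) :
    onHead F l = onHead G l := by
  cases l with
  | nil => rfl
  | cons a l => exact h _ _ rfl

theorem onLast_congr {F G : List A → A → X} {l : List A} (h : ∀ p c, p ++ [c] = l → F p c = G p c) :
    onLast F l = onLast G l := by
  rcases List.eq_nil_or_concat' l with rfl | ⟨p, a, rfl⟩
  · rfl
  · simpa using h _ _ rfl

/-- Together with `splitSum_onLast` this lets a letter cross a cut: taking the first letter behind
the cut or the last letter before it gives the same sum over marked letters. The cancellations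
between a product at the end of one block and a product at the start of the next rest on it. -/
theorem splitSum_onHead (H : List A → A → List A → X) (l : List A) :
    splitSum (fun p q => onHead (fun a q' => H p a q') q) l = letterSum H l := by
  induction l generalizing H with
  | nil => rfl
  | cons a l ih => rw [splitSum_cons, letterSum_cons, ← ih]; rfl

theorem splitSum_onLast (H : List A → A → List A → X) (l : List A) :
    splitSum (fun p q => onLast (fun p' a => H p' a q) p) l = letterSum H l := by
  -- A letter `b` is kept in front, since `onLast` behaves differently on the empty left part.
  have key : ∀ (l : List A) (H : List A → A → List A → X) (b : A),
      splitSum (fun p q => onLast (fun p' a => H p' a q) (b :: p)) l =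
        H [] b l + letterSum (fun p c q => H (b :: p) c q) l := by
    intro l
    induction l with
    | nil => intro H b; simp
    | cons a l ih =>
      intro H b
      rw [splitSum_cons, letterSum_cons]
      simp only [onLast_singleton]
      congr 1
      exact ih (fun p c q => H (b :: p) c q) a
  cases l with
  | nil => rfl
  | cons a l =>
    rw [splitSum_cons, letterSum_cons]
    simp only [onLast_nil, zero_add]
    exact key l H a

theorem mergeSum_smul (c : k) (φ : List A → X) (l : List A) :
    mergeSum (fun t => c • φ t) l = c • mergeSum φ l :=
  (map_mergeSum (DistribSMul.toAddMonoidHom X c) φ l).symm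

theorem splitSum_smul (c : k) (F : List A → List A → X) (l : List A) :
    splitSum (fun p q => c • F p q) l = c • splitSum F l :=
  (map_splitSum (DistribSMul.toAddMonoidHom X c) F l).symm

theorem letterSum_smul (c : k) (F : List A → A → List A → X) (l : List A) :
    letterSum (fun p a q => c • F p a q) l = c • letterSum F l :=
  (map_letterSum (DistribSMul.toAddMonoidHom X c) F l).symm

theorem mergeSum_neg (φ : List A → X) (l : List A) : mergeSum (fun t => - φ t) l = - mergeSum φ l :=
  (map_mergeSum (negAddMonoidHom : X →+ X) φ l).symm

theorem splitSum_neg (F : List A → List A → X) (l : List A) :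
    splitSum (fun p q => - F p q) l = - splitSum F l :=
  (map_splitSum (negAddMonoidHom : X →+ X) F l).symm

theorem letterSum_neg (F : List A → A → List A → X) (l : List A) :
    letterSum (fun p a q => - F p a q) l = - letterSum F l :=
  (map_letterSum (negAddMonoidHom : X →+ X) F l).symm

theorem splitSum_sub (F G : List A → List A → X) (l : List A) :
    splitSum (fun p q => F p q - G p q) l = splitSum F l - splitSum G l := by
  simp only [sub_eq_add_neg, splitSum_add, splitSum_neg]

theorem letterSum_sub (F G : List A → A → List A → X) (l : List A) :
    letterSum (fun p a q => F p a q - G p a q) l = letterSum F l - letterSum G l := by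
  simp only [sub_eq_add_neg, letterSum_add, letterSum_neg]

theorem mergeSum_sub (φ ψ : List A → X) (l : List A) :
    mergeSum (fun t => φ t - ψ t) l = mergeSum φ l - mergeSum ψ l := by
  simp only [sub_eq_add_neg, mergeSum_add, mergeSum_neg]

-- A product of neighbours lies in one of the two parts and never across the cut, so the merge sum
-- obeys a Leibniz rule; a product in the right part has passed `p.length` letters.
variable (k) in
theorem mergeSum_splitSum (F : List A → List A → X) (l : List A) :
    mergeSum (splitSum F) l = splitSum (fun p q =>
      mergeSum (fun t => F t q) p + ε ^ p.length • mergeSum (fun t => F p t) q) l := by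
  induction l generalizing F with
  | nil => simp
  | cons a l ih =>
    cases l with
    | nil => simp [splitSum_cons]
    | cons b l =>
      have e : (fun t => splitSum F (a :: t)) =
          fun t => F [] (a :: t) + splitSum (fun p q => F (a :: p) q) t := rfl
      rw [mergeSum_cons_cons, e, mergeSum_add, ih, splitSum_cons, splitSum_cons, splitSum_cons,
        splitSum_cons]
      simp only [mergeSum_cons_cons, mergeSum_nil, mergeSum_singleton, List.length_cons,
        List.length_nil, pow_zero, one_smul, pow_succ, mul_neg, neg_smul, mul_one, zero_add,
        splitSum_add, splitSum_sub, splitSum_neg]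
      abel

-- Sorts the products of neighbours by their position relative to a marked letter `c`: before it,
-- with its left neighbour, with its right neighbour, behind it. In the applications the marked
-- letter is often the value of a cocycle or a member of a Casimir pair.
variable (k) in
theorem mergeSum_append_cons (φ : List A → X) (p : List A) (c : A) (q : List A) :
    mergeSum φ (p ++ c :: q) = mergeSum (fun t => φ (t ++ c :: q)) p -
      ε ^ p.length • onLast (fun p' a => φ (p' ++ (a * c) :: q)) p +
      ε ^ p.length • onHead (fun a q' => φ (p ++ (c * a) :: q')) q -
      ε ^ p.length • mergeSum (fun t => φ (p ++ c :: t)) q := by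
  induction p generalizing φ with
  | nil =>
    rw [List.nil_append, mergeSum_cons]
    simp
  | cons a p ih =>
    cases p with
    | nil =>
      simp only [List.cons_append, List.nil_append, mergeSum_cons_cons, mergeSum_singleton,
        List.length_cons, List.length_nil, zero_add, pow_one, neg_smul, one_smul, onLast_singleton,
        mergeSum_cons _ c q]
      abel
    | cons b p =>
      have := ih (fun t => φ (a :: t))
      simp only [List.cons_append] at this ⊢
      rw [mergeSum_cons_cons, this, mergeSum_cons_cons, onLast_cons_cons]
      simp only [List.length_cons, pow_succ, mul_neg, neg_smul, mul_one]
      simp only [List.cons_append]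
      abel

/-! ### Words as lists -/

variable (k) in
/-- The word with the given letters. -/
def word (l : List A) : TensorAlgebra k A := (l.map (TensorAlgebra.ι k)).prod

variable (k) in
/-- The normalized word with the given letters. -/
def bword (l : List A) : Bar k A := toBar k A (word k l)

@[simp] theorem word_nil : word k ([] : List A) = 1 := rfl
theorem word_cons (a : A) (l : List A) : word k (a :: l) = TensorAlgebra.ι k a * word k l := by
  simp [word]
theorem word_append (l t : List A) : word k (l ++ t) = word k l * word k t := by simp [word]
theorem word_singleton (a : A) : word k [a] = TensorAlgebra.ι k a := by simp [word]
theorem bword_append (l t : List A) : bword k (l ++ t) = bword k l * bword k t := by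
  simp [bword, word_append]
@[simp] theorem bword_nil : bword k ([] : List A) = 1 := by simp [bword]
theorem bword_cons (a : A) (l : List A) : bword k (a :: l) = bword k [a] * bword k l :=
  bword_append [a] l
theorem toBar_word (l : List A) : toBar k A (word k l) = bword k l := rfl

theorem tprod_eq_word (a : Fin n → A) : TensorAlgebra.tprod k A n a = word k (List.ofFn a) := by
  rw [TensorAlgebra.tprod_apply, word, List.map_ofFn]
  rfl

theorem word_eq_tprod (l : List A) : word k l = TensorAlgebra.tprod k A l.length l.get := by
  rw [tprod_eq_word, List.ofFn_get]

variable (k A) in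
theorem span_word : Submodule.span k (Set.range (word k : List A → TensorAlgebra k A)) = ⊤ := by
  rw [eq_top_iff]
  intro t _
  induction t using TensorAlgebra.induction with
  | algebraMap r =>
    rw [Algebra.algebraMap_eq_smul_one]
    exact Submodule.smul_mem _ r (Submodule.subset_span ⟨[], rfl⟩)
  | ι x => exact Submodule.subset_span ⟨[x], word_singleton x⟩
  | add a b ha hb => exact add_mem (ha trivial) (hb trivial)
  | mul a b ha hb =>
    have : ∀ x ∈ Submodule.span k (Set.range (word k : List A → TensorAlgebra k A)),
        ∀ y ∈ Submodule.span k (Set.range (word k : List A → TensorAlgebra k A)),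
        x * y ∈ Submodule.span k (Set.range (word k : List A → TensorAlgebra k A)) := by
      intro x hx y hy
      refine (Submodule.mul_le (M := Submodule.span k (Set.range (word k))) (N :=
        Submodule.span k (Set.range (word k))) (P := Submodule.span k (Set.range (word k)))).1
        ?_ x hx y hy
      rw [Submodule.span_mul_span]
      refine Submodule.span_mono ?_
      rintro _ ⟨_, ⟨l, rfl⟩, _, ⟨t, rfl⟩, rfl⟩
      exact ⟨l ++ t, word_append l t⟩
    exact this a (ha trivial) b (hb trivial)

theorem ext_word {φ ψ : TensorAlgebra k A →ₗ[k] X} (h : ∀ l, φ (word k l) = ψ (word k l)) : φ = ψ :=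
  LinearMap.ext_on_range (span_word k A) h

theorem ext_bword {φ ψ : Bar k A →ₗ[k] X} (h : ∀ l, φ (bword k l) = ψ (bword k l)) : φ = ψ := by
  have : φ ∘ₗ (toBar k A).toLinearMap = ψ ∘ₗ (toBar k A).toLinearMap := ext_word h
  refine LinearMap.ext fun x => ?_
  obtain ⟨t, rfl⟩ := Ideal.Quotient.mk_surjective (I := degenerate k A) x
  exact LinearMap.congr_fun this t

theorem ofWords_word (φ : ∀ n : ℕ, Multi n X) (l : List A) :
    ofWords φ (word k l) = φ l.length l.get := by rw [word_eq_tprod, ofWords_tprod]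

theorem ofWords_ofFn (φ : ∀ n : ℕ, Multi n X) (a : Fin n → A) :
    ofWords φ (word k (List.ofFn a)) = φ n a := by rw [← tprod_eq_word, ofWords_tprod]

/-- The value of a multilinear map in `m` variables at a list, zero if the length is not `m`. -/
def ev (f : Multi m X) (l : List A) : X := onWords m f (word k l)

@[simp] theorem ev_ofFn {m : ℕ} (f : Multi m X) (a : Fin m → A) : ev f (List.ofFn a) = f a := by
  rw [ev, ← tprod_eq_word, onWords_tprod]

/-- This default value allows sums over all splittings without length conditions: only blocks of
length `m` contribute. -/
theorem ev_of_ne (f : Multi m X) {l : List A} (h : l.length ≠ m) : ev f l = 0 := by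
  rw [ev, onWords, ofWords_word, dif_neg (Ne.symm h)]
  rfl

theorem ev_of_eq (f : Multi m X) {l : List A} (h : l.length = m) :
    ev f l = f fun i => l.get (i.cast h.symm) := by
  subst h
  have := ev_ofFn f l.get
  simp only [List.ofFn_get] at this
  exact this

theorem exists_ofFn {l : List A} (h : l.length = m) : ∃ a : Fin m → A, List.ofFn a = l := by
  subst h
  exact ⟨l.get, List.ofFn_get l⟩

theorem ext_ev {f g : Multi m X} (h : ∀ l : List A, l.length = m → ev f l = ev g l) : f = g := by
  ext a
  simpa using h (List.ofFn a) (by simp)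

theorem ev_add (f g : Multi m X) (l : List A) : ev (f + g) l = ev f l + ev g l := by
  by_cases h : l.length = m
  · simp [ev_of_eq _ h]
  · simp [ev_of_ne _ h]

theorem ev_smul (c : k) (f : Multi m X) (l : List A) : ev (c • f) l = c • ev f l := by
  by_cases h : l.length = m
  · simp [ev_of_eq _ h]
  · simp [ev_of_ne _ h]

theorem ev_zero (l : List A) : ev (0 : Multi m X) l = 0 := by
  by_cases hu : l.length = m
  · rw [ev_of_eq _ hu]; rfl
  · rw [ev_of_ne _ hu]

theorem ev_sum {ι : Type*} (s : Finset ι) (f : ι → Multi m X) (l : List A) :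
    ev (∑ i ∈ s, f i) l = ∑ i ∈ s, ev (f i) l := by
  classical
  induction s using Finset.induction_on with
  | empty => simp [ev_zero]
  | insert a s ha ih => rw [Finset.sum_insert ha, Finset.sum_insert ha, ev_add, ih]

theorem ev_sub (f g : Multi m X) (l : List A) : ev (f - g) l = ev f l - ev g l := by
  rw [sub_eq_add_neg, ← neg_one_smul k g, ev_add, ev_smul, neg_one_smul, ← sub_eq_add_neg]

theorem ev_comp (φ : X →ₗ[k] Y) (f : Multi m X) (l : List A) :
    ev (φ.compMultilinearMap f) l = φ (ev f l) := by
  by_cases h : l.length = m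
  · simp [ev_of_eq _ h]
  · simp [ev_of_ne _ h]

theorem getElem_three {p u v : List A} {t : ℕ} (h : t < u.length) :
    (p ++ u ++ v)[p.length + t]'(by simp; omega) = u[t] := by
  simp only [List.append_assoc]
  rw [List.getElem_append_right (by omega), List.getElem_append_left (by omega)]
  simp

/-- Replaces the index arithmetic on `Fin N` by concatenation of lists. -/
theorem block_append {R : Type*} [Ring R] [Algebra k R] (π : TensorAlgebra k A →ₐ[k] R)
    (g : Multi m R) (p u v : List A) (hu : u.length = m) {j : ℕ} (hj : p.length = j) {l : List A}
    (hl : p ++ u ++ v = l) : block π j l.length g l.get = π (word k p) * ev g u * π (word k v) := by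
  subst hu hj hl
  rw [block_apply π (by simp), ev_of_eq g rfl, tprod_eq_word, tprod_eq_word]
  congr 3
  · congr 1
    apply List.ext_getElem
    · simp
    · intro i h1 h2
      simp only [List.getElem_ofFn, List.get_eq_getElem, List.append_assoc]
      rw [List.getElem_append_left]
  · funext t
    simp only [List.get_eq_getElem]
    exact getElem_three t.2
  · apply List.ext_getElem
    · simp; omega
    · intro i h1 h2
      simp only [List.getElem_ofFn, List.get_eq_getElem]
      rw [List.getElem_append_right (by simp)]
      simp

theorem block_of_lt {R : Type*} [Ring R] [Algebra k R] (π : TensorAlgebra k A →ₐ[k] R) {j : ℕ}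
    (g : Multi m R) (h : N < j + m) (a : Fin N → A) : block π j N g a = 0 := by
  rw [block, dif_neg (by omega)]
  rfl

theorem exists_append_of_le {j : ℕ} {l : List A} (h : j + m ≤ l.length) :
    ∃ p u v, p ++ u ++ v = l ∧ p.length = j ∧ u.length = m := by
  refine ⟨l.take j, (l.drop j).take m, (l.drop j).drop m, ?_, ?_, ?_⟩
  · simp
  · simp; omega
  · simp; omega

theorem ev_mulWord (x y : A) : ev (mulWord (k := k)) [x, y] = word k [x * y] := by
  have : ev (mulWord (k := k)) (List.ofFn ![x, y]) = _ := ev_ofFn _ _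
  simp only [List.ofFn_succ, List.ofFn_zero] at this
  refine this.trans ?_
  simp [mulWord, word]

theorem contract_append (p v : List A) (x y : A) {j : ℕ} (hj : p.length = j) {l : List A}
    (hl : p ++ x :: y :: v = l) :
    contract (k := k) j l.length l.get = word k (p ++ (x * y) :: v) := by
  rw [contract, block_append (AlgHom.id k (TensorAlgebra k A)) (mulWord (k := k)) p [x, y] v rfl hj
    (by simpa using hl), ev_mulWord]
  simp [word_append, word_cons, mul_assoc]

theorem sum_contract (φ : TensorAlgebra k A →ₗ[k] X) (l : List A) :
    ∑ i ∈ Finset.range (l.length - 1), ε ^ i • φ (contract i l.length l.get) =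
      mergeSum (fun t => φ (word k t)) l := by
  -- A prefix `p` is carried along, because the induction strips the first letter while `contract`
  -- counts places from the start of the whole word.
  suffices H : ∀ (p l : List A), ∑ i ∈ Finset.range (l.length - 1),
      ε ^ i • φ (contract (p.length + i) (p ++ l).length (p ++ l).get) =
      mergeSum (fun t => φ (word k (p ++ t))) l by simpa using H [] l
  intro p l
  induction l generalizing p with
  | nil => simp
  | cons a l ih =>
    cases l with
    | nil => simp
    | cons b l =>
      have h1 := ih (p ++ [a])
      simp only [List.append_assoc, List.cons_append, List.nil_append] at h1
      rw [mergeSum_cons_cons, ← h1]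
      simp only [List.length_cons, Nat.add_sub_cancel]
      rw [Finset.sum_range_succ', add_comm, sub_eq_add_neg, ← Finset.sum_neg_distrib]
      congr 1
      · simp only [pow_zero, one_smul, add_zero]
        rw [contract_append (k := k) p l a b rfl rfl]
      · refine Finset.sum_congr rfl fun i _ => ?_
        rw [pow_succ, mul_neg, mul_one, neg_smul]
        have e : ∀ (l₁ l₂ : List A) (j₁ j₂ : ℕ), l₁ = l₂ → j₁ = j₂ →
            contract (k := k) j₁ l₁.length l₁.get = contract j₂ l₂.length l₂.get := by
          rintro _ _ _ _ rfl rfl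
          rfl
        rw [e (p ++ a :: b :: l) (p ++ [a] ++ b :: l) (p.length + (i + 1)) ((p ++ [a]).length + i)
          (by simp) (by simp; omega)]

theorem barD_bword (l : List A) : barD (bword k l) = mergeSum (bword k) l := by
  rw [bword, barD_toBar, barWords, ofWords_word]
  simp only [sum_apply, smul_apply, LinearMap.compMultilinearMap_apply]
  exact sum_contract (toBar k A).toLinearMap l

theorem leftWords_word (x a : A) (l : List A) :
    leftWords x (word k (a :: l)) = word k ((x * a) :: l) := by
  change ofWords (contract 0) (TensorAlgebra.ι k x * word k (a :: l)) = _
  rw [← word_cons, ofWords_word]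
  exact contract_append [] l x a rfl rfl

theorem rightWords_word (x a : A) (l : List A) :
    rightWords x (word k (l ++ [a])) = word k (l ++ [a * x]) := by
  change ofWords (fun N => contract (N - 2) N) (word k (l ++ [a]) * TensorAlgebra.ι k x) = _
  rw [← word_singleton, ← word_append, ofWords_word]
  exact contract_append (k := k) l [] a x (by simp) (by simp)

theorem barLeft_bword (x a : A) (l : List A) :
    barLeft x (bword k (a :: l)) = bword k ((x * a) :: l) := by
  change toBar k A (leftWords x (word k (a :: l))) = _
  rw [leftWords_word]
  rfl

theorem barRight_bword (x a : A) (l : List A) :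
    barRight x (bword k (l ++ [a])) = bword k (l ++ [a * x]) := by
  change toBar k A (rightWords x (word k (l ++ [a]))) = _
  rw [rightWords_word]
  rfl

theorem bword_eq_zero (p q : List A) (hp : p ≠ []) (hq : q ≠ []) : bword k (p ++ 1 :: q) = 0 := by
  have h1 : 0 < p.length := List.length_pos_iff.2 hp
  have h2 : 0 < q.length := List.length_pos_iff.2 hq
  rw [bword, word_eq_tprod]
  refine toBar_eq_zero _ p.length h1 ?_ ?_
  · simp; omega
  · simp

variable (k A) in
theorem unitWords_eq :
    unitWords k A = {t | ∃ p q : List A, p ≠ [] ∧ q ≠ [] ∧ word k (p ++ 1 :: q) = t} := by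
  ext t
  constructor
  · rintro ⟨n, a, i, h0, h1, hi, rfl⟩
    refine ⟨(List.ofFn a).take i, (List.ofFn a).drop (i + 1), ?_, ?_, ?_⟩
    · rw [← List.length_pos_iff]; simp; omega
    · rw [← List.length_pos_iff]; simp; omega
    · rw [tprod_eq_word]
      congr 1
      have : (1 : A) = (List.ofFn a)[(i : ℕ)]'(by simp) := by simp [hi]
      rw [this, List.getElem_cons_drop, List.take_append_drop]
  · rintro ⟨p, q, hp, hq, rfl⟩
    have h1 : 0 < p.length := List.length_pos_iff.2 hp
    have h2 : 0 < q.length := List.length_pos_iff.2 hq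
    exact ⟨_, _, ⟨p.length, by simp⟩, h1, by simp; omega, by simp, (word_eq_tprod _).symm⟩

theorem bword_mem_barLength (l : List A) : bword k l ∈ barLength k A l.length :=
  Submodule.subset_span ⟨l.get, congrArg (toBar k A) (word_eq_tprod l).symm⟩

variable (k A) in
theorem barLength_eq_span (n : ℕ) :
    barLength k A n = Submodule.span k {x | ∃ l : List A, l.length = n ∧ bword k l = x} := by
  rw [barLength]
  congr 1
  ext x
  constructor
  · rintro ⟨a, rfl⟩
    exact ⟨List.ofFn a, by simp, congrArg (toBar k A) (tprod_eq_word a).symm⟩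
  · rintro ⟨l, rfl, rfl⟩
    exact ⟨l.get, congrArg (toBar k A) (word_eq_tprod l).symm⟩

theorem barLength_le {S : Submodule k (Bar k A)} (h : ∀ l : List A, l.length = n → bword k l ∈ S)
    (hx : x ∈ barLength k A n) : x ∈ S := by
  rw [barLength_eq_span] at hx
  refine Submodule.span_le.2 ?_ hx
  rintro _ ⟨l, hl, rfl⟩
  exact h l hl

theorem eqOn_barLength {φ ψ : Bar k A →ₗ[k] X}
    (h : ∀ l : List A, l.length = n → φ (bword k l) = ψ (bword k l)) (hx : x ∈ barLength k A n) :
    φ x = ψ x :=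
  barLength_le (S := LinearMap.eqLocus φ ψ) h hx

theorem eq_of_bword {φ ψ : Bar k A →ₗ[k] X} (h : ∀ l, φ (bword k l) = ψ (bword k l)) (x : Bar k A) :
    φ x = ψ x :=
  LinearMap.congr_fun (ext_bword h) x

theorem exists_append_singleton {l : List A} (h : l.length = m + 1) :
    ∃ w b, l = w ++ [b] ∧ w.length = m := by
  rcases List.eq_nil_or_concat' l with rfl | ⟨w, b, rfl⟩
  · simp at h
  · exact ⟨w, b, rfl, by simpa using h⟩

/-- Left multiplication on normalized words. -/
def mulL (y : Bar k A) : Bar k A →ₗ[k] Bar k A := LinearMap.mulLeft k y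

/-- Right multiplication on normalized words. -/
def mulR (y : Bar k A) : Bar k A →ₗ[k] Bar k A := LinearMap.mulRight k y

theorem mulL_apply (x y : Bar k A) : mulL x y = x * y := rfl

theorem mulR_apply (x y : Bar k A) : mulR x y = y * x := rfl

theorem bar_smul_mul (c : k) (x y : Bar k A) : (c • x) * y = c • (x * y) := smul_mul_assoc c x y

theorem bar_mul_smul (c : k) (x y : Bar k A) : x * (c • y) = c • (x * y) := mul_smul_comm c x y

/-! ### The Hochschild differential and insertions on lists -/

/-- No length condition is needed: for a list that does not have `m + 1` letters all terms vanish.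
The merge sum begins with a plus sign, whereas the inner terms of δ begin with a minus sign. -/
theorem ev_delta (L R : A →ₗ[k] Module.End k M) (m : ℕ) (f : Multi m M) (a : A) (l : List A) :
    ev (delta L R m f) (a :: l) = L a (ev f l) - mergeSum (ev f) (a :: l) +
      ε ^ (m + 1) • onLast (fun p c => R c (ev f p)) (a :: l) := by
  by_cases h : (a :: l).length = m + 1
  · obtain ⟨b, hb⟩ := exists_ofFn h
    have h1 : mergeSum (ev f) (a :: l) =
        ∑ i : Fin m, ε ^ (i : ℕ) • onWords m f (contract (i : ℕ) (m + 1) b) := by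
      have := sum_contract (onWords m f) (a :: l)
      refine this.symm.trans ?_
      rw [← hb, Fin.sum_univ_eq_sum_range (fun i => ε ^ i • onWords m f (contract i (m + 1) b))]
      -- The length of `List.ofFn b` equals `n` only propositionally, so the contraction has to be
      -- transported.
      have e : ∀ (n : ℕ) (b : Fin n → A) (i : ℕ), contract (k := k) i (List.ofFn b).length
          (List.ofFn b).get = contract i n b := by
        intro n b i
        have : ∀ (l : List A) (hl : l.length = n) (b : Fin n → A),
            (∀ j : Fin n, b j = l.get (j.cast hl.symm)) →
            contract (k := k) i l.length l.get = contract i n b := by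
          rintro l rfl b hb
          congr 1
          funext j
          exact (hb j).symm
        exact this _ (by simp) _ (by simp)
      refine Finset.sum_congr (by simp) fun i _ => ?_
      rw [e]
    rw [h1, ← hb, ev_ofFn]
    simp only [delta, LinearMap.coe_mk, AddHom.coe_mk, add_apply, sum_apply, smul_apply,
      LinearMap.compMultilinearMap_apply, LinearMap.uncurryLeft_apply,
      MultilinearMap.uncurryRight_apply, LinearMap.flip_apply]
    have hb0 : b 0 = a := by
      have := congrArg List.head? hb
      simpa [List.ofFn_succ] using this
    have hbt : List.ofFn (Fin.tail b) = l := by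
      have := congrArg List.tail hb
      rw [List.ofFn_succ] at this
      exact this
    have hl : List.ofFn b = List.ofFn (Fin.init b) ++ [b (Fin.last m)] := by
      rw [List.ofFn_succ_last]
      rfl
    rw [hl, onLast_append_singleton, ev_ofFn, ← hbt, ev_ofFn, hb0]
    simp only [pow_succ, mul_neg, mul_one, neg_smul, Finset.sum_neg_distrib]
    abel
  · rw [ev_of_ne _ h, ev_of_ne f (by simpa using h)]
    have h1 : mergeSum (ev f) (a :: l) = mergeSum (fun _ => 0) (a :: l) :=
      mergeSum_congr fun t ht => ev_of_ne f (by simp at ht h; omega)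
    have h2 : onLast (fun p c => R c (ev f p)) (a :: l) = onLast (fun _ _ => 0) (a :: l) := by
      refine onLast_congr fun p c hp => ?_
      have := congrArg List.length hp
      rw [ev_of_ne f (by simp at this h; omega), map_zero]
    rw [h1, h2, mergeSum_zero]
    rcases List.eq_nil_or_concat' (a :: l) with h | ⟨p, c, h⟩
    · simp at h
    · rw [h]; simp

theorem ev_eq_zero_of_mem {U : Submodule k M} {f : Multi m M} (hf : f ∈ cochains A U m)
    (p q : List A) : ev f (p ++ 1 :: q) = 0 := by
  by_cases h : (p ++ 1 :: q).length = m
  · rw [ev_of_eq f h]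
    have h' : p.length < m := by rw [← h]; simp
    exact hf.2 _ ⟨⟨p.length, h'⟩, by simp⟩
  · exact ev_of_ne f h

theorem ev_mem_of_mem {U : Submodule k M} {f : Multi m M} (hf : f ∈ cochains A U m) (l : List A) :
    ev f l ∈ U := by
  by_cases h : l.length = m
  · rw [ev_of_eq f h]
    exact hf.1 _
  · rw [ev_of_ne f h]
    exact zero_mem _

theorem mem_cochains {U : Submodule k M} {f : Multi m M}
    (h1 : ∀ l : List A, l.length = m → ev f l ∈ U)
    (h2 : ∀ p q : List A, p.length + q.length + 1 = m → ev f (p ++ 1 :: q) = 0) :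
    f ∈ cochains A U m := by
  refine ⟨fun a => ?_, ?_⟩
  · simpa using h1 (List.ofFn a) (by simp)
  · rintro a ⟨i, hi⟩
    have h : List.ofFn a = (List.ofFn a).take i ++ 1 :: (List.ofFn a).drop (i + 1) := by
      have : (1 : A) = (List.ofFn a)[(i : ℕ)]'(by simp) := by simp [hi]
      rw [this, List.getElem_cons_drop, List.take_append_drop]
    rw [← ev_ofFn f a, h]
    refine h2 _ _ ?_
    simp
    omega

theorem mem_cocycles {U : Submodule k M} {L R : A →ₗ[k] Module.End k M} {f : Multi m M} :
    f ∈ cocycles U L R m ↔ f ∈ cochains A U m ∧ delta L R m f = 0 := Iff.rfl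

theorem insertAt_bword {j : ℕ} (f : CΩ p m) (s u v : List A) (hs : s.length = j)
    (hu : u.length = m) :
    insertAt j f (bword k (s ++ u ++ v)) = bword k s * ev f.1 u * bword k v := by
  change ofWords (fun N => block (toBar k A) j N f.1) (word k (s ++ u ++ v)) = _
  rw [ofWords_word]
  exact block_append (toBar k A) f.1 s u v hu hs rfl

theorem insertAt_bword_of_lt {j : ℕ} (f : CΩ p m) (l : List A) (h : l.length < j + m) :
    insertAt j f (bword k l) = 0 := by
  change ofWords (fun N => block (toBar k A) j N f.1) (word k l) = _
  rw [ofWords_word]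
  exact block_of_lt (toBar k A) f.1 h _

theorem ev_block {j : ℕ} (g : Multi m (Bar k A)) (s u v : List A) (hs : s.length = j)
    (hu : u.length = m) (hN : (s ++ u ++ v).length = N) :
    ev (block (toBar k A) j N g) (s ++ u ++ v) = bword k s * ev g u * bword k v := by
  subst hN
  rw [ev_of_eq _ rfl]
  exact block_append (toBar k A) g s u v hu hs rfl

theorem sum_insertAt_unitWords (c : ℕ) (f : CΩ p m) (t : TensorAlgebra k A)
    (ht : t ∈ unitWords k A) :
    ofWords (fun N => ∑ j ∈ Finset.range (N + 1), ε ^ (c * j) •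
      block (toBar k A) j N f.1) t = 0 := by
  obtain ⟨n, a, i, h0, h1, hi, rfl⟩ := ht
  rw [ofWords_tprod, sum_apply]
  refine Finset.sum_eq_zero fun j _ => ?_
  rw [smul_apply, ← ofWords_tprod (fun N => block (toBar k A) j N f.1), block_unitWords j f _ ⟨n, a,
    i, h0, h1, hi, rfl⟩, smul_zero]

/-- The sum of the insertions of `f ∈ C^m(A, Ω̄^p)` in all places of a normalized word, with the
Koszul signs for `f` of degree `p + m + 1`. -/
def insertSum (f : CΩ p m) : Bar k A →ₗ[k] Bar k A :=
  liftBar _ (sum_insertAt_unitWords (p + m + 1) f)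

theorem splitSum_eq_of_length (F : List A → List A → X) (u v : List A)
    (hF : ∀ p q, p ++ q = u ++ v → p.length ≠ u.length → F p q = 0) :
    splitSum F (u ++ v) = F u v := by
  induction u generalizing F with
  | nil =>
    cases v with
    | nil => rfl
    | cons b v =>
      rw [List.nil_append, splitSum_cons]
      rw [splitSum_congr (G := fun _ _ => 0), splitSum_zero, add_zero]
      intro p q hpq
      exact hF _ _ (by simp [hpq]) (by simp)
  | cons a u ih =>
    rw [List.cons_append, splitSum_cons, hF [] (a :: (u ++ v)) rfl (by simp), zero_add]
    exact ih (fun p q => F (a :: p) q) fun p q hpq hne =>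
      hF _ _ (by simp [hpq]) (by simpa using hne)

/-- At most one splitting contributes. The full sum over splittings is kept so that the Leibniz
rules for `splitSum` apply to it. -/
theorem insertAt_append (f : CΩ p m) (s l : List A) : insertAt s.length f (bword k (s ++ l)) =
      splitSum (fun u v => bword k s * ev f.1 u * bword k v) l := by
  by_cases h : m ≤ l.length
  · obtain ⟨x, u, v, rfl, hx, rfl⟩ := exists_append_of_le (j := 0) (m := m) (l := l) (by omega)
    obtain rfl := List.length_eq_zero_iff.1 hx
    rw [List.nil_append, ← List.append_assoc, insertAt_bword f s u v rfl rfl, splitSum_eq_of_length]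
    intro p q _ hp
    rw [ev_of_ne _ hp]
    simp
  · rw [insertAt_bword_of_lt f _ (by simp; omega), splitSum_congr (G := fun _ _ => 0),
      splitSum_zero]
    intro u v huv
    have := congrArg List.length huv
    rw [ev_of_ne]
    · simp
    · simp at this; omega

/-- A cochain without arguments can also be inserted behind the last letter, so the range has to
exceed `l.length`; places that do not fit contribute zero. -/
theorem sum_range_insertAt (c n : ℕ) (f : CΩ p m) (s l : List A) (hn : l.length < n) :
    ∑ j ∈ Finset.range n, ε ^ (c * j) • insertAt (s.length + j) f (bword k (s ++ l)) =
      splitSum (fun x y => ε ^ (c * x.length) •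
        splitSum (fun u v => bword k (s ++ x) * ev f.1 u * bword k v) y) l := by
  induction l generalizing s n with
  | nil =>
    rw [Finset.sum_eq_single_of_mem 0 (by simpa using hn)]
    · have := insertAt_append f s []
      simp only [List.append_nil] at this
      simp [this]
    · intro j _ hj
      rw [insertAt_bword_of_lt f _ (by simp; omega), smul_zero]
  | cons a l ih =>
    obtain ⟨n, rfl⟩ : ∃ n', n = n' + 1 := ⟨n - 1, by omega⟩
    rw [Finset.sum_range_succ', add_comm, splitSum_cons]
    congr 1
    · simp [insertAt_append f s (a :: l)]
    · have := ih n (s ++ [a]) (by simpa using hn)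
      simp only [List.append_assoc, List.cons_append, List.nil_append] at this
      simp only [List.length_cons, mul_add, mul_one, pow_add, mul_comm _ (ε ^ c), mul_smul]
      rw [splitSum_smul, ← this, Finset.smul_sum]
      refine Finset.sum_congr rfl fun j _ => ?_
      rw [List.length_append, List.length_singleton, add_assoc, add_comm 1 j]

theorem insertSum_bword (f : CΩ p m) (l : List A) :
    insertSum f (bword k l) = splitSum (fun x y => ε ^ ((p + m + 1) * x.length) •
      splitSum (fun u v => bword k x * ev f.1 u * bword k v) y) l := by
  have := sum_range_insertAt (p + m + 1) (l.length + 1) f [] l (by simp)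
  simp only [List.nil_append, List.length_nil, zero_add] at this
  rw [← this]
  change ofWords _ (word k l) = _
  rw [ofWords_word, sum_apply]
  refine Finset.sum_congr rfl fun j _ => ?_
  rw [smul_apply]
  congr 1
  change _ = ofWords (fun N => block (toBar k A) j N f.1) (word k l)
  rw [ofWords_word]

/-- Exponents of signs are natural numbers; comparing them through their sum avoids subtraction. -/
theorem neg_one_pow_eq {a b : ℕ} (h : Even (a + b)) : ε ^ a = (-1) ^ b := by
  have h1 : ε ^ (a + b) = 1 := h.neg_one_pow
  rcases neg_one_pow_eq_or k a with ha | ha <;> rcases neg_one_pow_eq_or k b with hb | hb <;>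
    rw [pow_add, ha, hb] at h1 <;> rw [ha, hb] <;>
    first | simpa using h1 | simpa using h1.symm

/-! ### The bar differential and the two actions of `A` on normalized words -/

theorem barLeft_one (x : A) : barLeft x (1 : Bar k A) = 0 := by
  have : barLeft x (1 : Bar k A) = toBar k A (leftWords x (word k ([] : List A))) := by
    simp only [word_nil]; rfl
  have h2 : leftWords x (word k ([] : List A)) = 0 := by
    change ofWords (contract 0) (TensorAlgebra.ι k x * word k []) = 0
    rw [← word_cons, ofWords_word]
    exact block_of_lt _ _ (by simp) _
  rw [this, h2, map_zero]

theorem barRight_one (x : A) : barRight x (1 : Bar k A) = 0 := by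
  have : barRight x (1 : Bar k A) = toBar k A (rightWords x (word k ([] : List A))) := by
    simp only [word_nil]; rfl
  have h2 : rightWords x (word k ([] : List A)) = 0 := by
    change ofWords (fun N => contract (N - 2) N) (word k [] * TensorAlgebra.ι k x) = 0
    rw [← word_singleton, ← word_append, ofWords_word]
    exact block_of_lt _ _ (by simp) _
  rw [this, h2, map_zero]

theorem barD_one : barD (1 : Bar k A) = 0 := by
  have := barD_bword (k := k) ([] : List A)
  simpa using this

/-- A new first letter adds one face and changes the sign of all others. On the empty word the left
action is zero, which keeps the formula valid there. This is the recursion for inductions over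
words. -/
theorem barD_letter_mul (a : A) (x : Bar k A) :
    barD (bword k [a] * x) = barLeft a x - bword k [a] * barD x := by
  refine eq_of_bword (φ := barD ∘ₗ mulL (bword k [a]))
    (ψ := barLeft a - mulL (bword k [a]) ∘ₗ barD) (fun l => ?_) x
  simp only [LinearMap.comp_apply, LinearMap.sub_apply]
  rw [mulL_apply, ← bword_cons, barD_bword, mergeSum_cons, barD_bword, linear_mergeSum]
  congr 1
  · cases l with
    | nil => simp [barLeft_one]
    | cons b l => simp [barLeft_bword]
  · simp [mulL_apply, ← bword_cons]

theorem barD_mul_letter (a : A) (hx : x ∈ barLength k A n) :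
    barD (x * bword k [a]) = barD x * bword k [a] + ε ^ (n + 1) • barRight a x := by
  refine eqOn_barLength (φ := barD ∘ₗ mulR (bword k [a]))
    (ψ := mulR (bword k [a]) ∘ₗ barD + ε ^ (n + 1) • barRight a) ?_ hx
  rintro l rfl
  simp only [LinearMap.comp_apply, LinearMap.add_apply, LinearMap.smul_apply]
  rw [mulR_apply, ← bword_append, barD_bword, mergeSum_append_cons k, barD_bword, linear_mergeSum,
    pow_succ, mul_neg, mul_one, neg_smul, ← sub_eq_add_neg]
  simp only [onHead_nil, smul_zero, mergeSum_nil, add_zero, sub_zero, mulR_apply, ← bword_append]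
  congr 2
  rcases List.eq_nil_or_concat' l with rfl | ⟨p, c, rfl⟩
  · simp [barRight_one]
  · simp [barRight_bword]

theorem barD_barLeft (a : A) (x : Bar k A) : barD (barLeft a x) = barLeft a (barD x) := by
  refine eq_of_bword (φ := barD ∘ₗ barLeft a) (ψ := barLeft a ∘ₗ barD) (fun l => ?_) x
  simp only [LinearMap.comp_apply]
  cases l with
  | nil => simp [barLeft_one, barD_one]
  | cons b l =>
    rw [barLeft_bword, barD_bword, barD_bword, mergeSum_cons, mergeSum_cons, map_sub, linear_onHead,
      linear_mergeSum]
    simp [barLeft_bword, mul_assoc]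

theorem barD_barRight (a : A) (x : Bar k A) : barD (barRight a x) = barRight a (barD x) := by
  refine eq_of_bword (φ := barD ∘ₗ barRight a) (ψ := barRight a ∘ₗ barD) (fun l => ?_) x
  simp only [LinearMap.comp_apply]
  rcases List.eq_nil_or_concat' l with rfl | ⟨p, c, rfl⟩
  · simp [barRight_one, barD_one]
  · rw [barRight_bword, barD_bword, barD_bword, mergeSum_append_cons k, mergeSum_append_cons k]
    simp [linear_mergeSum, linear_onLast, barRight_bword, mul_assoc]

theorem barLeft_barRight (a b : A) (x : Bar k A) :
    barLeft a (barRight b x) = barRight b (barLeft a x) := by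
  refine eq_of_bword (φ := barLeft a ∘ₗ barRight b) (ψ := barRight b ∘ₗ barLeft a) (fun l => ?_) x
  simp only [LinearMap.comp_apply]
  rcases List.eq_nil_or_concat' l with rfl | ⟨p, c, rfl⟩
  · simp [barRight_one, barLeft_one]
  · rw [barRight_bword]
    cases p with
    | nil =>
      have := barRight_bword (k := k) b (a * c) []
      simp only [List.nil_append] at this ⊢
      rw [barLeft_bword, barLeft_bword, this, mul_assoc]
    | cons d p =>
      have := barRight_bword (k := k) b c ((a * d) :: p)
      simp only [List.cons_append] at this ⊢
      rw [barLeft_bword, barLeft_bword, this]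

theorem barRight_mul (a b : A) (x : Bar k A) : barRight (a * b) x = barRight b (barRight a x) := by
  refine eq_of_bword (φ := barRight (a * b)) (ψ := barRight b ∘ₗ barRight a) (fun l => ?_) x
  rcases List.eq_nil_or_concat' l with rfl | ⟨p, c, rfl⟩
  · simp [barRight_one]
  · simp [barRight_bword, mul_assoc]

/-- Induction on the word: in d(d([a] x)) = d(a x) − d([a] dx) the two terms a dx cancel, because d
is left linear. -/
theorem barD_barD (x : Bar k A) : barD (barD x) = 0 := by
  refine eq_of_bword (φ := barD ∘ₗ barD) (ψ := 0) (fun l => ?_) x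
  simp only [LinearMap.comp_apply, LinearMap.zero_apply]
  induction l with
  | nil => simp [barD_one]
  | cons a l ih =>
    rw [bword_cons, barD_letter_mul, map_sub, barD_letter_mul, barD_barLeft, ih]
    simp

/-- The factor `x` must contain a letter, since otherwise the action would reach the first letter of
`y`. -/
theorem barLeft_mul_of_mem (a : A) (hx : x ∈ barLength k A (n + 1)) (y : Bar k A) :
    barLeft a (x * y) = barLeft a x * y := by
  refine eqOn_barLength (φ := barLeft a ∘ₗ mulR y) (ψ := mulR y ∘ₗ barLeft a) (fun l hl => ?_) hx
  refine eq_of_bword (φ := barLeft a ∘ₗ mulL (bword k l)) (ψ := mulL (barLeft a (bword k l)))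
    (fun t => ?_) y
  obtain ⟨b, l, rfl⟩ := List.exists_cons_of_length_eq_add_one hl
  rw [LinearMap.comp_apply, mulL_apply, mulL_apply, ← bword_append, List.cons_append, barLeft_bword,
    barLeft_bword, ← bword_append]
  rfl

theorem barRight_mul_letter (a b : A) (x : Bar k A) :
    barRight a (x * bword k [b]) = x * bword k [b * a] := by
  refine eq_of_bword (φ := barRight a ∘ₗ mulR (bword k [b])) (ψ := mulR (bword k [b * a]))
    (fun t => ?_) x
  rw [LinearMap.comp_apply, mulR_apply, mulR_apply, ← bword_append, barRight_bword, bword_append]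

theorem mul_mem_barLength {x y : Bar k A} (hx : x ∈ barLength k A n) (hy : y ∈ barLength k A l) :
    x * y ∈ barLength k A (n + l) := by
  refine barLength_le (S := (barLength k A (n + l)).comap (mulR y)) ?_ hx
  rintro s rfl
  refine barLength_le (S := (barLength k A (s.length + l)).comap (mulL (bword k s))) ?_ hy
  rintro t rfl
  rw [Submodule.mem_comap, mulL_apply, ← bword_append, ← List.length_append]
  exact bword_mem_barLength _

theorem mergeSum_mem (U : Submodule k X) {l : List A}
    (h : ∀ t : List A, t.length + 1 = l.length → φ t ∈ U) : mergeSum φ l ∈ U := by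
  induction l generalizing φ with
  | nil => exact zero_mem _
  | cons a l ih =>
    cases l with
    | nil => exact zero_mem _
    | cons b l =>
      rw [mergeSum_cons_cons]
      exact sub_mem (h _ (by simp)) (ih fun t ht => h _ (by simpa using ht))

theorem splitSum_mem (U : Submodule k X) {F : List A → List A → X} {l : List A}
    (h : ∀ p q, p ++ q = l → F p q ∈ U) : splitSum F l ∈ U := by
  induction l generalizing F with
  | nil => exact h _ _ rfl
  | cons a l ih =>
    rw [splitSum_cons]
    exact add_mem (h _ _ rfl) (ih fun p q hpq => h _ _ (by simp [hpq]))

theorem barD_mem_barLength (hx : x ∈ barLength k A (n + 1)) : barD x ∈ barLength k A n := by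
  refine barLength_le (S := (barLength k A n).comap barD) (fun l hl => ?_) hx
  rw [Submodule.mem_comap, barD_bword]
  refine mergeSum_mem _ fun t ht => ?_
  rw [show n = t.length by omega]
  exact bword_mem_barLength t

theorem barLeft_mem_barLength (a : A) (hx : x ∈ barLength k A n) :
    barLeft a x ∈ barLength k A n := by
  refine barLength_le (S := (barLength k A n).comap (barLeft a)) ?_ hx
  rintro l rfl
  cases l with
  | nil => simp [barLeft_one]
  | cons b l =>
    rw [Submodule.mem_comap, barLeft_bword]
    exact bword_mem_barLength ((a * b) :: l)

theorem barRight_mem_barLength (a : A) (hx : x ∈ barLength k A n) :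
    barRight a x ∈ barLength k A n := by
  refine barLength_le (S := (barLength k A n).comap (barRight a)) ?_ hx
  rintro l rfl
  rcases List.eq_nil_or_concat' l with rfl | ⟨p, c, rfl⟩
  · simp [barRight_one]
  · rw [Submodule.mem_comap, barRight_bword]
    simpa using bword_mem_barLength (k := k) (p ++ [c * a])

theorem letter_mem (a : A) : bword k [a] ∈ barLength k A 1 := bword_mem_barLength [a]

theorem barD_mem_Omega (hx : x ∈ barLength k A (p + 2)) : barD x ∈ Omega k A p :=
  ⟨barD_mem_barLength hx, barD_barD x⟩

theorem barLeft_mem_Omega (a : A) (hx : x ∈ Omega k A p) : barLeft a x ∈ Omega k A p :=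
  ⟨barLeft_mem_barLength a hx.1, by
    change barD (barLeft a x) = 0
    rw [barD_barLeft, show barD x = 0 from hx.2, map_zero]⟩

theorem barRight_mem_Omega (a : A) (hx : x ∈ Omega k A p) : barRight a x ∈ Omega k A p :=
  ⟨barRight_mem_barLength a hx.1, by
    change barD (barRight a x) = 0
    rw [barD_barRight, show barD x = 0 from hx.2, map_zero]⟩

theorem barLeft_unit (hx : x ∈ barLength k A (n + 1)) : barLeft (1 : A) x = x := by
  refine eqOn_barLength (φ := barLeft 1) (ψ := LinearMap.id) (fun l hl => ?_) hx
  obtain ⟨b, l, rfl⟩ := List.exists_cons_of_length_eq_add_one hl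
  rw [barLeft_bword, one_mul, LinearMap.id_apply]

theorem barRight_unit (hx : x ∈ barLength k A (n + 1)) : barRight (1 : A) x = x := by
  refine eqOn_barLength (φ := barRight 1) (ψ := LinearMap.id) (fun l hl => ?_) hx
  obtain ⟨p, c, rfl, -⟩ := exists_append_singleton hl
  rw [barRight_bword, mul_one, LinearMap.id_apply]

theorem dOne_apply (x : Bar k A) : dOne x = barD (x * bword k [1]) := by
  have : bword k [(1 : A)] = toBar k A (TensorAlgebra.ι k 1) := by simp [bword, word]
  rw [this]
  rfl

theorem mul_unit_mul {x y : Bar k A} (hx : x ∈ barLength k A (n + 1))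
    (hy : y ∈ barLength k A (l + 1)) : x * bword k [1] * y = 0 := by
  refine eqOn_barLength (φ := mulR y ∘ₗ mulR (bword k [1])) (ψ := 0) (fun s hs => ?_) hx
  refine eqOn_barLength (φ := mulL (bword k s * bword k [1])) (ψ := 0) (fun t ht => ?_) hy
  rw [mulL_apply, ← bword_append, ← bword_append, List.append_assoc]
  exact bword_eq_zero s t (List.ne_nil_of_length_eq_add_one hs)
    (List.ne_nil_of_length_eq_add_one ht)

/-! ### The calculus of insertions -/

theorem insertAt_zero_bword (f : CΩ p m) (l : List A) :
    insertAt 0 f (bword k l) = splitSum (fun u v => ev f.1 u * bword k v) l := by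
  have := insertAt_append f [] l
  simpa using this

theorem insertAt_zero_mul (f : CΩ p m) (u : List A) (hu : u.length = m) (y : Bar k A) :
    insertAt 0 f (bword k u * y) = ev f.1 u * y := by
  refine eq_of_bword (φ := insertAt 0 f ∘ₗ mulL (bword k u)) (ψ := mulL (ev f.1 u))
    (fun t => ?_) y
  rw [LinearMap.comp_apply, mulL_apply, mulL_apply, ← bword_append]
  simpa using insertAt_bword f [] u t rfl hu

/-- Either the insertion takes place in front, or it leaves the first letter alone and passes it
with the Koszul sign. Together with `barD_letter_mul` this is what the inductions on `insertSum`
use. -/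
theorem insertSum_letter_mul (f : CΩ p m) (a : A) (y : Bar k A) :
    insertSum f (bword k [a] * y) =
      insertAt 0 f (bword k [a] * y) + ε ^ (p + m + 1) • (bword k [a] * insertSum f y) := by
  refine eq_of_bword (φ := insertSum f ∘ₗ mulL (bword k [a]))
    (ψ := insertAt 0 f ∘ₗ mulL (bword k [a]) + ε ^ (p + m + 1) • mulL (bword k [a]) ∘ₗ insertSum f)
    (fun l => ?_) y
  simp only [LinearMap.comp_apply, LinearMap.add_apply, LinearMap.smul_apply]
  rw [mulL_apply, ← bword_cons, insertSum_bword, insertSum_bword, splitSum_cons,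
    insertAt_zero_bword, linear_splitSum, ← splitSum_smul (ε ^ (p + m + 1))]
  congr 1
  · simp
  · refine splitSum_congr fun x y _ => ?_
    rw [map_smul, linear_splitSum, smul_smul, ← pow_add, List.length_cons, mul_add, mul_one,
      add_comm]
    simp only [mulL_apply, bword_cons a x, mul_assoc]

theorem insertSum_one (f : CΩ p m) : insertSum f (1 : Bar k A) = insertAt 0 f 1 := by
  rw [← bword_nil, insertSum_bword, insertAt_zero_bword]
  simp

theorem insertAt_zero_of_lt (f : CΩ p m) (hn : n < m) (hx : x ∈ barLength k A n) :
    insertAt 0 f x = 0 :=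
  eqOn_barLength (φ := insertAt 0 f) (ψ := 0)
    (fun l hl => insertAt_bword_of_lt f l (by omega)) hx

theorem one_mem_barLength : (1 : Bar k A) ∈ barLength k A 0 := by
  simpa using bword_mem_barLength (k := k) ([] : List A)

theorem letter_mul_mem (a : A) (hx : x ∈ barLength k A n) :
    bword k [a] * x ∈ barLength k A (n + 1) :=
  add_comm 1 n ▸ mul_mem_barLength (letter_mem a) hx

theorem ev_mem_barLength (f : CΩ p m) (l : List A) : ev f.1 l ∈ barLength k A (p + 1) :=
  (ev_mem_of_mem f.2 l).1

theorem barD_ev (f : CΩ p m) (l : List A) : barD (ev f.1 l) = 0 := (ev_mem_of_mem f.2 l).2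

theorem insertAt_zero_mem {n' : ℕ} (f : CΩ p m) (hn : n' + m = n + (p + 1))
    (hx : x ∈ barLength k A n) : insertAt 0 f x ∈ barLength k A n' := by
  refine barLength_le (S := (barLength k A n').comap (insertAt 0 f)) (fun l hl => ?_) hx
  rw [Submodule.mem_comap, insertAt_zero_bword]
  refine splitSum_mem _ fun u v huv => ?_
  by_cases hu : u.length = m
  · have := mul_mem_barLength (ev_mem_barLength f u) (bword_mem_barLength (k := k) v)
    have h2 := congrArg List.length huv
    rw [List.length_append] at h2
    rwa [show p + 1 + v.length = n' by omega] at this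
  · rw [ev_of_ne _ hu, zero_mul]
    exact zero_mem _

theorem insertSum_of_lt (f : CΩ p m) (hn : n < m) (hx : x ∈ barLength k A n) :
    insertSum f x = 0 := by
  refine eqOn_barLength (φ := insertSum f) (ψ := 0) ?_ hx
  clear hx
  rintro l rfl
  rw [LinearMap.zero_apply]
  induction l with
  | nil => rw [bword_nil, insertSum_one, insertAt_zero_of_lt f hn one_mem_barLength]
  | cons a l ih =>
    rw [bword_cons, insertSum_letter_mul, ih (Nat.lt_of_succ_lt hn),
      insertAt_zero_of_lt f hn (letter_mul_mem a (bword_mem_barLength l)), mul_zero, smul_zero,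
      add_zero]

theorem insertSum_mem {n' : ℕ} (f : CΩ p m) (hn : n' + m = n + (p + 1)) (hx : x ∈ barLength k A n) :
    insertSum f x ∈ barLength k A n' := by
  refine barLength_le (S := (barLength k A n').comap (insertSum f)) ?_ hx
  clear hx
  rintro l rfl
  rw [Submodule.mem_comap]
  induction l generalizing n' with
  | nil =>
    rw [bword_nil, insertSum_one]
    exact insertAt_zero_mem f hn one_mem_barLength
  | cons a l ih =>
    have hl := bword_mem_barLength (k := k) l
    rw [bword_cons, insertSum_letter_mul]
    refine add_mem (insertAt_zero_mem f hn (letter_mul_mem a hl)) (Submodule.smul_mem _ _ ?_)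
    by_cases hnm : l.length < m
    · rw [insertSum_of_lt f hnm hl, mul_zero]
      exact zero_mem _
    · rw [List.length_cons] at hn
      obtain ⟨n', rfl⟩ : ∃ i, n' = i + 1 := ⟨n' - 1, by omega⟩
      exact letter_mul_mem a (ih (by omega))

/-- The last letter of `x` meets the first letter of `t` in exactly one face, which the right action
on `x` records. -/
theorem barD_mul_bword (hx : x ∈ barLength k A n) (t : List A) :
    barD (x * bword k t) = barD x * bword k t +
      ε ^ (n + 1) • onHead (fun b t' => barRight b x * bword k t') t +
      ε ^ n • (x * barD (bword k t)) := by
  induction t generalizing n x with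
  | nil => simp [bword, barD_one]
  | cons b t ih =>
    have h1 := ih (mul_mem_barLength hx (letter_mem (k := k) b))
    rw [bword_cons b t, ← mul_assoc, h1, barD_mul_letter b hx, onHead_cons, barD_letter_mul]
    have h2 : onHead (fun c t' => barRight c (x * bword k [b]) * bword k t') t =
        x * barLeft b (bword k t) := by
      cases t with
      | nil => simp [bword, barLeft_one]
      | cons c t =>
        rw [onHead_cons, barRight_mul_letter, barLeft_bword, bword_cons (b * c) t, mul_assoc]
    rw [h2]
    simp only [add_mul, mul_sub, smul_sub, bar_smul_mul, mul_assoc, pow_succ, mul_neg, mul_one,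
      neg_neg, neg_smul, neg_mul]
    module

/-- The values of f are cycles, so d(f(u) v) consists of the face between f(u) and v and of the
faces of v. The former matches the last term of δf. The first term of δf has no counterpart in front
of a word, whence the correction by the left action of `a`. -/
theorem barD_insertAt_zero (f : CΩ p m) (g : CΩ p (m + 1)) (hg : g.1 = delta barLeft barRight m f.1)
    (a : A) (t : List A) :
    barD (insertAt 0 f (bword k (a :: t))) = ε ^ (p + m + 1) •
      (insertAt 0 f (barD (bword k (a :: t))) + insertAt 0 g (bword k (a :: t)) -
        barLeft a (insertAt 0 f (bword k t))) := by
  have hd : insertAt 0 f (barD (bword k (a :: t))) = splitSum (fun u v =>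
      mergeSum (ev f.1) u * bword k v + ε ^ m • (ev f.1 u * barD (bword k v))) (a :: t) := by
    rw [barD_bword, linear_mergeSum, show (fun t => insertAt 0 f (bword k t)) =
      splitSum (fun u v => ev f.1 u * bword k v) from funext (insertAt_zero_bword f),
      mergeSum_splitSum k]
    refine splitSum_congr fun u v _ => ?_
    have h3 := linear_mergeSum (mulR (bword k v)) (ev f.1) u
    have h4 := linear_mergeSum (mulL (ev f.1 u)) (bword k) v
    simp only [mulL_apply, mulR_apply] at h3 h4
    rw [h3, barD_bword, h4]
    by_cases hu : u.length = m
    · rw [hu]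
    · simp [ev_of_ne f.1 hu, mergeSum_zero]
  have hgv : insertAt 0 g (bword k (a :: t)) = barLeft a (insertAt 0 f (bword k t)) +
      splitSum (fun u v => - (mergeSum (ev f.1) u * bword k v) + ε ^ (m + 1) •
        onLast (fun p c => barRight c (ev f.1 p) * bword k v) u) (a :: t) := by
    have h0 : ev g.1 [] = 0 := ev_of_ne _ (by simp)
    rw [insertAt_zero_bword, insertAt_zero_bword, splitSum_cons, splitSum_cons, linear_splitSum]
    simp only [h0, mergeSum_nil, onLast_nil, zero_mul, smul_zero, neg_zero, zero_add]
    rw [← splitSum_add]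
    refine splitSum_congr fun u v _ => ?_
    have h3 := linear_onLast (mulR (bword k v)) (fun p c => barRight c (ev f.1 p)) (a :: u)
    simp only [mulR_apply] at h3
    rw [hg, ev_delta, barLeft_mul_of_mem a (ev_mem_barLength f u), ← h3, add_mul, sub_mul,
      smul_mul_assoc]
    abel
  rw [hd, hgv, insertAt_zero_bword, linear_splitSum, splitSum_add, splitSum_add, splitSum_neg,
    splitSum_smul (ε ^ m), splitSum_smul (ε ^ (m + 1)), splitSum_congr (G := fun u v =>
      ε ^ p • onHead (fun b t' => barRight b (ev f.1 u) * bword k t') v +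
        ε ^ (p + 1) • (ev f.1 u * barD (bword k v)))]
  · rw [splitSum_add, splitSum_smul (ε ^ p), splitSum_smul (ε ^ (p + 1)), splitSum_onHead (fun u b
      t' => barRight b (ev f.1 u) * bword k t'), splitSum_onLast (fun u b t' => barRight b (ev f.1
      u) * bword k t')]
    rcases neg_one_pow_eq_or k m with h | h <;> rcases neg_one_pow_eq_or k p with h' | h' <;>
      simp only [pow_succ, pow_add, h, h'] <;> module
  · intro u v _
    rw [barD_mul_bword (ev_mem_barLength f u), barD_ev, zero_mul, zero_add, pow_succ, pow_succ]
    simp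

theorem insertAt_barLeft_sub (f : CΩ p m) (a : A) (t : List A) :
    insertSum f (barLeft a (bword k t)) - barLeft a (insertSum f (bword k t)) =
      insertAt 0 f (barLeft a (bword k t)) - barLeft a (insertAt 0 f (bword k t)) := by
  cases t with
  | nil => rw [bword_nil, barLeft_one, map_zero, map_zero, insertSum_one]
  | cons b t =>
    rw [barLeft_bword, bword_cons, bword_cons b, insertSum_letter_mul, insertSum_letter_mul,
      map_add, map_smul, barLeft_mul_of_mem (n := 0) a (letter_mem b), barLeft_bword]
    abel

/-- Summed over all places, the correction in `barD_insertAt_zero` disappears, because a f(u) is now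
a face of a ⊗ f(u). Thus the insertions of f commute with d up to the insertions of δf. -/
theorem barD_insertSum (f : CΩ p m) (g : CΩ p (m + 1)) (hg : g.1 = delta barLeft barRight m f.1)
    (x : Bar k A) :
    barD (insertSum f x) = ε ^ (p + m + 1) • (insertSum f (barD x) + insertSum g x) := by
  refine eq_of_bword (φ := barD ∘ₗ insertSum f)
    (ψ := ε ^ (p + m + 1) • (insertSum f ∘ₗ barD + insertSum g)) (fun l => ?_) x
  simp only [LinearMap.comp_apply, LinearMap.add_apply, LinearMap.smul_apply]
  induction l with
  | nil =>
    rw [bword_nil, barD_one, insertSum_one, map_zero, insertSum_one, insertAt_zero_of_lt g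
      (Nat.succ_pos _) one_mem_barLength, ← bword_nil, insertAt_zero_bword]
    simp [barD_ev]
  | cons a t ih =>
    have h1 := barD_insertAt_zero f g hg a t
    have h2 := insertAt_barLeft_sub f a t
    rw [bword_cons] at h1 ⊢
    rw [insertSum_letter_mul, insertSum_letter_mul, map_add, map_smul, barD_letter_mul, h1, ih,
      barD_letter_mul, map_sub, map_sub, insertSum_letter_mul, sub_eq_iff_eq_add.1 h2,
      mul_smul_comm]
    rcases neg_one_pow_eq_or k (p + m + 1) with h | h <;>
      simp only [pow_succ, h, show p + (m + 1) + 1 = p + m + 1 + 1 from rfl, mul_add] <;> module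

theorem insertAt_zero_mul_of_le (f : CΩ p m) (hn : m ≤ n) (hx : x ∈ barLength k A n) (y : Bar k A) :
    insertAt 0 f (x * y) = insertAt 0 f x * y := by
  refine eqOn_barLength (φ := insertAt 0 f ∘ₗ mulR y) (ψ := mulR y ∘ₗ insertAt 0 f)
    (fun l hl => ?_) hx
  obtain ⟨s, u, v, rfl, hs, hu⟩ := exists_append_of_le (j := 0) (m := m) (l := l) (by omega)
  obtain rfl := List.length_eq_zero_iff.1 hs
  rw [LinearMap.comp_apply, LinearMap.comp_apply, mulR_apply, mulR_apply, List.nil_append,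
    bword_append, mul_assoc, insertAt_zero_mul f u hu, insertAt_zero_mul f u hu, mul_assoc]

/-! ### Insertions that use the last letter -/

/-- The insertions of `f` in `x ⊗ a` that use the last letter `a`. -/
def insertLast (f : CΩ p m) (a : A) : Bar k A →ₗ[k] Bar k A :=
  insertSum f ∘ₗ mulR (bword k [a]) - mulR (bword k [a]) ∘ₗ insertSum f

theorem insertSum_mul_letter (f : CΩ p m) (a : A) (x : Bar k A) :
    insertSum f (x * bword k [a]) = insertSum f x * bword k [a] + insertLast f a x := by
  simp [insertLast, mulR_apply]

/-- With `m ≤ n + 1` the letters used by an insertion at the end lie in x ⊗ a, so it passes `b` with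
the Koszul sign. -/
theorem insertLast_letter_mul (f : CΩ p m) (hn : m ≤ n + 1) (a b : A) (hx : x ∈ barLength k A n) :
    insertLast f a (bword k [b] * x) = ε ^ (p + m + 1) • (bword k [b] * insertLast f a x) := by
  have h1 := insertSum_letter_mul f b (x * bword k [a])
  have h2 := insertSum_mul_letter f a (bword k [b] * x)
  have h3 := insertSum_mul_letter f a x
  rw [mul_assoc, h1, insertSum_letter_mul, ← mul_assoc, insertAt_zero_mul_of_le f hn (letter_mul_mem
    b hx), h3, add_mul, mul_add, bar_smul_mul, smul_add, ← add_assoc, mul_assoc] at h2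
  exact (add_left_cancel h2).symm

theorem insertLast_mul {n' : ℕ} (f : CΩ p m) (hn : m ≤ n' + 1) (a : A) {x y : Bar k A}
    (hx : x ∈ barLength k A n) (hy : y ∈ barLength k A n') :
    insertLast f a (x * y) = ε ^ ((p + m + 1) * n) • (x * insertLast f a y) := by
  refine eqOn_barLength (φ := insertLast f a ∘ₗ mulR y)
    (ψ := ε ^ ((p + m + 1) * n) • mulR (insertLast f a y)) ?_ hx
  clear hx
  rintro s rfl
  rw [LinearMap.comp_apply, LinearMap.smul_apply, mulR_apply, mulR_apply]
  induction s with
  | nil => simp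
  | cons b s ih =>
    rw [bword_cons, mul_assoc, insertLast_letter_mul f (by omega) a b
      (mul_mem_barLength (bword_mem_barLength s) hy), ih, bar_mul_smul, smul_smul, ← pow_add,
      mul_assoc, List.length_cons, mul_add, mul_one, add_comm]

/-- An insertion that uses the last letter 1 evaluates a normalized cochain at a unit. For `m = 0`
the insertion behind the last letter uses no letter at all, hence the hypothesis. -/
theorem insertLast_one (f : CΩ p m) (hm : 1 ≤ m) (x : Bar k A) : insertLast f 1 x = 0 := by
  refine eq_of_bword (φ := insertLast f 1) (ψ := 0) (fun l => ?_) x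
  have h : insertSum f (bword k (l ++ [1])) = insertSum f (bword k l) * bword k [1] := by
    induction l with
    | nil =>
      have h1 := insertSum_letter_mul f 1 1
      have h2 := ev_eq_zero_of_mem f.2 [] []
      rw [mul_one, insertSum_one, insertAt_zero_of_lt f hm one_mem_barLength, mul_zero, smul_zero,
        add_zero] at h1
      rw [List.nil_append] at h2
      rw [List.nil_append, h1, bword_nil, insertSum_one, insertAt_zero_of_lt f hm one_mem_barLength,
        zero_mul, insertAt_zero_bword, splitSum_cons, splitSum_nil, ev_of_ne _ (by simp; omega), h2]
      simp
    | cons a l ih =>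
      rw [List.cons_append, bword_cons, insertSum_letter_mul, ih, bword_cons a l,
        insertSum_letter_mul, add_mul, bar_smul_mul, mul_assoc, ← bword_cons, ← bword_cons]
      congr 1
      by_cases hl : m ≤ (a :: l).length
      · rw [← insertAt_zero_mul_of_le f hl (bword_mem_barLength _), ← bword_append,
          List.cons_append]
      · rw [insertAt_bword_of_lt f (a :: l) (by omega), zero_mul, insertAt_zero_bword,
          splitSum_congr (G := fun _ _ => 0), splitSum_zero]
        intro u v huv
        by_cases hu : u.length = m
        · have h3 := congrArg List.length huv
          simp only [List.length_append, List.length_cons, List.length_nil] at h3 hl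
          obtain rfl : v = [] := List.length_eq_zero_iff.1 (by omega)
          rw [List.append_nil] at huv
          rw [huv, ← List.cons_append, ev_eq_zero_of_mem f.2, zero_mul]
        · rw [ev_of_ne _ hu, zero_mul]
  rw [bword_append, insertSum_mul_letter] at h
  simpa using h

/-- By the length condition the letters used in front and at the end are disjoint, and the two
insertions commute up to the sign of their degrees. -/
theorem insertLast_insertAt (f : CΩ p m) (g : CΩ q l) (a : A) (w : List A)
    (hw : m + l ≤ w.length + 1) (hm : 1 ≤ m) :
    insertLast f a (insertAt 0 g (bword k w)) = ε ^ ((p + m + 1) * (q + l + 1)) •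
      insertAt 0 g (insertLast f a (bword k w)) := by
  obtain ⟨s, u, v, rfl, hs, hu⟩ := exists_append_of_le (j := 0) (m := l) (l := w) (by omega)
  obtain rfl := List.length_eq_zero_iff.1 hs
  rw [List.nil_append] at hw ⊢
  rw [List.length_append] at hw
  rw [bword_append, insertAt_zero_mul g u hu, insertLast_mul f (by omega) a (ev_mem_barLength g u)
    (bword_mem_barLength v), insertLast_mul f (by omega) a (bword_mem_barLength u)
    (bword_mem_barLength v), map_smul, insertAt_zero_mul g u hu, smul_smul, ← pow_add, hu]
  congr 1
  exact neg_one_pow_eq ⟨(p + m + 1) * (q + l + 1), by ring⟩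

/-! ### The part of a double insertion that changes the first letter -/

/-- The insertions of `f` and `g` next to each other or into each other, at the head of a word. -/
def headCircle (f : CΩ p m) (g : CΩ q l) : Bar k A →ₗ[k] Bar k A :=
  insertSum f ∘ₗ insertAt 0 g + insertAt 0 f ∘ₗ insertSum g - insertAt 0 f ∘ₗ insertAt 0 g

/-- The graded commutator of `headCircle`. -/
def headBracket (f : CΩ p m) (g : CΩ q l) : Bar k A →ₗ[k] Bar k A :=
  headCircle f g - ε ^ ((p + m + 1) * (q + l + 1)) • headCircle g f

/-- The graded commutator of the sums of insertions. -/
def insertBracket (f : CΩ p m) (g : CΩ q l) : Bar k A →ₗ[k] Bar k A :=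
  insertSum f ∘ₗ insertSum g - ε ^ ((p + m + 1) * (q + l + 1)) • insertSum g ∘ₗ insertSum f

theorem headCircle_apply (f : CΩ p m) (g : CΩ q l) (x : Bar k A) :
    headCircle f g x = insertSum f (insertAt 0 g x) + insertAt 0 f (insertSum g x) -
      insertAt 0 f (insertAt 0 g x) := rfl

theorem headBracket_apply (f : CΩ p m) (g : CΩ q l) (x : Bar k A) :
    headBracket f g x = headCircle f g x - ε ^ ((p + m + 1) * (q + l + 1)) • headCircle g f x := rfl

theorem insertBracket_apply (f : CΩ p m) (g : CΩ q l) (x : Bar k A) :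
    insertBracket f g x = insertSum f (insertSum g x) -
      ε ^ ((p + m + 1) * (q + l + 1)) • insertSum g (insertSum f x) := rfl

/-- This is the purpose of `headCircle`: it collects, by inclusion and exclusion, the double
insertions in which at least one of the two takes place in front. The others keep the first letter.
-/
theorem insertSum_insertSum_letter_mul (f : CΩ p m) (g : CΩ q l) (a : A) (x : Bar k A) :
    insertSum f (insertSum g (bword k [a] * x)) = headCircle f g (bword k [a] * x) +
      ε ^ ((p + m + 1) + (q + l + 1)) • (bword k [a] * insertSum f (insertSum g x)) := by
  have h1 := congrArg (insertAt 0 f) (insertSum_letter_mul g a x)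
  have h2 := congrArg (insertSum f) (insertSum_letter_mul g a x)
  rw [map_add, map_smul] at h1 h2
  rw [h2, headCircle_apply, insertSum_letter_mul f a (insertSum g x), h1, pow_add]
  module

theorem insertBracket_letter_mul (f : CΩ p m) (g : CΩ q l) (a : A) (x : Bar k A) :
    insertBracket f g (bword k [a] * x) = headBracket f g (bword k [a] * x) +
      ε ^ ((p + m + 1) + (q + l + 1)) • (bword k [a] * insertBracket f g x) := by
  rw [insertBracket_apply, insertBracket_apply, headBracket_apply, insertSum_insertSum_letter_mul,
    insertSum_insertSum_letter_mul, mul_sub, bar_mul_smul, add_comm (q + l + 1) (p + m + 1)]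
  module

theorem headCircle_mul_letter (f : CΩ p m) (g : CΩ q l) (hm : 1 ≤ m) (w : List A)
    (hw : m + l ≤ w.length + 1) (a : A) :
    headCircle f g (bword k w * bword k [a]) = headCircle f g (bword k w) * bword k [a] +
      insertLast f a (insertAt 0 g (bword k w)) + insertAt 0 f (insertLast g a (bword k w)) := by
  have hn : (w.length + (q + 1) - l) + l = w.length + (q + 1) := by omega
  rw [headCircle_apply, headCircle_apply, insertAt_zero_mul_of_le g (by omega) (bword_mem_barLength
    w), insertSum_mul_letter, insertSum_mul_letter, map_add, insertAt_zero_mul_of_le f _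
    (insertSum_mem g hn (bword_mem_barLength w)), insertAt_zero_mul_of_le f _ (insertAt_zero_mem g
    hn (bword_mem_barLength w)), sub_mul, add_mul]
  · abel
  · omega
  · omega

/-- What prevents each circle product from being right linear are the terms with one cochain
inserted in front and the other at the end. These use disjoint letters and cancel in the graded
commutator. -/
theorem headBracket_mul_letter (f : CΩ p m) (g : CΩ q l) (hm : 1 ≤ m) (hl : 1 ≤ l) (w : List A)
    (hw : m + l ≤ w.length + 1) (a : A) :
    headBracket f g (bword k w * bword k [a]) = headBracket f g (bword k w) * bword k [a] := by
  rw [headBracket_apply, headBracket_apply, headCircle_mul_letter f g hm w hw, headCircle_mul_letter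
    g f hl w (by omega), insertLast_insertAt f g a w hw hm, insertLast_insertAt g f a w (by omega)
    hl, mul_comm (q + l + 1) (p + m + 1), sub_mul, bar_smul_mul]
  rcases neg_one_pow_eq_or k ((p + m + 1) * (q + l + 1)) with h | h <;> rw [h] <;> module

/-- The commutator of two operators that commute with d up to insertions of δf and δg commutes with
d up to the corresponding commutators; the one with δf is absent because f is a cocycle. -/
theorem barD_insertBracket (f : CΩ p m) (hf : delta barLeft barRight m f.1 = 0) (g : CΩ q l)
    (g' : CΩ q (l + 1)) (hg : g'.1 = delta barLeft barRight l g.1) (x : Bar k A) :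
    barD (insertBracket f g x) = ε ^ ((p + m + 1) + (q + l + 1)) •
      (insertBracket f g (barD x) + insertBracket f g' x) := by
  have hf' : ∀ x, barD (insertSum f x) = ε ^ (p + m + 1) • insertSum f (barD x) := by
    intro x
    have h0 : ∀ u : List A, ev (0 : CΩ p (m + 1)).1 u = 0 := ev_zero
    have : insertSum (0 : CΩ p (m + 1)) x = 0 :=
      eq_of_bword (φ := insertSum 0) (ψ := 0) (fun l => by
        simp only [insertSum_bword, h0, mul_zero, zero_mul, splitSum_zero, smul_zero,
          LinearMap.zero_apply]) x
    rw [barD_insertSum f 0 (by rw [hf]; rfl), this, add_zero]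
  rw [insertBracket_apply, insertBracket_apply, insertBracket_apply, map_sub, map_smul, hf',
    barD_insertSum g g' hg, barD_insertSum g g' hg, hf', map_smul, map_add, map_smul, show q + (l +
    1) + 1 = q + l + 1 + 1 from rfl, mul_add (p + m + 1) (q + l + 1) 1, mul_one, pow_add _ ((p + m +
    1) * (q + l + 1)) (p + m + 1), pow_add _ (p + m + 1) (q + l + 1)]
  rcases neg_one_pow_eq_or k (p + m + 1) with h | h <;>
    rcases neg_one_pow_eq_or k ((p + m + 1) * (q + l + 1)) with h' | h' <;>
    rw [h, h'] <;> module

theorem headBracket_one (f : CΩ p m) (g : CΩ q l) (hm : 1 ≤ m) (hl : 1 ≤ l) :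
    headBracket f g (1 : Bar k A) = 0 ∧ insertBracket f g (1 : Bar k A) = 0 := by
  have h1 := insertAt_zero_of_lt f hm one_mem_barLength
  have h2 := insertAt_zero_of_lt g hl one_mem_barLength
  constructor
  · simp [headBracket_apply, headCircle_apply, insertSum_one, h1, h2]
  · simp [insertBracket_apply, insertSum_one, h1, h2]

/-- Write `barD_insertBracket` for a ⊗ t and separate the terms with leading letter `a`. Those
cancel by the same formula for `t`; the rest is an identity for `headBracket`, with a correction by
the left action as in `barD_insertAt_zero`. -/
theorem barD_headBracket (f : CΩ p m) (hf : delta barLeft barRight m f.1 = 0) (hm : 1 ≤ m)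
    (hl : 1 ≤ l) (g : CΩ q l) (g' : CΩ q (l + 1)) (hg : g'.1 = delta barLeft barRight l g.1) (a : A)
    (t : List A) :
    barD (headBracket f g (bword k (a :: t))) = ε ^ ((p + m + 1) + (q + l + 1)) •
      (headBracket f g (barD (bword k (a :: t))) - barLeft a (headBracket f g (bword k t)) +
        headBracket f g' (bword k (a :: t))) := by
  have h1 := barD_insertBracket f hf g g' hg (bword k [a] * bword k t)
  have h2 := barD_insertBracket f hf g g' hg (bword k t)
  have h3 : insertBracket f g (barLeft a (bword k t)) - barLeft a (insertBracket f g (bword k t)) =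
      headBracket f g (barLeft a (bword k t)) - barLeft a (headBracket f g (bword k t)) := by
    cases t with
    | nil =>
      rw [bword_nil, barLeft_one, (headBracket_one f g hm hl).1, (headBracket_one f g hm hl).2]
      simp
    | cons b t =>
      rw [barLeft_bword, bword_cons, bword_cons b, insertBracket_letter_mul,
        insertBracket_letter_mul, map_add, map_smul, barLeft_mul_of_mem (n := 0) a (letter_mem b),
        barLeft_bword]
      abel
  rw [sub_eq_iff_eq_add] at h3
  rw [insertBracket_letter_mul, insertBracket_letter_mul, barD_letter_mul, map_sub,
    insertBracket_letter_mul, map_add, map_smul, barD_letter_mul, h2, h3] at h1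
  rw [bword_cons, barD_letter_mul, map_sub, eq_sub_of_add_eq h1]
  rw [show (p + m + 1) + (q + (l + 1) + 1) = (p + m + 1) + (q + l + 1) + 1 from rfl]
  simp only [bar_mul_smul, mul_add, pow_succ _ ((p + m + 1) + (q + l + 1))]
  rcases neg_one_pow_eq_or k ((p + m + 1) + (q + l + 1)) with h | h <;> rw [h] <;> module

/-! ### The complexes of normalized cochains and the connecting map -/

/-- If an argument is 1, the two terms that absorb it agree up to opposite signs, and all other
terms still have a unit among their arguments. -/
theorem delta_mem_cochains {U : Submodule k M} {L R : A →ₗ[k] Module.End k M}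
    (hL : ∀ a, ∀ x ∈ U, L a x ∈ U) (hR : ∀ a, ∀ x ∈ U, R a x ∈ U) (hL1 : ∀ x ∈ U, L 1 x = x)
    (hR1 : ∀ x ∈ U, R 1 x = x) {f : Multi m M} (hf : f ∈ cochains A U m) :
    delta L R m f ∈ cochains A U (m + 1) := by
  refine mem_cochains ?_ ?_
  · intro l hl
    obtain ⟨p, c, h, -⟩ := exists_append_singleton hl
    obtain ⟨a, l, rfl⟩ := List.exists_cons_of_length_eq_add_one hl
    rw [ev_delta, h, onLast_append_singleton]
    exact add_mem (sub_mem (hL _ _ (ev_mem_of_mem hf l))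
      (mergeSum_mem U fun t _ => ev_mem_of_mem hf t))
      (Submodule.smul_mem _ _ (hR _ _ (ev_mem_of_mem hf p)))
  · intro p q hpq
    have hz : ∀ p q : List A, ev f (p ++ 1 :: q) = 0 := ev_eq_zero_of_mem hf
    have hz0 : ∀ q : List A, ev f (1 :: q) = 0 := fun q => hz [] q
    have hlast : ∀ (p q : List A), q ≠ [] → onLast (fun p c => R c (ev f p)) (p ++ 1 :: q) = 0 := by
      intro p q hq
      rcases List.eq_nil_or_concat' q with h | ⟨s, c, rfl⟩
      · exact absurd h hq
      · rw [← List.cons_append, ← List.append_assoc, onLast_append_singleton, hz, map_zero]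
    cases p with
    | nil =>
      rw [List.nil_append, ev_delta, mergeSum_cons]
      simp only [hz0, mergeSum_zero, one_mul, sub_zero]
      cases q with
      | nil =>
        simp only [List.length_nil, zero_add] at hpq
        obtain rfl : m = 0 := by omega
        rw [hL1 _ (ev_mem_of_mem hf _)]
        simp [hR1 _ (ev_mem_of_mem hf _)]
      | cons b q =>
        have := hlast [] (b :: q) (by simp)
        rw [List.nil_append] at this
        rw [this, hL1 _ (ev_mem_of_mem hf _)]
        simp
    | cons a p =>
      have h1 : onLast (fun p' c => ev f (p' ++ (c * 1) :: q)) (a :: p) = ev f (a :: p ++ q) := by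
        obtain ⟨s, c, h, -⟩ := exists_append_singleton (List.length_cons (a := a) (as := p))
        rw [h, onLast_append_singleton, mul_one, List.append_assoc]
        rfl
      rw [List.cons_append, ev_delta, ← List.cons_append, mergeSum_append_cons k, hz, h1]
      simp only [hz, mergeSum_zero, map_zero]
      cases q with
      | nil =>
        obtain rfl : m = (a :: p).length := by simp at hpq ⊢; omega
        rw [onLast_append_singleton, hR1 _ (ev_mem_of_mem hf _), onHead_nil, List.append_nil,
          pow_succ]
        module
      | cons b q =>
        rw [hlast (a :: p) (b :: q) (by simp), onHead_cons, one_mul]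
        module

theorem delta_bar_mem {f : Multi m (Bar k A)} (hf : f ∈ CΩ p m) :
    delta barLeft barRight m f ∈ CΩ p (m + 1) :=
  delta_mem_cochains (fun a _ hx => barLeft_mem_Omega a hx) (fun a _ hx => barRight_mem_Omega a hx)
    (fun _ hx => barLeft_unit hx.1) (fun _ hx => barRight_unit hx.1) hf

/-- The Hochschild differential of a cochain with values in `Ω̄^p`. -/
def deltaCochain (f : CΩ p m) : CΩ p (m + 1) := ⟨delta barLeft barRight m f.1, delta_bar_mem f.2⟩

/-- As f(u) is a cycle, only two faces of f(u) ⊗ b ⊗ 1 are left: `b` multiplied into f(u), and `b`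
multiplied with 1. The sign in θ removes the dependence on `p`. -/
theorem ev_theta (f : CΩ p m) (u : List A) (hu : u.length = m) (b : A) :
    ev (theta f) (u ++ [b]) = barRight b (ev f.1 u) * bword k [1] - ev f.1 u * bword k [b] := by
  have h := ev_block f.1 [] u [b] (j := 0) (N := m + 1) rfl hu (by simp [hu])
  have hx := ev_mem_barLength f u
  rw [List.nil_append] at h
  rw [theta, ev_smul, ev_comp, h, bword_nil, one_mul, dOne_apply, barD_mul_letter (n := p + 2) _
    (mul_mem_barLength (n := p + 1) (l := 1) hx (letter_mem b)), barD_mul_letter b hx, barD_ev,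
    zero_mul, zero_add, barRight_mul_letter, mul_one, bar_smul_mul]
  rcases neg_one_pow_eq_or k p with h | h <;> simp only [pow_succ, h] <;> module

theorem theta_mem (f : CΩ p m) : theta f ∈ CΩ (p + 1) (m + 1) := by
  refine mem_cochains ?_ ?_
  · intro l hl
    obtain ⟨u, b, rfl, hu⟩ := exists_append_singleton hl
    have h := ev_block f.1 [] u [b] (j := 0) (N := m + 1) rfl hu (by simp [hu])
    rw [List.nil_append] at h
    rw [theta, ev_smul, ev_comp, dOne_apply, h, bword_nil, one_mul]
    exact Submodule.smul_mem _ _ (barD_mem_Omega (mul_mem_barLength (n := p + 2) (l := 1)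
      (mul_mem_barLength (n := p + 1) (l := 1) (ev_mem_barLength f u) (letter_mem b))
      (letter_mem 1)))
  · intro p' q hpq
    rcases List.eq_nil_or_concat' q with rfl | ⟨s, b, rfl⟩
    · rw [ev_theta f _ (by simpa using hpq), barRight_unit (ev_mem_barLength f p'), sub_self]
    · rw [← List.cons_append, ← List.append_assoc, ev_theta f _ (by simp at hpq ⊢; omega),
        ev_eq_zero_of_mem f.2]
      simp

/-- The connecting map on cochains. -/
def thetaCochain (f : CΩ p m) : CΩ (p + 1) (m + 1) := ⟨theta f, theta_mem f⟩

theorem mergeSum_theta (f : CΩ p m) (b : A) (w : List A) (hw : w.length = m + 1) :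
    mergeSum (fun t => ev (theta f) (t ++ [b])) w =
      barRight b (mergeSum (ev f.1) w) * bword k [1] - mergeSum (ev f.1) w * bword k [b] := by
  have h := linear_mergeSum (mulR (bword k [1]) ∘ₗ barRight b - mulR (bword k [b])) (ev f.1) w
  simp only [LinearMap.sub_apply, LinearMap.comp_apply, mulR_apply] at h
  rw [h]
  exact mergeSum_congr fun t ht => ev_theta f t (by omega) b

theorem delta_theta (f : CΩ p m) :
    delta barLeft barRight (m + 1) (theta f) = theta (deltaCochain f) := by
  refine ext_ev fun l hl => ?_
  obtain ⟨w, b, rfl, hw⟩ := exists_append_singleton hl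
  obtain ⟨s, c, hs, hsl⟩ := exists_append_singleton hw
  have hd : ev (deltaCochain f).1 w = ev (delta barLeft barRight m f.1) w := rfl
  rw [ev_theta (deltaCochain f) w hw, hd]
  obtain ⟨a, t, rfl⟩ := List.exists_cons_of_length_eq_add_one hw
  have ht : t.length = m := by simpa using hw
  have e2 : mergeSum (ev (theta f)) (a :: t ++ [b]) =
      barRight b (mergeSum (ev f.1) (a :: t)) * bword k [1] -
        mergeSum (ev f.1) (a :: t) * bword k [b] -
      ε ^ (m + 1) • (barRight (c * b) (ev f.1 s) * bword k [1] - ev f.1 s * bword k [c * b]) := by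
    rw [mergeSum_append_cons k, mergeSum_theta f b _ hw, hw, hs, onLast_append_singleton,
      ev_theta f s hsl]
    simp
  rw [List.cons_append, ev_delta, ← List.cons_append, onLast_append_singleton, e2, ev_delta,
    ev_theta f t ht, hs, onLast_append_singleton, ev_theta f s hsl, ← hs]
  simp only [map_sub, map_add, map_smul, barRight_mul_letter, one_mul, sub_mul, add_mul,
    bar_smul_mul]
  rw [barLeft_mul_of_mem a (barRight_mem_barLength b (ev_mem_barLength f t)), barLeft_mul_of_mem a
    (ev_mem_barLength f t), barLeft_barRight, barRight_mul, pow_succ _ (m + 1)]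
  module

/-! ### The bracket in terms of insertions -/

theorem ev_block_eq {j : ℕ} (f : CΩ p m) (u : List A) (hu : u.length = N) :
    ev (block (toBar k A) j N f.1) u = insertAt j f (bword k u) := by
  subst hu
  change _ = ofWords (fun N => block (toBar k A) j N f.1) (word k u)
  rw [ofWords_word, ev_of_eq _ rfl]
  rfl

theorem insertSum_eq_sum {n' : ℕ} (f : CΩ p m) (hn : n' < n + m) (hx : x ∈ barLength k A n') :
    insertSum f x = ∑ j ∈ Finset.range n, ε ^ ((p + m + 1) * j) • insertAt j f x := by
  have key := eqOn_barLength (φ := insertSum f)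
    (ψ := ∑ j ∈ Finset.range n, ε ^ ((p + m + 1) * j) • insertAt j f) (fun l hl => ?_) hx
  · simpa using key
  · have h := sum_range_insertAt (p + m + 1) (l.length + 1 + n) f [] l (by omega)
    simp only [List.nil_append, List.length_nil, zero_add] at h
    rw [insertSum_bword, ← h, LinearMap.sum_apply]
    refine (Finset.sum_subset (fun i hi => ?_) fun i _ hi => ?_).symm
    · simp only [Finset.mem_range] at hi ⊢; omega
    · simp only [Finset.mem_range] at hi
      rw [insertAt_bword_of_lt f l (by omega), smul_zero]

theorem insertSum_eq_insertAt_zero (f : CΩ p m) (hn : n ≤ m) (hx : x ∈ barLength k A n) :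
    insertSum f x = insertAt 0 f x := by
  rw [insertSum_eq_sum (n := 1) f (by omega) hx]
  simp

/-- On m + l − 1 letters the first sum runs through all places of g, with f inserted in front
afterwards. The second runs through all places of f, except the first, in the word with g inserted
in front. Their total is the circle product in front, followed by d(− ⊗ 1). -/
theorem ev_bullet (f : CΩ p m) (g : CΩ q l) (hN : N + 1 = m + l) (u : List A) (hu : u.length = N) :
    ev (bullet f g N) u = ε ^ (p + q) • dOne (headCircle f g (bword k u)) := by
  have hx : bword k u ∈ barLength k A N := hu ▸ bword_mem_barLength u
  rw [bullet, ev_add, ev_sum, ev_sum]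
  have h1 : ∑ i ∈ Finset.Icc 1 m, ev (ε ^ (p + q + (i - 1) * (q + l + 1)) •
      (dOne ∘ₗ insertAt 0 f).compMultilinearMap (block (toBar k A) (i - 1) N g.1)) u =
      ε ^ (p + q) • dOne (insertAt 0 f (insertSum g (bword k u))) := by
    rw [insertSum_eq_sum (n := m) g (by omega) hx, show Finset.Icc 1 m = Finset.Ico 1 (m + 1) from
      rfl, Finset.sum_Ico_eq_sum_range, map_sum, map_sum, Finset.smul_sum]
    refine Finset.sum_congr rfl fun i _ => ?_
    rw [ev_smul, ev_comp, ev_block_eq g u hu, Nat.add_sub_cancel_left, map_smul, map_smul,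
      smul_smul, ← pow_add, mul_comm i]
    rfl
  have h2 : ∑ i ∈ Finset.Icc 1 q, ev (ε ^ (p + q + i * (p + m + 1)) •
      (dOne ∘ₗ insertAt i f).compMultilinearMap (block (toBar k A) 0 N g.1)) u =
      ε ^ (p + q) • dOne (insertSum f (insertAt 0 g (bword k u)) -
        insertAt 0 f (insertAt 0 g (bword k u))) := by
    rw [insertSum_eq_sum (n := q + 1) (n' := m + q) f (by omega) (insertAt_zero_mem g (by omega)
      hx), show Finset.Icc 1 q = Finset.Ico 1 (q + 1) from rfl, Finset.sum_Ico_eq_sum_range,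
      Finset.sum_range_succ']
    simp only [mul_zero, pow_zero, one_smul, add_sub_cancel_right, Nat.add_sub_cancel]
    rw [map_sum, Finset.smul_sum]
    refine Finset.sum_congr rfl fun i _ => ?_
    rw [ev_smul, ev_comp, ev_block_eq g u hu, map_smul, smul_smul, ← pow_add, mul_comm (1 + i),
      add_comm 1 i]
    rfl
  rw [h1, h2, headCircle_apply, ← smul_add, ← map_add]
  congr 2
  abel

theorem ev_bracket (f : CΩ p m) (g : CΩ q l) (hN : N + 1 = m + l) (u : List A) (hu : u.length = N) :
    ev (bracket f g N) u = ε ^ (p + q) • dOne (headBracket f g (bword k u)) := by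
  rw [bracket, ev_sub, ev_smul, ev_bullet f g hN u hu, ev_bullet g f (by omega) u hu,
    headBracket_apply, map_sub, map_smul, add_comm q p, show m + p + 1 = p + m + 1 by ring, show l +
    q + 1 = q + l + 1 by ring]
  module

theorem headCircle_mem {n' : ℕ} (f : CΩ p m) (g : CΩ q l) (hn : n + (p + 1) + (q + 1) = n' + m + l)
    (hx : x ∈ barLength k A n) : headCircle f g x ∈ barLength k A n' := by
  rw [headCircle_apply]
  by_cases hln : n < l
  · rw [insertSum_of_lt g hln hx, insertAt_zero_of_lt g hln hx]
    simp
  · have h0 : (n + (q + 1) - l) + l = n + (q + 1) := by omega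
    exact sub_mem (add_mem (insertSum_mem f (by omega) (insertAt_zero_mem g h0 hx))
      (insertAt_zero_mem f (by omega) (insertSum_mem g h0 hx)))
      (insertAt_zero_mem f (by omega) (insertAt_zero_mem g h0 hx))

theorem headBracket_mem {n' : ℕ} (f : CΩ p m) (g : CΩ q l) (hn : n + (p + 1) + (q + 1) = n' + m + l)
    (hx : x ∈ barLength k A n) : headBracket f g x ∈ barLength k A n' := by
  rw [headBracket_apply]
  exact sub_mem (headCircle_mem f g hn hx)
    (Submodule.smul_mem _ _ (headCircle_mem g f (by omega) hx))

/-- Applying d(− ⊗ 1) to `barD_headBracket` gives the left action and the inner terms of δ. The last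
term comes from d(dx ⊗ 1) = ± dx, where `headBracket_mul_letter` recognizes dx as the right action
of the last letter on a value of the bracket. -/
theorem delta_bracket (f : CΩ p m) (hf : delta barLeft barRight m f.1 = 0) (hm : 1 ≤ m) (hl : 1 ≤ l)
    (g : CΩ q l) (hN : N + 1 = m + l) :
    delta barLeft barRight N (bracket f g N) = bracket f (deltaCochain g) (N + 1) := by
  refine ext_ev fun u hu => ?_
  rw [ev_bracket f (deltaCochain g) (by omega) u hu]
  obtain ⟨s, c, hs, hsl⟩ := exists_append_singleton hu
  obtain ⟨a, t, rfl⟩ := List.exists_cons_of_length_eq_add_one hu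
  have ht : t.length = N := by simpa using hu
  have hmem : ∀ v : List A, v.length = N → headBracket f g (bword k v) ∈ barLength k A (p + q + 1) :=
    fun v hv => headBracket_mem f g (n := N) (by omega) (hv ▸ bword_mem_barLength v)
  have hmem' : headBracket f g (bword k (a :: t)) ∈ barLength k A (p + q + 2) :=
    headBracket_mem f g (n := N + 1) (by omega) (hu ▸ bword_mem_barLength (a :: t))
  have key := barD_headBracket f hf hm hl g (deltaCochain g) rfl a t
  have e1 : barLeft a (ev (bracket f g N) t) =
      ε ^ (p + q) • dOne (barLeft a (headBracket f g (bword k t))) := by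
    rw [ev_bracket f g hN t ht, map_smul, dOne_apply, dOne_apply, ← barD_barLeft, barLeft_mul_of_mem
      a (hmem t ht)]
  have e2 : mergeSum (ev (bracket f g N)) (a :: t) =
      ε ^ (p + q) • dOne (headBracket f g (barD (bword k (a :: t)))) := by
    rw [barD_bword, linear_mergeSum, linear_mergeSum, ← mergeSum_smul (ε ^ (p + q))]
    exact mergeSum_congr fun v hv => ev_bracket f g hN v (by omega)
  have e3 : onLast (fun p c => barRight c (ev (bracket f g N) p)) (a :: t) =
      ε ^ (p + q) • barD (headBracket f g (bword k (a :: t))) := by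
    rw [hs, onLast_append_singleton, ev_bracket f g hN s hsl, map_smul, dOne_apply, ← barD_barRight,
      barRight_mul_letter, one_mul, ← headBracket_mul_letter f g hm hl s (by omega), bword_append]
  rw [ev_delta, e1, e2, e3]
  have h2 : dOne (barD (headBracket f g (bword k (a :: t)))) =
      ε ^ (p + q) • barD (headBracket f g (bword k (a :: t))) := by
    rw [dOne_apply, barD_mul_letter 1 (barD_mem_barLength hmem'), barD_barD, barRight_unit
      (barD_mem_barLength hmem')]
    rw [zero_mul, zero_add, pow_succ, pow_succ]
    simp
  rw [key, map_smul, map_add, map_sub] at h2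
  rw [key]
  have hsig : ε ^ (p + m + 1 + (q + l + 1)) = (-1) ^ (p + q) * (-1) ^ (N + 1) := by
    rw [← pow_add]
    exact neg_one_pow_eq ⟨p + q + 1 + (N + 1), by omega⟩
  rw [hsig] at h2 ⊢
  generalize headBracket f g (barD (bword k (a :: t))) = X at *
  generalize barLeft a (headBracket f g (bword k t)) = Y at *
  generalize headBracket f (deltaCochain g) (bword k (a :: t)) = Z at *
  generalize hD : barD (X - Y + Z) = D at *
  have h3 : dOne Z = dOne Y - dOne X + ε ^ (p + q) • ((X - Y + Z)) := by
    rcases neg_one_pow_eq_or k (p + q) with h | h <;>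
      rcases neg_one_pow_eq_or k (N + 1) with h' | h' <;> simp only [h, h'] at h2 ⊢ <;>
      first
      | linear_combination (norm := module) h2
      | linear_combination (norm := module) ε • h2
  rw [h3]
  rcases neg_one_pow_eq_or k (p + q) with h | h <;>
    rcases neg_one_pow_eq_or k (N + 1) with h' | h' <;> simp only [h, h'] <;> module

/-! ### The bracket commutes with the connecting map -/

/-- By `ev_theta` a value of θ(g) at (u, c) is −g(u) ⊗ c plus a word that ends in 1. The latter
vanishes by normalization unless `c` is the final letter `b`. The unspecified `z` is harmless, since
a further factor 1 will be appended. -/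
theorem insertAt_zero_theta {n' : ℕ} (g : CΩ q l) (b : A) (w : List A)
    (hn : n' + l = w.length + (q + 1)) :
    ∃ z ∈ barLength k A n', insertAt 0 (thetaCochain g) (bword k w * bword k [b]) =
      - (insertAt 0 g (bword k w) * bword k [b]) + z * bword k [1] := by
  by_cases hl : w.length < l
  · refine ⟨0, zero_mem _, ?_⟩
    rw [insertAt_bword_of_lt g w (by omega), ← bword_append, insertAt_bword_of_lt (thetaCochain g)
      _ (by simp; omega)]
    simp
  · obtain ⟨s, u, v, rfl, hs, hu⟩ := exists_append_of_le (j := 0) (m := l) (l := w) (by omega)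
    obtain rfl := List.length_eq_zero_iff.1 hs
    have hθ : ∀ c, ev (thetaCochain g).1 (u ++ [c]) =
        barRight c (ev g.1 u) * bword k [1] - ev g.1 u * bword k [c] := ev_theta g u hu
    rw [List.nil_append] at hn ⊢
    cases v with
    | nil =>
      rw [List.append_nil] at hn ⊢
      refine ⟨barRight b (ev g.1 u), ?_, ?_⟩
      · rw [show n' = q + 1 by omega]
        exact barRight_mem_barLength b (ev_mem_barLength g u)
      · have h1 := insertAt_zero_mul (thetaCochain g) (u ++ [b]) (by simp [hu]) 1
        have h2 := insertAt_zero_mul g u hu 1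
        rw [mul_one, mul_one] at h1 h2
        rw [← bword_append, h1, h2, hθ]
        abel
    | cons c v =>
      refine ⟨0, zero_mem _, ?_⟩
      have h1 := insertAt_zero_mul (thetaCochain g) (u ++ [c]) (by simp [hu])
        (bword k v * bword k [b])
      rw [bword_append, mul_assoc, ← mul_assoc (bword k [c]), ← bword_cons] at h1
      rw [bword_append, mul_assoc, h1, insertAt_zero_mul g u hu, hθ, sub_mul, mul_unit_mul (n := q)
        (l := v.length) (barRight_mem_barLength c (ev_mem_barLength g u))
        (mul_mem_barLength (bword_mem_barLength v) (letter_mem b)), bword_cons c v]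
      simp only [mul_assoc, zero_mul, add_zero, zero_sub]

theorem insertSum_theta {n' : ℕ} (g : CΩ q l) (b : A) (w : List A)
    (hn : n' + l = w.length + (q + 1)) :
    ∃ z ∈ barLength k A n', insertSum (thetaCochain g) (bword k w * bword k [b]) =
      - (insertSum g (bword k w) * bword k [b]) + z * bword k [1] := by
  obtain ⟨z, hz, h⟩ := insertAt_zero_theta g b w hn
  induction w generalizing n' z with
  | nil =>
    refine ⟨z, hz, ?_⟩
    have h1 := insertSum_letter_mul (thetaCochain g) b 1
    rw [insertSum_of_lt (thetaCochain g) (Nat.succ_pos _) one_mem_barLength, mul_one, mul_zero,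
      smul_zero, add_zero] at h1
    rw [bword_nil, one_mul] at h ⊢
    rw [h1, insertSum_one, h]
  | cons a w ih =>
    have hy := bword_mem_barLength (k := k) w
    rw [bword_cons] at h ⊢
    by_cases hl : w.length < l
    · refine ⟨z, hz, ?_⟩
      rw [mul_assoc, insertSum_letter_mul, insertSum_of_lt _ (by omega) (mul_mem_barLength hy
        (letter_mem b)), ← mul_assoc, h, insertSum_letter_mul, insertSum_of_lt g hl hy]
      simp
    · rw [List.length_cons] at hn
      obtain ⟨n', rfl⟩ : ∃ i, n' = i + 1 := ⟨n' - 1, by omega⟩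
      have hn' : n' + l = w.length + (q + 1) := by omega
      obtain ⟨y, hy, h0⟩ := insertAt_zero_theta g b w hn'
      obtain ⟨z', hz', h'⟩ := ih hn' y hy h0
      refine ⟨z + ε ^ (q + l + 1) • (bword k [a] * z'),
        add_mem hz (Submodule.smul_mem _ _ (letter_mul_mem a hz')), ?_⟩
      rw [mul_assoc, insertSum_letter_mul, h', ← mul_assoc, h, insertSum_letter_mul,
        neg_one_pow_eq (k := k) (a := q + 1 + (l + 1) + 1) (b := q + l + 1) ⟨q + l + 2, by omega⟩]
      simp only [add_mul, mul_add, mul_neg, smul_add, smul_neg, bar_smul_mul, mul_assoc]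
      abel

theorem insertAt_zero_theta_mul_unit (g : CΩ q l) {y : Bar k A} (hy : y ∈ barLength k A (l + 1)) :
    insertAt 0 (thetaCochain g) y * bword k [1] = - (insertAt 0 g y * bword k [1]) := by
  refine eqOn_barLength (φ := mulR (bword k [1]) ∘ₗ insertAt 0 (thetaCochain g))
    (ψ := - (mulR (bword k [1]) ∘ₗ insertAt 0 g)) (fun w hw => ?_) hy
  obtain ⟨u, c, rfl, hu⟩ := exists_append_singleton hw
  obtain ⟨z, hz, h⟩ := insertAt_zero_theta (n' := q + 1) g c u (by omega)
  rw [LinearMap.neg_apply, LinearMap.comp_apply, LinearMap.comp_apply, mulR_apply, mulR_apply,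
    bword_append, h, insertAt_zero_mul_of_le g hu.ge (bword_mem_barLength u), add_mul, mul_unit_mul
    hz (letter_mem 1)]
  simp

/-- As f has values in A, the word left after inserting f is just long enough for a single insertion
of g or θ(g), so the sum of insertions reduces to the one in front. The terms in which f uses the
last letter cancel by commuting disjoint insertions, and those with `z` vanish against 1 ⊗ 1. -/
theorem headBracket_theta (f : CΩ 0 m) (g : CΩ q l) (hm : 1 ≤ m) (w : List A)
    (hw : w.length + 1 = m + l) (b : A) :
    headBracket f (thetaCochain g) (bword k w * bword k [b]) * bword k [1] =
      - (headBracket f g (bword k w) * bword k [b] * bword k [1]) := by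
  have hx := bword_mem_barLength (k := k) w
  obtain ⟨z₁, hz₁, h1⟩ := insertSum_theta (n' := m + q) g b w (by omega)
  obtain ⟨z₂, hz₂, h2⟩ := insertAt_zero_theta (n' := m + q) g b w (by omega)
  have hxb : bword k w * bword k [b] ∈ barLength k A (w.length + 1) :=
    mul_mem_barLength hx (letter_mem b)
  have hIg : insertSum g (bword k w) ∈ barLength k A (m + q) := insertSum_mem g (by omega) hx
  have hHg : insertAt 0 g (bword k w) ∈ barLength k A (m + q) := insertAt_zero_mem g (by omega) hx
  have hIf : insertSum f (bword k w) ∈ barLength k A l := insertSum_mem f (by omega) hx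
  have hIfb : insertSum f (bword k w * bword k [b]) ∈ barLength k A (l + 1) :=
    insertSum_mem f (by omega) hxb
  have hHf : insertAt 0 f (bword k w) ∈ barLength k A l := insertAt_zero_mem f (by omega) hx
  have hHfb : insertAt 0 f (bword k w * bword k [b]) ∈ barLength k A (l + 1) :=
    insertAt_zero_mem f (by omega) hxb
  have e1 : insertSum f (insertAt 0 (thetaCochain g) (bword k w * bword k [b])) =
      - (insertSum f (insertAt 0 g (bword k w)) * bword k [b]) -
        insertLast f b (insertAt 0 g (bword k w)) + insertSum f z₂ * bword k [1] := by
    rw [h2, map_add, map_neg, insertSum_mul_letter, insertSum_mul_letter, insertLast_one f hm]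
    abel
  have e2 : insertAt 0 f (insertSum (thetaCochain g) (bword k w * bword k [b])) =
      - (insertAt 0 f (insertSum g (bword k w)) * bword k [b]) + insertAt 0 f z₁ * bword k [1] := by
    rw [h1, map_add, map_neg, insertAt_zero_mul_of_le f (by omega) hIg, insertAt_zero_mul_of_le f
      (by omega) hz₁]
  have e3 : insertAt 0 f (insertAt 0 (thetaCochain g) (bword k w * bword k [b])) =
      - (insertAt 0 f (insertAt 0 g (bword k w)) * bword k [b]) +
        insertAt 0 f z₂ * bword k [1] := by
    rw [h2, map_add, map_neg, insertAt_zero_mul_of_le f (by omega) hHg, insertAt_zero_mul_of_le f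
      (by omega) hz₂]
  have e4 : insertAt 0 (thetaCochain g) (insertSum f (bword k w * bword k [b])) * bword k [1] =
      - (insertAt 0 g (insertSum f (bword k w)) * bword k [b] * bword k [1]) -
        insertAt 0 g (insertLast f b (bword k w)) * bword k [1] := by
    rw [insertAt_zero_theta_mul_unit g hIfb, insertSum_mul_letter, map_add, insertAt_zero_mul_of_le
      g le_rfl hIf, add_mul]
    abel
  have e5 : insertSum (thetaCochain g) (insertAt 0 f (bword k w * bword k [b])) =
      insertAt 0 (thetaCochain g) (insertAt 0 f (bword k w * bword k [b])) :=
    insertSum_eq_insertAt_zero _ le_rfl hHfb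
  have e6 : insertSum g (insertAt 0 f (bword k w)) = insertAt 0 g (insertAt 0 f (bword k w)) :=
    insertSum_eq_insertAt_zero _ le_rfl hHf
  have e7 := insertLast_insertAt f g b w (by omega) hm
  have hz : ∀ z ∈ barLength k A (q + 1), z * bword k [1] * bword k [1] = 0 := fun z hz =>
    mul_unit_mul hz (letter_mem 1)
  have e8 := hz (insertSum f z₂) (insertSum_mem f (by omega) hz₂)
  have e9 := hz (insertAt 0 f z₁) (insertAt_zero_mem f (by omega) hz₁)
  have e10 := hz (insertAt 0 f z₂) (insertAt_zero_mem f (by omega) hz₂)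
  have hs : ε ^ ((0 + m + 1) * (q + 1 + (l + 1) + 1)) = (-1) ^ ((0 + m + 1) * (q + l + 1)) :=
    neg_one_pow_eq ⟨(0 + m + 1) * (q + l + 2), by ring⟩
  rw [headBracket_apply, headBracket_apply, headCircle_apply, headCircle_apply, headCircle_apply,
    headCircle_apply, e1, e2, e3, e5, e6, hs]
  simp only [add_sub_cancel_left, sub_mul, add_mul, bar_smul_mul, e4, e7, e8, e9, e10, neg_mul]
  module

/-- A unit in the first place is consumed by an insertion in front. A unit in the last place passes
through both circle products and leads to x ⊗ 1 ⊗ 1 = 0, where x has a letter because `1 ≤ q`. A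
unit in between kills the word itself. -/
theorem bracket_mem (f : CΩ 0 m) (g : CΩ q l) (hm : 1 ≤ m) (hl : 1 ≤ l) (hq : 1 ≤ q)
    (hN : N + 1 = m + l) : bracket f g N ∈ CΩ q N := by
  have hmem : ∀ v : List A, v.length = N → headBracket f g (bword k v) ∈ barLength k A (q + 1) :=
    fun v hv => headBracket_mem f g (n := N) (by omega) (hv ▸ bword_mem_barLength v)
  refine mem_cochains ?_ ?_
  · intro u hu
    rw [ev_bracket f g hN u hu, dOne_apply]
    exact Submodule.smul_mem _ _ (barD_mem_Omega (mul_mem_barLength (n := q + 1) (l := 1)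
      (hmem u hu) (letter_mem 1)))
  · intro s t hst
    rw [ev_bracket f g hN _ (by simp; omega), dOne_apply]
    have key : headBracket f g (bword k (s ++ 1 :: t)) * bword k [1] = 0 := by
      have h1 : ∀ {m p : ℕ} (f : CΩ p m), 1 ≤ m → ∀ x : Bar k A,
          insertAt 0 f (bword k [1] * x) = 0 := by
        intro m p f hm x
        refine eq_of_bword (φ := insertAt 0 f ∘ₗ mulL (bword k [1])) (ψ := 0) (fun t => ?_) x
        rw [LinearMap.comp_apply, mulL_apply, ← bword_cons, insertAt_zero_bword, splitSum_congr (G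
          := fun _ _ => 0), splitSum_zero, LinearMap.zero_apply]
        intro u v huv
        cases u with
        | nil => rw [ev_of_ne _ (by simp; omega), zero_mul]
        | cons a u =>
          obtain rfl : a = 1 := (List.cons.inj huv).1
          have := ev_eq_zero_of_mem f.2 [] u
          rw [List.nil_append] at this
          rw [this, zero_mul]
      have hc : ∀ {m l p q : ℕ} (f : CΩ p m) (g : CΩ q l),
          1 ≤ m → 1 ≤ l → ∀ x : Bar k A, headCircle f g (bword k [1] * x) = 0 := by
        intro m l p q f g hm hl x
        rw [headCircle_apply, h1 g hl, insertSum_letter_mul, h1 g hl, zero_add, map_smul, h1 f hm]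
        simp
      by_cases hs : s = []
      · rw [hs, List.nil_append, bword_cons, headBracket_apply, hc f g hm hl, hc g f hl hm]
        simp
      by_cases ht : t = []
      · have h2 : ∀ {m p : ℕ} (f : CΩ p m), 1 ≤ m → ∀ x : Bar k A,
            insertAt 0 f (x * bword k [1]) = insertAt 0 f x * bword k [1] := by
          intro m p f hm x
          refine eq_of_bword (φ := insertAt 0 f ∘ₗ mulR (bword k [1]))
            (ψ := mulR (bword k [1]) ∘ₗ insertAt 0 f) (fun t => ?_) x
          rw [LinearMap.comp_apply, LinearMap.comp_apply, mulR_apply, mulR_apply]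
          by_cases hle : m ≤ t.length
          · exact insertAt_zero_mul_of_le f hle (bword_mem_barLength t) _
          · rw [← bword_append, insertAt_bword_of_lt f t (by omega), zero_mul]
            by_cases hle' : t.length + 1 = m
            · have h3 := insertAt_zero_mul f (t ++ [1]) (by simpa using hle') 1
              rw [mul_one, mul_one, ev_eq_zero_of_mem f.2] at h3
              exact h3
            · exact insertAt_bword_of_lt f _ (by simp; omega)
        have h3 : ∀ {m p : ℕ} (f : CΩ p m), 1 ≤ m → ∀ x : Bar k A,
            insertSum f (x * bword k [1]) = insertSum f x * bword k [1] := by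
          intro m p f hm x
          rw [insertSum_mul_letter, insertLast_one f hm, add_zero]
        have hc' : ∀ {m l p q : ℕ} (f : CΩ p m) (g : CΩ q l), 1 ≤ m → 1 ≤ l → ∀ x : Bar k A,
            headCircle f g (x * bword k [1]) = headCircle f g x * bword k [1] := by
          intro m l p q f g hm hl x
          rw [headCircle_apply, headCircle_apply, h2 g hl, h3 g hl, h3 f hm, h2 f hm, h2 f hm,
            sub_mul, add_mul]
        rw [ht, bword_append, headBracket_apply, hc' f g hm hl, hc' g f hl hm, sub_mul,
          bar_smul_mul]
        have hsl : s.length + 1 = N := by simpa [ht] using hst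
        obtain ⟨q, rfl⟩ : ∃ i, q = i + 1 := ⟨q - 1, by omega⟩
        rw [mul_unit_mul (n := q) (l := 0) _ (letter_mem 1), mul_unit_mul (n := q) (l := 0) _
          (letter_mem 1)]
        · simp
        · exact headCircle_mem g f (n := s.length) (by omega) (bword_mem_barLength s)
        · exact headCircle_mem f g (n := s.length) (by omega) (bword_mem_barLength s)
      · rw [bword_eq_zero s t hs ht, map_zero, zero_mul]
    rw [key, map_zero, smul_zero]

/-- The bracket with a cochain with values in `A`, as a cochain. -/
def bracketCochain (f : CΩ 0 m) (g : CΩ q l) (hm : 1 ≤ m) (hl : 1 ≤ l) (hq : 1 ≤ q)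
    (hN : N + 1 = m + l) : CΩ q N := ⟨bracket f g N, bracket_mem f g hm hl hq hN⟩

theorem ev_bracket_theta (f : CΩ 0 m) (g : CΩ q l) (hm : 1 ≤ m) (hN : N + 1 = m + l) (w : List A)
    (hw : w.length = N) (b : A) :
    ev (bracket f (thetaCochain g) (N + 1)) (w ++ [b]) =
      ε ^ q • barD (headBracket f g (bword k w) * bword k [b] * bword k [1]) := by
  rw [ev_bracket f (thetaCochain g) (by omega) _ (by simp [hw]), dOne_apply, bword_append,
    headBracket_theta f g hm w (by omega), map_neg, zero_add, pow_succ]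
  module

/-- This makes the bracket compatible with the colimit. By `headBracket_theta` both sides are
obtained from the same word by appending `b` and applying d(− ⊗ 1); the words with an interior unit
drop out. -/
theorem bracket_theta (f : CΩ 0 m) (g : CΩ q l) (hm : 1 ≤ m) (hl : 1 ≤ l) (hq : 1 ≤ q)
    (hN : N + 1 = m + l) :
    bracket f (thetaCochain g) (N + 1) = theta (bracketCochain f g hm hl hq hN) := by
  refine ext_ev fun u hu => ?_
  obtain ⟨w, b, rfl, hw⟩ := exists_append_singleton hu
  have hX : headBracket f g (bword k w) ∈ barLength k A (q + 1) :=
    headBracket_mem f g (n := N) (by omega) (hw ▸ bword_mem_barLength w)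
  rw [ev_bracket_theta f g hm hN w hw, ev_theta _ w hw]
  have h1 : ev (bracketCochain f g hm hl hq hN).1 w = ev (bracket f g N) w := rfl
  rw [h1, ev_bracket f g hN w hw, dOne_apply]
  generalize headBracket f g (bword k w) = X at *
  have hXb : X * bword k [b] ∈ barLength k A (q + 2) :=
    mul_mem_barLength (n := q + 1) (l := 1) hX (letter_mem b)
  obtain ⟨q, rfl⟩ : ∃ i, q = i + 1 := ⟨q - 1, by omega⟩
  have h2 := mul_unit_mul (barD_mem_barLength hX) (letter_mem (k := k) b)
  rw [barD_mul_letter 1 hXb, barD_mul_letter b hX, barD_mul_letter 1 hX, barRight_unit hX,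
    barRight_mul_letter, mul_one, map_smul, map_add, map_smul, barRight_mul_letter, one_mul,
    zero_add]
  simp only [add_mul, smul_add, bar_smul_mul, h2, smul_zero, zero_add]
  rw [show q + 2 + 1 = q + 1 + 1 + 1 from rfl]
  rcases neg_one_pow_eq_or k (q + 1) with h | h <;> 
    simp only [pow_succ _ (q + 1 + 1), pow_succ _ (q + 1), pow_succ _ (q + 1 + 1 + 1), h] <;> module

/-! ### Linear maps given by values on lists -/

variable (k) in
/-- Functions on lists that are linear in each letter. -/
structure LetterLinear (W : List A → X) : Prop where
  add : ∀ p q a b, W (p ++ (a + b) :: q) = W (p ++ a :: q) + W (p ++ b :: q)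
  smul : ∀ p q (c : k) a, W (p ++ (c • a) :: q) = c • W (p ++ a :: q)

theorem ofFn_update (a : Fin n → A) (i : Fin n) (x : A) : List.ofFn (Function.update a i x) =
      (List.ofFn a).take i ++ x :: (List.ofFn a).drop (i + 1) := by
  refine List.ext_getElem ?_ ?_
  · simp; omega
  · intro j h1 h2
    rw [List.getElem_ofFn, List.getElem_append]
    have hj : j < n := by simpa using h1
    by_cases hji : j < (i : ℕ)
    · rw [dif_pos (by simp; omega), List.getElem_take, List.getElem_ofFn, Function.update_of_ne (by
        intro h; simp [← h] at hji)]
    · rw [dif_neg (by simp; omega)]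
      by_cases hji' : j = (i : ℕ)
      · subst hji'
        simp
      · rw [Function.update_of_ne (by intro h; apply hji'; simp [← h])]
        have h3 : j - ((List.ofFn a).take i).length = (j - i - 1) + 1 := by simp; omega
        simp only [h3, List.getElem_cons_succ, List.getElem_drop, List.getElem_ofFn]
        congr 2
        omega

/-- The multilinear map with the given values at lists. -/
def multi (W : List A → X) (hW : LetterLinear k W) (n : ℕ) : Multi n X where
  toFun a := W (List.ofFn a)
  map_update_add' {inst} a i x y := by
    -- The structure `MultilinearMap` quantifies over all decidability instances; they are
    -- identified with the canonical one.
    have : inst = instDecidableEqFin n := Subsingleton.elim _ _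
    subst this
    rw [ofFn_update, ofFn_update, ofFn_update, hW.add]
  map_update_smul' {inst} a i c x := by
    have : inst = instDecidableEqFin n := Subsingleton.elim _ _
    subst this
    rw [ofFn_update, ofFn_update, hW.smul]

theorem ev_multi (W : List A → X) (hW : LetterLinear k W) {l : List A} (hl : l.length = n) :
    ev (multi W hW n) l = W l := by
  subst hl
  rw [ev_of_eq _ rfl]
  change W (List.ofFn l.get) = W l
  rw [List.ofFn_get]

/-- The linear map on words with the given values. -/
def wordMap (W : List A → X) (hW : LetterLinear k W) : TensorAlgebra k A →ₗ[k] X :=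
  ofWords (multi W hW)

theorem wordMap_word (W : List A → X) (hW : LetterLinear k W) (l : List A) :
    wordMap W hW (word k l) = W l := by
  rw [wordMap, ofWords_word]
  change W (List.ofFn l.get) = W l
  rw [List.ofFn_get]

/-- The linear map on normalized words with the given values. -/
def barMap (W : List A → X) (hW : LetterLinear k W)
    (h0 : ∀ p q : List A, p ≠ [] → q ≠ [] → W (p ++ 1 :: q) = 0) : Bar k A →ₗ[k] X :=
  liftBar (wordMap W hW) (by
    intro t ht
    rw [unitWords_eq] at ht
    obtain ⟨p, q, hp, hq, rfl⟩ := ht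
    rw [wordMap_word, h0 p q hp hq])

theorem barMap_bword (W : List A → X) (hW : LetterLinear k W)
    (h0 : ∀ p q : List A, p ≠ [] → q ≠ [] → W (p ++ 1 :: q) = 0) (l : List A) :
    barMap W hW h0 (bword k l) = W l := wordMap_word W hW l

variable (k) in
theorem LetterLinear.word : LetterLinear k (SingHoch.word k : List A → TensorAlgebra k A) where
  add p q a b := by
    simp only [word_append, word_cons, map_add, add_mul, mul_add]
  smul p q c a := by
    simp only [word_append, word_cons, map_smul, smul_mul_assoc, mul_smul_comm]

theorem LetterLinear.map (hW : LetterLinear k W) (φ : X →ₗ[k] Y) :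
    LetterLinear k fun l => φ (W l) where
  add p q a b := by rw [hW.add, map_add]
  smul p q c a := by rw [hW.smul, map_smul]

variable (k) in
theorem LetterLinear.bword : LetterLinear k (SingHoch.bword k : List A → Bar k A) :=
  (LetterLinear.word k).map (toBar k A).toLinearMap

theorem LetterLinear.ev (f : Multi m X) : LetterLinear k (SingHoch.ev f) :=
  (LetterLinear.word k).map _

theorem LetterLinear.sum_add {W V : List A → X} (hW : LetterLinear k W) (hV : LetterLinear k V) :
    LetterLinear k fun l => W l + V l where
  add p q a b := by rw [hW.add, hV.add]; abel
  smul p q c a := by rw [hW.smul, hV.smul, smul_add]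

theorem LetterLinear.sub {W V : List A → X} (hW : LetterLinear k W) (hV : LetterLinear k V) :
    LetterLinear k fun l => W l - V l where
  add p q a b := by rw [hW.add, hV.add]; abel
  smul p q c a := by rw [hW.smul, hV.smul, smul_sub]

theorem LetterLinear.finsum {ι : Type*} (s : Finset ι) {W : ι → List A → X}
    (hW : ∀ i, LetterLinear k (W i)) : LetterLinear k fun l => ∑ i ∈ s, W i l where
  add p q a b := by
    rw [← Finset.sum_add_distrib]
    exact Finset.sum_congr rfl fun i _ => (hW i).add p q a b
  smul p q c a := by
    rw [Finset.smul_sum]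
    exact Finset.sum_congr rfl fun i _ => (hW i).smul p q c a

theorem LetterLinear.around (hW : LetterLinear k W) (s t : List A) :
    LetterLinear k fun l => W (s ++ (l ++ t)) where
  add p q a b := by
    have := hW.add (s ++ p) (q ++ t) a b
    simpa using this
  smul p q c a := by
    have := hW.smul (s ++ p) (q ++ t) c a
    simpa using this

theorem LetterLinear.length_smul (hW : LetterLinear k W) (c : ℕ → k) :
    LetterLinear k fun l => c l.length • W l where
  add p q a b := by simp only [hW.add, smul_add, List.length_append, List.length_cons]
  smul p q c' a := by
    simp only [hW.smul, List.length_append, List.length_cons]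
    rw [smul_comm]

theorem LetterLinear.splitSum {F : List A → List A → X} (h1 : ∀ q, LetterLinear k fun p => F p q)
    (h2 : ∀ p, LetterLinear k fun q => F p q) : LetterLinear k (SingHoch.splitSum F) where
  add p q a b := by
    induction p generalizing F with
    | nil =>
      simp only [List.nil_append, splitSum_cons]
      have e := (h2 []).add [] q a b
      simp only [List.nil_append] at e
      rw [e, splitSum_congr (G := fun p q => F (a :: p) q + F (b :: p) q), splitSum_add]
      · abel
      · intro x y _
        exact (h1 y).add [] x a b
    | cons c p ih =>
      simp only [List.cons_append, splitSum_cons]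
      have e := (h2 []).add (c :: p) q a b
      simp only [List.cons_append] at e
      rw [ih (F := fun p q => F (c :: p) q), e]
      · abel
      · intro y
        exact ⟨fun p q a b => (h1 y).add (c :: p) q a b, fun p q s a => (h1 y).smul (c :: p) q s a⟩
      · exact fun x => h2 (c :: x)
  smul p q s a := by
    induction p generalizing F with
    | nil =>
      simp only [List.nil_append, splitSum_cons]
      have e := (h2 []).smul [] q s a
      simp only [List.nil_append] at e
      rw [e, splitSum_congr (G := fun p q => s • F (a :: p) q), splitSum_smul, smul_add]
      · intro x y _
        exact (h1 y).smul [] x s a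
    | cons c p ih =>
      simp only [List.cons_append, splitSum_cons]
      have e := (h2 []).smul (c :: p) q s a
      simp only [List.cons_append] at e
      rw [ih (F := fun p q => F (c :: p) q), e, smul_add]
      · intro y
        exact ⟨fun p q a b => (h1 y).add (c :: p) q a b, fun p q s a => (h1 y).smul (c :: p) q s a⟩
      · exact fun x => h2 (c :: x)

theorem LetterLinear.scalarHead (φ : A →ₗ[k] k) {V : List A → X} (hV : LetterLinear k V) :
    LetterLinear k (SingHoch.onHead fun x q => φ x • V q) where
  add p q a b := by
    cases p with
    | nil => simp only [List.nil_append, onHead_cons, map_add, add_smul]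
    | cons c p => simp only [List.cons_append, onHead_cons, hV.add, smul_add]
  smul p q c a := by
    cases p with
    | nil => simp only [List.nil_append, onHead_cons, map_smul, smul_eq_mul, mul_smul]
    | cons b p =>
      simp only [List.cons_append, onHead_cons, hV.smul]
      rw [smul_comm]

/-! ### The Casimir element as a sum -/

section Casimir

variable [FiniteDimensional k A] (hf : IsSymmetrizing form)

/-- Finite families with `∑ e i ⊗ f i` the Casimir element. -/
structure IsCasimir {ι : Type*} [Fintype ι] (form : LinearMap.BilinForm k A) (e f : ι → A) :
    Prop where
  symm : ∀ a b, form a b = form b a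
  assoc : ∀ a b c, form (a * b) c = form a (b * c)
  left : ∀ x, ∑ i, form (e i) x • f i = x
  right : ∀ x, ∑ i, form x (f i) • e i = x

/-- The first duality relation is the definition of the Casimir element as the preimage of the
identity. The second follows by pairing with an arbitrary `y` and nondegeneracy. -/
theorem exists_casimir :
    ∃ (n : ℕ) (e f : Fin n → A), casimir hf = ∑ i, e i ⊗ₜ[k] f i ∧ IsCasimir form e f := by
  obtain ⟨s, hs⟩ := TensorProduct.exists_finset (casimir hf)
  let φ := s.equivFin.symm
  have hsum : casimir hf = ∑ i, (φ i).1.1 ⊗ₜ[k] (φ i).1.2 := by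
    rw [hs, Equiv.sum_comp φ (fun i : s => i.1.1 ⊗ₜ[k] i.1.2), Finset.sum_coe_sort s (fun i => i.1
      ⊗ₜ[k] i.2)]
  have hleft : ∀ x, ∑ i, form (φ i).1.1 x • (φ i).1.2 = x := by
    have h1 : dualTensorHomEquiv k A A ((TensorProduct.congr (form.toDual hf.nondegenerate)
        (LinearEquiv.refl k A)) (casimir hf)) = LinearMap.id := by
      simp [casimir]
    rw [hsum, map_sum, map_sum] at h1
    intro x
    have h2 := LinearMap.congr_fun h1 x
    simpa [LinearMap.sum_apply, dualTensorHom_apply, LinearMap.BilinForm.toDual_def] using h2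
  refine ⟨_, fun i => (φ i).1.1, fun i => (φ i).1.2, hsum, hf.symm, hf.assoc, hleft, fun x => ?_⟩
  refine sub_eq_zero.1 (hf.nondegenerate.1 _ fun y => ?_)
  have h1 := congrArg (form x) (hleft y)
  rw [map_sum] at h1
  rw [map_sub, LinearMap.sub_apply, ← h1, map_sum, LinearMap.sum_apply, sub_eq_zero]
  refine Finset.sum_congr rfl fun i _ => ?_
  rw [map_smul, map_smul, LinearMap.smul_apply, smul_eq_mul, smul_eq_mul, mul_comm]

end Casimir

theorem isLinearMap_sum {B : A → X} (hB : IsLinearMap k B) (c : ι → k) (x : ι → A) :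
    B (∑ i, c i • x i) = ∑ i, c i • B (x i) := by
  have := map_sum (hB.mk' B) (fun i => c i • x i) Finset.univ
  change B (∑ i, c i • x i) = ∑ i, B (c i • x i) at this
  rw [this]
  exact Finset.sum_congr rfl fun i _ => hB.map_smul _ _

/-- Expand φ(e i) in the family `e` and ψ(f j) in the family `f`: the coefficients are the same by
adjointness. -/
theorem IsCasimir.adjoint (h : IsCasimir form e f) {B : A → A → X} {φ ψ : A → A}
    (h1 : ∀ y, IsLinearMap k fun x => B x y) (h2 : ∀ x, IsLinearMap k fun y => B x y)
    (hφ : ∀ a b, form (φ a) b = form a (ψ b)) :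
    ∑ i, B (φ (e i)) (f i) = ∑ i, B (e i) (ψ (f i)) := by
  have e1 : ∀ i, B (φ (e i)) (f i) = ∑ j, form (φ (e i)) (f j) • B (e j) (f i) := fun i => by
    rw [← isLinearMap_sum (h1 (f i)), h.right]
  have e2 : ∀ j, B (e j) (ψ (f j)) = ∑ i, form (e i) (ψ (f j)) • B (e j) (f i) := fun j => by
    rw [← isLinearMap_sum (h2 (e j)), h.left]
  simp only [e1, e2, hφ]
  exact Finset.sum_comm

/-- Associativity makes right and left multiplication by `x` adjoint to each other, so a factor next
to one Casimir letter moves to the other. With `IsCasimir.slide_out` this is the source of all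
cyclic rotations below. -/
theorem IsCasimir.slide (h : IsCasimir form e f) {B : A → A → X}
    (h1 : ∀ y, IsLinearMap k fun x => B x y) (h2 : ∀ x, IsLinearMap k fun y => B x y) (x : A) :
    ∑ i, B (e i * x) (f i) = ∑ i, B (e i) (x * f i) :=
  h.adjoint h1 h2 (φ := (· * x)) (ψ := (x * ·)) fun a b => h.assoc a x b

theorem IsCasimir.slide_out (h : IsCasimir form e f) {B : A → A → X}
    (h1 : ∀ y, IsLinearMap k fun x => B x y) (h2 : ∀ x, IsLinearMap k fun y => B x y) (x : A) :
    ∑ i, B (x * e i) (f i) = ∑ i, B (e i) (f i * x) :=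
  h.adjoint h1 h2 (φ := (x * ·)) (ψ := (· * x)) fun a b => by rw [h.assoc, h.symm, h.assoc]

theorem IsCasimir.swap (h : IsCasimir form e f) {B : A → A → X}
    (h1 : ∀ y, IsLinearMap k fun x => B x y) (h2 : ∀ x, IsLinearMap k fun y => B x y) :
    ∑ i, B (e i) (f i) = ∑ i, B (f i) (e i) := by
  have e1 : ∀ i, B (e i) (f i) = ∑ j, form (f i) (f j) • B (e i) (e j) := fun i => by
    rw [← isLinearMap_sum (h2 (e i)), h.right]
  have e2 : ∀ i, B (f i) (e i) = ∑ j, form (f i) (f j) • B (e j) (e i) := fun i => by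
    rw [← isLinearMap_sum (h1 (e i)), h.right]
  simp only [e1, e2]
  rw [Finset.sum_comm]
  simp only [h.symm]

theorem IsCasimir.form_one (h : IsCasimir form e f) (a b : A) : form 1 (a * b) = form a b := by
  rw [← h.assoc, one_mul]

theorem LetterLinear.isLinearMap (hW : LetterLinear k W) (p q : List A) :
    IsLinearMap k fun a => W (p ++ a :: q) :=
  ⟨fun a b => hW.add p q a b, fun c a => hW.smul p q c a⟩

/-! ### Vanishing of the cohomology of the bar resolution and the connecting isomorphisms -/

/-- `x₀ ⊗ x₁ ⊗ ⋯ ↦ ⟨1, x₀⟩ a ⊗ x₁ ⊗ ⋯` -/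
def headForm (form : LinearMap.BilinForm k A) (a : A) : Bar k A →ₗ[k] Bar k A :=
  barMap (onHead fun x q => form 1 x • bword k ([a] ++ (q ++ [])))
    (((LetterLinear.bword k).around [a] []).scalarHead (form 1)) (by
      intro p q hp hq
      obtain ⟨c, p, rfl⟩ := List.exists_cons_of_ne_nil hp
      rw [List.cons_append, onHead_cons, List.append_nil, ← List.append_assoc, bword_eq_zero ([a] ++
        p) q (by simp) hq, smul_zero])

theorem headForm_bword (form : LinearMap.BilinForm k A) (a x : A) (q : List A) :
    headForm form a (bword k (x :: q)) = form 1 x • bword k (a :: q) := by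
  rw [headForm, barMap_bword]
  simp

theorem headForm_mem (a : A) (hx : x ∈ barLength k A (n + 1)) :
    headForm form a x ∈ barLength k A (n + 1) := by
  refine barLength_le (S := (barLength k A (n + 1)).comap (headForm form a)) (fun l hl => ?_) hx
  obtain ⟨b, q, rfl⟩ := List.exists_cons_of_length_eq_add_one hl
  rw [Submodule.mem_comap, headForm_bword, ← hl]
  exact Submodule.smul_mem _ _ (bword_mem_barLength (a :: q))

theorem headForm_barRight (a b : A) (hx : x ∈ barLength k A (n + 2)) :
    headForm form a (barRight b x) = barRight b (headForm form a x) := by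
  refine eqOn_barLength (φ := headForm form a ∘ₗ barRight b) (ψ := barRight b ∘ₗ headForm form a)
    (fun l hl => ?_) hx
  obtain ⟨s, d, rfl, hs⟩ := exists_append_singleton hl
  obtain ⟨c, q, rfl⟩ := List.exists_cons_of_length_eq_add_one hs
  rw [LinearMap.comp_apply, LinearMap.comp_apply, barRight_bword, List.cons_append, headForm_bword,
    List.cons_append, headForm_bword, map_smul, ← List.cons_append, ← List.cons_append,
    barRight_bword]

theorem headForm_isLinearMap (hx : x ∈ barLength k A (n + 1)) :
    IsLinearMap k fun a => headForm form a x := by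
  have hW := (LetterLinear.bword k (A := A)).isLinearMap []
  refine ⟨fun a b => eqOn_barLength (φ := headForm form (a + b))
    (ψ := headForm form a + headForm form b) (fun l hl => ?_) hx, fun c a =>
    eqOn_barLength (φ := headForm form (c • a)) (ψ := c • headForm form a) (fun l hl => ?_) hx⟩ <;>
  obtain ⟨d, q, rfl⟩ := List.exists_cons_of_length_eq_add_one hl
  · rw [LinearMap.add_apply, headForm_bword, headForm_bword, headForm_bword, ← smul_add]
    exact congrArg _ ((hW q).map_add a b)
  · rw [LinearMap.smul_apply, headForm_bword, headForm_bword, smul_comm]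
    exact congrArg _ ((hW q).map_smul c a)

theorem headForm_mul (a b : A) (hx : x ∈ barLength k A (n + 1)) :
    headForm form (a * b) x = barLeft a (headForm form b x) := by
  refine eqOn_barLength (ψ := barLeft a ∘ₗ headForm form b) (fun l hl => ?_) hx
  obtain ⟨c, q, rfl⟩ := List.exists_cons_of_length_eq_add_one hl
  rw [LinearMap.comp_apply, headForm_bword, headForm_bword, map_smul, barLeft_bword]

/-- The content is ∑ ⟨1, f_i c⟩ e_i = c: the functional ⟨1, −⟩ makes `A` a Frobenius algebra, so
that free left modules are also coinduced. The vanishing of cohomology below follows from this. -/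
theorem sum_headForm_barLeft (h : IsCasimir form e f) (hx : x ∈ barLength k A (n + 1)) :
    ∑ i, headForm form (e i) (barLeft (f i) x) = x := by
  have := eqOn_barLength (φ := ∑ i, headForm form (e i) ∘ₗ barLeft (f i)) (ψ := LinearMap.id)
    (fun l hl => ?_) hx
  · simpa [LinearMap.sum_apply] using this
  obtain ⟨c, q, rfl⟩ := List.exists_cons_of_length_eq_add_one hl
  have h2 := isLinearMap_sum ((LetterLinear.bword k).isLinearMap ([] : List A) q)
    (fun i => form c (f i)) e
  rw [h.right] at h2
  simp only [LinearMap.sum_apply, LinearMap.comp_apply, barLeft_bword, headForm_bword, h.form_one,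
    h.symm _ c]
  exact h2.symm

theorem ev_curryLeft (F : Multi (m + 1) X) (a : A) (l : List A) :
    ev (F.curryLeft a) l = ev F (a :: l) := by
  by_cases hl : l.length = m
  · subst hl
    rw [ev_of_eq _ rfl, ev_of_eq (l := a :: l) _ rfl]
    change F _ = F _
    congr 1
    funext i
    exact Fin.cases rfl (fun _ => rfl) i
  · rw [ev_of_ne _ hl, ev_of_ne _ (by simpa using hl)]

/-- The contracting homotopy of the cochains with values in a term of the bar resolution. -/
def contractCochain (form : LinearMap.BilinForm k A) (e f : ι → A) (F : Multi (m + 1) (Bar k A)) :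
    Multi m (Bar k A) := ∑ i, (headForm form (e i)).compMultilinearMap (F.curryLeft (f i))

theorem ev_contractCochain (F : Multi (m + 1) (Bar k A)) (l : List A) :
    ev (contractCochain form e f F) l = ∑ i, headForm form (e i) (ev F (f i :: l)) := by
  rw [contractCochain, ev_sum]
  exact Finset.sum_congr rfl fun i _ => by rw [ev_comp, ev_curryLeft]

theorem contractCochain_mem {F : Multi (m + 1) (Bar k A)}
    (hF : F ∈ cochains A (barLength k A (n + 1)) (m + 1)) :
    contractCochain form e f F ∈ cochains A (barLength k A (n + 1)) m := by
  refine mem_cochains ?_ ?_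
  · intro l _
    rw [ev_contractCochain]
    exact sum_mem fun i _ => headForm_mem _ (ev_mem_of_mem hF _)
  · intro p q _
    rw [ev_contractCochain]
    refine Finset.sum_eq_zero fun i _ => ?_
    rw [← List.cons_append, ev_eq_zero_of_mem hF, map_zero]

/-- Evaluate δF = 0 at (f_i, a, v), replace heads by e_i and sum over the Casimir pair. The leading
term returns F, and the product f_i a slides into the left action of `a`. Two letters are required
in the values so that the right action does not touch the head. -/
theorem delta_contractCochain (h : IsCasimir form e f) {F : Multi (m + 1) (Bar k A)}
    (hF : F ∈ cochains A (barLength k A (n + 2)) (m + 1))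
    (hd : delta barLeft barRight (m + 1) F = 0) :
    delta barLeft barRight m (contractCochain form e f F) = F := by
  refine ext_ev fun u hu => ?_
  obtain ⟨a, v, rfl⟩ := List.exists_cons_of_length_eq_add_one hu
  obtain ⟨p, c, hp, -⟩ := exists_append_singleton hu
  have hmem : ∀ l, ev F l ∈ barLength k A (n + 1 + 1) := fun l => ev_mem_of_mem hF l
  have h0 : ∀ i, barLeft (f i) (ev F (a :: v)) = ev F ((f i * a) :: v) -
      mergeSum (fun t => ev F (f i :: t)) (a :: v) +
        ε ^ (m + 1) • barRight c (ev F (f i :: p)) := by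
    intro i
    have h1 := ev_delta barLeft barRight (m + 1) F (f i) (a :: v)
    rw [hd, ev_zero, mergeSum_cons_cons, hp, ← List.cons_append, onLast_append_singleton, pow_succ,
      ← hp] at h1
    linear_combination (norm := module) -h1
  have h1 : ∑ i, headForm form (e i) (barLeft (f i) (ev F (a :: v))) = ev F (a :: v) :=
    sum_headForm_barLeft h (hmem _)
  have h2 : ∑ i, headForm form (e i) (ev F ((f i * a) :: v)) =
      barLeft a (ev (contractCochain form e f F) v) := by
    rw [ev_contractCochain, map_sum, ← h.slide_out (B := fun x y => headForm form x (ev F (y :: v)))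
      (fun y => headForm_isLinearMap (hmem _)) fun x =>
        ((LetterLinear.ev F).map (headForm form x)).isLinearMap [] v]
    exact Finset.sum_congr rfl fun i _ => headForm_mul _ _ (hmem _)
  have h3 : ∑ i, headForm form (e i) (mergeSum (fun t => ev F (f i :: t)) (a :: v)) =
      mergeSum (ev (contractCochain form e f F)) (a :: v) := by
    simp only [linear_mergeSum, ← mergeSum_finsum, ← ev_contractCochain]
  have h4 : ∑ i, headForm form (e i) (barRight c (ev F (f i :: p))) =
      barRight c (ev (contractCochain form e f F) p) := by
    rw [ev_contractCochain, map_sum]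
    exact Finset.sum_congr rfl fun i _ => headForm_barRight _ _ (hmem _)
  rw [ev_delta, ← h1, ← h2, ← h3, hp, onLast_append_singleton, ← h4, ← hp, Finset.smul_sum, ←
    Finset.sum_sub_distrib, ← Finset.sum_add_distrib]
  refine Finset.sum_congr rfl fun i _ => ?_
  rw [h0, map_add, map_sub, map_smul]

/-! ### The connecting map of 0 → Ω^{p+1} → A ⊗ Ā^p ⊗ A → Ω^p → 0 -/

/-- The cochain `g ⊗ 1`. -/
def mulOne (g : Multi m (Bar k A)) : Multi m (Bar k A) := (mulR (bword k [1])).compMultilinearMap g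

theorem ev_mulOne (g : Multi m (Bar k A)) (l : List A) :
    ev (mulOne g) l = ev g l * bword k [1] := by rw [mulOne, ev_comp, mulR_apply]

theorem mulOne_mem (g : CΩ p m) : mulOne g.1 ∈ cochains A (barLength k A (p + 2)) m := by
  refine mem_cochains ?_ ?_
  · intro l _
    rw [ev_mulOne]
    exact mul_mem_barLength (n := p + 1) (l := 1) (ev_mem_barLength g l) (letter_mem 1)
  · intro s t _
    rw [ev_mulOne, ev_eq_zero_of_mem g.2, zero_mul]

/-- Up to sign, g ⊗ 1 is a lift of g through d (`barD_mulOne`). Forming it commutes with the left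
but not with the right action, and the defect is θ(g). So θ represents the connecting map up to
sign. -/
theorem delta_mulOne (g : CΩ p m) :
    delta barLeft barRight m (mulOne g.1) = mulOne (deltaCochain g).1 + ε ^ m • theta g := by
  refine ext_ev fun u hu => ?_
  obtain ⟨a, v, rfl⟩ := List.exists_cons_of_length_eq_add_one hu
  obtain ⟨s, c, hp, hs⟩ := exists_append_singleton hu
  have e1 : ev (deltaCochain g).1 (a :: v) = ev (delta barLeft barRight m g.1) (a :: v) := rfl
  have e2 : mergeSum (ev (mulOne g.1)) (a :: v) = mergeSum (ev g.1) (a :: v) * bword k [1] := by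
    rw [← mulR_apply, linear_mergeSum]
    exact mergeSum_congr fun t _ => ev_mulOne _ _
  rw [ev_add, ev_smul, ev_delta, ev_mulOne, ev_mulOne, e1, ev_delta, e2, barLeft_mul_of_mem a
    (ev_mem_barLength g v), hp, onLast_append_singleton, onLast_append_singleton, ev_theta g s hs,
    ev_mulOne, barRight_mul_letter, one_mul]
  simp only [add_mul, sub_mul, bar_smul_mul, pow_succ]
  module

theorem delta_mulOne_of_eq_zero {g : CΩ p m} (hg : (deltaCochain g).1 = 0) :
    delta barLeft barRight m (mulOne g.1) = ε ^ m • theta g := by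
  rw [delta_mulOne, hg, mulOne, LinearMap.compMultilinearMap_zero, zero_add]

theorem barD_comp_eq_zero {F : Multi m (Bar k A)} (hF : F ∈ CΩ p m) :
    barD.compMultilinearMap F = 0 :=
  ext_ev fun l _ => by rw [ev_comp, ev_zero]; exact (ev_mem_of_mem hF l).2

theorem barD_comp_sub (F G : Multi m (Bar k A)) (c : k) :
    barD.compMultilinearMap (F - c • G) =
      barD.compMultilinearMap F - c • barD.compMultilinearMap G := by
  ext; simp

theorem barD_mulOne (g : CΩ p m) : barD.compMultilinearMap (mulOne g.1) = ε ^ p • g.1 := by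
  refine ext_ev fun l _ => ?_
  rw [ev_comp, ev_mulOne, ev_smul, barD_mul_letter 1 (ev_mem_barLength g l), barD_ev, zero_mul,
    zero_add, barRight_unit (ev_mem_barLength g l), pow_succ, pow_succ]
  simp

theorem barD_comp_mem {F : Multi m (Bar k A)} (hF : F ∈ cochains A (barLength k A (p + 2)) m) :
    barD.compMultilinearMap F ∈ CΩ p m := by
  refine mem_cochains ?_ ?_
  · intro l _
    rw [ev_comp]
    exact barD_mem_Omega (ev_mem_of_mem hF l)
  · intro s t _
    rw [ev_comp, ev_eq_zero_of_mem hF, map_zero]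

theorem delta_barD_comp (F : Multi m (Bar k A)) :
    delta barLeft barRight m (barD.compMultilinearMap F) =
      barD.compMultilinearMap (delta barLeft barRight m F) := by
  refine ext_ev fun u hu => ?_
  obtain ⟨a, v, rfl⟩ := List.exists_cons_of_length_eq_add_one hu
  rw [ev_comp, ev_delta, ev_delta, map_add, map_sub, map_smul, linear_mergeSum, linear_onLast,
    ev_comp, barD_barLeft]
  congr 2
  · congr 1
    exact funext fun t => ev_comp barD F t
  · exact onLast_congr fun p c _ => by rw [ev_comp, barD_barRight]

theorem Omega_le_barLength (p : ℕ) : Omega k A p ≤ barLength k A (p + 1) := inf_le_left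

theorem cochains_mono {U V : Submodule k M} (h : U ≤ V) (m : ℕ) : cochains A U m ≤ cochains A V m :=
  fun _ hf => ⟨fun a => h (hf.1 a), hf.2⟩

theorem mem_Omega_cochains {F : Multi m (Bar k A)} (hF : F ∈ cochains A (barLength k A (p + 1)) m)
    (hd : barD.compMultilinearMap F = 0) : F ∈ CΩ p m := by
  refine mem_cochains ?_ ?_
  · intro l _
    refine ⟨ev_mem_of_mem hF l, ?_⟩
    change barD (ev F l) = 0
    rw [← ev_comp, hd, ev_zero]
  · intro s t _
    exact ev_eq_zero_of_mem hF s t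

theorem theta_smul_eq {g g' : CΩ p m} {c : k} (h : g'.1 = c • g.1) : theta g' = c • theta g := by
  refine ext_ev fun l hl => ?_
  obtain ⟨w, b, rfl, hw⟩ := exists_append_singleton hl
  rw [ev_smul, ev_theta _ w hw, ev_theta _ w hw, h, ev_smul, map_smul, bar_smul_mul, bar_smul_mul,
    smul_sub]

/-- If θ(g) = δh', then g ⊗ 1 corrected by h' is a cocycle with values in the middle term, hence a
coboundary there. Applying d recovers g up to sign, because d kills h'. -/
theorem theta_injective (h : IsCasimir form e f) (g : ZOmega k A (m + 1) p)
    (hg : theta (omegaCochain g) ∈ BOmega k A (m + 1 + 1) (p + 1)) :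
    g.1 ∈ BOmega k A (m + 1) p := by
  obtain ⟨h', hh', hθ⟩ := hg
  have h1 := delta_mulOne_of_eq_zero (g := omegaCochain g) g.2.2
  set F := mulOne (omegaCochain g).1 - ε ^ (m + 1) • h' with hFdef
  have hF : F ∈ cochains A (barLength k A (p + 2)) (m + 1) :=
    sub_mem (mulOne_mem _) (Submodule.smul_mem _ _ (cochains_mono (Omega_le_barLength _) _ hh'))
  have hdF : delta barLeft barRight (m + 1) F = 0 := by
    rw [hFdef, map_sub, map_smul, h1, ← hθ, sub_self]
  refine ⟨ε ^ p • barD.compMultilinearMap (contractCochain form e f F),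
    Submodule.smul_mem _ _ (barD_comp_mem (contractCochain_mem hF)), ?_⟩
  rw [map_smul, delta_barD_comp, delta_contractCochain h hF hdF, hFdef, barD_comp_sub,
    barD_comp_eq_zero hh', barD_mulOne, smul_zero, sub_zero, smul_smul, ← pow_add,
    Even.neg_one_pow ⟨p, rfl⟩, one_smul]
  rfl

/-- In the middle term the given cocycle becomes δF, and dF, up to sign, is the cocycle it comes
from. Only the degree of the target has to be positive; the source may have degree 0. -/
theorem theta_surjective (h : IsCasimir form e f) (g : ZOmega k A (m + 1) (p + 1)) :
    ∃ g' : ZOmega k A m p, g.1 - theta (omegaCochain g') ∈ BOmega k A (m + 1) (p + 1) := by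
  have hG : g.1 ∈ cochains A (barLength k A (p + 2)) (m + 1) :=
    cochains_mono (Omega_le_barLength _) _ g.2.1
  have hF' := delta_contractCochain h hG g.2.2
  have hF := contractCochain_mem (form := form) (e := e) (f := f) hG
  set F := contractCochain form e f g.1
  let g₀ : ZOmega k A m p := ⟨barD.compMultilinearMap F, barD_comp_mem hF, by
    change delta barLeft barRight m _ = 0
    rw [delta_barD_comp, hF', barD_comp_eq_zero g.2.1]⟩
  have h1 := delta_mulOne_of_eq_zero (g := omegaCochain g₀) g₀.2.2
  have h2 : theta (omegaCochain (ε ^ (p + m) • g₀)) = ε ^ (p + m) • theta (omegaCochain g₀) :=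
    theta_smul_eq rfl
  have h3 : barD.compMultilinearMap (mulOne (omegaCochain g₀).1 - ε ^ p • F) = 0 := by
    rw [barD_comp_sub, barD_mulOne]
    exact sub_self _
  refine ⟨ε ^ (p + m) • g₀, -(ε ^ p • (mulOne (omegaCochain g₀).1 - ε ^ p • F)),
    neg_mem (Submodule.smul_mem _ _ (mem_Omega_cochains
      (sub_mem (mulOne_mem _) (Submodule.smul_mem _ _ hF)) h3)), ?_⟩
  rw [h2, map_neg, map_smul, map_sub, map_smul, h1, hF']
  rcases neg_one_pow_eq_or k p with h | h <;> rw [pow_add, h] <;> module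

/-! ### The Hochschild boundary on words -/

theorem LetterLinear.of_eq {V W : List A → X} (hW : LetterLinear k W) (h : ∀ l, V l = W l) :
    LetterLinear k V := by rwa [show V = W from funext h]

variable (k) in
/-- The Hochschild boundary, for functions on lists. -/
def hochSum (φ : List A → X) : List A → X :=
  onHead fun a l => mergeSum φ (a :: l) + ε ^ l.length • onLast (fun t c => φ ((c * a) :: t)) l

theorem hochSum_cons (φ : List A → X) (a : A) (l : List A) :
    hochSum k φ (a :: l) = mergeSum φ (a :: l) +
      ε ^ l.length • onLast (fun t c => φ ((c * a) :: t)) l := rfl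

theorem linear_hochSum (F : X →ₗ[k] Y) (φ : List A → X) (l : List A) :
    F (hochSum k φ l) = hochSum k (fun t => F (φ t)) l := by
  cases l with
  | nil => exact map_zero F
  | cons a l => rw [hochSum_cons, hochSum_cons, map_add, map_smul, linear_mergeSum, linear_onLast]

theorem hochSum_congr {φ ψ : List A → X} {l : List A}
    (h : ∀ t : List A, t.length + 1 = l.length → φ t = ψ t) : hochSum k φ l = hochSum k ψ l := by
  cases l with
  | nil => rfl
  | cons a l =>
    rw [hochSum_cons, hochSum_cons, mergeSum_congr h]
    congr 2
    refine onLast_congr fun p c hl => h _ ?_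
    simp [← hl]

theorem mergeSum_congr_cons {φ ψ : List A → X} {l : List A}
    (h : ∀ (b : A) (t : List A), t.length + 2 = l.length → φ (b :: t) = ψ (b :: t)) :
    mergeSum φ l = mergeSum ψ l := by
  match l with
  | [] => rfl
  | [_] => rfl
  | a :: b :: l =>
    refine mergeSum_congr fun t ht => ?_
    cases t with
    | nil => simp at ht
    | cons c t => exact h c t (by simp at ht ⊢; omega)

theorem mergeSum_head_mul (φ : List A → X) (a b : A) (l : List A) :
    mergeSum (onHead fun c q => φ ((a * c) :: q)) (b :: l) = mergeSum φ ((a * b) :: l) := by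
  rw [mergeSum_cons, mergeSum_cons]
  simp only [onHead_cons, mul_assoc]

theorem mergeSum_mergeSum (φ : List A → X) (l : List A) : mergeSum (mergeSum φ) l = 0 := by
  induction l generalizing φ with
  | nil => rfl
  | cons a l ih =>
    cases l with
    | nil => rfl
    | cons b l =>
      have h : (fun t => mergeSum φ (a :: t)) = fun t =>
          onHead (fun c q => φ ((a * c) :: q)) t - mergeSum (fun t => φ (a :: t)) t := by
        funext t
        rw [mergeSum_cons]
      rw [mergeSum_cons_cons, h, mergeSum_sub, ih, mergeSum_head_mul, sub_zero, sub_self]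

/-- The Hochschild complex is the bar complex closed up: read a₀ ⊗ ⋯ ⊗ a_r as the word a₀ ⊗ ⋯ ⊗ a_r
⊗ 1 whose last letter is to be multiplied to the front. The wrap-around term becomes the face a_r ·
1, and ∂² = 0 reduces to d² = 0. -/
theorem hochSum_eq_mergeSum (φ : List A → X) (a : A) (l : List A) :
    hochSum k φ (a :: l) = mergeSum (onHead fun b => onLast fun t c => φ ((c * b) :: t))
      (a :: l ++ [1]) := by
  rw [hochSum_cons, mergeSum_append_cons k]
  simp only [onHead_nil, mergeSum_nil, smul_zero, sub_zero, add_zero]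
  have h : mergeSum (fun t => onHead (fun b => onLast fun t c => φ ((c * b) :: t)) (t ++ [1]))
      (a :: l) = mergeSum φ (a :: l) := by
    refine mergeSum_congr_cons fun b t _ => ?_
    simp
  rcases List.eq_nil_or_concat' l with rfl | ⟨s, c, rfl⟩
  · simp
  · rw [h, ← List.cons_append, onLast_append_singleton, onLast_append_singleton]
    simp only [List.cons_append, onHead_cons, mul_one, onLast_append_singleton, List.length_cons,
      List.length_append, List.length_nil, pow_succ]
    module

theorem hochSum_hochSum (φ : List A → X) (l : List A) : hochSum k (hochSum k φ) l = 0 := by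
  cases l with
  | nil => rfl
  | cons a l =>
    rw [hochSum_eq_mergeSum, ← mergeSum_mergeSum (onHead fun b => onLast fun t c => φ ((c * b) ::
      t)) (a :: l ++ [1])]
    refine mergeSum_congr fun t ht => ?_
    cases t with
    | nil => rfl
    | cons b t =>
      rcases List.eq_nil_or_concat' t with rfl | ⟨s, c, rfl⟩
      · rfl
      · rw [onHead_cons, onLast_append_singleton, hochSum_cons, ← List.cons_append,
          mergeSum_append_cons k]
        simp only [onHead_nil, mergeSum_nil, smul_zero, sub_zero, add_zero]
        rcases List.eq_nil_or_concat' s with rfl | ⟨u, d, rfl⟩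
        · simp
        · rw [onLast_append_singleton, ← List.cons_append (a := b), onLast_append_singleton]
          simp only [List.cons_append, onHead_cons, onLast_append_singleton, List.length_cons,
            List.length_append, List.length_nil, pow_succ, mul_assoc]
          have h : mergeSum (fun t => onHead (fun b => onLast fun t c => φ ((c * b) :: t))
              (t ++ [c])) (b :: (u ++ [d])) = mergeSum φ ((c * b) :: (u ++ [d])) := by
            rw [← mergeSum_head_mul φ c b]
            refine mergeSum_congr_cons fun x t _ => ?_
            simp
          rw [h]
          module

/-! ### Rotations, the boundary of a word, and the spaces of chains -/

theorem finRotate_pow_val (i : ℕ) (j : Fin N) : (((finRotate N) ^ i) j : ℕ) = (j + i) % N := by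
  induction i with
  | zero => simp [Nat.mod_eq_of_lt j.2]
  | succ i ih =>
    cases N with
    | zero => exact j.elim0
    | succ N =>
      rw [pow_succ', Equiv.Perm.mul_apply, finRotate_apply, Fin.val_add, ih]
      simp [Nat.add_assoc]

theorem ofFn_finRotate (l : List A) (i : ℕ) :
    List.ofFn (fun j => l.get (((finRotate l.length) ^ i) j)) = l.rotate i := by
  refine List.ext_getElem (by simp) ?_
  intro j h1 h2
  rw [List.getElem_ofFn, List.getElem_rotate, List.get_eq_getElem]
  congr 1
  exact finRotate_pow_val i _

theorem domDomCongr_finRotate (l : List A) (i : ℕ) (φ : ∀ n : ℕ, Multi n X) :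
    ((φ l.length).domDomCongr (finRotate l.length ^ i)) l.get =
      ofWords φ (word k (l.rotate i)) := by
  rw [MultilinearMap.domDomCongr_apply, ← ofFn_finRotate, ofWords_ofFn]

theorem boundary_word (l : List A) : boundary k A (word k l) = hochSum k (word k) l := by
  have h1 := sum_contract (k := k) LinearMap.id l
  simp only [LinearMap.id_apply] at h1
  rw [boundary, ofWords_word]
  simp only [add_apply, sum_apply, smul_apply]
  rw [h1, domDomCongr_finRotate l _ (fun N => contract 0 N)]
  cases l with
  | nil =>
    rw [ofWords_word]
    simp only [mergeSum_nil, List.length_nil]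
    rw [contract, block_of_lt _ _ (by simp), smul_zero, add_zero]
    rfl
  | cons a l =>
    rw [hochSum_cons]
    simp only [List.length_cons, Nat.add_sub_cancel]
    congr 2
    rcases List.eq_nil_or_concat' l with rfl | ⟨s, c, rfl⟩
    · rw [ofWords_word, contract, block_of_lt _ _ (by simp)]
      rfl
    · have hr : (a :: (s ++ [c])).rotate (s ++ [c]).length = c :: a :: s := by
        simp
      rw [hr, onLast_append_singleton, ofWords_word]
      exact contract_append [] s c a rfl rfl

theorem boundary_boundary (x : TensorAlgebra k A) : boundary k A (boundary k A x) = 0 := by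
  have : boundary k A ∘ₗ boundary k A = 0 := by
    refine ext_word fun l => ?_
    rw [LinearMap.comp_apply, boundary_word, linear_hochSum, hochSum_congr fun t _ => boundary_word
      t, hochSum_hochSum, LinearMap.zero_apply]
  exact LinearMap.congr_fun this x

theorem chains_eq_span (r : ℕ) :
    chains k A r = Submodule.span k {x | ∃ l : List A, l.length = r + 1 ∧ word k l = x} := by
  rw [chains]
  congr 1
  ext x
  constructor
  · rintro ⟨a, rfl⟩
    exact ⟨List.ofFn a, by simp, (tprod_eq_word a).symm⟩
  · rintro ⟨l, hl, rfl⟩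
    obtain ⟨a, rfl⟩ := exists_ofFn hl
    exact ⟨a, tprod_eq_word a⟩

theorem word_mem_chains {l : List A} (hl : l.length = r + 1) : word k l ∈ chains k A r := by
  rw [chains_eq_span]
  exact Submodule.subset_span ⟨l, hl, rfl⟩

theorem chains_le {S : Submodule k (TensorAlgebra k A)}
    (h : ∀ (a : A) (l : List A), l.length = r → word k (a :: l) ∈ S) : chains k A r ≤ S := by
  rw [chains_eq_span, Submodule.span_le]
  rintro _ ⟨l, hl, rfl⟩
  obtain ⟨a, l, rfl⟩ := List.exists_cons_of_length_eq_add_one hl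
  exact h a l (by simpa using hl)

theorem eqOn_chains {φ ψ : TensorAlgebra k A →ₗ[k] X}
    (h : ∀ (a : A) (l : List A), l.length = r → φ (word k (a :: l)) = ψ (word k (a :: l)))
    {x : TensorAlgebra k A} (hx : x ∈ chains k A r) : φ x = ψ x :=
  chains_le (S := LinearMap.eqLocus φ ψ) h hx

theorem mergeSum_mem_submodule {S : Submodule k X} {l : List A}
    (h : ∀ (b : A) (t : List A), t.length + 2 = l.length → φ (b :: t) ∈ S) : mergeSum φ l ∈ S := by
  have := linear_mergeSum S.mkQ φ l
  have h' : mergeSum (fun t => S.mkQ (φ t)) l = mergeSum (fun _ => 0) l :=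
    mergeSum_congr_cons fun b t ht => (Submodule.Quotient.mk_eq_zero S).2 (h b t ht)
  rw [h', mergeSum_zero] at this
  exact (Submodule.Quotient.mk_eq_zero S).1 this

theorem hochSum_mem_submodule {S : Submodule k X} {l : List A}
    (h : ∀ t : List A, t.length + 1 = l.length → φ t ∈ S) : hochSum k φ l ∈ S := by
  have := linear_hochSum S.mkQ φ l
  have h' : hochSum k (fun t => S.mkQ (φ t)) l = hochSum k (fun _ => 0) l :=
    hochSum_congr fun t ht => (Submodule.Quotient.mk_eq_zero S).2 (h t ht)
  rw [h'] at this
  have h0 : hochSum k (fun _ : List A => (0 : X ⧸ S)) l = 0 := by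
    have := linear_hochSum (k := k) (0 : X →ₗ[k] X ⧸ S) φ l
    simpa using this.symm
  rw [h0] at this
  exact (Submodule.Quotient.mk_eq_zero S).1 this

theorem boundary_mem_chains {x : TensorAlgebra k A} (hx : x ∈ chains k A (r + 1)) :
    boundary k A x ∈ chains k A r := by
  refine chains_le (S := (chains k A r).comap (boundary k A)) (fun a l hl => ?_) hx
  rw [Submodule.mem_comap, boundary_word]
  refine hochSum_mem_submodule fun t ht => word_mem_chains ?_
  simp at ht
  omega

theorem boundary_chains_zero {x : TensorAlgebra k A} (hx : x ∈ chains k A 0) :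
    boundary k A x = 0 := by
  refine eqOn_chains (φ := boundary k A) (ψ := 0) (fun a l hl => ?_) hx
  obtain rfl : l = [] := by simpa using hl
  rw [boundary_word, hochSum_cons]
  simp

/-! ### Degenerate chains -/

section Degenerate

variable (k A)

/-- The span of the words with `n` letters and a letter `1` in one of the places `1, …, j`. -/
def unitChains (j n : ℕ) : Submodule k (TensorAlgebra k A) :=
  Submodule.span k {x | ∃ (a : A) (p q : List A), p.length < j ∧ p.length + q.length + 2 = n ∧
    word k (a :: p ++ 1 :: q) = x}

variable {k A}

theorem unitChains_zero (n : ℕ) : unitChains k A 0 n = ⊥ := by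
  rw [unitChains, Submodule.span_eq_bot]
  rintro _ ⟨a, p, q, h, -⟩
  omega

theorem word_mem_unitChains {j : ℕ} {a : A} {p q : List A} (h : p.length < j)
    (hn : p.length + q.length + 2 = n) : word k (a :: p ++ 1 :: q) ∈ unitChains k A j n :=
  Submodule.subset_span ⟨a, p, q, h, hn, rfl⟩

theorem unitChains_le {j : ℕ} {S : Submodule k (TensorAlgebra k A)}
    (h : ∀ (a : A) (p q : List A), p.length < j → p.length + q.length + 2 = n → word k (a :: p ++ 1 :: q) ∈ S) :
    unitChains k A j n ≤ S := by
  rw [unitChains, Submodule.span_le]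
  rintro _ ⟨a, p, q, h1, h2, rfl⟩
  exact h a p q h1 h2

theorem unitChains_mono {i j : ℕ} (h : i ≤ j) (n : ℕ) :
    unitChains k A i n ≤ unitChains k A j n := by
  refine Submodule.span_mono ?_
  rintro _ ⟨a, p, q, h1, h2, rfl⟩
  exact ⟨a, p, q, by omega, h2, rfl⟩

theorem unitChains_le_chains (j n : ℕ) : unitChains k A j (n + 1) ≤ chains k A n := by
  refine unitChains_le fun a p q h1 h2 => ?_
  exact word_mem_chains (by simp; omega)

/-- The two products that absorb the unit cancel; if the unit is the last letter, one of them is the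
wrap-around term. -/
theorem hochSum_unit (φ : List A → X) (a : A) (p q : List A) : hochSum k φ (a :: p ++ 1 :: q) =
      mergeSum (fun t => φ (t ++ 1 :: q)) (a :: p) +
      ε ^ p.length • mergeSum (fun t => φ (a :: p ++ 1 :: t)) q -
      ε ^ (p.length + q.length) • onLast (fun t c => φ ((c * a) :: p ++ 1 :: t)) q := by
  rw [List.cons_append, hochSum_cons, ← List.cons_append, mergeSum_append_cons k]
  have h1 : onLast (fun p' a => φ (p' ++ (a * 1) :: q)) (a :: p) = φ (a :: p ++ q) := by
    rcases List.eq_nil_or_concat' p with rfl | ⟨s, c, rfl⟩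
    · simp
    · rw [← List.cons_append, onLast_append_singleton]
      simp
  rw [h1]
  rcases List.eq_nil_or_concat' q with rfl | ⟨s, c, rfl⟩
  · simp only [onHead_nil, mergeSum_nil, smul_zero, sub_zero, add_zero, onLast_nil,
      onLast_append_singleton, one_mul, List.append_nil, List.length_append, List.length_cons,
      List.length_nil, pow_succ]
    module
  · have h2 : onHead (fun b q' => φ (a :: p ++ (1 * b) :: q')) (s ++ [c]) =
        φ (a :: p ++ (s ++ [c])) := by
      cases s <;> simp
    have h3 : p ++ 1 :: (s ++ [c]) = (p ++ 1 :: s) ++ [c] := by simp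
    rw [h2, h3, onLast_append_singleton, onLast_append_singleton]
    simp only [List.length_append, List.length_cons, List.length_nil, pow_succ, pow_add,
      List.cons_append]
    module

theorem boundary_unit_word (a : A) (p q : List A) : boundary k A (word k (a :: p ++ 1 :: q)) =
      mergeSum (fun t => word k (t ++ 1 :: q)) (a :: p) +
      ε ^ p.length • mergeSum (fun t => word k (a :: p ++ 1 :: t)) q -
      ε ^ (p.length + q.length) •
        onLast (fun t c => word k ((c * a) :: p ++ 1 :: t)) q := by rw [boundary_word, hochSum_unit]

theorem boundary_mem_unitChains {j : ℕ} {x : TensorAlgebra k A}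
    (hx : x ∈ unitChains k A j (n + 1)) : boundary k A x ∈ unitChains k A j n := by
  suffices h : unitChains k A j (n + 1) ≤ (unitChains k A j n).comap (boundary k A) from h hx
  refine unitChains_le fun a p q h1 h2 => ?_
  rw [Submodule.mem_comap, boundary_unit_word]
  refine sub_mem (add_mem ?_ (Submodule.smul_mem _ _ ?_)) (Submodule.smul_mem _ _ ?_)
  · refine mergeSum_mem_submodule fun b t ht => ?_
    simp only [List.length_cons] at ht
    exact word_mem_unitChains (by omega) (by omega)
  · exact mergeSum_mem_submodule fun b t ht =>
      word_mem_unitChains h1 (by simp only [List.length_cons]; omega)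
  · rcases List.eq_nil_or_concat' q with rfl | ⟨s, c, rfl⟩
    · simp
    · rw [onLast_append_singleton]
      simp only [List.length_append, List.length_cons, List.length_nil] at h2
      exact word_mem_unitChains h1 (by omega)

/-- Insertion of a letter `1` in the place `j`. -/
def insertUnit (j : ℕ) : TensorAlgebra k A →ₗ[k] TensorAlgebra k A :=
  wordMap (splitSum fun p q => (if p.length = j then (1 : k) else 0) • word k (p ++ 1 :: q))
    (LetterLinear.splitSum (fun q => LetterLinear.length_smul (W := fun p => word k (p ++ 1 :: q))
        (by simpa using (LetterLinear.word k).around [] (1 :: q))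
        (fun n => if n = j then (1 : k) else 0))
      (fun p => (((LetterLinear.word k).around (p ++ [1]) []).map
        (LinearMap.lsmul k _ (if p.length = j then (1 : k) else 0))).of_eq (fun q => by simp)))

theorem insertUnit_word (p q : List A) :
    insertUnit p.length (word k (p ++ q)) = word k (p ++ 1 :: q) := by
  rw [insertUnit, wordMap_word, splitSum_eq_of_length _ p q, if_pos rfl, one_smul]
  intro s t _ h
  rw [if_neg h, zero_smul]

theorem insertUnit_word_of_eq {j : ℕ} {p q : List A} (h : p.length = j) :
    insertUnit j (word k (p ++ q)) = word k (p ++ 1 :: q) := by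
  subst h
  exact insertUnit_word p q

theorem insertUnit_mem_unitChains {i j : ℕ} (hij : i ≤ j) {x : TensorAlgebra k A}
    (hx : x ∈ unitChains k A i n) : insertUnit (j + 1) x ∈ unitChains k A i (n + 1) := by
  suffices h : unitChains k A i n ≤ (unitChains k A i (n + 1)).comap (insertUnit (j + 1)) from h hx
  refine unitChains_le fun a p q h1 h2 => ?_
  rw [Submodule.mem_comap]
  -- Words too short to have a place `j + 1` are sent to zero.
  by_cases h : j - p.length - 1 ≤ q.length
  · obtain ⟨s, t, rfl, hs⟩ : ∃ s t, s ++ t = q ∧ s.length = j - p.length - 1 :=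
      ⟨q.take (j - p.length - 1), q.drop (j - p.length - 1), by simp, by simp [h]⟩
    have e : a :: p ++ 1 :: (s ++ t) = (a :: p ++ 1 :: s) ++ t := by simp
    rw [e, insertUnit_word_of_eq (by simp; omega), List.append_assoc, List.cons_append (a := (1 : A))]
    simp only [List.length_append] at h2
    exact word_mem_unitChains h1 (by simp; omega)
  · have e : insertUnit (j + 1) (word k (a :: p ++ 1 :: q)) = 0 := by
      rw [insertUnit, wordMap_word]
      refine (splitSum_congr (G := fun _ _ => 0) fun s t hst => ?_).trans (splitSum_zero _)
      have := congrArg List.length hst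
      simp at this
      rw [if_neg (by omega), zero_smul]
    rw [e]
    exact zero_mem _

/-- Doubling a unit in place `j + 1` contracts the chains with a unit up to that place, modulo those
with a unit up to place `j`. The products behind the units cancel between the two composites,
merging around the pair of units restores the word, and products before the units move a unit to an
earlier place. -/
theorem insertUnit_homotopy {j : ℕ} {x : TensorAlgebra k A}
    (hx : x ∈ unitChains k A (j + 1) (n + 1)) :
    boundary k A (insertUnit (j + 1) x) + insertUnit (j + 1) (boundary k A x) - ε ^ j • x ∈
      unitChains k A j (n + 1) := by
  suffices h : unitChains k A (j + 1) (n + 1) ≤ (unitChains k A j (n + 1)).comap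
      (boundary k A ∘ₗ insertUnit (j + 1) + insertUnit (j + 1) ∘ₗ boundary k A -
        ε ^ j • LinearMap.id) from h hx
  refine unitChains_le fun a p q h1 h2 => ?_
  rw [Submodule.mem_comap]
  simp only [LinearMap.sub_apply, LinearMap.add_apply, LinearMap.comp_apply, LinearMap.smul_apply,
    LinearMap.id_apply]
  rcases Nat.lt_succ_iff_lt_or_eq.1 h1 with h | rfl
  · have hw : word k (a :: p ++ 1 :: q) ∈ unitChains k A j (n + 1) := word_mem_unitChains h h2
    exact sub_mem (add_mem (boundary_mem_unitChains (insertUnit_mem_unitChains le_rfl hw))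
      (insertUnit_mem_unitChains le_rfl (boundary_mem_unitChains hw))) (Submodule.smul_mem _ _ hw)
  · have e1 : insertUnit (p.length + 1) (word k (a :: p ++ 1 :: q)) =
        word k (a :: p ++ 1 :: 1 :: q) := insertUnit_word_of_eq (by simp)
    have e2 : insertUnit (p.length + 1) (mergeSum (fun t => word k (a :: p ++ 1 :: t)) q) =
        mergeSum (fun t => word k (a :: p ++ 1 :: 1 :: t)) q := by
      rw [linear_mergeSum]
      exact mergeSum_congr fun t _ => insertUnit_word_of_eq (by simp)
    have e3 : insertUnit (p.length + 1) (onLast (fun t c => word k ((c * a) :: p ++ 1 :: t)) q) =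
        onLast (fun t c => word k ((c * a) :: p ++ 1 :: 1 :: t)) q := by
      rw [linear_onLast]
      exact onLast_congr fun t c _ => insertUnit_word_of_eq (by simp)
    have m1 : mergeSum (fun t => word k (t ++ 1 :: 1 :: q)) (a :: p) ∈
        unitChains k A p.length (n + 1) :=
      mergeSum_mem_submodule fun b t ht => by
        simp only [List.length_cons] at ht
        exact word_mem_unitChains (by omega) (by simp; omega)
    have m2 : insertUnit (p.length + 1) (mergeSum (fun t => word k (t ++ 1 :: q)) (a :: p)) ∈
        unitChains k A p.length (n + 1) := by
      refine insertUnit_mem_unitChains le_rfl (mergeSum_mem_submodule fun b t ht => ?_)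
      simp only [List.length_cons] at ht
      exact word_mem_unitChains (by omega) (by omega)
    rw [e1, boundary_unit_word, boundary_unit_word, map_sub, map_add, map_smul, map_smul, e2, e3]
    have e4 : mergeSum (fun t => word k (a :: p ++ 1 :: t)) (1 :: q) =
        onHead (fun _ _ => word k (a :: p ++ 1 :: q)) q -
          mergeSum (fun t => word k (a :: p ++ 1 :: 1 :: t)) q := by
      rw [mergeSum_cons]
      congr 1
      exact onHead_congr fun c s h => by rw [one_mul, h]
    have e5 : ε ^ (p.length + (1 :: q).length) •
        onLast (fun t c => word k ((c * a) :: p ++ 1 :: t)) (1 :: q) =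
        ε ^ (p.length + 1) • (word k (a :: p ++ 1 :: q) -
          onHead (fun _ _ => word k (a :: p ++ 1 :: q)) q) -
        ε ^ (p.length + q.length) • onLast (fun t c => word k ((c * a) :: p ++ 1 :: 1 :: t)) q := by
      rcases List.eq_nil_or_concat' q with rfl | ⟨s, c, rfl⟩
      · simp
      · rw [← List.cons_append, onLast_append_singleton, onLast_append_singleton]
        cases s <;> simp [pow_succ, pow_add]
    rw [e4, e5]
    convert add_mem m1 m2 using 1
    rw [pow_succ]
    module

/-- Tor is computed here by all chains, whereas κ only sees normalized words; the acyclicity of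
degenerate chains bridges the gap. The induction lowers the last admissible place of the unit by
`insertUnit_homotopy`. -/
theorem exists_boundary_of_mem_unitChains {j : ℕ} {x : TensorAlgebra k A}
    (hx : x ∈ unitChains k A j (n + 1)) (hb : boundary k A x = 0) :
    ∃ y ∈ unitChains k A j (n + 2), boundary k A y = x := by
  induction j generalizing x with
  | zero =>
    rw [unitChains_zero] at hx
    exact ⟨0, zero_mem _, by rw [map_zero, (Submodule.mem_bot k).1 hx]⟩
  | succ j ih =>
    have h := insertUnit_homotopy hx
    rw [hb, map_zero, add_zero] at h
    obtain ⟨y, hy, hyx⟩ := ih h (by rw [map_sub, boundary_boundary, map_smul, hb]; simp)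
    refine ⟨ε ^ j • (insertUnit (j + 1) x - y), Submodule.smul_mem _ _
      (sub_mem ?_ (unitChains_mono (Nat.le_succ j) _ hy)), ?_⟩
    · have : unitChains k A (j + 1) (n + 1) ≤
          (unitChains k A (j + 1) (n + 2)).comap (insertUnit (j + 1)) := by
        refine unitChains_le fun a p q h1 h2 => ?_
        rw [Submodule.mem_comap]
        rcases Nat.lt_succ_iff_lt_or_eq.1 h1 with h | rfl
        · exact unitChains_mono (Nat.le_succ j) _
            (insertUnit_mem_unitChains le_rfl (word_mem_unitChains h h2))
        · rw [insertUnit_word_of_eq (by simp)]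
          exact word_mem_unitChains h1 (by simp; omega)
      exact this hx
    · rw [map_smul, map_sub, hyx]
      rcases neg_one_pow_eq_or k j with h | h <;> rw [h] <;> module

end Degenerate

/-! ### Chains and invariant words -/

variable (k) in
/-- `a₀ ⊗ ⋯ ⊗ a_r ↦ ∑ e_i a₀ ⊗ a₁ ⊗ ⋯ ⊗ a_r ⊗ f_i` -/
def casimirMap (e f : ι → A) : TensorAlgebra k A →ₗ[k] Bar k A :=
  ∑ i, mulR (bword k [f i]) ∘ₗ (toBar k A).toLinearMap ∘ₗ leftWords (e i)

theorem casimirMap_word (a : A) (l : List A) :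
    casimirMap k e f (word k (a :: l)) = ∑ i, bword k ((e i * a) :: l ++ [f i]) := by
  rw [casimirMap, LinearMap.sum_apply]
  refine Finset.sum_congr rfl fun i _ => ?_
  rw [LinearMap.comp_apply, LinearMap.comp_apply, leftWords_word, mulR_apply, bword_append]
  rfl

theorem casimirMap_mem (hz : z ∈ chains k A r) : casimirMap k e f z ∈ barLength k A (r + 2) := by
  refine chains_le (S := (barLength k A (r + 2)).comap (casimirMap k e f)) (fun a l hl => ?_) hz
  rw [Submodule.mem_comap, casimirMap_word]
  refine sum_mem fun i _ => ?_
  have := bword_mem_barLength (k := k) ((e i * a) :: l ++ [f i])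
  simpa [hl] using this

theorem bword_ends_left (a b : A) (l t : List A) :
    IsLinearMap k fun x => bword k ((a * x * b) :: l ++ t) := by
  have h := (LetterLinear.bword k).isLinearMap ([] : List A) (l ++ t)
  refine ⟨fun x y => ?_, fun c x => ?_⟩
  · rw [mul_add, add_mul]
    exact h.map_add _ _
  · rw [mul_smul_comm, smul_mul_assoc]
    exact h.map_smul _ _

theorem bword_ends_right (a b : A) (t : List A) :
    IsLinearMap k fun x => bword k (t ++ [a * x * b]) := by
  have h := (LetterLinear.bword k).isLinearMap t []
  refine ⟨fun x y => ?_, fun c x => ?_⟩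
  · rw [mul_add, add_mul]
    exact h.map_add _ _
  · rw [mul_smul_comm, smul_mul_assoc]
    exact h.map_smul _ _

theorem casimir_slide (h : IsCasimir form e f) (a b : A) (l : List A) :
    ∑ i, bword k ((e i * (a * b)) :: l ++ [f i]) = ∑ i, bword k ((e i * b) :: l ++ [a * f i]) := by
  have := h.slide (B := fun x y => bword k ((x * b) :: l ++ [y]))
    (fun y => by simpa using bword_ends_left 1 b l [y])
    (fun x => by simpa using bword_ends_right 1 1 ((x * b) :: l)) a
  simpa [mul_assoc] using this

theorem casimir_slide_out (h : IsCasimir form e f) (a b : A) (l : List A) :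
    ∑ i, bword k ((a * e i * b) :: l ++ [f i]) = ∑ i, bword k ((e i * b) :: l ++ [f i * a]) :=
  h.slide_out (B := fun x y => bword k ((x * b) :: l ++ [y]))
    (fun y => by simpa using bword_ends_left 1 b l [y])
    (fun x => by simpa using bword_ends_right 1 1 ((x * b) :: l)) a

theorem barLeft_casimirMap (h : IsCasimir form e f) (a : A) (hz : z ∈ chains k A r) :
    barLeft a (casimirMap k e f z) = barRight a (casimirMap k e f z) := by
  refine eqOn_chains (φ := barLeft a ∘ₗ casimirMap k e f) (ψ := barRight a ∘ₗ casimirMap k e f)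
    (fun b l _ => ?_) hz
  rw [LinearMap.comp_apply, LinearMap.comp_apply, casimirMap_word, map_sum, map_sum]
  have := casimir_slide_out (k := k) h a b l
  simp only [List.cons_append, barLeft_bword, ← mul_assoc]
  simp only [← List.cons_append, barRight_bword]
  exact this

/-- The wrap-around term of ∂ corresponds to the face in which the last letter is multiplied into
f_i: the Casimir pair carries this factor to the front. -/
theorem barD_casimirMap (h : IsCasimir form e f) (hz : z ∈ chains k A (r + 1)) :
    barD (casimirMap k e f z) = casimirMap k e f (boundary k A z) := by
  refine eqOn_chains (φ := barD ∘ₗ casimirMap k e f)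
    (ψ := casimirMap k e f ∘ₗ boundary k A) (fun a l hl => ?_) hz
  rw [LinearMap.comp_apply, LinearMap.comp_apply, casimirMap_word, boundary_word, linear_hochSum,
    hochSum_cons, map_sum]
  obtain ⟨b, t, rfl⟩ := List.exists_cons_of_length_eq_add_one hl
  obtain ⟨s, c, hs, -⟩ := exists_append_singleton hl
  have h1 : mergeSum (fun t => casimirMap k e f (word k t)) (a :: b :: t) =
      ∑ i, mergeSum (fun t => bword k (t ++ [f i])) ((e i * a) :: b :: t) := by
    simp only [mergeSum_cons_cons, Finset.sum_sub_distrib, casimirMap_word, mul_assoc,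
      mergeSum_finsum, List.cons_append]
  rw [h1, hs, onLast_append_singleton, casimirMap_word, casimir_slide h, Finset.smul_sum, ←
    Finset.sum_add_distrib]
  refine Finset.sum_congr rfl fun i _ => ?_
  rw [barD_bword, mergeSum_append_cons k, ← List.cons_append, onLast_append_singleton]
  simp only [onHead_nil, mergeSum_nil, smul_zero, sub_zero, add_zero, List.cons_append,
    List.length_cons, pow_succ]
  module

theorem casimirMap_unitChains {j : ℕ} (hz : z ∈ unitChains k A j n) : casimirMap k e f z = 0 := by
  refine unitChains_le (S := LinearMap.ker (casimirMap k e f)) (fun a p q _ _ => ?_) hz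
  rw [LinearMap.mem_ker, List.cons_append, casimirMap_word]
  refine Finset.sum_eq_zero fun i _ => ?_
  have := bword_eq_zero (k := k) ((e i * a) :: p) (q ++ [f i]) (by simp) (by simp)
  simpa using this

theorem LetterLinear.lastToHead (hW : LetterLinear k W) :
    LetterLinear k (onLast fun t c => W (c :: t)) where
  add p q a b := by
    rcases List.eq_nil_or_concat' q with rfl | ⟨s, c, rfl⟩
    · simp only [onLast_append_singleton]
      exact hW.add [] p a b
    · simp only [← List.cons_append, ← List.append_assoc, onLast_append_singleton]
      exact hW.add (c :: p) s a b
  smul p q c a := by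
    rcases List.eq_nil_or_concat' q with rfl | ⟨s, b, rfl⟩
    · simp only [onLast_append_singleton]
      exact hW.smul [] p c a
    · simp only [← List.cons_append, ← List.append_assoc, onLast_append_singleton]
      exact hW.smul (b :: p) s c a

/-- `x₀ ⊗ x₁ ⊗ ⋯ ⊗ x_r ⊗ x_{r+1} ↦ ⟨1, x₀⟩ x_{r+1} ⊗ x₁ ⊗ ⋯ ⊗ x_r`, modulo degenerate chains -/
def closeUp (form : LinearMap.BilinForm k A) (r : ℕ) :
    Bar k A →ₗ[k] TensorAlgebra k A ⧸ unitChains k A r (r + 1) :=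
  barMap (fun l => (unitChains k A r (r + 1)).mkQ (onHead (fun x t => form 1 x •
      onLast (fun u c => (if (c :: u).length = r + 1 then (1 : k) else 0) • word k (c :: u)) t) l))
    (((LetterLinear.lastToHead ((LetterLinear.word k).length_smul
      (fun n => if n = r + 1 then (1 : k) else 0))).scalarHead (form 1)).map _) (by
      intro p q hp hq
      obtain ⟨x, p, rfl⟩ := List.exists_cons_of_ne_nil hp
      rcases List.eq_nil_or_concat' q with rfl | ⟨q, c, rfl⟩
      · exact absurd rfl hq
      · rw [List.cons_append, onHead_cons, ← List.cons_append, ← List.append_assoc,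
          onLast_append_singleton, map_smul, map_smul]
        split_ifs with h
        · simp only [List.length_append, List.length_cons] at h
          rw [← List.cons_append, Submodule.mkQ_apply, (Submodule.Quotient.mk_eq_zero _).2
            (word_mem_unitChains (by omega) (by omega)), smul_zero, smul_zero]
        · rw [zero_smul, smul_zero])

/-- The functional ⟨1, −⟩ on e_i a turns f_i back into `a`, so the Casimir map has a left inverse
modulo degenerate chains. The quotient is needed for the inverse to be defined on normalized words.
-/
theorem closeUp_casimirMap (h : IsCasimir form e f) (hz : z ∈ chains k A r) :
    closeUp form r (casimirMap k e f z) = (unitChains k A r (r + 1)).mkQ z := by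
  refine eqOn_chains (φ := closeUp form r ∘ₗ casimirMap k e f)
    (ψ := (unitChains k A r (r + 1)).mkQ) (fun a l hl => ?_) hz
  rw [LinearMap.comp_apply, casimirMap_word, map_sum]
  have h1 : ∀ i, closeUp form r (bword k ((e i * a) :: l ++ [f i])) =
      (unitChains k A r (r + 1)).mkQ (form (e i) a • word k (f i :: l)) := by
    intro i
    rw [closeUp, barMap_bword, List.cons_append, onHead_cons, onLast_append_singleton, if_pos (by
      simp [hl]), one_smul, h.form_one]
  rw [Finset.sum_congr rfl fun i _ => h1 i, ← map_sum]
  have h2 := isLinearMap_sum ((LetterLinear.word k).isLinearMap ([] : List A) l)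
    (fun i => form (e i) a) f
  rw [h.left] at h2
  exact congrArg _ h2.symm

theorem mem_unitChains_of_casimirMap_eq_zero (h : IsCasimir form e f) (hz : z ∈ chains k A r)
    (h0 : casimirMap k e f z = 0) : z ∈ unitChains k A r (r + 1) := by
  have := closeUp_casimirMap h hz
  rw [h0, map_zero] at this
  exact (Submodule.Quotient.mk_eq_zero _).1 this.symm

/-- In the expansion of `sum_headForm_barLeft` invariance replaces the left action of f_i by the
right one. A word b ⊗ s ⊗ c then becomes ⟨1, b⟩ ∑ e_i ⊗ s ⊗ c f_i, the Casimir image of ⟨1, b⟩ c ⊗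
s. -/
theorem exists_casimirMap_eq (h : IsCasimir form e f) (hx : x ∈ barLength k A (r + 2))
    (hinv : ∀ a, barLeft a x = barRight a x) : ∃ z ∈ chains k A r, casimirMap k e f z = x := by
  have := barLength_le (S := ((chains k A r).map (casimirMap k e f)).comap
    (∑ i, headForm form (e i) ∘ₗ barRight (f i))) (fun l hl => ?_) hx
  · rw [← sum_headForm_barLeft h hx]
    simpa [LinearMap.sum_apply, hinv] using this
  obtain ⟨s, c, rfl, hs⟩ := exists_append_singleton hl
  obtain ⟨b, s, rfl⟩ := List.exists_cons_of_length_eq_add_one hs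
  refine ⟨form 1 b • word k (c :: s), Submodule.smul_mem _ _ (word_mem_chains hs), ?_⟩
  have h1 := casimir_slide (k := k) h c 1 s
  simp only [mul_one] at h1
  rw [map_smul, casimirMap_word, h1, Finset.smul_sum, LinearMap.sum_apply]
  refine Finset.sum_congr rfl fun i _ => ?_
  rw [LinearMap.comp_apply, barRight_bword, List.cons_append, List.cons_append, headForm_bword]

/-! ### The cochains of chains -/

theorem ev_tprod {u : List A} (hu : u.length = m) :
    ev ((toBar k A).toLinearMap.compMultilinearMap (TensorAlgebra.tprod k A m)) u = bword k u := by
  subst hu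
  rw [ev_of_eq _ rfl, ← toBar_word, word_eq_tprod]
  rfl

variable (k) in
/-- `a₀ ⊗ ⋯ ⊗ a_r ↦ ((b₁, …, b_m) ↦ ∑ d(e_i a₀ ⊗ a₁ ⊗ ⋯ ⊗ a_r ⊗ f_i ⊗ b₁ ⊗ ⋯ ⊗ b_m ⊗ 1))` -/
def kappaMap (e f : ι → A) (m : ℕ) (z : TensorAlgebra k A) : Multi m (Bar k A) :=
  (dOne ∘ₗ mulL (casimirMap k e f z)).compMultilinearMap
    ((toBar k A).toLinearMap.compMultilinearMap (TensorAlgebra.tprod k A m))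

theorem ev_kappaMap (z : TensorAlgebra k A) {u : List A} (hu : u.length = m) :
    ev (kappaMap k e f m z) u = dOne (casimirMap k e f z * bword k u) := by
  rw [kappaMap, ev_comp, ev_tprod hu]
  rfl

theorem kappa_eq [FiniteDimensional k A] {hf : IsSymmetrizing form}
    (h : casimir hf = ∑ i, e i ⊗ₜ[k] f i) (m : ℕ) (z : TensorAlgebra k A) :
    kappa hf m z = kappaMap k e f m z := by
  refine ext_ev fun u hu => ?_
  rw [kappa, ev_comp, ev_tprod hu, ev_kappaMap z hu, h, map_sum, map_sum, casimirMap,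
    LinearMap.sum_apply, LinearMap.comp_apply, LinearMap.mulLeft_apply]
  congr 2
  refine Finset.sum_congr rfl fun i _ => ?_
  rw [TensorProduct.lift.tmul, LinearMap.comp_apply, LinearMap.comp_apply, mulR_apply, ← toBar_word,
    word_singleton]
  exact map_mul (toBar k A) _ _

theorem kappaMap_add (m : ℕ) (z w : TensorAlgebra k A) :
    kappaMap k e f m (z + w) = kappaMap k e f m z + kappaMap k e f m w := by
  refine ext_ev fun u hu => ?_
  rw [ev_add, ev_kappaMap _ hu, ev_kappaMap _ hu, ev_kappaMap _ hu, map_add, add_mul, map_add]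

theorem kappaMap_smul (m : ℕ) (c : k) (z : TensorAlgebra k A) :
    kappaMap k e f m (c • z) = c • kappaMap k e f m z := by
  refine ext_ev fun u hu => ?_
  rw [ev_smul, ev_kappaMap _ hu, ev_kappaMap _ hu, map_smul, bar_smul_mul, map_smul]

theorem kappaMap_zero (m : ℕ) : kappaMap k e f m 0 = 0 := by
  simpa using kappaMap_smul (k := k) (e := e) (f := f) m 0 0

theorem kappaMap_mem (hz : z ∈ chains k A r) (hp : r + m + 1 = p) :
    kappaMap k e f m z ∈ CΩ p m := by
  subst hp
  refine mem_cochains ?_ ?_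
  · intro u hu
    rw [ev_kappaMap z hu, dOne_apply]
    refine barD_mem_Omega ?_
    have h1 := bword_mem_barLength (k := k) u
    rw [hu] at h1
    have h2 := mul_mem_barLength (mul_mem_barLength (casimirMap_mem (e := e) (f := f) hz) h1)
      (letter_mem (k := k) (1 : A))
    have e1 : r + 2 + m + 1 = r + m + 1 + 2 := by omega
    rwa [e1] at h2
  · intro s t hst
    rw [ev_kappaMap z (by simp; omega)]
    have h0 : casimirMap k e f z * bword k (s ++ 1 :: t) * bword k [1] = 0 := by
      have e1 : bword k (s ++ 1 :: t) = bword k s * bword k [1] * bword k t := by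
        rw [bword_append, bword_cons, mul_assoc]
      have h1 := mul_mem_barLength (casimirMap_mem (e := e) (f := f) hz) (bword_mem_barLength s)
      have h2 := mul_mem_barLength (bword_mem_barLength (k := k) t) (letter_mem (k := k) (1 : A))
      have e2 : r + 2 + s.length = r + 1 + s.length + 1 := by omega
      rw [e2] at h1
      have h3 := mul_unit_mul h1 h2
      simp only [mul_assoc] at h3
      rw [e1]
      simp only [mul_assoc]
      exact h3
    rw [dOne_apply, h0, map_zero]

/-- `kappaMap` as a cochain. -/
def kappaCochain (e f : ι → A) (hz : z ∈ chains k A r) (hp : r + m + 1 = p) : CΩ p m :=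
  ⟨kappaMap k e f m z, kappaMap_mem hz hp⟩

/-- When θ is applied to d(Y ⊗ 1), the term dY ⊗ 1 ⊗ b vanishes by normalization. So κ in every
degree comes from degree 0 by iterating θ, and questions about κ reduce to low degree. -/
theorem theta_kappaCochain (hz : z ∈ chains k A r) (hp : r + m + 1 = p) :
    theta (kappaCochain e f (m := m) hz hp) = kappaMap k e f (m + 1) z := by
  subst hp
  refine ext_ev fun u hu => ?_
  obtain ⟨w, b, rfl, hw⟩ := exists_append_singleton hu
  have hY : casimirMap k e f z * bword k w ∈ barLength k A (r + 2 + m) := by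
    rw [← hw]
    exact mul_mem_barLength (casimirMap_mem hz) (bword_mem_barLength w)
  have e1 : ev (kappaCochain e f (m := m) hz rfl).1 w =
      dOne (casimirMap k e f z * bword k w) := ev_kappaMap z hw
  rw [ev_theta _ w hw, e1, ev_kappaMap z hu, dOne_apply, dOne_apply, bword_append, ← mul_assoc]
  generalize casimirMap k e f z * bword k w = Y at hY
  have hY1 : Y ∈ barLength k A (r + 1 + m + 1) := by
    have : r + 1 + m + 1 = r + 2 + m := by omega
    rwa [this]
  have hdY : barD Y ∈ barLength k A (r + m + 1) := by
    have := barD_mem_barLength hY1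
    have h2 : r + m + 1 = r + 1 + m := by omega
    rwa [h2]
  rw [barD_mul_letter 1 hY, barD_mul_letter 1 (mul_mem_barLength hY (letter_mem b)), barD_mul_letter
    b hY, barRight_unit hY1, map_add, map_smul, barRight_mul_letter, one_mul, barRight_unit (n := r
    + 2 + m) (mul_mem_barLength hY (letter_mem b)), add_mul, add_mul, mul_unit_mul (l := 0) hdY
    (letter_mem b), bar_smul_mul, bar_smul_mul, pow_succ _ (r + 2 + m + 1), zero_add]
  module

theorem theta_sub_eq {g g' g'' : CΩ p m} (h : g''.1 = g.1 - g'.1) :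
    theta g'' = theta g - theta g' := by
  refine ext_ev fun l hl => ?_
  obtain ⟨w, b, rfl, hw⟩ := exists_append_singleton hl
  rw [ev_sub, ev_theta _ w hw, ev_theta _ w hw, ev_theta _ w hw, h, ev_sub, map_sub, sub_mul,
    sub_mul]
  abel

theorem delta_zero_apply (g : Multi 0 (Bar k A)) (a : A) :
    ev (delta barLeft barRight 0 g) [a] = barLeft a (ev g []) - barRight a (ev g []) := by
  rw [ev_delta]
  simp [sub_eq_add_neg]

/-- In degree 0 the differential compares the two actions, which agree on Casimir images; only the
terms produced by d, that is by ∂, remain. The higher degrees follow since δ and θ commute. -/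
theorem delta_kappaMap (h : IsCasimir form e f) (m : ℕ) (hz : z ∈ chains k A (r + 1)) :
    delta barLeft barRight m (kappaMap k e f m z) =
      ε ^ (r + 1) • kappaMap k e f (m + 1) (boundary k A z) := by
  induction m with
  | zero =>
    refine ext_ev fun u hu => ?_
    obtain ⟨a, rfl⟩ := List.length_eq_one_iff.1 hu
    have hV := casimirMap_mem (e := e) (f := f) hz
    have hbz := boundary_mem_chains hz
    have hW := casimirMap_mem (e := e) (f := f) hbz
    have hd : barD (casimirMap k e f (boundary k A z)) = 0 := by
      rw [← barD_casimirMap h hz, barD_barD]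
    have hinv := barLeft_casimirMap h a hz
    have hinv' := barLeft_casimirMap h a hbz
    rw [delta_zero_apply, ev_smul, ev_kappaMap (u := []) (m := 0) z rfl,
      ev_kappaMap _ hu, dOne_apply, dOne_apply, bword_nil, mul_one]
    rw [barD_mul_letter 1 hV, barD_casimirMap h hz, barRight_unit (n := r + 1 + 1) hV,
      barD_mul_letter 1 (mul_mem_barLength hW (letter_mem a)), barD_mul_letter a hW, hd, zero_mul,
      zero_add, map_add, map_add, map_smul, map_smul, hinv, barLeft_mul_of_mem (n := r + 1) a hW,
      hinv', barRight_mul_letter, one_mul, barRight_unit (n := r + 2) (mul_mem_barLength hW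
      (letter_mem a)), bar_smul_mul]
    rcases neg_one_pow_eq_or k r with h | h <;> simp only [pow_succ, h] <;> module
  | succ m ih =>
    have h1 := delta_theta (kappaCochain e f (m := m) hz rfl)
    rw [theta_kappaCochain] at h1
    rw [h1, ← theta_kappaCochain (boundary_mem_chains hz) (m := m + 1) (p := r + 1 + m + 1) (by
      omega)]
    exact theta_smul_eq ih

theorem theta_mem_BOmega {g : CΩ p (m + 1)} (hg : g.1 ∈ BOmega k A (m + 1) p) :
    theta g ∈ BOmega k A (m + 1 + 1) (p + 1) := by
  obtain ⟨h, hh, hg⟩ := hg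
  refine ⟨theta ⟨h, hh⟩, theta_mem _, ?_⟩
  rw [delta_theta]
  exact congrArg theta (Subtype.ext hg)

theorem kappaMap_mem_ZOmega (h : IsCasimir form e f) (hp : r + 1 + m + 1 = p)
    (hz : z ∈ cycles k A (r + 1)) : kappaMap k e f m z ∈ ZOmega k A m p := by
  refine ⟨kappaMap_mem hz.1 hp, ?_⟩
  have h0 : boundary k A z = 0 := hz.2
  change delta barLeft barRight m _ = 0
  rw [delta_kappaMap h m hz.1, h0, kappaMap_zero, smul_zero]

theorem kappaMap_mem_BOmega (h : IsCasimir form e f) (hp : r + 1 + m + 1 = p)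
    (hz : z ∈ boundaries k A r) : kappaMap k e f (m + 1) z ∈ BOmega k A (m + 1) p := by
  obtain ⟨y, hy, rfl⟩ := hz
  refine ⟨ε ^ (r + 1) • kappaMap k e f m y, Submodule.smul_mem _ _ (kappaMap_mem hy hp), ?_⟩
  rw [map_smul, delta_kappaMap h m hy, smul_smul, ← pow_add, Even.neg_one_pow ⟨r + 1, rfl⟩, one_smul]

/-- Descending along θ to degree 0 leads to an invariant cycle of normalized words, which is a
Casimir image. -/
theorem kappaMap_surjective (h : IsCasimir form e f) (hp : r + 1 + (m + 1) + 1 = p)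
    (g : ZOmega k A (m + 1) p) :
    ∃ z ∈ cycles k A (r + 1), g.1 - kappaMap k e f (m + 1) z ∈ BOmega k A (m + 1) p := by
  induction m generalizing p with
  | zero =>
    obtain rfl : r + 2 + 1 = p := by omega
    obtain ⟨g', hg'⟩ := theta_surjective h g
    have hx : ev g'.1 [] ∈ barLength k A (r + 1 + 2) := (ev_mem_of_mem g'.2.1 []).1
    have hdx : barD (ev g'.1 []) = 0 := (ev_mem_of_mem g'.2.1 []).2
    obtain ⟨y, hy, hyx⟩ := exists_casimirMap_eq h hx (fun a => by
      have h1 : delta barLeft barRight 0 g'.1 = 0 := g'.2.2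
      have := delta_zero_apply g'.1 a
      rw [h1, ev_zero] at this
      exact (sub_eq_zero.1 this.symm))
    -- The chain `y` need not be a cycle, but the Casimir image of its boundary is zero, so the
    -- boundary is degenerate. A degenerate chain `w` with the same boundary repairs it.
    have hby : boundary k A y ∈ unitChains k A r (r + 1) :=
      mem_unitChains_of_casimirMap_eq_zero h (boundary_mem_chains hy)
        (by rw [← barD_casimirMap h hy, hyx, hdx])
    obtain ⟨w, hw, hwy⟩ := exists_boundary_of_mem_unitChains hby (boundary_boundary y)
    have hz : y - w ∈ chains k A (r + 1) := sub_mem hy (unitChains_le_chains _ _ hw)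
    have hVz : casimirMap k e f (y - w) = ev g'.1 [] := by
      rw [map_sub, casimirMap_unitChains hw, sub_zero, hyx]
    have hκ : g'.1 = ε ^ (r + 2) • kappaMap k e f 0 (y - w) := by
      refine ext_ev fun u hu => ?_
      obtain rfl : u = [] := by simpa using hu
      rw [ev_smul, ev_kappaMap (u := []) (m := 0) _ rfl, dOne_apply, hVz, bword_nil, mul_one,
        barD_mul_letter 1 hx, hdx, zero_mul, zero_add, barRight_unit (n := r + 2) hx, smul_smul, ←
        pow_add, Even.neg_one_pow ⟨r + 3, by ring⟩, one_smul]
    refine ⟨ε ^ (r + 2) • (y - w), Submodule.smul_mem _ _ ⟨hz, ?_⟩, ?_⟩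
    · change boundary k A _ = 0
      rw [map_sub, hwy, sub_self]
    · rw [kappaMap_smul, ← theta_kappaCochain hz (m := 0) (p := r + 2) rfl, ← theta_smul_eq (g :=
        kappaCochain e f (m := 0) hz rfl) (g' := omegaCochain g') hκ]
      exact hg'
  | succ m ih =>
    obtain ⟨p, rfl⟩ : ∃ q, p = q + 1 := ⟨p - 1, by omega⟩
    obtain ⟨g', hg'⟩ := theta_surjective h g
    obtain ⟨z, hz, hzg⟩ := ih (p := p) (by omega) g'
    refine ⟨z, hz, ?_⟩
    have h1 := theta_mem_BOmega (g := ⟨g'.1 - kappaMap k e f (m + 1) z,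
      sub_mem g'.2.1 (kappaMap_mem hz.1 (by omega))⟩) hzg
    rw [theta_sub_eq (g := omegaCochain g') (g' := kappaCochain e f hz.1 (by omega)) rfl,
      theta_kappaCochain] at h1
    have := add_mem hg' h1
    rwa [sub_add_sub_cancel] at this

/-- In degree 1, κ(z) = δh' says that κ₀(z) ⊗ 1 − h' is invariant, hence the Casimir image of a
chain `y`. Applying d shows that z − ∂y is degenerate; being a cycle, it is a boundary. Higher
degrees follow by injectivity of θ. -/
theorem kappaMap_injective (h : IsCasimir form e f) (hp : r + 1 + (m + 1) + 1 = p)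
    (hz : z ∈ cycles k A (r + 1)) (hB : kappaMap k e f (m + 1) z ∈ BOmega k A (m + 1) p) :
    z ∈ boundaries k A (r + 1) := by
  induction m generalizing p with
  | zero =>
    obtain rfl : r + 2 + 1 = p := by omega
    obtain ⟨h', hh', hδ⟩ := hB
    have hV := casimirMap_mem (e := e) (f := f) hz.1
    have hbz : boundary k A z = 0 := hz.2
    have hdV : barD (casimirMap k e f z) = 0 := by rw [barD_casimirMap h hz.1, hbz, map_zero]
    have hx : ev (kappaMap k e f 0 z) [] = ε ^ (r + 2) • casimirMap k e f z := by
      rw [ev_kappaMap (u := []) (m := 0) _ rfl, dOne_apply, bword_nil, mul_one,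
        barD_mul_letter 1 hV, hdV, zero_mul, zero_add, barRight_unit (n := r + 2) hV]
      simp [pow_succ]
    let g : CΩ (r + 2) 0 := kappaCochain e f hz.1 rfl
    have hg : (deltaCochain g).1 = 0 := by
      change delta barLeft barRight 0 (kappaMap k e f 0 z) = 0
      rw [delta_kappaMap h 0 hz.1, hbz, kappaMap_zero, smul_zero]
    have h1 := delta_mulOne_of_eq_zero hg
    rw [pow_zero, one_smul, theta_kappaCochain] at h1
    have hF : ev (mulOne g.1 - h') [] ∈ barLength k A (r + 2 + 2) := by
      rw [ev_sub]
      exact sub_mem (ev_mem_of_mem (mulOne_mem g) []) (Omega_le_barLength _ (ev_mem_of_mem hh' []))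
    obtain ⟨y, hy, hyx⟩ := exists_casimirMap_eq h hF (fun a => by
      have := delta_zero_apply (mulOne g.1 - h') a
      rw [map_sub, h1, hδ, sub_self, ev_zero] at this
      exact (sub_eq_zero.1 this.symm))
    have hVby : casimirMap k e f (boundary k A y) = casimirMap k e f z := by
      have h2 : barD (ev h' []) = 0 := (ev_mem_of_mem hh' []).2
      rw [← barD_casimirMap h hy, hyx, ev_sub, map_sub, h2, sub_zero, ← ev_comp, barD_mulOne,
        ev_smul]
      change ε ^ (r + 2) • ev (kappaMap k e f 0 z) [] = _
      rw [hx, smul_smul, ← pow_add, Even.neg_one_pow ⟨r + 2, rfl⟩, one_smul]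
    have hu : z - boundary k A y ∈ unitChains k A (r + 1) (r + 1 + 1) :=
      mem_unitChains_of_casimirMap_eq_zero h (sub_mem hz.1 (boundary_mem_chains hy))
        (by rw [map_sub, hVby, sub_self])
    obtain ⟨w, hw, hwz⟩ := exists_boundary_of_mem_unitChains hu
      (by rw [map_sub, boundary_boundary, hbz, sub_zero])
    exact ⟨w + y, add_mem (unitChains_le_chains _ _ hw) hy, by rw [map_add, hwz, sub_add_cancel]⟩
  | succ m ih =>
    obtain ⟨p, rfl⟩ : ∃ q, p = q + 1 := ⟨p - 1, by omega⟩
    refine ih (p := p) (by omega) ?_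
    refine theta_injective h ⟨kappaMap k e f (m + 1) z, kappaMap_mem_ZOmega h (by omega) hz⟩ ?_
    have := theta_kappaCochain (e := e) (f := f) hz.1 (m := m + 1) (p := p) (by omega)
    rw [← this] at hB
    exact hB

/-! ### Induced maps on subquotients -/

section Subquotient

variable {k C C₁ C₂ : Type*} [Field k] [AddCommGroup C] [Module k C] [AddCommGroup C₁] [Module k C₁]
  [AddCommGroup C₂] [Module k C₂] {Z₁ B₁ : Submodule k C₁} {Z₂ B₂ : Submodule k C₂}
  {Z B : Submodule k C}

theorem Subquotient.mk_eq_zero (z : Z) : Subquotient.mk B z = 0 ↔ z.1 ∈ B :=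
  Submodule.Quotient.mk_eq_zero (B.submoduleOf Z)

theorem Subquotient.mk_eq_mk (z w : Z) :
    Subquotient.mk B z = Subquotient.mk B w ↔ z.1 - w.1 ∈ B := by
  rw [← sub_eq_zero, ← map_sub, Subquotient.mk_eq_zero]
  rfl

theorem Subquotient.exists_mk (x : Subquotient Z B) : ∃ z, Subquotient.mk B z = x :=
  Submodule.mkQ_surjective _ x

theorem exists_induces (φ : Z₁ → C) (hadd : ∀ z w, φ (z + w) = φ z + φ w)
    (hsmul : ∀ (c : k) z, φ (c • z) = c • φ z) (hZ : ∀ z, φ z ∈ Z) (hB : ∀ z, z.1 ∈ B₁ → φ z ∈ B) :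
    ∃ Φ : Subquotient Z₁ B₁ →ₗ[k] Subquotient Z B, Induces φ Φ := by
  let ψ : Z₁ →ₗ[k] Z :=
    { toFun := fun z => ⟨φ z, hZ z⟩
      map_add' := fun z w => Subtype.ext (hadd z w)
      map_smul' := fun c z => Subtype.ext (hsmul c z) }
  refine ⟨Submodule.liftQ (B₁.submoduleOf Z₁) (Subquotient.mk B ∘ₗ ψ) (fun z hz => ?_),
    fun z => ⟨hZ z, rfl⟩⟩
  exact (Subquotient.mk_eq_zero (ψ z)).2 (hB z hz)

theorem exists_induces₂ (φ : Z₁ → Z₂ → C) (hadd₁ : ∀ z z' w, φ (z + z') w = φ z w + φ z' w)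
    (hsmul₁ : ∀ (c : k) z w, φ (c • z) w = c • φ z w)
    (hadd₂ : ∀ z w w', φ z (w + w') = φ z w + φ z w')
    (hsmul₂ : ∀ (c : k) z w, φ z (c • w) = c • φ z w) (hZ : ∀ z w, φ z w ∈ Z)
    (hB₁ : ∀ z w, z.1 ∈ B₁ → φ z w ∈ B) (hB₂ : ∀ z w, w.1 ∈ B₂ → φ z w ∈ B) :
    ∃ Φ : Subquotient Z₁ B₁ →ₗ[k] Subquotient Z₂ B₂ →ₗ[k] Subquotient Z B, Induces₂ φ Φ := by
  have h1 : ∀ z, ∃ Φ : Subquotient Z₂ B₂ →ₗ[k] Subquotient Z B, Induces (φ z) Φ := fun z =>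
    exists_induces (φ z) (hadd₂ z) (fun c w => hsmul₂ c z w) (hZ z) (hB₂ z)
  choose Ψ hΨ using h1
  have hΨ' : ∀ z w, Ψ z (Subquotient.mk B₂ w) = Subquotient.mk B ⟨φ z w, hZ z w⟩ :=
    fun z w => (hΨ z w).2
  let ψ : Z₁ →ₗ[k] Subquotient Z₂ B₂ →ₗ[k] Subquotient Z B :=
    { toFun := Ψ
      map_add' := fun z z' => by
        refine LinearMap.ext fun x => ?_
        obtain ⟨w, rfl⟩ := x.exists_mk
        rw [LinearMap.add_apply, hΨ', hΨ', hΨ', ← map_add]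
        exact congrArg _ (Subtype.ext (hadd₁ z z' w))
      map_smul' := fun c z => by
        refine LinearMap.ext fun x => ?_
        obtain ⟨w, rfl⟩ := x.exists_mk
        rw [RingHom.id_apply, LinearMap.smul_apply, hΨ', hΨ', ← map_smul]
        exact congrArg _ (Subtype.ext (hsmul₁ c z w)) }
  refine ⟨Submodule.liftQ (B₁.submoduleOf Z₁) ψ (fun z hz => ?_), fun z w => ⟨hZ z w, hΨ' z w⟩⟩
  refine LinearMap.ext fun x => ?_
  obtain ⟨w, rfl⟩ := x.exists_mk
  exact (hΨ' z w).trans ((Subquotient.mk_eq_zero _).2 (hB₁ z w hz))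

end Subquotient

/-! ### The stages of singular Hochschild cohomology -/

theorem theta_add_eq {g g' g'' : CΩ p m} (h : g''.1 = g.1 + g'.1) :
    theta g'' = theta g + theta g' := by
  refine ext_ev fun l hl => ?_
  rcases List.eq_nil_or_concat' l with h | ⟨w, b, rfl⟩
  · simp [h] at hl
  · have hw : w.length = m := by simpa using hl
    rw [ev_add, ev_theta _ w hw, ev_theta _ w hw, ev_theta _ w hw, h, ev_add, map_add, add_mul,
      add_mul]
    abel

theorem theta_mem_ZOmega (g : ZOmega k A m p) :
    theta (omegaCochain g) ∈ ZOmega k A (m + 1) (p + 1) := by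
  refine ⟨theta_mem _, ?_⟩
  change delta barLeft barRight (m + 1) _ = 0
  rw [delta_theta]
  have h : (deltaCochain (omegaCochain g)).1 = (0 : k) • (deltaCochain (omegaCochain g)).1 := by
    rw [zero_smul]
    exact g.2.2
  rw [theta_smul_eq h, zero_smul]

theorem exists_thetaEquiv (h : IsCasimir form e f) (m p : ℕ) :
    ∃ Θ : HHOmega k A (m + 1) p ≃ₗ[k] HHOmega k A (m + 1 + 1) (p + 1),
      Induces (fun g => theta (omegaCochain g)) Θ.toLinearMap := by
  obtain ⟨Θ, hΘ⟩ := exists_induces (B₁ := BOmega k A (m + 1) p)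
    (B := BOmega k A (m + 1 + 1) (p + 1)) (fun g : ZOmega k A (m + 1) p => theta (omegaCochain g))
    (fun g g' => theta_add_eq rfl) (fun c g => theta_smul_eq rfl) theta_mem_ZOmega
    (fun g hg => theta_mem_BOmega hg)
  refine ⟨LinearEquiv.ofBijective Θ ⟨?_, ?_⟩, hΘ⟩
  · refine (injective_iff_map_eq_zero Θ).2 fun x hx => ?_
    obtain ⟨g, rfl⟩ := x.exists_mk
    obtain ⟨h1, h2⟩ := hΘ g
    rw [h2, Subquotient.mk_eq_zero] at hx
    exact (Subquotient.mk_eq_zero g).2 (theta_injective h g hx)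
  · intro y
    obtain ⟨g, rfl⟩ := y.exists_mk
    obtain ⟨g', hg'⟩ := theta_surjective h g
    obtain ⟨h1, h2⟩ := hΘ g'
    refine ⟨Subquotient.mk _ g', ?_⟩
    rw [h2, eq_comm, Subquotient.mk_eq_mk]
    exact hg'

theorem toSg_theta {i : ℤ} (hm : 0 < m) (hi : (m : ℤ) - p = i) (g : ZOmega k A m p) :
    toSg m p i hm hi (Subquotient.mk _ g) =
      toSg (m + 1) (p + 1) i (Nat.succ_pos m) (by push_cast; omega)
        (Subquotient.mk _ ⟨theta (omegaCochain g), theta_mem_ZOmega g⟩) := by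
  refine (Submodule.Quotient.eq (sgRelations k A i)).2 (Submodule.subset_span ?_)
  exact ⟨⟨(m, p), hm, hi⟩, g, ⟨theta (omegaCochain g), theta_mem_ZOmega g⟩, rfl, rfl⟩

/-- The map from a stage of the colimit to the stage `HH^1(A, Ω̄^s(A))`. -/
def stageDown (h : IsCasimir form e f) (s : ℕ) : ∀ a b : ℕ, HHOmega k A a b →ₗ[k] HHOmega k A 1 s
  -- The zero values do not occur at the stages (l + 1, s + l); they only make the function total.
  | 0, _ => 0
  | 1, b => if hb : b = s then hb ▸ LinearMap.id else 0
  | _ + 2, 0 => 0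
  | a + 2, b + 1 => stageDown h s (a + 1) b ∘ₗ (exists_thetaEquiv h a b).choose.symm.toLinearMap

theorem stageDown_theta (h : IsCasimir form e f) (s : ℕ) {a b : ℕ} (ha : 0 < a)
    (g : ZOmega k A a b) :
    stageDown h s (a + 1) (b + 1) (Subquotient.mk _ ⟨theta (omegaCochain g), theta_mem_ZOmega g⟩) =
        stageDown h s a b (Subquotient.mk _ g) := by
  obtain ⟨a, rfl⟩ : ∃ c, a = c + 1 := ⟨a - 1, by omega⟩
  obtain ⟨h1, h2⟩ := (exists_thetaEquiv h a b).choose_spec g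
  rw [stageDown, LinearMap.comp_apply]
  congr 1
  exact (LinearEquiv.symm_apply_eq _).2 h2.symm

theorem stageDown_injective (h : IsCasimir form e f) (s l : ℕ) :
    Function.Injective (stageDown (k := k) h s (l + 1) (s + l)) := by
  induction l with
  | zero =>
    rw [stageDown, dif_pos (by rfl)]
    exact Function.injective_id
  | succ l ih =>
    change Function.Injective (stageDown h s (l + 1) (s + l) ∘ₗ
      (exists_thetaEquiv h l (s + l)).choose.symm.toLinearMap)
    exact ih.comp (LinearEquiv.injective _)

/-- Going down to the first stage by the inverses of θ respects the relations of the colimit, so it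
factors through the colimit and detects every stage. -/
theorem toSg_injective_aux (h : IsCasimir form e f) {i : ℤ} (s l : ℕ) (hi : (1 : ℤ) - s = i) :
    Function.Injective (toSg (k := k) (A := A) (l + 1) (s + l) i (Nat.succ_pos l)
      (by push_cast; omega)) := by
  have hrel : sgRelations k A i ≤ LinearMap.ker (DirectSum.toModule k (SgIndex i) (HHOmega k A 1 s)
      fun x => stageDown h s x.1.1 x.1.2) := by
    refine Submodule.span_le.2 ?_
    rintro _ ⟨x, g, g', hg, rfl⟩
    obtain rfl : g' = ⟨theta (omegaCochain g), theta_mem_ZOmega g⟩ := Subtype.ext hg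
    change DirectSum.toModule k (SgIndex i) _ _ _ = 0
    rw [map_sub, DirectSum.toModule_lof, DirectSum.toModule_lof]
    exact sub_eq_zero.2 (stageDown_theta h s x.2.1 g).symm
  refine Function.Injective.of_comp (f := (sgRelations k A i).liftQ _ hrel) ?_
  convert stageDown_injective (k := k) h s l using 1
  funext x
  exact DirectSum.toModule_lof (R := k) (ι := SgIndex i)
    (M := fun x => HHOmega k A x.1.1 x.1.2) ⟨(l + 1, s + l), Nat.succ_pos l, by
      simp only; push_cast; omega⟩ x

theorem toSg_range_aux (h : IsCasimir form e f) {i : ℤ} (s l : ℕ) (hi : (1 : ℤ) - s = i) :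
    LinearMap.range (toSg (k := k) (A := A) (l + 1) (s + l) i (Nat.succ_pos l)
      (by push_cast; omega)) =
    LinearMap.range (toSg (k := k) (A := A) 1 s i Nat.one_pos (by push_cast; omega)) := by
  induction l with
  | zero => rfl
  | succ l ih =>
    rw [← ih]
    obtain ⟨Θ, hΘ⟩ := exists_thetaEquiv (k := k) h l (s + l)
    refine le_antisymm ?_ ?_
    · rintro _ ⟨y, rfl⟩
      obtain ⟨x, rfl⟩ := Θ.surjective y
      obtain ⟨g, rfl⟩ := x.exists_mk
      obtain ⟨h1, h2⟩ := hΘ g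
      refine ⟨Subquotient.mk _ g, (toSg_theta _ _ g).trans ?_⟩
      exact congrArg _ h2.symm
    · rintro _ ⟨x, rfl⟩
      obtain ⟨g, rfl⟩ := x.exists_mk
      exact ⟨_, (toSg_theta _ _ g).symm⟩

/-- For i ≤ 1 the stages form a single ray that starts at HH^1(A, Ω^s) with s = 1 − i, and all maps
along the ray are isomorphisms. -/
theorem toSg_bijective (h : IsCasimir form e f) {i : ℤ} (hm : 0 < m) (hi : (m : ℤ) - p = i)
    (hi1 : i ≤ 1) : Function.Bijective (toSg (k := k) (A := A) m p i hm hi) := by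
  obtain ⟨s, hs⟩ : ∃ s : ℕ, (1 : ℤ) - s = i := ⟨(1 - i).toNat, by omega⟩
  have key : ∀ x : SgIndex i, ∃ l : ℕ, x.1 = (l + 1, s + l) := by
    rintro ⟨⟨a, b⟩, ha, hab⟩
    simp only at ha hab
    exact ⟨a - 1, Prod.ext (by simp only; omega) (by simp only; omega)⟩
  obtain ⟨l, hl⟩ := key ⟨(m, p), hm, hi⟩
  obtain ⟨rfl, rfl⟩ := Prod.mk.inj hl
  refine ⟨toSg_injective_aux h s l hs, ?_⟩
  rw [← LinearMap.range_eq_top, toSg_range_aux h s l hs, eq_top_iff]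
  rintro y -
  obtain ⟨u, rfl⟩ := Submodule.mkQ_surjective (sgRelations k A i) y
  induction u using DirectSum.induction_on with
  | zero => rw [map_zero]; exact zero_mem _
  | add x y hx hy => rw [map_add]; exact add_mem hx hy
  | of x c =>
    obtain ⟨⟨a, b⟩, hx⟩ := x
    obtain ⟨l', hl'⟩ := key ⟨(a, b), hx⟩
    obtain ⟨rfl, rfl⟩ := Prod.mk.inj hl'
    rw [← toSg_range_aux (k := k) h s l' hs]
    exact ⟨c, rfl⟩

/-! ### The isomorphisms from homology -/

theorem exists_kappaEquiv [FiniteDimensional k A] {hf : IsSymmetrizing form}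
    (hc : casimir hf = ∑ i, e i ⊗ₜ[k] f i) (h : IsCasimir form e f) (hm : 1 ≤ m) (hr : 1 ≤ r)
    (hp : r + m + 1 = p) :
    ∃ κ : HHhom k A r ≃ₗ[k] HHOmega k A m p, Induces (fun z => kappa hf m z.1) κ.toLinearMap := by
  obtain ⟨m, rfl⟩ : ∃ c, m = c + 1 := ⟨m - 1, by omega⟩
  obtain ⟨r, rfl⟩ : ∃ c, r = c + 1 := ⟨r - 1, by omega⟩
  obtain ⟨κ, hκ⟩ := exists_induces (Z := ZOmega k A (m + 1) p) (B₁ := boundaries k A (r + 1))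
    (B := BOmega k A (m + 1) p) (fun z : cycles k A (r + 1) => kappa hf (m + 1) z.1)
    (fun z w => by simp only [kappa_eq hc]; exact kappaMap_add _ _ _)
    (fun c z => by simp only [kappa_eq hc]; exact kappaMap_smul _ _ _)
    (fun z => by simp only [kappa_eq hc]; exact kappaMap_mem_ZOmega h hp z.2)
    (fun z hz => by
      simp only [kappa_eq hc]
      exact kappaMap_mem_BOmega h (by omega) hz)
  refine ⟨LinearEquiv.ofBijective κ ⟨?_, ?_⟩, hκ⟩
  · refine (injective_iff_map_eq_zero κ).2 fun x hx => ?_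
    obtain ⟨z, rfl⟩ := x.exists_mk
    obtain ⟨h1, h2⟩ := hκ z
    rw [h2, Subquotient.mk_eq_zero] at hx
    simp only [kappa_eq hc] at hx
    exact (Subquotient.mk_eq_zero z).2 (kappaMap_injective h hp z.2 hx)
  · intro y
    obtain ⟨g, rfl⟩ := y.exists_mk
    obtain ⟨z, hz, hzg⟩ := kappaMap_surjective h hp g
    obtain ⟨h1, h2⟩ := hκ ⟨z, hz⟩
    refine ⟨Subquotient.mk _ ⟨z, hz⟩, ?_⟩
    rw [h2, eq_comm, Subquotient.mk_eq_mk]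
    simp only [kappa_eq hc]
    exact hzg

/-! ### Sums over splittings in three parts -/

/-- The sum over all ways to split a list into three. -/
def split3 (H : List A → List A → List A → X) : List A → X :=
  splitSum fun x y => splitSum (fun u v => H x u v) y

theorem split3_congr {H H' : List A → List A → List A → X} {l : List A}
    (h : ∀ x u v, x ++ (u ++ v) = l → H x u v = H' x u v) : split3 H l = split3 H' l :=
  splitSum_congr fun x _ hxy => splitSum_congr fun u v huv => h x u v (by rw [huv, hxy])

theorem split3_add (H H' : List A → List A → List A → X) (l : List A) :
    split3 (fun x u v => H x u v + H' x u v) l = split3 H l + split3 H' l := by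
  simp only [split3, splitSum_add]

theorem split3_smul (c : k) (H : List A → List A → List A → X) (l : List A) :
    split3 (fun x u v => c • H x u v) l = c • split3 H l := by simp only [split3, splitSum_smul]

theorem split3_sub (H H' : List A → List A → List A → X) (l : List A) :
    split3 (fun x u v => H x u v - H' x u v) l = split3 H l - split3 H' l := by
  simp only [split3, splitSum_sub]

theorem split3_zero (l : List A) : split3 (fun _ _ _ => (0 : X)) l = 0 := by
  simp only [split3, splitSum_zero]

theorem splitSum_onLast_out (H : List A → A → List A → List A → X) (x y : List A) :
    splitSum (fun u v => onLast (fun x' c => H x' c u v) x) y =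
      onLast (fun x' c => splitSum (H x' c) y) x := by
  rcases List.eq_nil_or_concat' x with rfl | ⟨s, c, rfl⟩
  · exact splitSum_zero y
  · simp only [onLast_append_singleton]

theorem splitSum_onHead_out (H : A → List A → List A → List A → X) (x y : List A) :
    splitSum (fun u v => onHead (fun c x' => H c x' u v) x) y =
      onHead (fun c x' => splitSum (H c x') y) x := by
  cases x with
  | nil => exact splitSum_zero y
  | cons c x => rfl

theorem splitSum_onHead_left (H : A → List A → List A → X) (l : List A) :
    splitSum (fun p q => onHead (fun c p' => H c p' q) p) l =
      onHead (fun c l' => splitSum (H c) l') l := by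
  cases l with
  | nil => rfl
  | cons a l => rw [splitSum_cons, onHead_nil, zero_add]; rfl

theorem splitSum_append_singleton (F : List A → List A → X) (l : List A) (c : A) :
    splitSum F (l ++ [c]) = splitSum (fun p q => F p (q ++ [c])) l + F (l ++ [c]) [] := by
  induction l generalizing F with
  | nil => rfl
  | cons a l ih => rw [List.cons_append, splitSum_cons, splitSum_cons, ih, add_assoc]; rfl

theorem splitSum_onLast_right (H : List A → List A → A → X) (l : List A) :
    splitSum (fun p q => onLast (fun q' c => H p q' c) q) l =
      onLast (fun l' c => splitSum (fun p q' => H p q' c) l') l := by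
  rcases List.eq_nil_or_concat' l with rfl | ⟨s, c, rfl⟩
  · rfl
  · rw [splitSum_append_singleton]
    simp only [onLast_append_singleton, onLast_nil, add_zero]

theorem splitSum_shift (H : List A → A → List A → X) (l : List A) :
    splitSum (fun p q => onLast (fun p' a => H p' a q) p) l =
      splitSum (fun p q => onHead (fun a q' => H p a q') q) l := by
  rw [splitSum_onLast, splitSum_onHead]

theorem split3_shift_left (H : List A → A → List A → List A → X) (l : List A) :
    split3 (fun x u v => onLast (fun x' a => H x' a u v) x) l =
      split3 (fun x u v => onHead (fun a u' => H x a u' v) u) l := by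
  simp only [split3, splitSum_onLast_out, splitSum_onHead_left]
  exact splitSum_shift (fun x' a y => splitSum (H x' a) y) l

theorem split3_shift_right (H : List A → List A → A → List A → X) (l : List A) :
    split3 (fun x u v => onLast (fun u' a => H x u' a v) u) l =
      split3 (fun x u v => onHead (fun a v' => H x u a v') v) l :=
  splitSum_congr fun _ _ _ => splitSum_shift _ _

theorem split3_onHead_left (H : A → List A → List A → List A → X) (l : List A) :
    split3 (fun x u v => onHead (fun c x' => H c x' u v) x) l =
      onHead (fun c l' => split3 (H c) l') l := by
  simp only [split3, splitSum_onHead_out]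
  exact splitSum_onHead_left _ l

theorem split3_onLast_right (H : List A → List A → List A → A → X) (l : List A) :
    split3 (fun x u v => onLast (fun v' c => H x u v' c) v) l =
      onLast (fun l' c => split3 (fun x u v' => H x u v' c) l') l := by
  simp only [split3, splitSum_onLast_right]

variable (k) in
theorem mergeSum_split3 (H : List A → List A → List A → X) (l : List A) :
    mergeSum (split3 H) l = split3 (fun x u v => mergeSum (fun t => H t u v) x +
      ε ^ x.length • mergeSum (fun t => H x t v) u +
      ε ^ (x.length + u.length) • mergeSum (fun t => H x u t) v) l := by
  have hout : ∀ x y : List A, mergeSum (fun t => splitSum (fun u v => H t u v) y) x =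
      splitSum (fun u v => mergeSum (fun t => H t u v) x) y := by
    intro x y
    induction y generalizing H with
    | nil => rfl
    | cons a y ih => simp only [splitSum_cons, mergeSum_add, ih]
  rw [split3, mergeSum_splitSum k]
  refine splitSum_congr fun x y _ => ?_
  rw [hout, mergeSum_splitSum k, ← splitSum_smul, ← splitSum_add]
  refine splitSum_congr fun u v _ => ?_
  rw [smul_add, smul_smul, ← pow_add, ← add_assoc]

variable (k) in
theorem mergeSum_sign (c : ℕ) (φ : List A → X) (l : List A) :
    mergeSum (fun t => ε ^ (c * t.length) • φ t) l = ε ^ (c * l.length + c) • mergeSum φ l := by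
  rw [← mergeSum_smul]
  refine mergeSum_congr fun t ht => ?_
  rw [← ht]
  congr 1
  exact neg_one_pow_eq ⟨c * t.length + c, by ring⟩

/-! ### Cocycles as functions on lists -/

variable (k) in
/-- A function on lists that is a normalized Hochschild `m`-cocycle. -/
structure ListCocycle (m : ℕ)
    (F : List A → A) : Prop where
  linear : LetterLinear k F
  length : ∀ l, l.length ≠ m → F l = 0
  unit : ∀ p q, F (p ++ 1 :: q) = 0
  cocycle : ∀ l, onHead (fun a t => a * F t) l - mergeSum F l +
    ε ^ (m + 1) • onLast (fun t c => F t * c) l = 0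

theorem listCocycle_ev (f : ZA k A m) : ListCocycle k m (ev f.1) where
  linear := LetterLinear.ev _
  length _ h := ev_of_ne _ h
  unit p q := ev_eq_zero_of_mem f.2.1 p q
  cocycle l := by
    cases l with
    | nil => simp
    | cons a l =>
      have h := ev_delta (LinearMap.mul k A) (LinearMap.mul k A).flip m f.1 a l
      have h0 : delta (LinearMap.mul k A) (LinearMap.mul k A).flip m f.1 = 0 := f.2.2
      rw [h0, ev_zero] at h
      exact h.symm

variable (k) in
/-- The functional `a₁ ⊗ ⋯ ↦ ∑ ± φ(a₁, …, F(a_{i+1}, …, a_{i+m}), …)`. -/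
def insertLetter (m : ℕ) (F : List A → A) (φ : List A → X) : List A → X :=
  split3 fun x u v => ε ^ ((m + 1) * x.length) • φ (x ++ F u :: v)

theorem LetterLinear.map_mergeSum (hφ : LetterLinear k φ) (x v : List A) (F : List A → A)
    (u : List A) : φ (x ++ mergeSum F u :: v) = mergeSum (fun t => φ (x ++ F t :: v)) u :=
  linear_mergeSum ((hφ.isLinearMap x v).mk' _) F u

theorem LetterLinear.map_onHead (hφ : LetterLinear k φ) (x v : List A) (F : A → List A → A)
    (u : List A) : φ (x ++ onHead F u :: v) = onHead (fun a t => φ (x ++ F a t :: v)) u :=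
  linear_onHead ((hφ.isLinearMap x v).mk' _) F u

theorem LetterLinear.map_onLast (hφ : LetterLinear k φ) (x v : List A) (F : List A → A → A)
    (u : List A) : φ (x ++ onLast F u :: v) = onLast (fun t a => φ (x ++ F t a :: v)) u :=
  linear_onLast ((hφ.isLinearMap x v).mk' _) F u

theorem LetterLinear.map_zero (hφ : LetterLinear k φ) (x v : List A) : φ (x ++ 0 :: v) = 0 :=
  (hφ.isLinearMap x v).map_zero

theorem ListCocycle.apply (hF : ListCocycle k m F) (hφ : LetterLinear k φ) (x u v : List A) :
    onHead (fun a t => φ (x ++ (a * F t) :: v)) u - mergeSum (fun t => φ (x ++ F t :: v)) u +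
      ε ^ (m + 1) • onLast (fun t c => φ (x ++ (F t * c) :: v)) u = 0 := by
  rw [← hφ.map_onHead, ← hφ.map_mergeSum, ← hφ.map_onLast, ← (hφ.isLinearMap x v).map_smul, ←
    (hφ.isLinearMap x v).map_sub, ← (hφ.isLinearMap x v).map_add, hF.cocycle]
  exact hφ.map_zero x v

/-- The counterpart of `barD_insertSum` for functions on lists. The products of F(u) with its two
neighbours are moved into the block by the shift lemmas, where the cocycle identity turns them into
products inside u. -/
theorem insertLetter_mergeSum (hF : ListCocycle k m F) (hφ : LetterLinear k φ) (l : List A) :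
    insertLetter k m F (mergeSum φ) l = ε ^ (m + 1) • mergeSum (insertLetter k m F φ) l := by
  have e1 : mergeSum (insertLetter k m F φ) l = split3 (fun x u v =>
      ε ^ ((m + 1) * x.length + (m + 1)) • mergeSum (fun t => φ (t ++ F u :: v)) x +
      ε ^ (m * x.length) • mergeSum (fun t => φ (x ++ F t :: v)) u +
      ε ^ (m * x.length + m) • mergeSum (fun t => φ (x ++ F u :: t)) v) l := by
    rw [insertLetter, mergeSum_split3 k]
    refine split3_congr fun x u v _ => ?_
    rw [mergeSum_sign, mergeSum_smul, mergeSum_smul, smul_smul, smul_smul, ← pow_add, ← pow_add]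
    have h1 : ε ^ (x.length + (m + 1) * x.length) = (-1) ^ (m * x.length) :=
      neg_one_pow_eq ⟨x.length * (m + 1), by ring⟩
    rw [h1]
    by_cases hu : u.length = m
    · have h2 : ε ^ (x.length + u.length + (m + 1) * x.length) = (-1) ^ (m * x.length + m) :=
        neg_one_pow_eq ⟨x.length * (m + 1) + m, by rw [hu]; ring⟩
      rw [h2]
    · rw [hF.length u hu]
      simp only [hφ.map_zero, mergeSum_zero, smul_zero]
  have e2 : insertLetter k m F (mergeSum φ) l = split3 (fun x u v =>
      ε ^ ((m + 1) * x.length) • mergeSum (fun t => φ (t ++ F u :: v)) x -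
      ε ^ (m * x.length) • mergeSum (fun t => φ (x ++ F u :: t)) v) l -
      split3 (fun x u v =>
        onLast (fun p a => ε ^ (m * (p.length + 1)) • φ (p ++ (a * F u) :: v)) x) l +
      split3 (fun x u v =>
        onHead (fun a q => ε ^ (m * x.length) • φ (x ++ (F u * a) :: q)) v) l := by
    rw [← split3_sub, ← split3_add, insertLetter]
    refine split3_congr fun x u v _ => ?_
    have h1 : onLast (fun p a => ε ^ (m * (p.length + 1)) • φ (p ++ (a * F u) :: v)) x =
        ε ^ (m * x.length) • onLast (fun p a => φ (p ++ (a * F u) :: v)) x := by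
      rcases List.eq_nil_or_concat' x with rfl | ⟨s, c, rfl⟩
      · simp
      · simp
    have h2 : onHead (fun a q => ε ^ (m * x.length) • φ (x ++ (F u * a) :: q)) v =
        ε ^ (m * x.length) • onHead (fun a q => φ (x ++ (F u * a) :: q)) v := by
      cases v <;> simp
    have h3 : ε ^ (m * x.length) = ε ^ ((m + 1) * x.length) * (-1) ^ x.length := by
      rw [← pow_add]
      exact neg_one_pow_eq ⟨x.length * (m + 1), by ring⟩
    rw [h1, h2, mergeSum_append_cons k, h3]
    module
  rw [e1, e2, split3_shift_left (fun p a u v => ε ^ (m * (p.length + 1)) • φ (p ++ (a * F u) :: v)),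
    ← split3_shift_right (fun x u a q => ε ^ (m * x.length) • φ (x ++ (F u * a) :: q)), ←
    split3_sub, ← split3_add, ← split3_smul]
  refine split3_congr fun x u v _ => ?_
  have h := hF.apply hφ x u v
  have h1 : onHead (fun a t => ε ^ (m * (x.length + 1)) • φ (x ++ (a * F t) :: v)) u =
      ε ^ (m * (x.length + 1)) • onHead (fun a t => φ (x ++ (a * F t) :: v)) u := by
    cases u <;> simp
  have h2 : onLast (fun t c => ε ^ (m * x.length) • φ (x ++ (F t * c) :: v)) u =
      ε ^ (m * x.length) • onLast (fun t c => φ (x ++ (F t * c) :: v)) u := by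
    rcases List.eq_nil_or_concat' u with rfl | ⟨s, c, rfl⟩ <;> simp
  rw [h1, h2]
  have h3 : mergeSum (fun t => φ (x ++ F t :: v)) u = onHead (fun a t => φ (x ++ (a * F t) :: v)) u +
      ε ^ (m + 1) • onLast (fun t c => φ (x ++ (F t * c) :: v)) u := by
    rw [← sub_eq_zero, ← neg_eq_zero, ← h]
    abel
  rw [h3]
  simp only [mul_add, mul_one, add_mul, one_mul, pow_add, pow_one]
  rcases neg_one_pow_eq_or k m with h | h <;> simp only [h] <;>
    rcases neg_one_pow_eq_or k (m * x.length) with h' | h' <;> simp only [h'] <;> module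

/-! ### The Connes operator -/

theorem onLast_smul (c : k) (F : List A → A → X) (l : List A) :
    onLast (fun t a => c • F t a) l = c • onLast F l :=
  (linear_onLast (LinearMap.lsmul k X c) F l).symm

theorem splitSum_eq_letterSum_add (G : List A → List A → X) (l : List A) :
    splitSum G l = letterSum (fun p c q => G p (c :: q)) l + G l [] := by
  induction l generalizing G with
  | nil => simp [splitSum]
  | cons a l ih => rw [splitSum_cons, letterSum_cons, ih, add_assoc]

theorem splitSum_eq_add_letterSum (G : List A → List A → X) (l : List A) :
    splitSum G l = G [] l + letterSum (fun p c q => G (p ++ [c]) q) l := by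
  induction l generalizing G with
  | nil => simp [splitSum]
  | cons a l ih => rw [splitSum_cons, letterSum_cons, ih]; rfl

variable (k) in
/-- The signed sum over the cyclic rotations of a list. -/
def cyclicSum (φ : List A → X) : List A → X :=
  letterSum fun p c q => ε ^ (p.length * (q.length + 1)) • φ (c :: q ++ p)

theorem cyclicSum_congr {φ ψ : List A → X} (h : ∀ a l, φ (a :: l) = ψ (a :: l)) (l : List A) :
    cyclicSum k φ l = cyclicSum k ψ l := letterSum_congr fun p c q _ => by rw [List.cons_append, h]

theorem cyclicSum_add (φ ψ : List A → X) (l : List A) :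
    cyclicSum k (fun t => φ t + ψ t) l = cyclicSum k φ l + cyclicSum k ψ l := by
  simp only [cyclicSum, smul_add, letterSum_add]

theorem cyclicSum_sub (φ ψ : List A → X) (l : List A) :
    cyclicSum k (fun t => φ t - ψ t) l = cyclicSum k φ l - cyclicSum k ψ l := by
  simp only [cyclicSum, smul_sub, letterSum_sub]

/-- The sum over all rotations absorbs a signed rotation by one place. The two ways of indexing the
rotations by splittings differ only in whether the trivial rotation is written with an empty left or
an empty right part. -/
theorem cyclicSum_rotate (φ : List A → X) (l : List A) :
    cyclicSum k (onLast fun t c => ε ^ t.length • φ (c :: t)) l = cyclicSum k φ l := by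
  have h := (splitSum_eq_letterSum_add (fun p q => ε ^ (p.length * q.length) •
    onLast (fun t c => ε ^ t.length • φ (c :: t)) (q ++ p)) l).symm.trans
    (splitSum_eq_add_letterSum _ l)
  simp only [List.length_nil, Nat.mul_zero, Nat.zero_mul, pow_zero, one_smul, List.append_nil,
    List.nil_append] at h
  rw [add_comm, add_left_cancel_iff] at h
  refine h.trans (letterSum_congr fun p c q _ => ?_)
  rw [← List.append_assoc, onLast_append_singleton, smul_smul, ← pow_add]
  congr 1
  refine neg_one_pow_eq ⟨p.length * q.length + p.length + q.length, ?_⟩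
  simp
  ring

theorem cyclicSum_eq_splitSum (φ : List A → X) : cyclicSum k φ =
    splitSum fun p q => onHead (fun c q' => ε ^ (p.length * (q'.length + 1)) •
      φ (c :: q' ++ p)) q := by
  funext l
  rw [splitSum_onHead]
  rfl

theorem cyclicSum_mul_head (φ : List A → X) (b : A) (t : List A) : cyclicSum k φ (b :: t) =
      splitSum (fun p q => ε ^ ((p.length + 1) * q.length) • φ (q ++ b :: p)) t := by
  rw [splitSum_eq_letterSum_add, cyclicSum, letterSum_cons, add_comm]
  simp

/-- The classical relation N b = b' N, in transposed form. A product of neighbours in a rotated list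
is a product of neighbours in the list itself or the product of its last and first letters, and the
latter is the wrap-around term. -/
theorem hochSum_cyclicSum (φ : List A → X) (l : List A) :
    hochSum k (cyclicSum k φ) l = cyclicSum k (mergeSum φ) l := by
  cases l with
  | nil => rfl
  | cons a l =>
    have e1 : mergeSum (cyclicSum k φ) (a :: l) = splitSum (fun p q => onHead (fun c q' =>
        ε ^ (p.length * (q'.length + 1) + (q'.length + 1)) •
          mergeSum (fun t => φ (c :: q' ++ t)) p +
        ε ^ (p.length * (q'.length + 1)) • mergeSum (fun t => φ (t ++ p)) (c :: q')) q)
        (a :: l) := by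
      rw [cyclicSum_eq_splitSum, mergeSum_splitSum k]
      refine splitSum_congr fun p q _ => ?_
      cases q with
      | nil =>
        simp only [onHead_nil, mergeSum_zero, mergeSum_nil, smul_zero, add_zero]
      | cons c q =>
        simp only [onHead_cons]
        congr 1
        · rw [← mergeSum_smul]
          refine mergeSum_congr fun t ht => ?_
          rw [← ht]
          congr 1
          exact neg_one_pow_eq ⟨t.length * (q.length + 1) + (q.length + 1), by ring⟩
        · rw [← mergeSum_smul, ← mergeSum_smul]
          refine mergeSum_congr_cons fun b t ht => ?_
          simp only [List.length_cons] at ht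
          rw [onHead_cons, smul_smul, ← pow_add, show q.length = t.length + 1 by omega]
          congr 1
          exact neg_one_pow_eq ⟨p.length * (t.length + 2), by ring⟩
    have e2 : cyclicSum k (mergeSum φ) (a :: l) = mergeSum (cyclicSum k φ) (a :: l) +
        splitSum (fun p q => onHead (fun b p' => onLast (fun q' c =>
          ε ^ ((p'.length + 1) * (q'.length + 1) + q'.length) •
            φ (q' ++ (c * b) :: p')) q) p) (a :: l) := by
      rw [e1, cyclicSum_eq_splitSum, ← splitSum_add]
      refine splitSum_congr fun p q _ => ?_
      cases q with
      | nil => cases p <;> simp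
      | cons c q =>
        cases p with
        | nil => simp
        | cons b p =>
          obtain ⟨s, d, hs⟩ : ∃ s d, c :: q = s ++ [d] := by
            rcases List.eq_nil_or_concat' (c :: q) with h | ⟨s, d, h⟩
            · simp at h
            · exact ⟨s, d, h⟩
          have hl : q.length = s.length := by
            have := congrArg List.length hs
            simpa using this
          simp only [onHead_cons]
          rw [mergeSum_append_cons k, hs, mergeSum_cons (fun t => φ (s ++ [d] ++ t)) b p]
          simp only [onLast_append_singleton, List.length_append, List.length_cons, List.length_nil,
            hl, List.append_assoc, List.cons_append, List.nil_append, pow_succ, pow_add, mul_add,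
            add_mul, one_mul, mul_one]
          rcases neg_one_pow_eq_or k s.length with h | h <;> simp only [h] <;> module
    rw [hochSum_cons, e2]
    congr 1
    rw [splitSum_onHead_left, onHead_cons]
    rw [splitSum_onLast_right (fun p' q' c => ε ^ ((p'.length + 1) * (q'.length + 1) + q'.length) •
      φ (q' ++ (c * a) :: p')), ← onLast_smul]
    refine onLast_congr fun t c ht => ?_
    rw [cyclicSum_mul_head, ← splitSum_smul]
    refine splitSum_congr fun p q hpq => ?_
    rw [smul_smul, ← pow_add, ← ht, ← hpq]
    congr 1
    simp only [List.length_append, List.length_cons, List.length_nil]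
    exact neg_one_pow_eq ⟨p.length * q.length + p.length + 2 * q.length + 1, by ring⟩

variable (k) in
/-- The Connes operator, for functions on lists. -/
def connesSum (φ : List A → X) : List A → X :=
  cyclicSum k (onHead fun c x => φ (1 :: c :: x) + φ (c :: 1 :: x))

/-- B is the norm N followed by the insertion of a unit before or behind the first letter. The
boundary of such words is 1 − t, for `φ` and for the auxiliary `h`, minus the insertions applied
after b'. The norm kills 1 − t by `cyclicSum_rotate`, and N b = b' N does the rest. -/
theorem connesSum_hochSum (φ : List A → X) (l : List A) :
    connesSum k (hochSum k φ) l = - hochSum k (connesSum k φ) l := by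
  set s₁ : List A → X := onHead fun c x => φ (1 :: c :: x) with hs₁
  set s₂ : List A → X := onHead fun c x => φ (c :: 1 :: x) with hs₂
  set h : List A → X := onHead fun c x => onHead (fun b y => φ ((c * b) :: 1 :: y)) x with hh
  have e1 : ∀ c x, onHead (fun c x => hochSum k φ (1 :: c :: x) + hochSum k φ (c :: 1 :: x))
      (c :: x) = (φ (c :: x) - onLast (fun t c => ε ^ t.length • φ (c :: t)) (c :: x)) +
        (h (c :: x) - onLast (fun t c => ε ^ t.length • h (c :: t)) (c :: x)) -
        (mergeSum s₁ (c :: x) + mergeSum s₂ (c :: x)) := by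
    intro c x
    have m1 : mergeSum s₁ (c :: x) = mergeSum (fun t => φ (1 :: t)) (c :: x) :=
      mergeSum_congr_cons fun b t _ => rfl
    have m2 : mergeSum s₂ (c :: x) = h (c :: x) - mergeSum (fun t => φ (c :: 1 :: t)) x := by
      rw [mergeSum_cons]
      rfl
    have m3 : onLast (fun t c => ε ^ t.length • h (c :: t)) (c :: x) =
        ε ^ x.length • onLast (fun t y => φ ((y * c) :: 1 :: t)) x := by
      rcases List.eq_nil_or_concat' x with rfl | ⟨s, d, rfl⟩
      · simp [hh]
      · rw [← List.cons_append, onLast_append_singleton, onLast_append_singleton]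
        simp [hh]
    have m4 : ε ^ (c :: x).length • onLast (fun t y => φ ((y * 1) :: t)) (c :: x) =
        - onLast (fun t c => ε ^ t.length • φ (c :: t)) (c :: x) := by
      rcases List.eq_nil_or_concat' x with rfl | ⟨s, d, rfl⟩
      · simp
      · rw [← List.cons_append, onLast_append_singleton, onLast_append_singleton]
        simp [pow_succ]
    have m5 := hochSum_unit (k := k) φ c [] x
    simp only [List.nil_append, List.cons_append, mergeSum_singleton, List.length_nil, zero_add,
      pow_zero, one_smul] at m5
    rw [onHead_cons, m5, hochSum_cons, m1, m2, m3, m4, mergeSum_cons_cons, one_mul]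
    abel
  have e2 : hochSum k (connesSum k φ) l = cyclicSum k (fun t => mergeSum s₁ t + mergeSum s₂ t) l := by
    rw [connesSum, hochSum_cyclicSum]
    refine cyclicSum_congr (fun a t => ?_) l
    rw [← mergeSum_add]
    exact mergeSum_congr_cons fun b t _ => rfl
  rw [e2, connesSum, cyclicSum_congr (ψ := fun t =>
    (φ t - onLast (fun t c => ε ^ t.length • φ (c :: t)) t) +
        (h t - onLast (fun t c => ε ^ t.length • h (c :: t)) t) -
        (mergeSum s₁ t + mergeSum s₂ t)) e1, cyclicSum_sub, cyclicSum_add, cyclicSum_sub, cyclicSum_sub,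
    cyclicSum_rotate, cyclicSum_rotate, sub_self, sub_self]
  abel

theorem sum_range_rotate (H : ℕ → List A → X) (l : List A) :
    ∑ i ∈ Finset.range l.length, H i (l.rotate i) =
      letterSum (fun p c q => H p.length (c :: q ++ p)) l := by
  have h : ∀ (K : List A → List A → X) (l : List A),
      ∑ i ∈ Finset.range l.length, K (l.take i) (l.drop i) =
        letterSum (fun p c q => K p (c :: q)) l := by
    intro K l
    induction l generalizing K with
    | nil => rfl
    | cons a l ih =>
      rw [List.length_cons, Finset.sum_range_succ', letterSum_cons, add_comm, ← ih (fun p q => K (a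
        :: p) q)]
      rfl
  rw [← h (fun p q => H p.length (q ++ p))]
  refine Finset.sum_congr rfl fun i hi => ?_
  have hi' : i ≤ l.length := (Finset.mem_range.1 hi).le
  rw [List.rotate_eq_drop_append_take hi', List.length_take, min_eq_left hi']

theorem connesB_word (l : List A) : connesB k A (word k l) = connesSum k (word k) l := by
  let φ : ∀ N : ℕ, Multi N (TensorAlgebra k A) := fun N =>
    (LinearMap.mulLeft k (TensorAlgebra.ι k 1)).compMultilinearMap (TensorAlgebra.tprod k A N) +
      block (AlgHom.id k (TensorAlgebra k A)) 0 N
        ((LinearMap.mulRight k (TensorAlgebra.ι k 1)).compMultilinearMap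
          (TensorAlgebra.tprod k A 1))
  have hφ : ∀ (c : A) (x : List A), ofWords φ (word k (c :: x)) =
      word k (1 :: c :: x) + word k (c :: 1 :: x) := by
    intro c x
    rw [ofWords_word]
    change _ * TensorAlgebra.tprod k A _ _ + block _ 0 _ _ _ = _
    have h1 : ev ((LinearMap.mulRight k (TensorAlgebra.ι k 1)).compMultilinearMap
        (TensorAlgebra.tprod k A 1)) [c] = word k [c, 1] := by
      have h2 : ev (TensorAlgebra.tprod k A 1) [c] = word k [c] := by
        rw [ev_of_eq (TensorAlgebra.tprod k A 1) (l := [c]) rfl, word_eq_tprod]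
        rfl
      rw [ev_comp, h2, LinearMap.mulRight_apply, word_singleton, word_cons, word_singleton]
    have h3 := block_append (AlgHom.id k (TensorAlgebra k A))
      ((LinearMap.mulRight k (TensorAlgebra.ι k (1 : A))).compMultilinearMap
        (TensorAlgebra.tprod k A 1)) [] [c] x rfl (j := 0) rfl (l := c :: x) rfl
    rw [← word_eq_tprod, ← word_cons, h3, h1, word_nil]
    simp only [map_one, one_mul, AlgHom.id_apply]
    rw [← word_append]
    rfl
  rw [connesB, ofWords_word]
  simp only [sum_apply, smul_apply]
  have h1 : ∀ i, ((φ l.length).domDomCongr (finRotate l.length ^ i)) l.get =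
      ofWords φ (word k (l.rotate i)) := fun i => domDomCongr_finRotate l i φ
  have h2 := sum_range_rotate (fun i t => ε ^ (i * (l.length - 1)) • ofWords φ (word k t)) l
  refine (Finset.sum_congr rfl fun i _ => congrArg _ (h1 i)).trans (h2.trans ?_)
  rw [connesSum, cyclicSum]
  refine letterSum_congr fun p c q hl => ?_
  rw [List.cons_append, hφ, onHead_cons, ← hl]
  congr 1
  -- With rotation number `p.length` and `p.length + q.length + 1` letters the two exponents agree
  -- modulo 2, because p (p + 1) is even.
  refine neg_one_pow_eq ?_
  simp only [List.length_append, List.length_cons, ← Nat.add_assoc, Nat.add_sub_cancel]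
  have := Nat.even_mul_succ_self p.length
  have e : p.length * (p.length + q.length) + p.length * (q.length + 1) =
      p.length * (p.length + 1) + (p.length * q.length + p.length * q.length) := by ring
  rw [e]
  exact this.add ⟨_, rfl⟩

theorem linear_connesSum (F : X →ₗ[k] Y) (φ : List A → X) (l : List A) :
    F (connesSum k φ l) = connesSum k (fun t => F (φ t)) l := by
  rw [connesSum, connesSum, cyclicSum, cyclicSum, linear_letterSum]
  refine letterSum_congr fun p c q _ => ?_
  rw [map_smul, List.cons_append, onHead_cons, onHead_cons, map_add]

theorem connesSum_congr {φ ψ : List A → X} (h : ∀ t, φ t = ψ t) (l : List A) :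
    connesSum k φ l = connesSum k ψ l := by rw [show φ = ψ from funext h]

theorem boundary_connesB (x : TensorAlgebra k A) :
    boundary k A (connesB k A x) = - connesB k A (boundary k A x) := by
  have : boundary k A ∘ₗ connesB k A = - (connesB k A ∘ₗ boundary k A) := by
    refine ext_word fun l => ?_
    rw [LinearMap.neg_apply, LinearMap.comp_apply, LinearMap.comp_apply, connesB_word,
      boundary_word, linear_connesSum, connesSum_congr boundary_word, connesSum_hochSum,
      linear_hochSum, hochSum_congr fun t _ => connesB_word t]
  exact LinearMap.congr_fun this x

theorem letterSum_mem_submodule {S : Submodule k X} {H : List A → A → List A → X} {l : List A}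
    (h : ∀ p c q, p ++ c :: q = l → H p c q ∈ S) : letterSum H l ∈ S := by
  have := linear_letterSum S.mkQ H l
  have h' : letterSum (fun p c q => S.mkQ (H p c q)) l = letterSum (fun _ _ _ => 0) l :=
    letterSum_congr fun p c q hl => (Submodule.Quotient.mk_eq_zero S).2 (h p c q hl)
  rw [h', letterSum_zero] at this
  exact (Submodule.Quotient.mk_eq_zero S).1 this

theorem connesB_mem_chains {x : TensorAlgebra k A} (hx : x ∈ chains k A r) :
    connesB k A x ∈ chains k A (r + 1) := by
  refine chains_le (S := (chains k A (r + 1)).comap (connesB k A)) (fun a l hl => ?_) hx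
  rw [Submodule.mem_comap, connesB_word, connesSum, cyclicSum]
  refine letterSum_mem_submodule fun p c q h => Submodule.smul_mem _ _ ?_
  have := congrArg List.length h
  simp only [List.length_append, List.length_cons] at this
  rw [List.cons_append, onHead_cons]
  exact add_mem (word_mem_chains (by simp; omega)) (word_mem_chains (by simp; omega))

variable (k A) in
theorem exists_connes (r : ℕ) :
    ∃ B : HHhom k A r →ₗ[k] HHhom k A (r + 1), Induces (fun z => connesB k A z.1) B := by
  refine exists_induces (fun z : cycles k A r => connesB k A z.1) (fun z w => map_add _ _ _)
    (fun c z => map_smul _ _ _) (fun z => ⟨connesB_mem_chains z.2.1, ?_⟩) ?_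
  · have h : boundary k A z.1 = 0 := z.2.2
    change boundary k A _ = 0
    rw [boundary_connesB, h, map_zero, neg_zero]
  · rintro z ⟨y, hy, hyz⟩
    refine ⟨- connesB k A y, neg_mem (connesB_mem_chains hy), ?_⟩
    rw [map_neg, boundary_connesB, neg_neg, hyz]

/-! ### The cap product -/

theorem ev_uncurryLeft (g : A →ₗ[k] Multi m X) (a : A) (l : List A) :
    ev (LinearMap.uncurryLeft (M := fun _ : Fin (m + 1) => A) g) (a :: l) = ev (g a) l := by
  rw [← ev_curryLeft, LinearMap.curry_uncurryLeft]

theorem cap_word (f : Multi m A) (a : A) (l : List A) :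
    cap f (word k (a :: l)) = splitSum (fun u v => word k ((a * ev f u) :: v)) l := by
  rw [cap, ofWords_word]
  by_cases h : m ≤ l.length
  · obtain ⟨u, v, rfl, hu⟩ : ∃ u v, u ++ v = l ∧ u.length = m :=
      ⟨l.take m, l.drop m, by simp, by simp [h]⟩
    have h1 := fun g => block_append (AlgHom.id k (TensorAlgebra k A)) (m := m + 1) g [] (a :: u) v
      (by simp [hu]) (j := 0) rfl (l := a :: (u ++ v)) rfl
    rw [h1, ev_uncurryLeft, splitSum_eq_of_length]
    · simp only [LinearMap.coe_mk, AddHom.coe_mk]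
      rw [ev_comp, word_nil]
      simp only [map_one, one_mul, AlgHom.id_apply]
      rfl
    · intro p q hpq hp
      have h0 : ev f p = 0 := ev_of_ne f (by omega)
      rw [h0, mul_zero]
      exact (LetterLinear.word k).map_zero [] q
  · rw [block_of_lt _ _ (by simp; omega), splitSum_congr (G := fun _ _ => 0), splitSum_zero]
    intro p q hpq
    have h0 : ev f p = 0 := ev_of_ne f (by
      have := congrArg List.length hpq
      simp at this
      omega)
    rw [h0, mul_zero]
    exact (LetterLinear.word k).map_zero [] q

theorem cap_mem_chains (f : Multi m A) {x : TensorAlgebra k A} (hx : x ∈ chains k A (r + m)) :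
    cap f x ∈ chains k A r := by
  refine chains_le (S := (chains k A r).comap (cap f)) (fun a l hl => ?_) hx
  rw [Submodule.mem_comap, cap_word]
  refine splitSum_mem _ fun p q hpq => ?_
  by_cases hp : p.length = m
  · refine word_mem_chains ?_
    have := congrArg List.length hpq
    simp at this ⊢
    omega
  · have h0 := (LetterLinear.word (A := A) k).map_zero [] q
    simp only [List.nil_append] at h0
    rw [ev_of_ne f hp, mul_zero, h0]
    exact zero_mem _

/-- The faces of x before and inside the block taken by f belong to δf, those behind it to ∂(f ∩ x).
The product of f(u) with the letter behind the block occurs in both with opposite signs and is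
absent from f ∩ ∂x. -/
theorem cap_boundary (f : Multi m A) {x : TensorAlgebra k A} (hx : x ∈ chains k A r) :
    cap f (boundary k A x) = cap (delta (LinearMap.mul k A) (LinearMap.mul k A).flip m f) x +
        ε ^ m • boundary k A (cap f x) := by
  refine eqOn_chains (φ := cap f ∘ₗ boundary k A)
    (ψ := cap (delta (LinearMap.mul k A) (LinearMap.mul k A).flip m f) +
      ε ^ m • (boundary k A ∘ₗ cap f)) (fun a l _ => ?_) hx
  simp only [LinearMap.add_apply, LinearMap.smul_apply, LinearMap.comp_apply]
  have hW := LetterLinear.word (A := A) k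
  have e1 : cap f (boundary k A (word k (a :: l))) =
      onHead (fun b l' => splitSum (fun u v => word k ((a * b * ev f u) :: v)) l') l -
        splitSum (fun u v => mergeSum (fun t => word k ((a * ev f t) :: v)) u +
          ε ^ u.length • mergeSum (fun t => word k ((a * ev f u) :: t)) v) l +
      ε ^ l.length •
        onLast (fun t c => splitSum (fun u v => word k ((c * a * ev f u) :: v)) t) l := by
    have i1 : onHead (fun b t => cap f (word k ((a * b) :: t))) l =
        onHead (fun b l' => splitSum (fun u v => word k ((a * b * ev f u) :: v)) l') l :=
      onHead_congr fun b t _ => cap_word _ _ _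
    have i2 : mergeSum (fun t => cap f (word k (a :: t))) l =
        mergeSum (splitSum fun u v => word k ((a * ev f u) :: v)) l :=
      mergeSum_congr fun t _ => cap_word _ _ _
    have i3 : onLast (fun t c => cap f (word k ((c * a) :: t))) l =
        onLast (fun t c => splitSum (fun u v => word k ((c * a * ev f u) :: v)) t) l :=
      onLast_congr fun t c _ => cap_word _ _ _
    rw [boundary_word, linear_hochSum, hochSum_cons, mergeSum_cons, i1, i2, i3, ← mergeSum_splitSum k]
  have e2 : cap (delta (LinearMap.mul k A) (LinearMap.mul k A).flip m f) (word k (a :: l)) =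
      splitSum (fun u v => onHead (fun b u' => word k ((a * b * ev f u') :: v)) u -
        mergeSum (fun t => word k ((a * ev f t) :: v)) u +
        ε ^ (m + 1) • onLast (fun t c => word k ((a * ev f t * c) :: v)) u) l := by
    rw [cap_word]
    refine splitSum_congr fun u v _ => ?_
    have hd : ev (delta (LinearMap.mul k A) (LinearMap.mul k A).flip m f) u =
        onHead (fun b u' => b * ev f u') u - mergeSum (ev f) u +
          ε ^ (m + 1) • onLast (fun t c => ev f t * c) u := by
      cases u with
      | nil =>
        rw [ev_of_ne _ (by simp)]
        simp
      | cons b u =>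
        rw [ev_delta]
        rfl
    have hW' : IsLinearMap k fun x => word k ((a * x) :: v) := by
      refine ⟨fun x y => ?_, fun c x => ?_⟩
      · rw [mul_add]
        exact hW.add [] v _ _
      · rw [mul_smul_comm]
        exact hW.smul [] v _ _
    have h1 := linear_onHead (hW'.mk' _) (fun b u' => b * ev f u') u
    have h2 := linear_mergeSum (hW'.mk' _) (ev f) u
    have h3 := linear_onLast (hW'.mk' _) (fun t c => ev f t * c) u
    simp only [IsLinearMap.mk'_apply, ← mul_assoc] at h1 h2 h3
    rw [hd, hW'.map_add, hW'.map_sub, hW'.map_smul, h1, h2, h3]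
  have e3 : boundary k A (cap f (word k (a :: l))) =
      splitSum (fun u v => onHead (fun b v' => word k ((a * ev f u * b) :: v')) v -
        mergeSum (fun t => word k ((a * ev f u) :: t)) v +
        ε ^ (l.length + m) • onLast (fun t c => word k ((c * a * ev f u) :: t)) v) l := by
    rw [cap_word, linear_splitSum]
    refine splitSum_congr fun u v huv => ?_
    rw [boundary_word, hochSum_cons, mergeSum_cons]
    congr 1
    by_cases hu : u.length = m
    · simp only [← mul_assoc]
      congr 1
      refine neg_one_pow_eq ⟨v.length + m, ?_⟩
      rw [← huv, List.length_append, hu]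
      ring
    · have h0 : ∀ (y : A) (t : List A), word k ((y * ev f u) :: t) = 0 := by
        intro y t
        rw [ev_of_ne f hu, mul_zero]
        exact hW.map_zero [] t
      rw [ev_of_ne f hu]
      simp only [mul_zero]
      have := hW.map_zero []
      simp only [List.nil_append] at this
      simp only [this]
      have hz : onLast (fun (_ : List A) (_ : A) => (0 : TensorAlgebra k A)) v = 0 := by
        rcases List.eq_nil_or_concat' v with rfl | ⟨s, c, rfl⟩
        · rfl
        · rw [onLast_append_singleton]
      simp [hz]
  rw [e1, e2, e3]
  rw [← splitSum_onHead_left (fun b u v => word k ((a * b * ev f u) :: v)), ← splitSum_onLast_right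
    (fun u v c => word k ((c * a * ev f u) :: v))]
  simp only [splitSum_add, splitSum_sub]
  rw [splitSum_smul (ε ^ (m + 1)), splitSum_smul (ε ^ (l.length + m))]
  rw [splitSum_shift (fun t c v => word k ((a * ev f t * c) :: v))]
  have e4 : splitSum (fun u v => ε ^ u.length •
      mergeSum (fun t => word k ((a * ev f u) :: t)) v) l = ε ^ m •
      splitSum (fun u v => mergeSum (fun t => word k ((a * ev f u) :: t)) v) l := by
    rw [← splitSum_smul (ε ^ m)]
    refine splitSum_congr fun u v _ => ?_
    by_cases hu : u.length = m
    · rw [hu]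
    · rw [ev_of_ne f hu, mul_zero]
      have := hW.map_zero []
      simp only [List.nil_append] at this
      simp only [this, mergeSum_zero, smul_zero]
  rw [e4]
  rcases neg_one_pow_eq_or k m with h | h <;> simp only [pow_add, pow_succ, h] <;> module

theorem cap_add (m : ℕ) (f g : Multi m A) {x : TensorAlgebra k A} (hx : x ∈ chains k A r) :
    cap (f + g) x = cap f x + cap g x := by
  refine eqOn_chains (φ := cap (f + g)) (ψ := cap f + cap g) (fun a l _ => ?_) hx
  rw [LinearMap.add_apply, cap_word, cap_word, cap_word, ← splitSum_add]
  refine splitSum_congr fun u v _ => ?_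
  rw [ev_add, mul_add]
  exact (LetterLinear.word k).add [] v _ _

theorem cap_smul (m : ℕ) (c : k) (f : Multi m A) {x : TensorAlgebra k A} (hx : x ∈ chains k A r) :
    cap (c • f) x = c • cap f x := by
  refine eqOn_chains (φ := cap (c • f)) (ψ := c • cap f) (fun a l _ => ?_) hx
  rw [LinearMap.smul_apply, cap_word, cap_word, ← splitSum_smul]
  refine splitSum_congr fun u v _ => ?_
  rw [ev_smul, mul_smul_comm]
  exact (LetterLinear.word k).smul [] v _ _

theorem cap_zero (m : ℕ) {x : TensorAlgebra k A} (hx : x ∈ chains k A r) :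
    cap (0 : Multi m A) x = 0 := by simpa using cap_smul m (0 : k) (0 : Multi m A) hx

variable (k A) in
theorem exists_cap {s : ℕ} (h : s + m = r) :
    ∃ c : HH k A m →ₗ[k] HHhom k A r →ₗ[k] HHhom k A s, Induces₂ (fun f z => cap f.1 z.1) c := by
  subst h
  have hbf : ∀ (f : ZA k A m) {t : ℕ} {x : TensorAlgebra k A}, x ∈ chains k A t →
      cap f.1 (boundary k A x) = ε ^ m • boundary k A (cap f.1 x) := by
    intro f t x hx
    have h0 : delta (LinearMap.mul k A) (LinearMap.mul k A).flip m f.1 = 0 := f.2.2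
    rw [cap_boundary f.1 hx, h0, cap_zero _ hx, zero_add]
  have hsign : ε ^ m * ε ^ m = 1 := by rw [← pow_add, Even.neg_one_pow ⟨m, rfl⟩]
  refine exists_induces₂ (fun (f : ZA k A m) (z : cycles k A (s + m)) => cap f.1 z.1)
    (fun f g z => cap_add m _ _ z.2.1) (fun c f z => cap_smul m c _ z.2.1)
    (fun f z w => map_add _ _ _) (fun c f z => map_smul _ _ _)
    (fun f z => ⟨cap_mem_chains f.1 z.2.1, ?_⟩) ?_ ?_
  · have hz : boundary k A z.1 = 0 := z.2.2
    have h1 := hbf f z.2.1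
    rw [hz, map_zero] at h1
    change boundary k A _ = 0
    have h2 := congrArg (fun y => ε ^ m • y) h1
    simp only [smul_zero, smul_smul, hsign, one_smul] at h2
    exact h2.symm
  · intro f z hf
    have hz : boundary k A z.1 = 0 := z.2.2
    cases m with
    | zero =>
      have hf0 : f.1 = 0 := hf
      rw [hf0, cap_zero _ z.2.1]
      exact zero_mem _
    | succ m =>
      obtain ⟨g, -, hg⟩ := hf
      have h1 := cap_boundary g z.2.1
      rw [hz, map_zero, hg, eq_comm, add_eq_zero_iff_eq_neg] at h1
      rw [h1]
      refine neg_mem (Submodule.smul_mem _ _ ⟨cap g z.1, cap_mem_chains g ?_, rfl⟩)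
      have h2 : (z : TensorAlgebra k A) ∈ chains k A (s + (m + 1)) := z.2.1
      exact (show s + (m + 1) = s + 1 + m by omega) ▸ h2
  · rintro f z ⟨y, hy, hyz⟩
    change cap f.1 z.1 ∈ _
    rw [← hyz, hbf f hy]
    refine Submodule.smul_mem _ _ ⟨cap f.1 y, cap_mem_chains f.1 ?_, rfl⟩
    rwa [show s + m + 1 = s + 1 + m by omega] at hy

/-! ### The cap product with the last letters -/

theorem LetterLinear.onHead {H : A → List A → X} (h1 : ∀ l, IsLinearMap k fun a => H a l)
    (h2 : ∀ a, LetterLinear k (H a)) : LetterLinear k (SingHoch.onHead H) where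
  add p q a b := by
    cases p with
    | nil => exact (h1 q).map_add a b
    | cons c p => exact (h2 c).add p q a b
  smul p q c a := by
    cases p with
    | nil => exact (h1 q).map_smul c a
    | cons b p => exact (h2 b).smul p q c a

theorem LetterLinear.letterMap (hF : LetterLinear k F) (hφ : LetterLinear k φ) (x v : List A) :
    LetterLinear k fun u => φ (x ++ F u :: v) := hF.map ((hφ.isLinearMap x v).mk' _)

theorem LetterLinear.left (hφ : LetterLinear k φ) (t : List A) :
    LetterLinear k fun l => φ (l ++ t) := (hφ.around [] t).of_eq fun _ => rfl

theorem LetterLinear.right (hφ : LetterLinear k φ) (s : List A) :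
    LetterLinear k fun l => φ (s ++ l) := (hφ.around s []).of_eq fun l => by rw [List.append_nil]

theorem LetterLinear.const_smul (hφ : LetterLinear k φ) (c : k) : LetterLinear k fun l => c • φ l :=
  hφ.length_smul fun _ => c

theorem LetterLinear.split3 {H : List A → List A → List A → X}
    (h1 : ∀ u v, LetterLinear k fun x => H x u v) (h2 : ∀ x v, LetterLinear k fun u => H x u v)
    (h3 : ∀ x u, LetterLinear k fun v => H x u v) : LetterLinear k (SingHoch.split3 H) := by
  refine LetterLinear.splitSum (fun y => ?_)
    (fun x => LetterLinear.splitSum (fun v => h2 x v) (fun u => h3 x u))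
  refine ⟨fun p q a b => ?_, fun p q c a => ?_⟩
  · rw [← splitSum_add]
    exact splitSum_congr fun u v _ => (h1 u v).add p q a b
  · rw [← splitSum_smul]
    exact splitSum_congr fun u v _ => (h1 u v).smul p q c a

theorem LetterLinear.insertLetter (m : ℕ) (hF : LetterLinear k F) (hφ : LetterLinear k φ) :
    LetterLinear k (SingHoch.insertLetter k m F φ) :=
  LetterLinear.split3 (fun u v => (hφ.left (F u :: v)).length_smul fun n => ε ^ ((m + 1) * n))
    (fun x v => (hF.letterMap hφ x v).const_smul (ε ^ ((m + 1) * x.length)))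
    (fun x u => ((hφ.right (x ++ [F u])).const_smul (ε ^ ((m + 1) * x.length))).of_eq fun v => by simp)

theorem isLinearMap_mul_letter (hφ : LetterLinear k φ) (a b : A) (t : List A) :
    IsLinearMap k fun x => φ ((a * x * b) :: t) := by
  have h := hφ.isLinearMap ([] : List A) t
  refine ⟨fun x y => ?_, fun c x => ?_⟩
  · rw [mul_add, add_mul]
    exact h.map_add _ _
  · rw [mul_smul_comm, smul_mul_assoc]
    exact h.map_smul _ _

theorem capLast_letterLinear (hF : LetterLinear k F) :
    LetterLinear k (onHead fun a => splitSum fun x u => word k ((F u * a) :: x)) := by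
  have hW := LetterLinear.word (A := A) k
  refine LetterLinear.onHead (fun l => ?_) (fun a => ?_)
  · refine ⟨fun a b => ?_, fun c a => ?_⟩
    · rw [← splitSum_add]
      exact splitSum_congr fun x u _ => by
        have := (isLinearMap_mul_letter hW (F u) 1 x).map_add a b
        simpa using this
    · rw [← splitSum_smul]
      exact splitSum_congr fun x u _ => by
        have := (isLinearMap_mul_letter hW (F u) 1 x).map_smul c a
        simpa using this
  · refine LetterLinear.splitSum (fun u => (hW.right [F u * a]).of_eq fun x => rfl) (fun x => ?_)
    have := isLinearMap_mul_letter hW 1 a x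
    exact (hF.map (this.mk' _)).of_eq fun u => by simp

/-- `a₀ ⊗ ⋯ ⊗ a_r ↦ F(a_{r-m+1}, …, a_r) a₀ ⊗ a₁ ⊗ ⋯ ⊗ a_{r-m}` -/
def capLast (F : List A → A) (hF : LetterLinear k F) : TensorAlgebra k A →ₗ[k] TensorAlgebra k A :=
  wordMap _ (capLast_letterLinear hF)

theorem capLast_word (hF : LetterLinear k F) (a : A) (l : List A) :
    capLast F hF (word k (a :: l)) = splitSum (fun x u => word k ((F u * a) :: x)) l := by
  rw [capLast, wordMap_word]
  rfl

theorem capHomotopy_letterLinear (m : ℕ) (hF : LetterLinear k F) :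
    LetterLinear k (onHead fun a => insertLetter k m F fun t => word k (a :: t)) := by
  have hW := LetterLinear.word (A := A) k
  refine LetterLinear.onHead (fun l => ?_)
    (fun a => LetterLinear.insertLetter m hF ((hW.right [a]).of_eq fun x => rfl))
  have h := fun t => hW.isLinearMap ([] : List A) t
  refine ⟨fun a b => ?_, fun c a => ?_⟩
  · rw [insertLetter, insertLetter, insertLetter, ← split3_add]
    exact split3_congr fun x u v _ => by
      rw [← smul_add]
      exact congrArg _ ((h (x ++ F u :: v)).map_add a b)
  · rw [insertLetter, insertLetter, ← split3_smul]
    exact split3_congr fun x u v _ => by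
      rw [smul_comm]
      exact congrArg _ ((h (x ++ F u :: v)).map_smul c a)

/-- `a₀ ⊗ ⋯ ⊗ a_r ↦ ∑ ± a₀ ⊗ ⋯ ⊗ F(a_{i+1}, …, a_{i+m}) ⊗ ⋯ ⊗ a_r` -/
def capHomotopy (m : ℕ) (F : List A → A) (hF : LetterLinear k F) :
    TensorAlgebra k A →ₗ[k] TensorAlgebra k A := wordMap _ (capHomotopy_letterLinear m hF)

theorem capHomotopy_word (m : ℕ) (hF : LetterLinear k F) (a : A) (l : List A) :
    capHomotopy m F hF (word k (a :: l)) = insertLetter k m F (fun t => word k (a :: t)) l := by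
  rw [capHomotopy, wordMap_word]
  rfl

theorem splitSum_eq_onHead (G : List A → List A → X) (l : List A) :
    splitSum G l = G [] l + onHead (fun c l' => splitSum (fun p q => G (c :: p) q) l') l := by
  cases l with
  | nil => simp
  | cons a l => rfl

theorem splitSum_eq_onLast (G : List A → List A → X) (l : List A) :
    splitSum G l = onLast (fun l' c => splitSum (fun p q => G p (q ++ [c])) l') l + G l [] := by
  rcases List.eq_nil_or_concat' l with rfl | ⟨s, c, rfl⟩
  · simp
  · rw [splitSum_append_singleton, onLast_append_singleton]

theorem onHead_smul (c : k) (F : A → List A → X) (l : List A) :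
    onHead (fun a t => c • F a t) l = c • onHead F l := by cases l <;> simp

theorem insertLetter_congr (m : ℕ) (F : List A → A) {φ ψ : List A → X} {l : List A}
    (h : ∀ t, φ t = ψ t) : insertLetter k m F φ l = insertLetter k m F ψ l := by
  rw [show φ = ψ from funext h]

theorem insertLetter_onHead (F : List A → A) (H : A → List A → X) (l : List A) :
    insertLetter k m F (onHead H) l = splitSum (fun u v => H (F u) v) l +
      ε ^ (m + 1) • onHead (fun b t => insertLetter k m F (H b) t) l := by
  rw [insertLetter, split3, splitSum_eq_onHead]
  congr 1
  · simp
  · rw [← onHead_smul]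
    refine onHead_congr fun b t _ => ?_
    rw [insertLetter, split3, ← splitSum_smul (ε ^ (m + 1))]
    refine splitSum_congr fun x y _ => ?_
    rw [← splitSum_smul (ε ^ (m + 1))]
    refine splitSum_congr fun u v _ => ?_
    rw [List.cons_append, onHead_cons, smul_smul, ← pow_add]
    congr 1
    exact neg_one_pow_eq ⟨(m + 1) * (x.length + 1), by rw [List.length_cons]; ring⟩

theorem splitSum_swap_last (G : List A → List A → List A → X) (l : List A) :
    split3 G l = onLast (fun t c => split3 (fun x u v => G x u (v ++ [c])) t) l +
      splitSum (fun x u => G x u []) l := by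
  have h : split3 G l = split3 (fun x u v => onLast (fun v' c => G x u (v' ++ [c])) v) l +
      splitSum (fun x u => G x u []) l := by
    rw [split3, split3, ← splitSum_add]
    refine splitSum_congr fun x y _ => ?_
    rw [splitSum_eq_onLast, splitSum_onLast_right]
  rw [h, split3_onLast_right]

theorem insertLetter_onLast (hF : ∀ l : List A, l.length ≠ m → F l = 0) {H : List A → A → X}
    (h0 : ∀ x, H x 0 = 0) (hH : ∀ x v c, H (x ++ 0 :: v) c = 0) (l : List A) :
    insertLetter k m F (fun t => ε ^ t.length • onLast H t) l =
      ε ^ (m * (l.length + 1) + 1) • splitSum (fun x u => H x (F u)) l +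
      ε ^ (l.length + m + 1) • onLast (fun t c => insertLetter k m F (fun x => H x c) t) l := by
  rw [insertLetter, splitSum_swap_last, add_comm, ← splitSum_smul, ← onLast_smul]
  congr 1
  · refine splitSum_congr fun x u hl => ?_
    by_cases hu : u.length = m
    · rw [onLast_append_singleton, smul_smul, ← pow_add]
      congr 1
      refine neg_one_pow_eq ⟨m * x.length + x.length + 1 + m * (m + 1) / 2, ?_⟩
      have h2 : m * (m + 1) / 2 * 2 = m * (m + 1) := Nat.div_mul_cancel (Nat.even_mul_succ_self m).two_dvd
      rw [← hl]
      simp only [List.length_append, List.length_cons, List.length_nil, hu]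
      generalize m * (m + 1) / 2 = d at *
      linarith
    · rw [hF u hu, onLast_append_singleton, h0, smul_zero, smul_zero, smul_zero]
  · refine onLast_congr fun t c ht => ?_
    rw [insertLetter, ← split3_smul]
    refine split3_congr fun x u v hx => ?_
    by_cases hu : u.length = m
    · rw [← List.cons_append, ← List.append_assoc, onLast_append_singleton, smul_smul, smul_smul, ←
        pow_add, ← pow_add]
      congr 1
      refine neg_one_pow_eq ⟨(m + 1) * x.length + x.length + v.length + m + 2, ?_⟩
      rw [← ht, ← hx]
      simp only [List.length_append, List.length_cons, List.length_nil, hu]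
      ring
    · rw [hF u hu, ← List.cons_append, ← List.append_assoc, onLast_append_singleton, hH]
      simp

theorem linear_insertLetter (ψ : X →ₗ[k] Y) (m : ℕ) (F : List A → A) (φ : List A → X) (l : List A) :
    ψ (insertLetter k m F φ l) = insertLetter k m F (fun t => ψ (φ t)) l := by
  rw [insertLetter, split3, linear_splitSum]
  refine splitSum_congr fun x y _ => ?_
  rw [linear_splitSum]
  refine splitSum_congr fun u v _ => ?_
  rw [map_smul]

theorem insertLetter_add (m : ℕ) (F : List A → A) (φ ψ : List A → X) (l : List A) :
    insertLetter k m F (fun t => φ t + ψ t) l =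
      insertLetter k m F φ l + insertLetter k m F ψ l := by
  simp only [insertLetter, smul_add, split3_add]

theorem insertLetter_sub (m : ℕ) (F : List A → A) (φ ψ : List A → X) (l : List A) :
    insertLetter k m F (fun t => φ t - ψ t) l =
      insertLetter k m F φ l - insertLetter k m F ψ l := by
  simp only [insertLetter, smul_sub, split3_sub]

/-- The homotopy inserts the value of f in every place behind a₀. In its boundary only the two
products of that value with a₀ survive, one directly and one around the end: these are the cap
products with the first and with the last letters. -/
theorem boundary_capHomotopy (f : ZA k A m) (hz : z ∈ chains k A r) :
    boundary k A (capHomotopy m (ev f.1) (LetterLinear.ev f.1) z) =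
      cap f.1 z - ε ^ (m * (r + 1)) • capLast (ev f.1) (LetterLinear.ev f.1) z +
        ε ^ (m + 1) • capHomotopy m (ev f.1) (LetterLinear.ev f.1) (boundary k A z) := by
  set D := capHomotopy m (ev f.1) (LetterLinear.ev f.1) with hD
  have hF := listCocycle_ev f
  have hW := LetterLinear.word (A := A) k
  refine eqOn_chains (φ := boundary k A ∘ₗ D) (ψ := cap f.1 - ε ^ (m * (r + 1)) •
    capLast (ev f.1) (LetterLinear.ev f.1) + ε ^ (m + 1) • (D ∘ₗ boundary k A))
    (fun a l hl => ?_) hz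
  simp only [LinearMap.add_apply, LinearMap.sub_apply, LinearMap.smul_apply, LinearMap.comp_apply]
  have hWa : ∀ a : A, LetterLinear k fun t => word k (a :: t) := fun a =>
    (hW.right [a]).of_eq fun x => rfl
  have e1 : boundary k A (D (word k (a :: l))) =
      insertLetter k m (ev f.1) (onHead fun b t => word k ((a * b) :: t)) l -
      insertLetter k m (ev f.1) (mergeSum fun t => word k (a :: t)) l +
      insertLetter k m (ev f.1)
        (fun t => ε ^ t.length • onLast (fun t c => word k ((c * a) :: t)) t) l := by
    rw [hD, capHomotopy_word, linear_insertLetter, ← insertLetter_sub, ← insertLetter_add]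
    refine insertLetter_congr m _ fun t => ?_
    rw [boundary_word, hochSum_cons, mergeSum_cons]
  have e2 : D (boundary k A (word k (a :: l))) =
      onHead (fun b t => insertLetter k m (ev f.1) (fun t => word k ((a * b) :: t)) t) l -
      mergeSum (insertLetter k m (ev f.1) fun t => word k (a :: t)) l +
      ε ^ l.length •
        onLast (fun t c => insertLetter k m (ev f.1) (fun t => word k ((c * a) :: t)) t) l := by
    rw [boundary_word, linear_hochSum, hochSum_cons, mergeSum_cons]
    simp only [hD, capHomotopy_word]
  have h0 : ∀ x : List A, word k ((0 * a) :: x) = 0 := fun x => by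
    rw [zero_mul]; exact hW.map_zero [] x
  rw [e1, e2, insertLetter_mergeSum hF (hWa a), insertLetter_onHead, insertLetter_onLast hF.length
    h0 (fun x v c => hW.map_zero ((c * a) :: x) v), cap_word, capLast_word, hl]
  rcases neg_one_pow_eq_or k m with h | h <;> simp only [pow_add, pow_one, h] <;> module

/-! ### The operator `Δ` -/

section BV

theorem pairing_word (f : Multi m A) (a : A) (l : List A) :
    pairing form f (word k (a :: l)) = form a (ev f l) := by
  refine (ev_uncurryLeft _ a l).trans ?_
  exact ev_comp (form a) f l

theorem pairing_add (f g : Multi m A) {x : TensorAlgebra k A} (hx : x ∈ chains k A r) :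
    pairing form (f + g) x = pairing form f x + pairing form g x := by
  refine eqOn_chains (φ := pairing form (f + g)) (ψ := pairing form f + pairing form g)
    (fun a l _ => ?_) hx
  rw [LinearMap.add_apply, pairing_word, pairing_word, pairing_word, ev_add, map_add]

theorem pairing_smul (c : k) (f : Multi m A) {x : TensorAlgebra k A} (hx : x ∈ chains k A r) :
    pairing form (c • f) x = c • pairing form f x := by
  refine eqOn_chains (φ := pairing form (c • f)) (ψ := c • pairing form f) (fun a l _ => ?_) hx
  rw [LinearMap.smul_apply, pairing_word, pairing_word, ev_smul, map_smul]

/-- Symmetry and associativity of the form carry the right factor in the last term of δf to the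
front, where it becomes the wrap-around term of ∂. -/
theorem pairing_delta (hf : IsSymmetrizing form) (f : Multi m A) {x : TensorAlgebra k A}
    (hx : x ∈ chains k A (m + 1)) :
    pairing form (delta (LinearMap.mul k A) (LinearMap.mul k A).flip m f) x =
      pairing form f (boundary k A x) := by
  refine eqOn_chains (φ := pairing form (delta (LinearMap.mul k A) (LinearMap.mul k A).flip m f))
    (ψ := pairing form f ∘ₗ boundary k A) (fun a l hl => ?_) hx
  obtain ⟨b, l, rfl⟩ := List.exists_cons_of_length_eq_add_one hl
  rw [LinearMap.comp_apply, pairing_word, ev_delta, boundary_word, linear_hochSum, hochSum_cons,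
    mergeSum_cons (fun t => pairing form f (word k t)) a, map_add, map_sub, map_smul,
    linear_mergeSum, linear_onLast, hl, onHead_cons]
  congr 2
  · rw [pairing_word, hf.assoc]
    rfl
  · exact mergeSum_congr fun t _ => (pairing_word _ _ _).symm
  · refine onLast_congr fun t c _ => ?_
    rw [pairing_word, hf.assoc, hf.symm c, hf.assoc]
    rfl

variable [FiniteDimensional k A]

theorem ev_tprod_word {l : List A} (hl : l.length = n) :
    ev (TensorAlgebra.tprod k A n) l = word k l := by
  subst hl
  rw [ev_of_eq _ rfl, word_eq_tprod]
  rfl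

theorem form_bvDelta (hf : IsSymmetrizing form) (f : Multi m A) (a : A) {l : List A}
    (hl : l.length = m - 1) :
    form (ev (bvDelta hf f) l) a = ε ^ m • pairing form f (connesB k A (word k (a :: l))) := by
  rw [bvDelta, ev_comp, LinearMap.comp_apply, LinearEquiv.coe_coe,
    LinearMap.BilinForm.apply_toDual_symm_apply, ev_tprod_word hl, word_cons]
  rfl

theorem pairing_bvDelta (hf : IsSymmetrizing form) (f : Multi m A) {x : TensorAlgebra k A}
    (hx : x ∈ chains k A (m - 1)) :
    pairing form (bvDelta hf f) x = ε ^ m • pairing form f (connesB k A x) := by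
  refine eqOn_chains (φ := pairing form (bvDelta hf f))
    (ψ := ε ^ m • (pairing form f ∘ₗ connesB k A)) (fun a l hl => ?_) hx
  rw [pairing_word, hf.symm, form_bvDelta hf f a hl]
  rfl

theorem eq_of_form (hf : IsSymmetrizing form) {x y : A} (h : ∀ a, form x a = form y a) : x = y := by
  refine sub_eq_zero.1 (hf.nondegenerate.1 _ fun a => ?_)
  rw [map_sub, LinearMap.sub_apply, h, sub_self]

theorem eq_of_pairing (hf : IsSymmetrizing form) {f g : Multi m A}
    (h : ∀ x ∈ chains k A m, pairing form f x = pairing form g x) : f = g := by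
  refine ext_ev fun l hl => eq_of_form hf fun a => ?_
  have := h (word k (a :: l)) (word_mem_chains (by simp [hl]))
  rwa [pairing_word, pairing_word, hf.symm, hf.symm a] at this

theorem bvDelta_add (hf : IsSymmetrizing form) (f g : Multi m A) :
    bvDelta hf (f + g) = bvDelta hf f + bvDelta hf g := by
  refine eq_of_pairing hf fun x hx => ?_
  rw [pairing_add _ _ hx, pairing_bvDelta hf _ hx, pairing_bvDelta hf _ hx, pairing_bvDelta hf _ hx,
    pairing_add _ _ (connesB_mem_chains hx), smul_add]

theorem bvDelta_smul (hf : IsSymmetrizing form) (c : k) (f : Multi m A) :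
    bvDelta hf (c • f) = c • bvDelta hf f := by
  refine eq_of_pairing hf fun x hx => ?_
  rw [pairing_smul _ _ hx, pairing_bvDelta hf _ hx, pairing_bvDelta hf _ hx, pairing_smul _ _
    (connesB_mem_chains hx), smul_comm]

theorem bvDelta_mem (hf : IsSymmetrizing form) {f : Multi m A}
    (h : f ∈ cochains A (⊤ : Submodule k A) m) :
    bvDelta hf f ∈ cochains A (⊤ : Submodule k A) (m - 1) := by
  refine mem_cochains (fun _ _ => trivial) fun p q hpq => eq_of_form hf fun a => ?_
  rw [form_bvDelta hf f a (by simp; omega), connesB_word, linear_connesSum, connesSum, cyclicSum,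
    letterSum_congr (G := fun _ _ _ => 0), letterSum_zero, smul_zero, map_zero,
    LinearMap.zero_apply]
  intro x c y hxy
  rw [List.cons_append, onHead_cons, pairing_word, pairing_word]
  have h1 : ev f (1 :: (y ++ x)) = 0 := ev_eq_zero_of_mem h [] (y ++ x)
  have h2 : ev f (c :: (y ++ x)) = 0 := by
    have hmem : (1 : A) ∈ c :: (y ++ x) := by
      have : (1 : A) ∈ x ++ c :: y := by rw [hxy]; simp
      simp only [List.mem_append, List.mem_cons] at this ⊢
      tauto
    obtain ⟨s, t, hst⟩ := List.append_of_mem hmem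
    rw [hst]
    exact ev_eq_zero_of_mem h s t
  rw [h1, h2, map_zero, map_zero, add_zero, smul_zero]

/-- A cochain is determined by its pairing with chains, under which δ is the transpose of ∂ and Δ
that of ± B. So the claim is ∂B = −B∂, with the minus sign absorbed by the sign in Δ. -/
theorem delta_bvDelta (hf : IsSymmetrizing form) (f : Multi (m + 1) A) :
    delta (LinearMap.mul k A) (LinearMap.mul k A).flip m (bvDelta hf f) =
      bvDelta hf (delta (LinearMap.mul k A) (LinearMap.mul k A).flip (m + 1) f) := by
  refine eq_of_pairing hf fun x hx => ?_
  have hx' : x ∈ chains k A (m + 1) := hx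
  have h1 : boundary k A x ∈ chains k A (m + 1 - 1) := boundary_mem_chains hx'
  refine (pairing_delta hf (m := m) (bvDelta hf f) hx').trans ?_
  rw [pairing_bvDelta hf _ h1]
  refine Eq.trans ?_ (pairing_bvDelta hf (m := m + 1 + 1) _ hx').symm
  rw [pairing_delta hf _ (connesB_mem_chains hx'), boundary_connesB, map_neg, pow_succ]
  module

/-- In degree 0 the only coboundary is 0, so Δδ has to vanish exactly; it does because ∂ is zero on
chains with one letter. -/
theorem bvDelta_delta_zero (hf : IsSymmetrizing form) (f : Multi 0 A) :
    bvDelta hf (delta (LinearMap.mul k A) (LinearMap.mul k A).flip 0 f) = 0 := by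
  refine eq_of_pairing hf fun x hx => ?_
  have hx' : x ∈ chains k A 0 := hx
  rw [pairing_bvDelta hf _ hx, pairing_delta hf _ (connesB_mem_chains hx'), boundary_connesB,
    boundary_chains_zero hx', map_zero, neg_zero, map_zero, smul_zero]
  refine (eqOn_chains (φ := pairing form (0 : Multi 0 A)) (ψ := 0) (fun a l _ => ?_) hx').symm
  rw [pairing_word, ev_zero, map_zero, LinearMap.zero_apply]

theorem exists_bvDelta (hf : IsSymmetrizing form) (hm : 1 ≤ m) :
    ∃ Δ : HH k A m →ₗ[k] HH k A (m - 1), Induces (fun f => bvDelta hf f.1) Δ := by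
  obtain ⟨m, rfl⟩ : ∃ m', m = m' + 1 := ⟨m - 1, by omega⟩
  refine exists_induces (fun f : ZA k A (m + 1) => bvDelta hf f.1) (fun f g => bvDelta_add hf _ _)
    (fun c f => bvDelta_smul hf c _) (fun f => ⟨bvDelta_mem hf f.2.1, ?_⟩) ?_
  · have h0 : delta (LinearMap.mul k A) (LinearMap.mul k A).flip (m + 1) f.1 = 0 := f.2.2
    change delta _ _ m (bvDelta hf f.1) = 0
    rw [delta_bvDelta, h0]
    have := bvDelta_smul hf (0 : k) (0 : Multi (m + 1 + 1) A)
    simpa using this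
  · rintro f ⟨g, hg, hgf⟩
    change bvDelta hf f.1 ∈ _
    rw [← hgf]
    cases m with
    | zero =>
      rw [bvDelta_delta_zero]
      exact zero_mem _
    | succ m => exact ⟨bvDelta hf g, bvDelta_mem hf hg, delta_bvDelta hf g⟩

end BV

/-! ### Sums over splittings of two lists -/

section Split5

/-- The value `y` at the empty list, and `0` elsewhere. -/
def onNil (y : X) : List A → X
  | [] => y
  | _ :: _ => 0

@[simp] theorem onNil_nil (y : X) : onNil y ([] : List A) = y := rfl
@[simp] theorem onNil_cons (y : X) (a : A) (l : List A) : onNil y (a :: l) = 0 := rfl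

theorem onHead_append_cons (H : A → List A → X) (p : List A) (c : A) (l : List A) :
    onHead H (p ++ c :: l) = onHead (fun b p' => H b (p' ++ c :: l)) p + onNil (H c l) p := by
  cases p <;> simp

theorem onLast_append_cons (H : List A → A → X) (p : List A) (c : A) (l : List A) :
    onLast H (p ++ c :: l) = onLast (fun l' d => H (p ++ c :: l') d) l + onNil (H p c) l := by
  rcases List.eq_nil_or_concat' l with rfl | ⟨s, d, rfl⟩
  · simp
  · rw [← List.cons_append, ← List.append_assoc, onLast_append_singleton, onLast_append_singleton]
    cases s <;> simp

theorem splitSum_onNil_left (G : List A → List A → X) (l : List A) :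
    splitSum (fun p q => onNil (G p q) p) l = G [] l := by
  cases l with
  | nil => rfl
  | cons a l => rw [splitSum_cons]; simp [splitSum_zero]

theorem splitSum_onNil_right (G : List A → List A → X) (l : List A) :
    splitSum (fun p q => onNil (G p q) q) l = G l [] := by
  induction l generalizing G with
  | nil => rfl
  | cons a l ih => rw [splitSum_cons, ih (fun p q => G (a :: p) q)]; simp

theorem onNil_finsum (s : Finset ι) (y : ι → X) (l : List A) :
    onNil (∑ i ∈ s, y i) l = ∑ i ∈ s, onNil (y i) l := by cases l <;> simp

theorem onNil_smul (c : k) (y : X) (l : List A) : onNil (c • y) l = c • onNil y l := by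
  cases l <;> simp

theorem onHead_length_smul {c d : ℕ → k} (h : ∀ n, c n = d (n + 1)) (H : A → List A → X)
    (l : List A) : onHead (fun a t => c t.length • H a t) l = d l.length • onHead H l := by
  cases l <;> simp [h]

theorem onLast_length_smul {c d : ℕ → k} (h : ∀ n, c n = d (n + 1)) (H : List A → A → X)
    (l : List A) : onLast (fun t a => c t.length • H t a) l = d l.length • onLast H l := by
  rcases List.eq_nil_or_concat' l with rfl | ⟨t, b, rfl⟩ <;> simp [h]

theorem mergeSum_length_smul {c d : ℕ → k} (h : ∀ n, c n = d (n + 1)) (H : List A → X)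
    (l : List A) : mergeSum (fun t => c t.length • H t) l = d l.length • mergeSum H l := by
  rw [← mergeSum_smul]
  refine mergeSum_congr fun t ht => ?_
  rw [← ht, h]

theorem mergeSum_splitSum_out (G : List A → List A → List A → X) (y : List A) (l : List A) :
    mergeSum (fun t => splitSum (G t) y) l =
      splitSum (fun u v => mergeSum (fun t => G t u v) l) y := by
  induction y generalizing G with
  | nil => rfl
  | cons a y ih => simp only [splitSum_cons, mergeSum_add, ih]

theorem onHead_splitSum_out (G : A → List A → List A → List A → X) (y : List A) (l : List A) :
    onHead (fun a t => splitSum (G a t) y) l =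
      splitSum (fun u v => onHead (fun a t => G a t u v) l) y := by
  cases l with
  | nil => exact (splitSum_zero y).symm
  | cons a l => rfl

theorem onLast_splitSum_out (G : List A → A → List A → List A → X) (y : List A) (l : List A) :
    onLast (fun t a => splitSum (G t a) y) l =
      splitSum (fun u v => onLast (fun t a => G t a u v) l) y := by
  rcases List.eq_nil_or_concat' l with rfl | ⟨t, b, rfl⟩
  · exact (splitSum_zero y).symm
  · simp only [onLast_append_singleton]

theorem onNil_splitSum_out (G : List A → List A → X) (x y : List A) :
    splitSum (fun u v => onNil (G u v) x) y = onNil (splitSum G y) x := by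
  cases x with
  | nil => rfl
  | cons a x => exact splitSum_zero y

/-- The sum over all ways to split a list into two and another one into three. -/
def split5 (H : List A → List A → List A → List A → List A → X) (β ζ : List A) : X :=
  splitSum (fun p q => split3 (H p q) ζ) β

variable {H H' : List A → List A → List A → List A → List A → X} {β ζ : List A}

theorem split5_congr
    (h : ∀ p q x u v, p ++ q = β → x ++ (u ++ v) = ζ → H p q x u v = H' p q x u v) :
    split5 H β ζ = split5 H' β ζ :=
  splitSum_congr fun p q h1 => split3_congr fun x u v h2 => h p q x u v h1 h2

variable (H H' β ζ)

theorem split5_add :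
    split5 (fun p q x u v => H p q x u v + H' p q x u v) β ζ = split5 H β ζ + split5 H' β ζ := by
  simp only [split5, split3_add, splitSum_add]

theorem split5_sub :
    split5 (fun p q x u v => H p q x u v - H' p q x u v) β ζ = split5 H β ζ - split5 H' β ζ := by
  simp only [split5, split3_sub, splitSum_sub]

theorem split5_smul (c : k) : split5 (fun p q x u v => c • H p q x u v) β ζ = c • split5 H β ζ := by
  simp only [split5, split3_smul, splitSum_smul]

theorem split5_zero : split5 (fun _ _ _ _ _ => (0 : X)) β ζ = 0 := by
  simp only [split5, split3_zero, splitSum_zero]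

theorem split5_onHead_first (G : A → List A → List A → List A → List A → List A → X) :
    split5 (fun p q x u v => onHead (fun b p' => G b p' q x u v) p) β ζ =
      onHead (fun b β' => split5 (G b) β' ζ) β := by
  refine Eq.trans ?_ (splitSum_onHead_left (fun b p q => split3 (G b p q) ζ) β)
  refine splitSum_congr fun p q _ => ?_
  simp only [split3, onHead_splitSum_out]

variable (k) in
theorem mergeSum_split5_first : mergeSum (fun β' => split5 H β' ζ) β =
    split5 (fun p q x u v => mergeSum (fun p' => H p' q x u v) p +
      ε ^ p.length • mergeSum (fun q' => H p q' x u v) q) β ζ := by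
  refine (mergeSum_splitSum k _ β).trans (splitSum_congr fun p q _ => ?_)
  rw [split3_add, split3_smul]
  simp only [split3, mergeSum_splitSum_out]

theorem split5_shift_first (G : List A → A → List A → List A → List A → List A → X) :
    split5 (fun p q x u v => onLast (fun p' a => G p' a q x u v) p) β ζ =
      split5 (fun p q x u v => onHead (fun a q' => G p a q' x u v) q) β ζ := by
  refine Eq.trans ?_ ((splitSum_shift (fun p a q => split3 (G p a q) ζ) β).trans ?_)
  · refine splitSum_congr fun p q _ => ?_
    simp only [split3, onLast_splitSum_out]
  · refine splitSum_congr fun p q _ => ?_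
    simp only [split3, onHead_splitSum_out]

theorem split5_onHead_second (G : A → List A → List A → List A → List A → List A → X) :
    split5 (fun p q x u v => onHead (fun a x' => G a p q x' u v) x) β ζ =
      onHead (fun a ζ' => split5 (G a) β ζ') ζ := by
  refine (splitSum_congr fun p q _ => split3_onHead_left (fun a => G a p q) ζ).trans ?_
  exact (onHead_splitSum_out (fun a ζ' p q => split3 (G a p q) ζ') β ζ).symm

theorem split5_onLast_second (G : A → List A → List A → List A → List A → List A → X) :
    split5 (fun p q x u v => onLast (fun v' c => G c p q x u v') v) β ζ =
      onLast (fun ζ' c => split5 (G c) β ζ') ζ := by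
  refine (splitSum_congr fun p q _ => split3_onLast_right (fun x u v c => G c p q x u v) ζ).trans ?_
  exact (onLast_splitSum_out (fun ζ' c p q => split3 (G c p q) ζ') β ζ).symm

variable (k) in
theorem mergeSum_split5_second : mergeSum (fun ζ' => split5 H β ζ') ζ =
    split5 (fun p q x u v => mergeSum (fun t => H p q t u v) x +
      ε ^ x.length • mergeSum (fun t => H p q x t v) u +
      ε ^ (x.length + u.length) • mergeSum (fun t => H p q x u t) v) β ζ := by
  refine (mergeSum_splitSum_out (fun ζ' p q => split3 (H p q) ζ') β ζ).trans ?_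
  exact splitSum_congr fun p q _ => mergeSum_split3 k (H p q) ζ

theorem split5_shift_left (G : List A → List A → List A → A → List A → List A → X) :
    split5 (fun p q x u v => onLast (fun x' a => G p q x' a u v) x) β ζ =
      split5 (fun p q x u v => onHead (fun a u' => G p q x a u' v) u) β ζ :=
  splitSum_congr fun p q _ => split3_shift_left (G p q) ζ

theorem split5_shift_right (G : List A → List A → List A → List A → A → List A → X) :
    split5 (fun p q x u v => onLast (fun u' a => G p q x u' a v) u) β ζ =
      split5 (fun p q x u v => onHead (fun a v' => G p q x u a v') v) β ζ :=
  splitSum_congr fun p q _ => split3_shift_right (G p q) ζ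

variable {s t t' t'' : ℕ → ℕ → ℕ → ℕ → ℕ}

variable (k) in
/-- The sum over all splittings with signs that depend on the numbers of letters. -/
def signSum (s : ℕ → ℕ → ℕ → ℕ → ℕ) (H : List A → List A → List A → List A → List A → X)
    (β ζ : List A) : X :=
  split5 (fun p q x u v => ε ^ s p.length x.length u.length v.length • H p q x u v) β ζ

/-- A letter that crosses from one block to the next changes the lengths and with them the sign. The
parity hypothesis compares the two sign functions at the lengths before and after. -/
theorem signSum_shift_first (G : List A → A → List A → List A → List A → List A → X)
    (h : ∀ p x u v, Even (s (p + 1) x u v) ↔ Even (t p x u v)) :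
    signSum k s (fun p q x u v => onLast (fun p' a => G p' a q x u v) p) β ζ =
      signSum k t (fun p q x u v => onHead (fun a q' => G p a q' x u v) q) β ζ := by
  refine (split5_congr fun p q x u v _ _ => (onLast_length_smul
    (c := fun n => (-1) ^ t n x.length u.length v.length)
    (d := fun n => (-1) ^ s n x.length u.length v.length)
    (fun n => neg_one_pow_congr (h n _ _ _).symm) _ p).symm).trans ?_
  simp only [split5_shift_first, onHead_smul, signSum]

theorem signSum_shift_left (G : List A → List A → List A → A → List A → List A → X)
    (h : ∀ p x u v, Even (s p (x + 1) u v) ↔ Even (t p x (u + 1) v)) :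
    signSum k s (fun p q x u v => onLast (fun x' a => G p q x' a u v) x) β ζ =
      signSum k t (fun p q x u v => onHead (fun a u' => G p q x a u' v) u) β ζ := by
  refine (split5_congr fun p q x u v _ _ => (onLast_length_smul
    (c := fun n => (-1) ^ s p.length (n + 1) u.length v.length)
    (d := fun n => (-1) ^ s p.length n u.length v.length) (fun _ => rfl) _ x).symm).trans ?_
  rw [split5_shift_left (G := fun p q x a u v =>
    (-1) ^ s p.length (x.length + 1) u.length v.length • G p q x a u v)]
  exact split5_congr fun p _ x u v _ _ => onHead_length_smul
    (c := fun n => (-1) ^ s p.length (x.length + 1) n v.length)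
    (d := fun n => (-1) ^ t p.length x.length n v.length)
    (fun n => neg_one_pow_congr (h _ _ n _)) _ u

theorem signSum_shift_right (G : List A → List A → List A → List A → A → List A → X)
    (h : ∀ p x u v, Even (s p x (u + 1) v) ↔ Even (t p x u (v + 1))) :
    signSum k s (fun p q x u v => onLast (fun u' a => G p q x u' a v) u) β ζ =
      signSum k t (fun p q x u v => onHead (fun a v' => G p q x u a v') v) β ζ := by
  refine (split5_congr fun p q x u v _ _ => (onLast_length_smul
    (c := fun n => (-1) ^ s p.length x.length (n + 1) v.length)
    (d := fun n => (-1) ^ s p.length x.length n v.length) (fun _ => rfl) _ u).symm).trans ?_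
  rw [split5_shift_right (G := fun p q x u a v =>
    (-1) ^ s p.length x.length (u.length + 1) v.length • G p q x u a v)]
  exact split5_congr fun p _ x u v _ _ => onHead_length_smul
    (c := fun n => (-1) ^ s p.length x.length (u.length + 1) n)
    (d := fun n => (-1) ^ t p.length x.length u.length n)
    (fun n => neg_one_pow_congr (h _ _ _ n)) _ v

theorem onHead_signSum_first (G : A → List A → List A → List A → List A → List A → X)
    (h : ∀ p x u v, Even (s p x u v) ↔ Even (t (p + 1) x u v)) :
    onHead (fun b β' => signSum k s (G b) β' ζ) β =
      signSum k t (fun p q x u v => onHead (fun b p' => G b p' q x u v) p) β ζ :=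
  (split5_onHead_first β ζ _).symm.trans (split5_congr fun p _ x u v _ _ => onHead_length_smul
    (c := fun n => (-1) ^ s n x.length u.length v.length)
    (d := fun n => (-1) ^ t n x.length u.length v.length)
    (fun n => neg_one_pow_congr (h n _ _ _)) _ p)

theorem mergeSum_signSum_first (h : ∀ p x u v, Even (s p x u v) ↔ Even (t (p + 1) x u v)) :
    mergeSum (fun β' => signSum k s H β' ζ) β =
      signSum k t (fun p q x u v => mergeSum (fun p' => H p' q x u v) p) β ζ +
      signSum k (fun p x u v => p + s p x u v)
        (fun p q x u v => mergeSum (fun q' => H p q' x u v) q) β ζ := by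
  rw [signSum, signSum, ← split5_add]
  refine (mergeSum_split5_first k _ β ζ).trans (split5_congr fun p q x u v _ _ => ?_)
  rw [mergeSum_smul, smul_smul, ← pow_add]
  exact congrArg (· + _) (mergeSum_length_smul (c := fun n => (-1) ^ s n x.length u.length v.length)
    (d := fun n => (-1) ^ t n x.length u.length v.length)
    (fun n => neg_one_pow_congr (h n _ _ _)) _ p)

theorem onHead_signSum_second (G : A → List A → List A → List A → List A → List A → X)
    (h : ∀ p x u v, Even (s p x u v) ↔ Even (t p (x + 1) u v)) :
    onHead (fun a ζ' => signSum k s (G a) β ζ') ζ =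
      signSum k t (fun p q x u v => onHead (fun a x' => G a p q x' u v) x) β ζ :=
  (split5_onHead_second β ζ _).symm.trans (split5_congr fun p _ x u v _ _ => onHead_length_smul
    (c := fun n => (-1) ^ s p.length n u.length v.length)
    (d := fun n => (-1) ^ t p.length n u.length v.length)
    (fun n => neg_one_pow_congr (h _ n _ _)) _ x)

theorem onLast_signSum_second (G : A → List A → List A → List A → List A → List A → X)
    (h : ∀ p x u v, Even (s p x u v) ↔ Even (t p x u (v + 1))) :
    onLast (fun ζ' c => signSum k s (G c) β ζ') ζ =
      signSum k t (fun p q x u v => onLast (fun v' c => G c p q x u v') v) β ζ :=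
  (split5_onLast_second β ζ _).symm.trans (split5_congr fun p _ x u v _ _ => onLast_length_smul
    (c := fun n => (-1) ^ s p.length x.length u.length n)
    (d := fun n => (-1) ^ t p.length x.length u.length n)
    (fun n => neg_one_pow_congr (h _ _ _ n)) _ v)

theorem mergeSum_signSum_second (h : ∀ p x u v, Even (s p x u v) ↔ Even (t p (x + 1) u v))
    (h' : ∀ p x u v, Even (s p x u v) ↔ Even (t' p x (u + 1) v))
    (h'' : ∀ p x u v, Even (s p x u v) ↔ Even (t'' p x u (v + 1))) :
    mergeSum (fun ζ' => signSum k s H β ζ') ζ =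
      signSum k t (fun p q x u v => mergeSum (fun x' => H p q x' u v) x) β ζ +
      signSum k (fun p x u v => x + t' p x u v)
        (fun p q x u v => mergeSum (fun u' => H p q x u' v) u) β ζ +
      signSum k (fun p x u v => x + u + t'' p x u v)
        (fun p q x u v => mergeSum (fun v' => H p q x u v') v) β ζ := by
  rw [signSum, signSum, signSum, ← split5_add, ← split5_add]
  refine (mergeSum_split5_second k _ β ζ).trans (split5_congr fun p q x u v _ _ => ?_)
  simp only [pow_add ε, mul_smul]
  exact congrArg₂ _ (congrArg₂ _ (mergeSum_length_smul
      (c := fun n => (-1) ^ s p.length n u.length v.length)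
      (d := fun n => (-1) ^ t p.length n u.length v.length)
      (fun n => neg_one_pow_congr (h _ n _ _)) _ x)
    (congrArg _ (mergeSum_length_smul (c := fun n => (-1) ^ s p.length x.length n v.length)
      (d := fun n => (-1) ^ t' p.length x.length n v.length)
      (fun n => neg_one_pow_congr (h' _ _ n _)) _ u)))
    (congrArg _ (congrArg _ (mergeSum_length_smul
      (c := fun n => (-1) ^ s p.length x.length u.length n)
      (d := fun n => (-1) ^ t'' p.length x.length u.length n)
      (fun n => neg_one_pow_congr (h'' _ _ _ n)) _ v)))

/-- This lemma and the next three extract the terms with one empty block, which have no partner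
under the shift lemmas. -/
theorem signSum_onNil_first : signSum k s (fun p q x u v => onNil (H p q x u v) p) β ζ =
    split3 (fun x u v => ε ^ s 0 x.length u.length v.length • H [] β x u v) ζ := by
  simp only [signSum, split5, split3, ← onNil_smul, onNil_splitSum_out, splitSum_onNil_left,
    List.length_nil]

theorem signSum_onNil_left : signSum k s (fun p q x u v => onNil (H p q x u v) x) β ζ =
    splitSum (fun p q => splitSum (fun u v =>
      ε ^ s p.length 0 u.length v.length • H p q [] u v) ζ) β := by
  simp only [signSum, split5, split3, ← onNil_smul, onNil_splitSum_out, splitSum_onNil_left,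
    List.length_nil]

theorem signSum_onNil_middle : signSum k s (fun p q x u v => onNil (H p q x u v) u) β ζ =
    splitSum (fun p q => splitSum (fun x v =>
      ε ^ s p.length x.length 0 v.length • H p q x [] v) ζ) β := by
  simp only [signSum, split5, split3, ← onNil_smul, splitSum_onNil_left, List.length_nil]

theorem signSum_onNil_right : signSum k s (fun p q x u v => onNil (H p q x u v) v) β ζ =
    splitSum (fun p q => splitSum (fun x u =>
      ε ^ s p.length x.length u.length 0 • H p q x u []) ζ) β := by
  simp only [signSum, split5, split3, ← onNil_smul, splitSum_onNil_right, List.length_nil]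

end Split5

/-! ### Cocycles that take the first letters of the rotations of a chain -/

/-- The last term vanishes unless `u` has m + 1 letters, so its sign may be written with the length
of `u`. This form fits the signs in merge sums of longer lists. -/
theorem ListCocycle.map_graded (hF : ListCocycle k m F) (φ : A →ₗ[k] X) (u : List A) :
    onHead (fun a t => φ (a * F t)) u - mergeSum (fun t => φ (F t)) u +
      ε ^ u.length • onLast (fun t c => φ (F t * c)) u = 0 := by
  have h := congrArg φ (hF.cocycle u)
  rw [map_add, map_sub, map_smul, linear_onHead, linear_mergeSum, linear_onLast, map_zero] at h
  by_cases hu : u.length = m + 1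
  · rwa [hu]
  · have h0 : onLast (fun t c => φ (F t * c)) u = 0 := by
      rcases List.eq_nil_or_concat' u with rfl | ⟨s, c, rfl⟩
      · rfl
      · rw [onLast_append_singleton, hF.length s (by simpa using hu), zero_mul, map_zero]
    rwa [h0, smul_zero] at h ⊢

theorem onLast_append_cons_append_cons (H : List A → A → X) (p : List A) (b : A) (v : List A)
    (c : A) (x : List A) :
    onLast H (p ++ b :: (v ++ c :: x)) =
      onLast (fun x' d => H (p ++ b :: (v ++ c :: x')) d) x + onNil (H (p ++ b :: v) c) x := by
  simpa using onLast_append_cons H (p ++ b :: v) c x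

theorem neg_one_pow_length_append_cons (p : List A) (b : A) (v : List A) (c : A) (x : List A) :
    ε ^ (p ++ b :: (v ++ c :: x)).length = (-1) ^ (p.length + v.length + x.length) :=
  neg_one_pow_eq ⟨p.length + v.length + x.length + 1, by
    simp only [List.length_append, List.length_cons]; ring⟩

/-- `W` after left multiplication of the first letter by `b`. -/
def headMul (b : A) (W : List A → X) : List A → X := onHead fun h t => W ((b * h) :: t)

theorem headMul_cons (b : A) (W : List A → X) (h : A) (t : List A) :
    headMul b W (h :: t) = W ((b * h) :: t) := rfl

/-- The exponent of the sign of the rotation of the last `v` letters of a chain to the front, and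
of `p` letters past the chain with `1 + x + u + v` letters. -/
def rotSign (p x u v : ℕ) : ℕ := v * (1 + x + u) + p * (x + u + v + 1)

/-- `∑ W(F(p, e, v, z₀, x), u, f, q)` -/
def rotTerm (e f : ι → A) (F : List A → A) (W : List A → X) (z₀ : A) (p q x u v : List A) : X :=
  ∑ i, W (F (p ++ e i :: (v ++ z₀ :: x)) :: (u ++ f i :: q))

variable (k) in
/-- The sum over all rotations of the chain `z₀, ζ` such that the argument of `F`, with a first part
of `β` and a Casimir letter in front of the chain, contains `z₀`. -/
def rotCap (e f : ι → A) (F : List A → A) (W : List A → X) (z₀ : A) (ζ β : List A) : X :=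
  signSum k rotSign (rotTerm e f F W z₀) β ζ

theorem eq_zero_of_sub {a b c d : X} (hb : b = 0) (hc : c = 0) (hd : d = 0)
    (h : a - b - c - d = 0) : a = 0 := by simpa [hb, hc, hd] using h

/-- The left side is the differential in the letters of β, without its last term, minus the
Hochschild boundary in the chain. A letter that leaves one block enters the next with the opposite
contribution, so only splittings with an empty block survive: p empty gives terms of the cap product
with B, v empty terms of the bracket, and x empty a family that `cycleCap_homotopy` cancels. -/
theorem rotCap_homotopy (hF : ListCocycle k m F) (hW : LetterLinear k W)
    (hd : ∀ l, mergeSum W l = 0) (h : IsCasimir form e f) (z₀ : A) (ζ β : List A)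
    (hm : m ≤ ζ.length) :
    ε ^ ζ.length • (onHead (fun b β' => rotCap k e f F (headMul b W) z₀ ζ β') β -
        mergeSum (rotCap k e f F W z₀ ζ) β) -
      (onHead (fun a ζ' => rotCap k e f F W (z₀ * a) ζ' β) ζ -
        mergeSum (fun ζ' => rotCap k e f F W z₀ ζ' β) ζ +
        ε ^ ζ.length • onLast (fun ζ' c => rotCap k e f F W (c * z₀) ζ' β) ζ) =
    split3 (fun x u v => ε ^ (v.length * (1 + x.length + u.length)) •
        ∑ i, W ((e i * F (v ++ z₀ :: x)) :: (u ++ f i :: β))) ζ -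
      splitSum (fun p q => splitSum (fun x u => ε ^ (p.length * (x.length + u.length)) •
        ∑ i, W (F (p ++ (e i * z₀) :: x) :: (u ++ f i :: q))) ζ) β +
      splitSum (fun p q => splitSum (fun u v => ε ^ (rotSign p.length 0 u.length v.length +
          (p.length + v.length)) •
        ∑ i, W ((F (p ++ e i :: v) * z₀) :: (u ++ f i :: q))) ζ) β := by
  have l1 : ∀ p s t : List A, IsLinearMap k fun y => W (F (p ++ y :: s) :: t) := fun p s t =>
    (hF.linear.letterMap hW [] t).isLinearMap p s
  have l2 : ∀ (y : A) (s t : List A), IsLinearMap k fun w => W (y :: (s ++ w :: t)) :=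
    fun y s t => hW.isLinearMap (y :: s) t
  -- How the sign changes when one of the blocks grows by a letter.
  have hp : ∀ p x u v, Even (rotSign p x u v) ↔ Even (rotSign (p + 1) x u v + (x + u + v + 1)) :=
    fun p x u v => by simp only [rotSign, parity_simps]; grind
  have hx : ∀ p x u v, Even (rotSign p x u v) ↔ Even (rotSign p (x + 1) u v + (v + p)) :=
    fun p x u v => by simp only [rotSign, parity_simps]; grind
  have hu : ∀ p x u v, Even (rotSign p x u v) ↔ Even (rotSign p x (u + 1) v + (v + p)) :=
    fun p x u v => by simp only [rotSign, parity_simps]; grind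
  have hv : ∀ p x u v, Even (rotSign p x u v) ↔ Even (rotSign p x u (v + 1) + (1 + x + u + p)) :=
    fun p x u v => by simp only [rotSign, parity_simps]; grind
  -- The three passages of a letter between blocks: from `x` to `u` across the end of the argument
  -- of `F`, and from `u` to `v` and from `p` to `q` through the Casimir pair.
  have s1 := signSum_shift_left (k := k) β ζ (s := fun p x u v => rotSign p x u v + (p + v + x))
    (t := fun p x u v => rotSign p x u v + (p + v + x) + 1)
    (fun p q x c u v => ∑ i, W ((F (p ++ e i :: (v ++ z₀ :: x)) * c) :: (u ++ f i :: q)))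
    (fun p x u v => by simp only [rotSign, parity_simps]; grind)
  have s2 := signSum_shift_right (k := k) β ζ (s := fun p x u v => rotSign p x u v + (p + v + x) + u)
    (t := fun p x u v => rotSign p x u v + p)
    (fun p q x u a v => ∑ i, W (F (p ++ e i :: (v ++ z₀ :: x)) :: (u ++ (a * f i) :: q)))
    (fun p x u v => by simp only [rotSign, parity_simps]; grind)
  have s3 := signSum_shift_first (k := k) β ζ (s := fun p x u v => rotSign p x u v + p)
    (t := fun p x u v => rotSign p x u v + (p + v + x) + u)
    (fun p a q x u v => ∑ i, W (F (p ++ e i :: (v ++ z₀ :: x)) :: (u ++ (f i * a) :: q)))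
    (fun p x u v => by simp only [rotSign, parity_simps]; grind)
  -- The unpaired terms with p, v or x empty form the right-hand side.
  have n1 := signSum_onNil_first (k := k) (s := rotSign) (fun p q x u v =>
    ∑ i, W ((e i * F (v ++ z₀ :: x)) :: (u ++ f i :: q))) β ζ
  have n2 := signSum_onNil_right (k := k) (s := fun p x u v => rotSign p x u v + p) (fun p q x u v =>
    ∑ i, W (F (p ++ (e i * z₀) :: x) :: (u ++ f i :: q))) β ζ
  have n3 := signSum_onNil_left (k := k) (s := fun p x u v => rotSign p x u v + (p + v + x))
    (fun p q x u v => ∑ i, W ((F (p ++ e i :: v) * z₀) :: (u ++ f i :: q))) β ζ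
  have e1 : ∀ x u v, rotSign 0 x u v = v * (1 + x + u) := fun x u v => by simp [rotSign]
  have e2 : ∀ p x u, ε ^ (rotSign p x u 0 + p) = (-1) ^ (p * (x + u)) := fun p x u =>
    neg_one_pow_congr (by simp only [rotSign, parity_simps]; grind)
  simp only [e1] at n1
  simp only [e2] at n2
  rw [← n1, ← n2]
  refine Eq.trans ?_ (congrArg _ n3)
  unfold rotCap
  rw [onHead_signSum_first (t := fun p x u v => rotSign p x u v + (x + u + v + 1)) _ _ _ hp,
    mergeSum_signSum_first (t := fun p x u v => rotSign p x u v + (x + u + v + 1)) _ _ _ hp,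
    onHead_signSum_second (t := fun p x u v => rotSign p x u v + (v + p)) _ _ _ hx,
    mergeSum_signSum_second (t := fun p x u v => rotSign p x u v + (v + p)) (t' := fun p x u v =>
    rotSign p x u v + (v + p)) (t'' := fun p x u v => rotSign p x u v + (1 + x + u + p)) _ _ _ hx hu
    hv, onLast_signSum_second (t := fun p x u v => rotSign p x u v + (1 + x + u + p)) _ _ _ hv]
  rw [← sub_eq_zero] at s1 s2 s3 ⊢
  refine eq_zero_of_sub s1 s2 s3 ?_
  simp only [signSum, ← split5_smul, ← split5_sub, ← split5_add]
  refine (split5_congr fun p q x u v _ hζ => ?_).trans (split5_zero β ζ)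
  have hl : ζ.length = x.length + u.length + v.length := by simp [← hζ, add_assoc]
  -- `C` is the cocycle identity for `F`, and `M` is the vanishing of the merge sum of `W`, both
  -- summed over the Casimir pair. The summand of the whole formula is a combination of the two.
  have C := Finset.sum_eq_zero (s := Finset.univ) fun i _ => hF.map_graded
    ((hW.isLinearMap [] (u ++ f i :: q)).mk' _) (p ++ e i :: (v ++ z₀ :: x))
  have M := Finset.sum_eq_zero (s := Finset.univ) fun i _ =>
    hd (F (p ++ e i :: (v ++ z₀ :: x)) :: (u ++ f i :: q))
  -- With `u` empty the argument of `F` contains `z₀`, a Casimir letter and all of `ζ`, hence more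
  -- than m letters.
  have h2 : ∀ i, onNil (W ((F (p ++ e i :: (v ++ z₀ :: x)) * f i) :: q)) u = 0 := fun i => by
    cases u with
    | nil =>
      rw [onNil_nil, hF.length _ (by simp at hm hl ⊢; omega), zero_mul]
      exact hW.map_zero [] q
    | cons a u => rfl
  simp only [IsLinearMap.mk'_apply, List.nil_append, onLast_append_cons_append_cons,
    neg_one_pow_length_append_cons, onHead_append_cons, mergeSum_append_cons k, mergeSum_cons, h2,
    add_zero] at C M
  simp only [Finset.sum_add_distrib, Finset.sum_sub_distrib, ← Finset.smul_sum, ← mergeSum_finsum, ←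
    onHead_finsum, ← onLast_finsum, ← onNil_finsum] at C M
  simp only [fun (p q u v x : List A) (a : A) =>
    h.slide (B := fun y w => W (F (p ++ y :: (v ++ z₀ :: x)) :: (u ++ w :: q)))
      (fun w => l1 _ _ _) (fun y => l2 _ _ _) a,
    fun (p q u v x : List A) (a : A) =>
    h.slide_out (B := fun y w => W (F (p ++ y :: (v ++ z₀ :: x)) :: (u ++ w :: q)))
      (fun w => l1 _ _ _) (fun y => l2 _ _ _) a] at C
  simp only [rotTerm, headMul_cons, hl, pow_add, pow_one] at C M ⊢
  generalize ε ^ rotSign p.length x.length u.length v.length = s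
  rcases neg_one_pow_eq_or k p.length with hp | hp <;>
    rcases neg_one_pow_eq_or k x.length with hx | hx <;>
    rcases neg_one_pow_eq_or k u.length with hu | hu <;>
    rcases neg_one_pow_eq_or k v.length with hv | hv <;>
    simp only [hp, hx, hu, hv] at C M ⊢ <;>
    first
      | linear_combination (norm := module) -s • C - s • M
      | linear_combination (norm := module) -s • C + s • M

/-! ### Cyclic rotations of the argument of a cocycle -/

def cycleSign (p x u v : ℕ) : ℕ := (u + v + p) * (1 + x) + (1 + u) * (v + 1 + p)

/-- `∑ ⟨1, F(v, f, p, f', u)⟩ W(e z₀, x, e', q)` -/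
def cycleTerm (form : LinearMap.BilinForm k A) (e f : ι → A) (F : List A → A) (W : List A → X)
    (z₀ : A) (p q x u v : List A) : X :=
  ∑ i, ∑ j, form 1 (F (v ++ f i :: (p ++ f j :: u))) • W ((e i * z₀) :: (x ++ e j :: q))

/-- The sum over all rotations of the argument of `F`. -/
def cycleCap (form : LinearMap.BilinForm k A) (e f : ι → A) (F : List A → A) (W : List A → X)
    (z₀ : A) (ζ β : List A) : X := signSum k cycleSign (cycleTerm form e f F W z₀) β ζ

theorem neg_neg_one_pow (n : ℕ) : -(ε ^ n) = (-1) ^ (n + 1) := by rw [pow_succ]; ring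

theorem isLinearMap_finsum (s : Finset ι) {G : ι → A → X} (h : ∀ i, IsLinearMap k (G i)) :
    IsLinearMap k fun a => ∑ i ∈ s, G i a where
  map_add a b := by
    rw [← Finset.sum_add_distrib]
    exact Finset.sum_congr rfl fun i _ => (h i).map_add a b
  map_smul c a := by
    rw [Finset.smul_sum]
    exact Finset.sum_congr rfl fun i _ => (h i).map_smul c a

/-- Exchange the members of the second Casimir pair; the sum over the first pair then expands the
value of F in the family `e`. -/
theorem cycleTerm_onNil (hF : LetterLinear k F) (hW : LetterLinear k W) (h : IsCasimir form e f)
    (z₀ : A) (p q x u : List A) :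
    ∑ i, ∑ j, form 1 (f i * F (p ++ f j :: u)) • W ((e i * z₀) :: (x ++ e j :: q)) =
      ∑ j, W ((F (p ++ e j :: u) * z₀) :: (x ++ f j :: q)) := by
  have hl : ∀ t, IsLinearMap k fun y => W ((y * z₀) :: t) := fun t => by
    simpa using isLinearMap_mul_letter hW 1 z₀ t
  rw [Finset.sum_comm, h.swap (B := fun a b => W ((F (p ++ a :: u) * z₀) :: (x ++ b :: q))) (fun b
    => by simpa using (hF.map ((hl (x ++ b :: q)).mk' _)).isLinearMap p u) (fun a => hW.isLinearMap
    ((F (p ++ a :: u) * z₀) :: x) q)]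
  refine Finset.sum_congr rfl fun j _ => ?_
  conv_rhs => rw [← h.right (F (p ++ f j :: u)), isLinearMap_sum (hl _)]
  exact Finset.sum_congr rfl fun i _ => by rw [h.form_one, h.symm]

-- The scheme of `rotCap_homotopy`, with F inside the scalar ⟨1, F(⋯)⟩, where a right factor of F
-- may be moved to its left (`hc`). With v empty the last family of `rotCap_homotopy` appears with
-- opposite sign. With p empty two Casimir letters are multiplied, which gives Δ. With u empty the
-- second pair reproduces the value of F as a letter of the word, a term of the bracket.
set_option maxHeartbeats 1000000 in
theorem cycleCap_homotopy (hF : ListCocycle k m F) (hW : LetterLinear k W)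
    (hd : ∀ l, mergeSum W l = 0) (h : IsCasimir form e f) (z₀ : A) (ζ β : List A)
    (hm : m ≤ ζ.length) :
    ε ^ ζ.length • (onHead (fun b β' => cycleCap form e f F (headMul b W) z₀ ζ β') β -
        mergeSum (cycleCap form e f F W z₀ ζ) β) -
      (onHead (fun a ζ' => cycleCap form e f F W (z₀ * a) ζ' β) ζ -
        mergeSum (fun ζ' => cycleCap form e f F W z₀ ζ' β) ζ +
        ε ^ ζ.length • onLast (fun ζ' c => cycleCap form e f F W (c * z₀) ζ' β) ζ) =
    -(splitSum (fun p q => splitSum (fun u v => ε ^ (rotSign p.length 0 u.length v.length +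
          (p.length + v.length)) •
        ∑ i, W ((F (p ++ e i :: v) * z₀) :: (u ++ f i :: q))) ζ) β +
      split3 (fun x u v => ε ^ (cycleSign 0 x.length u.length v.length + v.length) •
        ∑ i, ∑ j, form 1 (F (v ++ (f i * f j) :: u)) • W ((e i * z₀) :: (x ++ e j :: β))) ζ +
      splitSum (fun p q => splitSum (fun x v =>
        ε ^ ((v.length + p.length) * (1 + x.length)) •
        ∑ i, W ((e i * z₀) :: (x ++ F (v ++ f i :: p) :: q))) ζ) β) := by
  have l1 : ∀ (w : X) (s t : List A), IsLinearMap k fun y => form 1 (F (s ++ y :: t)) • w :=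
    fun w s t => ((hF.linear.map ((form 1).smulRight w)).isLinearMap s t)
  have l2 : ∀ (c : k) (y : A) (s t : List A), IsLinearMap k fun w => c • W (y :: (s ++ w :: t)) :=
    fun c y s t => (hW.const_smul c).isLinearMap (y :: s) t
  have l3 : ∀ (c : k) (t : List A), IsLinearMap k fun w => c • W ((w * z₀) :: t) := fun c t => by
    simpa using isLinearMap_mul_letter (hW.const_smul c) 1 z₀ t
  have hp : ∀ p x u v, Even (cycleSign p x u v) ↔ Even (cycleSign (p + 1) x u v + (x + u)) :=
    fun p x u v => by simp only [cycleSign, parity_simps]; grind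
  have hx : ∀ p x u v, Even (cycleSign p x u v) ↔ Even (cycleSign p (x + 1) u v + (u + v + p)) :=
    fun p x u v => by simp only [cycleSign, parity_simps]; grind
  have hu : ∀ p x u v, Even (cycleSign p x u v) ↔ Even (cycleSign p x (u + 1) v + (x + v + p)) :=
    fun p x u v => by simp only [cycleSign, parity_simps]; grind
  have hv : ∀ p x u v, Even (cycleSign p x u v) ↔ Even (cycleSign p x u (v + 1) + (x + u)) :=
    fun p x u v => by simp only [cycleSign, parity_simps]; grind
  have hc : ∀ y c : A, form 1 (y * c) = form 1 (c * y) := fun y c => by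
    rw [h.form_one, h.form_one, h.symm]
  have s1 := signSum_shift_right (k := k) β ζ (s := fun p x u v => cycleSign p x u v + (v + p + u))
    (t := fun p x u v => cycleSign p x u v + 1) (fun p q x u c v => ∑ i, ∑ j,
      form 1 (c * F (v ++ f i :: (p ++ f j :: u))) • W ((e i * z₀) :: (x ++ e j :: q)))
    (fun p x u v => by simp only [cycleSign, parity_simps]; grind)
  have s2 := signSum_shift_first (k := k) β ζ (s := fun p x u v => cycleSign p x u v + (v + p))
    (t := fun p x u v => cycleSign p x u v + (x + u + v + p) + 1) (fun p b q x u v => ∑ i, ∑ j,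
      form 1 (F (v ++ f i :: (p ++ f j :: u))) • W ((e i * z₀) :: (x ++ (e j * b) :: q)))
    (fun p x u v => by simp only [cycleSign, parity_simps]; grind)
  have s3 := signSum_shift_left (k := k) β ζ (s := fun p x u v =>
    cycleSign p x u v + (x + u + v + p)) (t := fun p x u v => cycleSign p x u v + (v + p) + 1)
    (fun p q x a u v => ∑ i, ∑ j,
      form 1 (F (v ++ f i :: (p ++ f j :: u))) • W ((e i * z₀) :: (x ++ (a * e j) :: q)))
    (fun p x u v => by simp only [cycleSign, parity_simps]; grind)
  have n1 := signSum_onNil_right (k := k) (s := cycleSign) (fun p q x u v =>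
    ∑ i, ∑ j, form 1 (f i * F (p ++ f j :: u)) • W ((e i * z₀) :: (x ++ e j :: q))) β ζ
  have n2 := signSum_onNil_first (k := k) (s := fun p x u v => cycleSign p x u v + v)
    (fun p q x u v => ∑ i, ∑ j, form 1 (F (v ++ (f i * f j) :: u)) •
      W ((e i * z₀) :: (x ++ e j :: q))) β ζ
  have n3 := signSum_onNil_middle (k := k) (s := fun p x u v => cycleSign p x u v + (v + p + u))
    (fun p q x u v => ∑ i, ∑ j, form 1 (F (v ++ f i :: p) * f j) •
      W ((e i * z₀) :: (x ++ e j :: q))) β ζ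
  have e1 : ∀ p x u, ε ^ cycleSign p x u 0 = -(-1) ^ (rotSign p 0 x u + (p + u)) :=
    fun p x u => by
      rw [neg_neg_one_pow]
      exact neg_one_pow_congr (by simp only [cycleSign, rotSign, parity_simps]; grind)
  have e2 : ∀ p x v, ε ^ (cycleSign p x 0 v + (v + p + 0)) = -(-1) ^ ((v + p) * (1 + x)) :=
    fun p x v => by
      rw [neg_neg_one_pow]
      exact neg_one_pow_congr (by simp only [cycleSign, parity_simps]; grind)
  have e3 : ∀ i x v p q, ∑ j, form 1 (F (v ++ f i :: p) * f j) •
      W ((e i * z₀) :: (x ++ e j :: q)) = W ((e i * z₀) :: (x ++ F (v ++ f i :: p) :: q)) := by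
    intro i x v p q
    have hl := hW.isLinearMap ((e i * z₀) :: x) q
    simp only [List.cons_append] at hl
    conv_rhs => rw [← h.right (F (v ++ f i :: p)), isLinearMap_sum hl]
    exact Finset.sum_congr rfl fun j _ => by rw [h.form_one]
  simp only [e1, cycleTerm_onNil hF.linear hW h, neg_smul, splitSum_neg] at n1
  simp only [e2, e3, neg_smul, splitSum_neg] at n3
  rw [← neg_eq_iff_eq_neg] at n1 n3
  refine Eq.trans ?_ (congrArg Neg.neg (congrArg₂ _ (congrArg₂ _ n1 n2) n3))
  unfold cycleCap
  rw [onHead_signSum_first (t := fun p x u v => cycleSign p x u v + (x + u)) _ _ _ hp,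
    mergeSum_signSum_first (t := fun p x u v => cycleSign p x u v + (x + u)) _ _ _ hp,
    onHead_signSum_second (t := fun p x u v => cycleSign p x u v + (u + v + p)) _ _ _ hx,
    mergeSum_signSum_second (t := fun p x u v => cycleSign p x u v + (u + v + p)) (t' := fun p x u v
    => cycleSign p x u v + (x + v + p)) (t'' := fun p x u v => cycleSign p x u v + (x + u)) _ _ _ hx
    hu hv, onLast_signSum_second (t := fun p x u v => cycleSign p x u v + (x + u)) _ _ _ hv]
  rw [← sub_eq_zero] at s1 s2 s3 ⊢
  refine eq_zero_of_sub s1 (neg_eq_zero.2 s2) s3 ?_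
  simp only [signSum, ← neg_one_smul k (split5 _ _ _), ← split5_smul, ← split5_sub, ← split5_add]
  refine (split5_congr fun p q x u v _ hζ => ?_).trans (split5_zero β ζ)
  have hl : ζ.length = x.length + u.length + v.length := by simp [← hζ, add_assoc]
  have C := Finset.sum_eq_zero (s := Finset.univ) fun i _ =>
    Finset.sum_eq_zero (s := Finset.univ) fun j _ => hF.map_graded
      ((form 1).smulRight (W ((e i * z₀) :: (x ++ e j :: q)))) (v ++ f i :: (p ++ f j :: u))
  have M : ∀ i j, form 1 (F (v ++ f i :: (p ++ f j :: u))) • _ = (0 : X) := fun i j =>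
    (congrArg _ (hd ((e i * z₀) :: (x ++ e j :: q)))).trans (smul_zero _)
  have h2 : ∀ i j, form 1 (F (v ++ f i :: (p ++ f j :: u))) •
      onNil (W ((e i * z₀ * e j) :: q)) x = 0 := fun i j => by
    cases x with
    | nil => rw [hF.length _ (by simp at hm hl ⊢; omega), map_zero, zero_smul]
    | cons a x => rw [onNil_cons, smul_zero]
  have M := Finset.sum_eq_zero (s := Finset.univ) fun i _ =>
    Finset.sum_eq_zero (s := Finset.univ) fun j _ => M i j
  simp only [LinearMap.smulRight_apply, onLast_append_cons_append_cons,
    neg_one_pow_length_append_cons, onHead_append_cons, mergeSum_append_cons k, mergeSum_cons,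
    smul_add, smul_sub, h2, add_zero, smul_comm (form 1 _), ← onHead_smul (form 1 _), ← onLast_smul
    (form 1 _), ← mergeSum_smul (form 1 _)] at C M
  simp only [Finset.sum_add_distrib, Finset.sum_sub_distrib, ← Finset.smul_sum, ← mergeSum_finsum, ←
    onHead_finsum, ← onLast_finsum, ← onNil_finsum] at C M
  simp only [fun i (v p u q x : List A) (a : A) =>
      (h.slide (B := fun w y => form 1 (F (v ++ f i :: (p ++ y :: u))) •
        W ((e i * z₀) :: (x ++ w :: q))) (fun y => l2 _ _ _ _)
          (fun w => by simpa using l1 _ (v ++ f i :: p) u) a).symm,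
    fun i (v p u q x : List A) (a : A) =>
      (h.slide_out (B := fun w y => form 1 (F (v ++ f i :: (p ++ y :: u))) •
        W ((e i * z₀) :: (x ++ w :: q))) (fun y => l2 _ _ _ _)
          (fun w => by simpa using l1 _ (v ++ f i :: p) u) a).symm,
    fun s i t j w c => hc (F (s ++ f i :: (t ++ f j :: w))) c,
    cycleTerm_onNil hF.linear hW h, e3] at C
  have l4 : ∀ v p u q x, ∀ y, IsLinearMap k fun w => ∑ j,
    form 1 (F (v ++ y :: (p ++ f j :: u))) • W ((w * z₀) :: (x ++ e j :: q)) :=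
    fun v p u q x y => isLinearMap_finsum _ fun j => l3 _ _
  have l5 : ∀ v p u q x, ∀ w, IsLinearMap k fun y => ∑ j,
    form 1 (F (v ++ y :: (p ++ f j :: u))) • W ((w * z₀) :: (x ++ e j :: q)) :=
    fun v p u q x y => isLinearMap_finsum _ fun j => l1 _ _ _
  simp only [cycleTerm, headMul_cons, ← mul_assoc, fun v p u q x a =>
    h.slide (l4 v p u q x) (l5 v p u q x) a, fun v p u q x a =>
    h.slide_out (l4 v p u q x) (l5 v p u q x) a]
  simp only [hl, pow_add, pow_one] at C M ⊢
  generalize ε ^ cycleSign p.length x.length u.length v.length = s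
  rcases neg_one_pow_eq_or k p.length with hp | hp <;>
    rcases neg_one_pow_eq_or k x.length with hx | hx <;>
    rcases neg_one_pow_eq_or k u.length with hu | hu <;>
    rcases neg_one_pow_eq_or k v.length with hv | hv <;>
    simp only [hp, hx, hu, hv] at C M ⊢ <;>
    first
      | linear_combination (norm := module) -s • C - s • M
      | linear_combination (norm := module) -s • C + s • M

/-! ### Insertion of the values of a cocycle into rotated chains -/

theorem insertLetter_zero (m : ℕ) (F : List A → A) (l : List A) :
    insertLetter k m F (fun _ => (0 : X)) l = 0 := by
  simp only [insertLetter, smul_zero, split3_zero]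

theorem insertLetter_smul (m : ℕ) (F : List A → A) (c : k) (φ : List A → X) (l : List A) :
    insertLetter k m F (fun t => c • φ t) l = c • insertLetter k m F φ l := by
  rw [insertLetter, insertLetter, ← split3_smul c]
  exact split3_congr fun x u v _ => smul_comm _ _ _

theorem insertLetter_onNil (m : ℕ) (F : List A → A) (y : X) (l : List A) :
    insertLetter k m F (onNil y) l = 0 := by
  have h : ∀ (x : List A) (a : A) (v : List A), onNil y (x ++ a :: v) = 0 := fun x a v => by
    cases x <;> rfl
  simp only [insertLetter, h, smul_zero, split3_zero]

theorem insertLetter_onNil_out (m : ℕ) (F : List A → A) (G : List A → X) (w l : List A) :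
    insertLetter k m F (fun t => onNil (G t) w) l = onNil (insertLetter k m F G l) w := by
  cases w with
  | nil => rfl
  | cons a w => exact insertLetter_zero m F l

theorem insertLetter_onHead_out (m : ℕ) (F : List A → A) (G : List A → A → List A → X)
    (w l : List A) :
    insertLetter k m F (fun t => onHead (G t) w) l =
      onHead (fun a w' => insertLetter k m F (fun t => G t a w') l) w := by
  cases w with
  | nil => exact insertLetter_zero m F l
  | cons a w => rfl

theorem insertLetter_onLast_out (m : ℕ) (F : List A → A) (G : List A → List A → A → X)
    (w l : List A) :
    insertLetter k m F (fun t => onLast (G t) w) l =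
      onLast (fun w' a => insertLetter k m F (fun t => G t w' a) l) w := by
  rcases List.eq_nil_or_concat' w with rfl | ⟨s, c, rfl⟩
  · exact insertLetter_zero m F l
  · simp only [onLast_append_singleton]

theorem insertLetter_mergeSum_out (m : ℕ) (F : List A → A) (G : List A → List A → X)
    (w l : List A) :
    insertLetter k m F (fun t => mergeSum (G t) w) l =
      mergeSum (fun w' => insertLetter k m F (fun t => G t w') l) w := by
  simp only [insertLetter, split3, mergeSum_splitSum_out, mergeSum_smul]

theorem onHead_zero (l : List A) : onHead (fun _ _ => (0 : X)) l = 0 := by cases l <;> rfl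

theorem onLast_zero (l : List A) : onLast (fun _ _ => (0 : X)) l = 0 := by
  rcases List.eq_nil_or_concat' l with rfl | ⟨s, c, rfl⟩
  · rfl
  · exact onLast_append_singleton _ _ _

theorem insertLetter_neg_one_pow (hF : ∀ l : List A, l.length ≠ m → F l = 0)
    (hφ : ∀ x v, φ (x ++ 0 :: v) = 0) (l : List A) :
    insertLetter k m F (fun t => ε ^ t.length • φ t) l =
      ε ^ (l.length + m + 1) • insertLetter k m F φ l := by
  rw [insertLetter, insertLetter, ← split3_smul]
  refine split3_congr fun x u v hl => ?_
  by_cases hu : u.length = m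
  · rw [smul_smul, smul_smul, ← pow_add, ← pow_add]
    congr 1
    refine neg_one_pow_eq ⟨(m + 1) * x.length + x.length + v.length + m + 1, ?_⟩
    rw [← hl]
    simp only [List.length_append, List.length_cons, hu]
    ring
  · rw [hF u hu, hφ]
    simp

/-- `∑ W(e, t, z₀, w, f, β)` -/
def insertTerm (e f : ι → A) (W : List A → X) (t : List A) (z₀ : A) (w β : List A) : X :=
  ∑ i, W (e i :: (t ++ z₀ :: (w ++ f i :: β)))

variable (k) in
/-- The sum over all rotations of a chain and all insertions of `F` into the letters that come to
stand before the first letter of the chain. -/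
def insertCap (m : ℕ) (e f : ι → A) (F : List A → A) (W : List A → X) (z₀ : A) (ζ β : List A) : X :=
  splitSum (fun w y => ε ^ (y.length * (1 + w.length) + (m + 1)) •
    insertLetter k m F (fun t => insertTerm e f W t z₀ w β) y) ζ

theorem LetterLinear.insertTerm (hW : LetterLinear k W) (e f : ι → A) (z₀ : A) (w β : List A) :
    LetterLinear k fun t => SingHoch.insertTerm e f W t z₀ w β :=
  LetterLinear.finsum _ fun i => (hW.around [e i] (z₀ :: (w ++ f i :: β))).of_eq fun _ => rfl

-- Here F is inserted among the letters that a rotation has brought before z₀. Insertion commutes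
-- with merging by `insertLetter_mergeSum`, and letters travel around the end through the Casimir
-- pair (`s1`). What remains has w empty, where z₀ slides to the front and a term of the bracket
-- appears, or has the value of F multiplied with e_i or with z₀.
set_option maxHeartbeats 1000000 in
theorem insertCap_homotopy (hF : ListCocycle k m F) (hW : LetterLinear k W)
    (hd : ∀ l, mergeSum W l = 0) (h : IsCasimir form e f) (z₀ : A) (ζ β : List A) :
    ε ^ ζ.length • (onHead (fun b β' => insertCap k m e f F (headMul b W) z₀ ζ β') β -
        mergeSum (insertCap k m e f F W z₀ ζ) β) -
      (onHead (fun a ζ' => insertCap k m e f F W (z₀ * a) ζ' β) ζ -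
        mergeSum (fun ζ' => insertCap k m e f F W z₀ ζ' β) ζ +
        ε ^ ζ.length • onLast (fun ζ' c => insertCap k m e f F W (c * z₀) ζ' β) ζ) =
    ε ^ (m + 1) • insertLetter k m F (fun t => ∑ i, W ((e i * z₀) :: (t ++ f i :: β))) ζ -
      splitSum (fun w y => ε ^ (y.length * (1 + w.length)) •
        splitSum (fun u v => ∑ i, W ((e i * F u) :: (v ++ z₀ :: (w ++ f i :: β)))) y) ζ -
      splitSum (fun w y => ε ^ (y.length * (1 + w.length) + (m * (y.length + 1) + 1)) •
        splitSum (fun x u => insertTerm e f W x (F u * z₀) w β) y) ζ := by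
  have l2 : ∀ t z w x β', IsLinearMap k fun y => W (x :: (t ++ z :: (w ++ y :: β'))) :=
    fun t z w x β' => by simpa using hW.isLinearMap (x :: (t ++ z :: w)) β'
  have l1 : ∀ s, IsLinearMap k fun x => W (x :: s) := fun s => hW.isLinearMap [] s
  have l0 : ∀ (z : A) (s : ι → List A), LetterLinear k fun t => ∑ i, W (e i :: (t ++ z :: s i)) :=
    fun z s => LetterLinear.finsum _ fun i => (hW.around [e i] (z :: s i)).of_eq fun _ => rfl
  have l0' : ∀ z : ι → A, LetterLinear k fun t => ∑ i, W (e i :: (t ++ z i :: β)) :=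
    fun z => LetterLinear.finsum _ fun i => (hW.around [e i] (z i :: β)).of_eq fun _ => rfl
  have o1 : ∀ n w (H : A → List A → X), onHead (fun a t => ε ^ (n * (1 + t.length) + (m + 1)) •
      H a t) w = ε ^ (n * w.length + (m + 1)) • onHead H w := fun n w H =>
    onHead_length_smul (c := fun l => (-1) ^ (n * (1 + l) + (m + 1)))
      (d := fun l => (-1) ^ (n * l + (m + 1))) (fun l => by rw [add_comm 1]) H w
  have o2 : ∀ n w (H : List A → X), mergeSum (fun t => ε ^ (n * (1 + t.length) + (m + 1)) •
      H t) w = ε ^ (n * w.length + (m + 1)) • mergeSum H w := fun n w H =>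
    mergeSum_length_smul (c := fun l => (-1) ^ (n * (1 + l) + (m + 1)))
      (d := fun l => (-1) ^ (n * l + (m + 1))) (fun l => by rw [add_comm 1]) H w
  have hs : ∀ n w : ℕ, ε ^ (n * (1 + w) + (m + 1)) =
      (-1) ^ ((n + 1 + 1) * (1 + w) + (m + 1)) := fun n w =>
    neg_one_pow_eq ⟨(n + 1) * (1 + w) + (m + 1), by ring⟩
  have o3 : ∀ n w (H : List A → X), mergeSum (fun t => ε ^ (t.length * (1 + n) + (m + 1)) •
      H t) w = ε ^ ((w.length + 1) * (1 + n) + (m + 1)) • mergeSum H w := fun n w H =>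
    mergeSum_length_smul (c := fun l => (-1) ^ (l * (1 + n) + (m + 1)))
      (d := fun l => (-1) ^ ((l + 1) * (1 + n) + (m + 1))) (fun l => hs l n) H w
  have o4 : ∀ n w (H : List A → A → X), onLast (fun t a => ε ^ (t.length * (1 + n) + (m + 1)) •
      H t a) w = ε ^ ((w.length + 1) * (1 + n) + (m + 1)) • onLast H w := fun n w H =>
    onLast_length_smul (c := fun l => (-1) ^ (l * (1 + n) + (m + 1)))
      (d := fun l => (-1) ^ ((l + 1) * (1 + n) + (m + 1))) (fun l => hs l n) H w
  have s1 : splitSum (fun w y => ε ^ (y.length * (1 + w.length) + (m + 1)) •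
        onHead (fun b y' => insertLetter k m F (fun t =>
          ∑ i, W ((e i * b) :: (t ++ z₀ :: (w ++ f i :: β)))) y') y -
      ε ^ (y.length * (1 + w.length) + (y.length + m + 1 + w.length)) •
        onLast (fun w' a => insertLetter k m F (fun t =>
          ∑ i, W (e i :: (t ++ z₀ :: (w' ++ (a * f i) :: β)))) y) w) ζ = 0 := by
    rw [splitSum_sub, sub_eq_zero]
    have e1 : ∀ w y : List A, _ := fun w y =>
      (onHead_length_smul (c := fun n => ε ^ ((n + 1) * (1 + w.length) + (m + 1)))
        (d := fun n => ε ^ (n * (1 + w.length) + (m + 1))) (fun n => rfl)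
        (fun b y' => insertLetter k m F (fun t =>
          ∑ i, W ((e i * b) :: (t ++ z₀ :: (w ++ f i :: β)))) y') y).symm
    have e2 : ∀ w y : List A, _ := fun w y =>
      (onLast_length_smul (c := fun n => ε ^ ((y.length + 1) * (1 + n) + (m + 1)))
        (d := fun n => ε ^ (y.length * (1 + n) + (y.length + m + 1 + n)))
        (fun n => neg_one_pow_eq ⟨y.length * n + 2 * y.length + n + m + 2, by ring⟩)
        (fun w' a => insertLetter k m F (fun t =>
          ∑ i, W (e i :: (t ++ z₀ :: (w' ++ (a * f i) :: β)))) y) w).symm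
    refine (splitSum_congr fun w y _ => e1 w y).trans
      (Eq.trans ?_ (splitSum_congr fun w y _ => e2 w y).symm)
    rw [splitSum_shift (fun w a y => ε ^ ((y.length + 1) * (1 + w.length) + (m + 1)) • insertLetter
      k m F (fun t => ∑ i, W (e i :: (t ++ z₀ :: (w ++ (a * f i) :: β)))) y)]
    refine splitSum_congr fun w y _ => onHead_congr fun b y' _ => ?_
    congr 1
    exact insertLetter_congr m F fun t => h.slide
      (B := fun x y => W (x :: (t ++ z₀ :: (w ++ y :: β)))) (fun y => l1 _)
      (fun x => l2 _ _ _ _ _) b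
  have n1 := splitSum_onNil_left (fun w y => ε ^ (m + 1) •
    insertLetter k m F (fun t => ∑ i, W (e i :: (t ++ (z₀ * f i) :: β))) y) ζ
  have n2 : insertLetter k m F (fun t => ∑ i, W ((e i * z₀) :: (t ++ f i :: β))) ζ =
      insertLetter k m F (fun t => ∑ i, W (e i :: (t ++ (z₀ * f i) :: β))) ζ :=
    insertLetter_congr m F fun t => h.slide (B := fun x y => W (x :: (t ++ y :: β)))
      (fun y => l1 _) (fun x => by simpa using hW.isLinearMap (x :: t) β) z₀
  unfold insertCap
  rw [n2, ← n1, ← sub_eq_zero, onHead_splitSum_out, mergeSum_splitSum_out, ← splitSum_onHead_left,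
    mergeSum_splitSum k, ← splitSum_onLast_right]
  refine eq_zero_of_sub (neg_eq_zero.2 s1) (c := 0) (d := 0) rfl rfl ?_
  rw [sub_zero, sub_zero, sub_neg_eq_add]
  simp only [← splitSum_smul (ε ^ ζ.length), ← splitSum_sub, ← splitSum_add]
  rw [← splitSum_zero ζ]
  refine splitSum_congr fun w y hl => ?_
  -- The merge sum of `W` vanishes as a function of the letters `t` before `z₀`; inserting `F` into
  -- this identity yields the relation among the terms.
  have M := congrArg (fun φ : List A → X => insertLetter k m F φ y) (funext (β := fun _ => X)
    fun t => Finset.sum_eq_zero (s := Finset.univ) fun i _ =>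
      hd (e i :: (t ++ z₀ :: (w ++ f i :: β))))
  simp only [mergeSum_cons, onHead_append_cons, mergeSum_append_cons k] at M
  simp only [Finset.sum_add_distrib, Finset.sum_sub_distrib, ← Finset.smul_sum, ← mergeSum_finsum, ←
    onHead_finsum, ← onLast_finsum, ← onNil_finsum] at M
  rw [insertLetter_zero, insertLetter_sub, insertLetter_add, insertLetter_onHead,
    insertLetter_onNil, insertLetter_sub, insertLetter_add, insertLetter_sub, insertLetter_mergeSum
    hF (l0 z₀ fun i => w ++ f i :: β), insertLetter_onLast hF.length (fun x => Finset.sum_eq_zero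
    fun i _ => by rw [zero_mul]; exact hW.map_zero (e i :: x) _) (fun x v c => (l0 (c * z₀)
    _).map_zero x v), insertLetter_neg_one_pow hF.length, insertLetter_neg_one_pow hF.length] at M
  rotate_left
  iterate 2
    · intro x v
      simp only [fun z s => (l0 z s).map_zero x v, fun z => (l0' z).map_zero x v, onHead_zero,
        onLast_zero, mergeSum_zero, smul_zero, add_zero, sub_zero]
      try cases w <;> simp
  simp only [insertLetter_add, insertLetter_sub, insertLetter_smul, insertLetter_onHead_out,
    insertLetter_onLast_out, insertLetter_mergeSum_out, insertLetter_onNil_out] at M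
  have hz : ζ.length = w.length + y.length := by rw [← hl, List.length_append]
  have hn : ∀ x : X, ε ^ (y.length * (1 + w.length)) • onNil x w =
      ε ^ y.length • onNil x w := fun x => by cases w <;> simp
  have N := hn (insertLetter k m F (fun t => ∑ i, W (e i :: (t ++ (z₀ * f i) :: β))) y)
  simp only [o1, o2, o3, o4, onHead_smul, mergeSum_smul, insertTerm, headMul_cons, fun t z w β b =>
    h.slide_out (B := fun x y => W (x :: (t ++ z :: (w ++ y :: β)))) (fun y => l1 _) (fun x => l2 _
    _ _ _ _) b]
  simp only [hz, mul_add, add_mul, pow_add, mul_one, one_mul, pow_one, onNil_smul] at M N ⊢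
  generalize ε ^ (y.length * w.length) = s at M N ⊢
  generalize ε ^ (m * y.length) = c at M N ⊢
  rcases neg_one_pow_eq_or k m with hm | hm <;> rcases neg_one_pow_eq_or k w.length with hw | hw <;>
    rcases neg_one_pow_eq_or k y.length with hy | hy <;>
    simp only [hm, hw, hy] at M N ⊢ <;>
    first
      | linear_combination (norm := module) s • M + N
      | linear_combination (norm := module) s • M - N
      | linear_combination (norm := module) -s • M + N
      | linear_combination (norm := module) -s • M - N

/-! ### Linearity and normalization of the parts of the homotopy -/

theorem isLinearMap_const_smul (c : k) {G : A → X} (h : IsLinearMap k G) :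
    IsLinearMap k fun a => c • G a where
  map_add a b := by rw [h.map_add, smul_add]
  map_smul d a := by rw [h.map_smul, smul_comm]

theorem isLinearMap_splitSum {G : A → List A → List A → X}
    (h : ∀ p q, IsLinearMap k fun a => G a p q) (l : List A) :
    IsLinearMap k fun a => splitSum (G a) l where
  map_add a b := by
    rw [← splitSum_add]
    exact splitSum_congr fun p q _ => (h p q).map_add a b
  map_smul c a := by
    rw [← splitSum_smul]
    exact splitSum_congr fun p q _ => (h p q).map_smul c a

theorem isLinearMap_split3 {G : A → List A → List A → List A → X}
    (h : ∀ x u v, IsLinearMap k fun a => G a x u v) (l : List A) :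
    IsLinearMap k fun a => split3 (G a) l :=
  isLinearMap_splitSum (fun x y => isLinearMap_splitSum (fun u v => h x u v) y) l

theorem isLinearMap_insertLetter (m : ℕ) (F : List A → A) {G : A → List A → X}
    (h : ∀ t, IsLinearMap k fun a => G a t) (l : List A) :
    IsLinearMap k fun a => insertLetter k m F (G a) l :=
  isLinearMap_split3 (fun x u v => isLinearMap_const_smul _ (h (x ++ F u :: v))) l

theorem LetterLinear.splitSum_param {G : List A → List A → List A → X}
    (h : ∀ p q, LetterLinear k fun t => G t p q) (l : List A) :
    LetterLinear k fun t => SingHoch.splitSum (G t) l where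
  add p q a b := by
    rw [← splitSum_add]
    exact splitSum_congr fun u v _ => (h u v).add p q a b
  smul p q c a := by
    rw [← splitSum_smul]
    exact splitSum_congr fun u v _ => (h u v).smul p q c a

theorem LetterLinear.split3_param {G : List A → List A → List A → List A → X}
    (h : ∀ x u v, LetterLinear k fun t => G t x u v) (l : List A) :
    LetterLinear k fun t => SingHoch.split3 (G t) l :=
  LetterLinear.splitSum_param (fun x y => LetterLinear.splitSum_param (fun u v => h x u v) y) l

theorem LetterLinear.insertLetter_param (m : ℕ) (F : List A → A) {G : List A → List A → X}
    (h : ∀ t, LetterLinear k fun s => G s t) (l : List A) :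
    LetterLinear k fun s => SingHoch.insertLetter k m F (G s) l :=
  LetterLinear.split3_param (fun x u v => (h (x ++ F u :: v)).const_smul _) l

theorem linear_split3 (ψ : X →ₗ[k] Y) (H : List A → List A → List A → X) (l : List A) :
    ψ (split3 H l) = split3 (fun x u v => ψ (H x u v)) l := by simp only [split3, linear_splitSum]

theorem linear_split5 (ψ : X →ₗ[k] Y) (H : List A → List A → List A → List A → List A → X)
    (β ζ : List A) : ψ (split5 H β ζ) = split5 (fun p q x u v => ψ (H p q x u v)) β ζ := by
  simp only [split5, linear_split3, linear_splitSum]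

theorem split3_mem (U : Submodule k X) {H : List A → List A → List A → X} {l : List A}
    (h : ∀ x u v, x ++ (u ++ v) = l → H x u v ∈ U) : split3 H l ∈ U :=
  splitSum_mem U fun x y hy => splitSum_mem U fun u v hv => h x u v (by rw [hv, hy])

theorem split5_mem (U : Submodule k X) {H : List A → List A → List A → List A → List A → X}
    {β ζ : List A} (h : ∀ p q x u v, p ++ q = β → x ++ (u ++ v) = ζ → H p q x u v ∈ U) :
    split5 H β ζ ∈ U := splitSum_mem U fun p q hq => split3_mem U fun x u v hv => h p q x u v hq hv

theorem insertLetter_mem (U : Submodule k X) {l : List A}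
    (h : ∀ x u v, x ++ (u ++ v) = l → φ (x ++ F u :: v) ∈ U) : insertLetter k m F φ l ∈ U :=
  split3_mem U fun x u v hl => Submodule.smul_mem _ _ (h x u v hl)

theorem split5_append_singleton (H : List A → List A → List A → List A → List A → X) (β ζ : List A)
    (d : A) :
    split5 H (β ++ [d]) ζ = split5 (fun p q x u v => H p (q ++ [d]) x u v) β ζ +
        split3 (fun x u v => H (β ++ [d]) [] x u v) ζ := by
  rw [split5, splitSum_append_singleton]
  rfl

variable (k) in
/-- The homotopy between the bracket with `κ(z₀, ζ)` and the value of `κ` at the bracket of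
chains. -/
def bracketHomotopy (m : ℕ) (form : LinearMap.BilinForm k A) (e f : ι → A) (F : List A → A)
    (W : List A → X) (z₀ : A) (ζ β : List A) : X :=
  rotCap k e f F W z₀ ζ β - insertCap k m e f F W z₀ ζ β + cycleCap form e f F W z₀ ζ β

theorem linear_bracketHomotopy (ψ : X →ₗ[k] Y) (W : List A → X) (z₀ : A) (ζ β : List A) :
    ψ (bracketHomotopy k m form e f F W z₀ ζ β) =
      bracketHomotopy k m form e f F (fun l => ψ (W l)) z₀ ζ β := by
  simp only [bracketHomotopy, rotCap, cycleCap, insertCap, signSum, rotTerm, cycleTerm, insertTerm,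
    linear_split5, linear_splitSum, linear_insertLetter, map_smul, map_sum, map_add, map_sub]

theorem LetterLinear.bracketHomotopy_right (hF : LetterLinear k F) (hW : LetterLinear k W) (z₀ : A)
    (ζ : List A) : LetterLinear k (bracketHomotopy k m form e f F W z₀ ζ) := by
  refine LetterLinear.sum_add (LetterLinear.sub (LetterLinear.splitSum (fun q => ?_) fun p => ?_)
    ?_) (LetterLinear.splitSum (fun q => ?_) fun p => ?_)
  · refine LetterLinear.split3_param (fun x u v => LetterLinear.length_smul (LetterLinear.finsum _
      fun i => ((hF.left (e i :: (v ++ z₀ :: x))).letterMap hW [] (u ++ f i :: q)).of_eq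
        fun _ => rfl) fun n => ε ^ rotSign n x.length u.length v.length) ζ
  · refine LetterLinear.split3_param (fun x u v => LetterLinear.const_smul (LetterLinear.finsum _
      fun i => ((hW.right (F (p ++ e i :: (v ++ z₀ :: x)) :: (u ++ [f i]))).of_eq
        fun _ => by simp)) _) ζ
  · exact LetterLinear.splitSum_param (fun w y => LetterLinear.const_smul
      (LetterLinear.insertLetter_param m F (fun t => LetterLinear.finsum _ fun i =>
        (hW.right (e i :: (t ++ z₀ :: (w ++ [f i])))).of_eq fun _ => by simp) y) _) ζ
  · refine LetterLinear.split3_param (fun x u v => LetterLinear.length_smul (LetterLinear.finsum _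
      fun i => LetterLinear.finsum _ fun j =>
        ((hF.around (v ++ [f i]) (f j :: u)).map ((form 1).smulRight
          (W ((e i * z₀) :: (x ++ e j :: q))))).of_eq fun _ => by simp)
        fun n => ε ^ cycleSign n x.length u.length v.length) ζ
  · refine LetterLinear.split3_param (fun x u v => LetterLinear.const_smul (LetterLinear.finsum _
      fun i => LetterLinear.finsum _ fun j => ((hW.right ((e i * z₀) :: (x ++ [e j]))).of_eq
        fun _ => by simp).const_smul _) _) ζ

theorem LetterLinear.bracketHomotopy_left (hF : LetterLinear k F) (hW : LetterLinear k W)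
    (β : List A) :
    LetterLinear k (SingHoch.onHead fun z₀ ζ => bracketHomotopy k m form e f F W z₀ ζ β) := by
  refine LetterLinear.onHead (fun ζ => ?_) fun z₀ => LetterLinear.sum_add (LetterLinear.sub ?_ ?_) ?_
  · have h1 : IsLinearMap k fun z₀ => rotCap k e f F W z₀ ζ β :=
      isLinearMap_splitSum (fun p q => isLinearMap_split3 (fun x u v =>
        isLinearMap_const_smul _ (isLinearMap_finsum _ fun i => by
          simpa using (hF.letterMap hW [] (u ++ f i :: q)).isLinearMap (p ++ e i :: v) x)) ζ) β
    have h2 : IsLinearMap k fun z₀ => insertCap k m e f F W z₀ ζ β :=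
      isLinearMap_splitSum (fun w y => isLinearMap_const_smul _ (isLinearMap_insertLetter m F
        (fun t => isLinearMap_finsum _ fun i => hW.isLinearMap (e i :: t) (w ++ f i :: β)) y)) ζ
    have h3 : IsLinearMap k fun z₀ => cycleCap form e f F W z₀ ζ β :=
      isLinearMap_splitSum (fun p q => isLinearMap_split3 (fun x u v =>
        isLinearMap_const_smul _ (isLinearMap_finsum _ fun i => isLinearMap_finsum _ fun j =>
          isLinearMap_const_smul _ (by
            simpa using isLinearMap_mul_letter hW (e i) 1 (x ++ e j :: q)))) ζ) β
    exact (h1.mk' _ - h2.mk' _ + h3.mk' _).isLinear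
  · refine LetterLinear.splitSum_param (fun p q => LetterLinear.split3
      (fun u v => ?_) (fun x v => ?_) (fun x u => ?_)) β
    · exact LetterLinear.length_smul (LetterLinear.finsum _ fun i =>
        ((hF.letterMap hW [] (u ++ f i :: q)).right (p ++ e i :: (v ++ [z₀]))).of_eq
          fun _ => by simp) fun n => ε ^ rotSign p.length n u.length v.length
    · exact LetterLinear.length_smul (LetterLinear.finsum _ fun i =>
        (hW.around [F (p ++ e i :: (v ++ z₀ :: x))] (f i :: q)).of_eq
          fun _ => rfl) fun n => ε ^ rotSign p.length x.length n v.length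
    · exact LetterLinear.length_smul (LetterLinear.finsum _ fun i =>
        ((hF.letterMap hW [] (u ++ f i :: q)).around (p ++ [e i]) (z₀ :: x)).of_eq
          fun _ => by simp) fun n => ε ^ rotSign p.length x.length u.length n
  · refine LetterLinear.splitSum (fun y => ?_) (fun w => ?_)
    · exact LetterLinear.length_smul (LetterLinear.insertLetter_param m F
        (fun t => LetterLinear.finsum _ fun i =>
          (hW.around (e i :: (t ++ [z₀])) (f i :: β)).of_eq fun _ => by simp) y)
        fun n => ε ^ (y.length * (1 + n) + (m + 1))
    · exact LetterLinear.length_smul (LetterLinear.insertLetter m hF (hW.insertTerm e f z₀ w β))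
        fun n => ε ^ (n * (1 + w.length) + (m + 1))
  · refine LetterLinear.splitSum_param (fun p q => LetterLinear.split3
      (fun u v => ?_) (fun x v => ?_) (fun x u => ?_)) β
    · exact LetterLinear.length_smul (LetterLinear.finsum _ fun i => LetterLinear.finsum _ fun j =>
        LetterLinear.const_smul ((hW.around [e i * z₀] (e j :: q)).of_eq
          fun _ => rfl) _) fun n => ε ^ cycleSign p.length n u.length v.length
    · exact LetterLinear.length_smul (LetterLinear.finsum _ fun i => LetterLinear.finsum _ fun j =>
        ((hF.right (v ++ f i :: (p ++ [f j]))).map ((form 1).smulRight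
          (W ((e i * z₀) :: (x ++ e j :: q))))).of_eq fun _ => by simp)
        fun n => ε ^ cycleSign p.length x.length n v.length
    · exact LetterLinear.length_smul (LetterLinear.finsum _ fun i => LetterLinear.finsum _ fun j =>
        ((hF.left (f i :: (p ++ f j :: u))).map ((form 1).smulRight
          (W ((e i * z₀) :: (x ++ e j :: q))))).of_eq fun _ => by simp)
        fun n => ε ^ cycleSign p.length x.length u.length n

theorem bracketHomotopy_mem (hF : ListCocycle k m F) (hW : LetterLinear k W) (U : Submodule k X)
    (z₀ : A) (ζ β : List A) (hU : ∀ l : List A, l.length + m = ζ.length + β.length + 4 → W l ∈ U) :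
    bracketHomotopy k m form e f F W z₀ ζ β ∈ U := by
  refine add_mem (sub_mem (split5_mem U fun p q x u v hβ hζ => Submodule.smul_mem _ _
    (Submodule.sum_mem _ fun i _ => ?_)) (splitSum_mem U fun w y hζ => Submodule.smul_mem _ _
    (insertLetter_mem U fun x u v hy => ?_))) (split5_mem U fun p q x u v hβ hζ =>
    Submodule.smul_mem _ _ (Submodule.sum_mem _ fun i _ => Submodule.sum_mem _ fun j _ => ?_))
  · by_cases h : (p ++ e i :: (v ++ z₀ :: x)).length = m
    · exact hU _ (by simp only [← h, ← hβ, ← hζ, List.length_append, List.length_cons]; omega)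
    · have h0 := hW.map_zero [] (u ++ f i :: q)
      rw [List.nil_append] at h0
      rw [hF.length _ h, h0]
      exact zero_mem _
  · by_cases h : u.length = m
    · exact Submodule.sum_mem _ fun i _ => hU _ (by
        simp only [← h, ← hζ, ← hy, List.length_append, List.length_cons]; omega)
    · rw [hF.length _ h, (hW.insertTerm e f z₀ w β).map_zero x v]
      exact zero_mem _
  · by_cases h : (v ++ f i :: (p ++ f j :: u)).length = m
    · exact Submodule.smul_mem _ _ (hU _ (by
        simp only [← h, ← hβ, ← hζ, List.length_append, List.length_cons]; omega))
    · rw [hF.length _ h, map_zero, zero_smul]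
      exact zero_mem _

theorem append_eq_append_cons {p q s t : List A} {c : A} (h : p ++ q = s ++ c :: t) :
    (∃ p', p = s ++ c :: p') ∨ ∃ s', q = s' ++ c :: t := by
  rcases List.append_eq_append_iff.1 h with ⟨r, h1, h2⟩ | ⟨r, h1, h2⟩
  · exact Or.inr ⟨r, h2⟩
  · cases r with
    | nil => exact Or.inr ⟨[], by simpa using h2.symm⟩
    | cons a r =>
      simp only [List.cons_append, List.cons.injEq] at h2
      exact Or.inl ⟨r, by rw [h1, h2.1]⟩

/-- A unit in β ends up either in the argument of F or as a letter of W behind the first one. -/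
theorem bracketHomotopy_unit (hF : ListCocycle k m F) (hW : LetterLinear k W)
    (hu : ∀ a p q, W (a :: (p ++ 1 :: q)) = 0) (z₀ : A) (ζ s t : List A) :
    bracketHomotopy k m form e f F W z₀ ζ (s ++ 1 :: t) = 0 := by
  rw [← Submodule.mem_bot k]
  refine add_mem (sub_mem (split5_mem _ fun p q x u v hβ _ => Submodule.smul_mem _ _
    (Submodule.sum_mem _ fun i _ => ?_)) (splitSum_mem _ fun w y _ => Submodule.smul_mem _ _
    (insertLetter_mem _ fun x u v _ => Submodule.sum_mem _ fun i _ => ?_)))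
    (split5_mem _ fun p q x u v hβ _ => Submodule.smul_mem _ _
      (Submodule.sum_mem _ fun i _ => Submodule.sum_mem _ fun j _ => ?_))
  · rcases append_eq_append_cons hβ with ⟨p', rfl⟩ | ⟨s', rfl⟩
    · rw [Submodule.mem_bot, List.append_assoc, List.cons_append, hF.unit]
      exact hW.map_zero [] (u ++ f i :: q)
    · simpa using hu (F (p ++ e i :: (v ++ z₀ :: x))) (u ++ f i :: s') t
  · simpa using hu (e i) ((x ++ F u :: v) ++ z₀ :: (w ++ f i :: s)) t
  · rcases append_eq_append_cons hβ with ⟨p', rfl⟩ | ⟨s', rfl⟩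
    · have := hF.unit (v ++ f i :: s) (p' ++ f j :: u)
      simp only [List.append_assoc, List.cons_append] at this ⊢
      rw [this, map_zero, zero_smul]
      exact zero_mem _
    · have := hu (e i * z₀) (x ++ e j :: s') t
      rw [List.append_assoc, List.cons_append] at this
      rw [this, smul_zero]
      exact zero_mem _

/-- F can never take the last letter `d`: its argument would contain β, `d` and a Casimir letter,
which exceeds m letters. -/
theorem bracketHomotopy_append_singleton (hF : ListCocycle k m F) (hW : LetterLinear k W) (z₀ d : A)
    (ζ β : List A) (hm : m ≤ β.length + 1) :
    bracketHomotopy k m form e f F W z₀ ζ (β ++ [d]) =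
      bracketHomotopy k m form e f F (fun l => W (l ++ [d])) z₀ ζ β := by
  have h0 : ∀ c x, F (β ++ d :: c :: x) = 0 := fun c x =>
    hF.length _ (by simp only [List.length_append, List.length_cons]; omega)
  have h1 : ∀ v b c u, F (v ++ b :: (β ++ d :: c :: u)) = 0 := fun v b c u =>
    hF.length _ (by simp only [List.length_append, List.length_cons]; omega)
  have h2 : ∀ t, W (0 :: t) = 0 := hW.map_zero []
  simp only [bracketHomotopy, rotCap, cycleCap, signSum, split5_append_singleton, rotTerm,
    cycleTerm, insertCap, insertTerm, h0, h1, h2, map_zero, zero_smul, Finset.sum_const_zero,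
    smul_zero, split3_zero, add_zero, List.cons_append, List.append_assoc, List.nil_append]

/-! ### The terms of the homotopy as values of the operations on chains -/

theorem splitSum_append_cons (G : List A → List A → X) (p : List A) (c : A) (q : List A) :
    splitSum G (p ++ c :: q) = splitSum (fun u v => G u (v ++ c :: q)) p +
      splitSum (fun u v => G (p ++ c :: u) v) q := by
  induction p generalizing G with
  | nil => rfl
  | cons a p ih => rw [List.cons_append, splitSum_cons, splitSum_cons, ih, add_assoc]; rfl

theorem splitSum_splitSum_left (G : List A → List A → List A → X) (l : List A) :
    splitSum (fun p q => splitSum (fun u v => G u v q) p) l = split3 G l := by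
  induction l generalizing G with
  | nil => rfl
  | cons a l ih =>
    rw [split3, splitSum_cons, splitSum_cons]
    simp only [splitSum_cons]
    rw [splitSum_add, ih fun u v q => G (a :: u) v q, split3, splitSum_nil]
    abel

theorem splitSum_finsum {κ : Type*} (s : Finset κ) (H : κ → List A → List A → X) (l : List A) :
    splitSum (fun p q => ∑ i ∈ s, H i p q) l = ∑ i ∈ s, splitSum (H i) l := by
  induction l generalizing H with
  | nil => rfl
  | cons a l ih =>
    simp only [splitSum_cons]
    rw [ih fun i p q => H i (a :: p) q, Finset.sum_add_distrib]

theorem connesSum_normalized (h : ∀ c x, φ (c :: 1 :: x) = 0) (b : A) (t : List A) :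
    connesSum k φ (b :: t) =
      splitSum (fun p q => ε ^ ((p.length + 1) * q.length) • φ (1 :: (q ++ b :: p))) t := by
  rw [connesSum, cyclicSum_mul_head]
  refine splitSum_congr fun p q _ => ?_
  congr 1
  cases q with
  | nil => simp [h]
  | cons c q => simp [h]

variable (e f W) in
/-- `a₀ ⊗ ⋯ ⊗ a_r ↦ ∑ W(e a₀, a₁, …, a_r, f, β)` -/
def casimirList (β : List A) : List A → X := onHead fun a l => ∑ i, W ((e i * a) :: (l ++ f i :: β))

theorem casimirList_cons (β : List A) (a : A) (l : List A) :
    casimirList e f W β (a :: l) = ∑ i, W ((e i * a) :: (l ++ f i :: β)) := rfl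

theorem LetterLinear.casimirList (hW : LetterLinear k W) (β : List A) :
    LetterLinear k (SingHoch.casimirList e f W β) := by
  refine LetterLinear.onHead (fun l => isLinearMap_finsum _ fun i => ?_)
    (fun a => LetterLinear.finsum _ fun i => (hW.around [e i * a] (f i :: β)).of_eq fun _ => rfl)
  simpa using isLinearMap_mul_letter hW (e i) 1 (l ++ f i :: β)

theorem casimirList_unit (hu : ∀ a p b q, W (a :: (p ++ 1 :: b :: q)) = 0) (β : List A) (c : A)
    (p q : List A) : casimirList e f W β (c :: (p ++ 1 :: q)) = 0 := by
  refine Finset.sum_eq_zero fun i _ => ?_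
  rw [List.append_assoc, List.cons_append]
  cases q with
  | nil => exact hu _ _ _ _
  | cons b q => exact hu _ _ _ _

theorem casimirList_zero (hW : LetterLinear k W) (β : List A) (l : List A) :
    casimirList e f W β (0 :: l) = 0 := (hW.casimirList β).map_zero [] l

/-- In a rotation of the chain the letters taken by the cocycle either include z₀ or all lie before
it. The two cases are surviving terms of `rotCap_homotopy` and of `insertCap_homotopy`. -/
theorem cap_connesB_word {g : Multi m A} (hF : ListCocycle k m (ev g)) (hW : LetterLinear k W)
    (hu : ∀ a p b q, W (a :: (p ++ 1 :: b :: q)) = 0) (z₀ : A) (ζ β : List A) :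
    wordMap _ (hW.casimirList (e := e) (f := f) β) (cap g (connesB k A (word k (z₀ :: ζ)))) =
      split3 (fun x u v => ε ^ (v.length * (1 + x.length + u.length)) •
        ∑ i, W ((e i * ev g (v ++ z₀ :: x)) :: (u ++ f i :: β))) ζ +
      splitSum (fun w y => ε ^ (y.length * (1 + w.length)) •
        splitSum (fun u v => ∑ i, W ((e i * ev g u) :: (v ++ z₀ :: (w ++ f i :: β)))) y) ζ := by
  have hc : ∀ a l, wordMap _ (hW.casimirList (e := e) (f := f) β) (cap g (word k (a :: l))) =
      splitSum (fun u v => casimirList e f W β ((a * ev g u) :: v)) l := fun a l => by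
    rw [cap_word, linear_splitSum]
    simp only [wordMap_word]
  rw [connesB_word, linear_connesSum, linear_connesSum, connesSum_normalized]
  · simp only [hc, one_mul, splitSum_append_cons, smul_add, splitSum_add]
    rw [add_comm]
    congr 1
    · rw [← splitSum_splitSum_left]
      refine splitSum_congr fun p q _ => ?_
      rw [← splitSum_smul]
      refine splitSum_congr fun u v hp => ?_
      rw [← hp, List.length_append, casimirList_cons]
      congr 2
      ring
    · refine splitSum_congr fun p q _ => ?_
      rw [mul_comm, add_comm]
      congr 1
      refine splitSum_congr fun u v _ => ?_
      rw [casimirList_cons]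
      simp only [List.append_assoc, List.cons_append]
  · intro c x
    rw [hc, splitSum_cons]
    have h1 := casimirList_unit (e := e) (f := f) hu β (c * ev g []) [] x
    rw [List.nil_append] at h1
    rw [h1, zero_add]
    have h2 : ∀ p, ev g (1 :: p) = 0 := fun p => hF.unit [] p
    simp only [h2, mul_zero, casimirList_zero hW, splitSum_zero]

/-- The rotations of F(u) z₀ ⊗ ⋯ are the surviving terms of `insertCap_homotopy` in which the value
of F is multiplied with z₀. -/
theorem connesB_capLast_word (hF : ListCocycle k m F) (hW : LetterLinear k W)
    (hu : ∀ a p b q, W (a :: (p ++ 1 :: b :: q)) = 0) (z₀ : A) (ζ β : List A) :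
    ε ^ (m * ζ.length + 1) • wordMap _ (hW.casimirList (e := e) (f := f) β)
        (connesB k A (capLast F hF.linear (word k (z₀ :: ζ)))) =
      splitSum (fun w y => ε ^ (y.length * (1 + w.length) + (m * (y.length + 1) + 1)) •
        splitSum (fun x u => insertTerm e f W x (F u * z₀) w β) y) ζ := by
  rw [capLast_word, linear_splitSum, linear_splitSum, ← splitSum_smul]
  have h0 : ∀ c x, wordMap _ (hW.casimirList (e := e) (f := f) β) (word k (c :: 1 :: x)) = 0 :=
    fun c x => (wordMap_word _ _ _).trans (casimirList_unit hu β c [] x)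
  have h1 : ∀ b t, wordMap _ (hW.casimirList (e := e) (f := f) β) (connesB k A (word k (b :: t))) =
      splitSum (fun p q => ε ^ ((p.length + 1) * q.length) • insertTerm e f W q b p β) t := by
    intro b t
    rw [connesB_word, linear_connesSum, connesSum_normalized h0]
    refine splitSum_congr fun p q _ => ?_
    rw [wordMap_word, casimirList_cons, insertTerm]
    simp only [mul_one, List.append_assoc, List.cons_append]
  simp only [h1, ← splitSum_smul]
  rw [splitSum_splitSum_left, split3]
  refine splitSum_congr fun w y hl => ?_
  refine splitSum_congr fun x u hy => ?_
  by_cases h : u.length = m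
  · rw [smul_smul, ← pow_add]
    congr 1
    rw [← hl, ← hy]
    refine neg_one_pow_congr ?_
    simp only [List.length_append, h, Nat.even_add, Nat.even_mul, Nat.even_add_one]
    grind
  · rw [hF.length u h, zero_mul]
    have : insertTerm e f W x 0 w β = 0 := Finset.sum_eq_zero fun i _ => hW.map_zero (e i :: x) _
    rw [this, smul_zero, smul_zero, smul_zero]

theorem form_bvDelta_splitSum [FiniteDimensional k A] (hf : IsSymmetrizing form) {g : Multi m A}
    (hF : ListCocycle k m (ev g)) (a : A) {s : List A} (hs : s.length = m - 1) :
    form (ev (bvDelta hf g) s) a = ε ^ m • splitSum (fun p q =>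
      ε ^ ((p.length + 1) * q.length) • form 1 (ev g (q ++ a :: p))) s := by
  have h2 : ∀ p, ev g (1 :: p) = 0 := fun p => hF.unit [] p
  rw [form_bvDelta hf g a hs, connesB_word, linear_connesSum, connesSum_normalized]
  · simp only [pairing_word]
  · intro c x
    rw [pairing_word, h2, map_zero]

/-- Expand e_i Δ(g)(s) in the family `e`. By the definition of Δ the coefficients are sums over
rotations of the argument of g, with a product of two Casimir letters in place of a₀; this is the
case of p empty in `cycleCap_homotopy`. -/
theorem capLast_bvDelta_word [FiniteDimensional k A] (hf : IsSymmetrizing form) (hm : 1 ≤ m)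
    (h : IsCasimir form e f) {g : Multi m A} (hF : ListCocycle k m (ev g)) (hW : LetterLinear k W)
    (z₀ : A) (ζ β : List A) :
    ε ^ ((m - 1) * ζ.length) • wordMap _ (hW.casimirList (e := e) (f := f) β)
        (capLast (ev (bvDelta hf g)) (LetterLinear.ev _) (word k (z₀ :: ζ))) =
      split3 (fun x u v => ε ^ (cycleSign 0 x.length u.length v.length + v.length) •
        ∑ i, ∑ j, form 1 (ev g (v ++ (f i * f j) :: u)) • W ((e i * z₀) :: (x ++ e j :: β))) ζ := by
  rw [capLast_word, linear_splitSum, ← splitSum_smul, split3]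
  refine splitSum_congr fun x s hl => ?_
  have l1 : ∀ t, IsLinearMap k fun y => W ((y * z₀) :: t) := fun t => by
    simpa using isLinearMap_mul_letter hW 1 z₀ t
  rw [wordMap_word, casimirList_cons]
  by_cases hs : s.length = m - 1
  · have e1 : ∀ i, W ((e i * (ev (bvDelta hf g) s * z₀)) :: (x ++ f i :: β)) =
        ∑ j, ε ^ m • splitSum (fun u v => ε ^ ((u.length + 1) * v.length) •
          form 1 (ev g (v ++ (f j * e i) :: u)) • W ((e j * z₀) :: (x ++ f i :: β))) s := by
      intro i
      rw [← mul_assoc]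
      conv_lhs => rw [← h.right (e i * ev (bvDelta hf g) s)]
      rw [isLinearMap_sum (l1 _)]
      refine Finset.sum_congr rfl fun j _ => ?_
      have e2 : form (e i * ev (bvDelta hf g) s) (f j) =
          form (ev (bvDelta hf g) s) (f j * e i) := by
        rw [h.assoc, h.symm, h.assoc]
      rw [e2, form_bvDelta_splitSum hf hF _ hs, smul_assoc]
      congr 1
      have := linear_splitSum ((LinearMap.toSpanSingleton k X (W ((e j * z₀) :: (x ++ f i :: β)))))
        (fun u v => ε ^ ((u.length + 1) * v.length) • form 1 (ev g (v ++ (f j * e i) :: u))) s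
      simp only [LinearMap.toSpanSingleton_apply] at this
      rw [this]
      simp only [smul_assoc]
    have e3 : ∀ u v, ∑ i, ∑ j, form 1 (ev g (v ++ (f j * e i) :: u)) •
        W ((e j * z₀) :: (x ++ f i :: β)) = ∑ i, ∑ j, form 1 (ev g (v ++ (f i * f j) :: u)) •
          W ((e i * z₀) :: (x ++ e j :: β)) := by
      intro u v
      rw [Finset.sum_comm]
      refine Finset.sum_congr rfl fun j _ => ?_
      refine h.swap (B := fun a b => form 1 (ev g (v ++ (f j * a) :: u)) •
        W ((e j * z₀) :: (x ++ b :: β))) (fun b => ?_) (fun a => ?_)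
      · have L := (hF.linear.map ((form 1).smulRight (W ((e j * z₀) :: (x ++ b :: β))))).isLinearMap v u
        exact ⟨fun a b => by rw [mul_add]; exact L.map_add _ _,
          fun c a => by rw [mul_smul_comm]; exact L.map_smul _ _⟩
      · exact isLinearMap_const_smul _ (hW.isLinearMap ((e j * z₀) :: x) β)
    simp only [e1, ← Finset.smul_sum, ← splitSum_finsum, ← splitSum_smul]
    refine splitSum_congr fun u v hu => ?_
    rw [← e3]
    simp only [smul_smul, ← pow_add]
    congr 1
    obtain ⟨n, rfl⟩ : ∃ n, m = n + 1 := ⟨m - 1, by omega⟩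
    have hn : n = u.length + v.length := by
      rw [← hu, List.length_append] at hs
      omega
    rw [← hl, ← hu, hn]
    refine neg_one_pow_congr ?_
    simp only [List.length_append, cycleSign, Nat.add_sub_cancel, Nat.even_add, Nat.even_mul,
      Nat.even_add_one]
    grind
  · have e1 : ∀ i, W ((e i * (ev (bvDelta hf g) s * z₀)) :: (x ++ f i :: β)) = 0 := fun i => by
      rw [ev_of_ne _ hs, zero_mul, mul_zero]
      exact hW.map_zero [] _
    have e2 : ∀ u v, u ++ v = s → ∀ y, ev g (v ++ y :: u) = 0 := fun u v huv y =>
      hF.length _ fun h => hs (by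
        rw [← huv]
        simp only [List.length_append, List.length_cons] at h ⊢
        omega)
    rw [Finset.sum_eq_zero fun i _ => e1 i, smul_zero, ← splitSum_zero s]
    refine splitSum_congr fun u v huv => ?_
    simp only [e2 u v huv, map_zero, zero_smul, Finset.sum_const_zero, smul_zero]

/-! ### The homotopy -/

theorem onHead_add (G H : A → List A → X) (l : List A) :
    onHead (fun a t => G a t + H a t) l = onHead G l + onHead H l := by cases l <;> simp

theorem onHead_sub (G H : A → List A → X) (l : List A) :
    onHead (fun a t => G a t - H a t) l = onHead G l - onHead H l := by cases l <;> simp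

theorem onLast_add (G H : List A → A → X) (l : List A) :
    onLast (fun t a => G t a + H t a) l = onLast G l + onLast H l := by
  rcases List.eq_nil_or_concat' l with rfl | ⟨t, c, rfl⟩ <;> simp

theorem onLast_sub (G H : List A → A → X) (l : List A) :
    onLast (fun t a => G t a - H t a) l = onLast G l - onLast H l := by
  rcases List.eq_nil_or_concat' l with rfl | ⟨t, c, rfl⟩ <;> simp

variable (k) in
/-- The values of the bracket with `κ(z₀, ζ)`. -/
def bracketList (m : ℕ) (e f : ι → A) (F : List A → A) (W : List A → X) (z₀ : A) (ζ β : List A) :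
    X :=
  splitSum (fun p q => splitSum (fun x u => ε ^ (p.length * (x.length + u.length)) •
      ∑ i, W (F (p ++ (e i * z₀) :: x) :: (u ++ f i :: q))) ζ) β +
    ε ^ (m + 1) • insertLetter k m F (fun t => ∑ i, W ((e i * z₀) :: (t ++ f i :: β))) ζ +
    splitSum (fun p q => splitSum (fun x v =>
      ε ^ ((v.length + p.length) * (1 + x.length)) •
        ∑ i, W ((e i * z₀) :: (x ++ F (v ++ f i :: p) :: q))) ζ) β

/-- Combine the three formulas with signs +, −, +. The families with the value of F multiplied with
z₀ in front cancel between the first and the third; the rest assembles to the operations on chains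
and to the bracket. -/
theorem bracketHomotopy_boundary [FiniteDimensional k A] (hf : IsSymmetrizing form) (hm : 1 ≤ m)
    {g : Multi m A} (hF : ListCocycle k m (ev g)) (hW : LetterLinear k W)
    (hd : ∀ l, mergeSum W l = 0) (hu : ∀ a p b q, W (a :: (p ++ 1 :: b :: q)) = 0)
    (h : IsCasimir form e f) (z₀ : A) (ζ β : List A) (hr : m ≤ ζ.length) :
    ε ^ ζ.length •
        (onHead (fun b β' => bracketHomotopy k m form e f (ev g) (headMul b W) z₀ ζ β') β -
          mergeSum (bracketHomotopy k m form e f (ev g) W z₀ ζ) β) -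
      hochSum k (onHead fun z₀ ζ => bracketHomotopy k m form e f (ev g) W z₀ ζ β) (z₀ :: ζ) =
    wordMap _ (hW.casimirList (e := e) (f := f) β) (cap g (connesB k A (word k (z₀ :: ζ)))) +
      ε ^ (m * ζ.length + 1) • wordMap _ (hW.casimirList (e := e) (f := f) β)
        (connesB k A (capLast (ev g) hF.linear (word k (z₀ :: ζ)))) -
      ε ^ ((m - 1) * ζ.length) • wordMap _ (hW.casimirList (e := e) (f := f) β)
        (capLast (ev (bvDelta hf g)) (LetterLinear.ev _) (word k (z₀ :: ζ))) -
      bracketList k m e f (ev g) W z₀ ζ β := by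
  have h1 := rotCap_homotopy hF hW hd h z₀ ζ β hr
  have h2 := insertCap_homotopy hF hW hd h z₀ ζ β
  have h3 := cycleCap_homotopy hF hW hd h z₀ ζ β hr
  rw [cap_connesB_word hF hW hu, connesB_capLast_word hF hW hu, capLast_bvDelta_word hf hm h hF hW,
    hochSum_cons, mergeSum_cons, bracketList]
  have e1 : bracketHomotopy k m form e f (ev g) W z₀ ζ = fun t =>
    rotCap k e f (ev g) W z₀ ζ t - insertCap k m e f (ev g) W z₀ ζ t +
      cycleCap form e f (ev g) W z₀ ζ t := rfl
  rw [e1]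
  simp only [onHead_cons, bracketHomotopy, onHead_add, onHead_sub, mergeSum_add, mergeSum_sub,
    onLast_add, onLast_sub]
  linear_combination (norm := module) h1 - h2 + h3

variable (k A) in
theorem LetterLinear.barD_bword : LetterLinear k fun l : List A => barD (SingHoch.bword k l) :=
  (LetterLinear.bword k).map barD

variable (k A) in
theorem LetterLinear.barD_bword_last (c : A) :
    LetterLinear k fun l : List A => barD (SingHoch.bword k (l ++ [c])) :=
  (LetterLinear.barD_bword k A).left [c]

theorem mergeSum_barD_bword (l : List A) : mergeSum (fun l => barD (bword k l)) l = 0 := by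
  rw [← linear_mergeSum, ← barD_bword, barD_barD]

theorem barD_bword_unit (a : A) (p : List A) (b : A) (q : List A) :
    barD (bword k (a :: (p ++ 1 :: b :: q))) = 0 := by
  rw [← List.cons_append, bword_eq_zero _ _ (by simp) (by simp), map_zero]

variable (k) in
/-- The homotopy as a linear map on chains, for the letters `c`. -/
def homotopyMap (m : ℕ) (form : LinearMap.BilinForm k A) (e f : ι → A) (hF : LetterLinear k F)
    (c : List A) : TensorAlgebra k A →ₗ[k] Bar k A :=
  wordMap _ (hF.bracketHomotopy_left (m := m) (form := form) (e := e) (f := f)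
    (LetterLinear.barD_bword_last k A 1) c)

theorem homotopyMap_word (hF : LetterLinear k F) (c : List A) (z₀ : A) (ζ : List A) :
    homotopyMap k m form e f hF c (word k (z₀ :: ζ)) =
      bracketHomotopy k m form e f F (fun l => barD (bword k (l ++ [1]))) z₀ ζ c :=
  wordMap_word _ _ _

theorem LetterLinear.homotopyMap (hF : LetterLinear k F) :
    LetterLinear k (SingHoch.homotopyMap k m form e f hF) where
  add p q a b := by
    refine ext_word fun l => ?_
    rw [LinearMap.add_apply]
    cases l with
    | nil => simp only [SingHoch.homotopyMap, wordMap_word, onHead_nil, add_zero]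
    | cons z₀ ζ =>
      simp only [homotopyMap_word]
      exact (hF.bracketHomotopy_right (barD_bword_last k A 1) z₀ ζ).add p q a b
  smul p q c a := by
    refine ext_word fun l => ?_
    rw [LinearMap.smul_apply]
    cases l with
    | nil => simp only [SingHoch.homotopyMap, wordMap_word, onHead_nil, smul_zero]
    | cons z₀ ζ =>
      simp only [homotopyMap_word]
      exact (hF.bracketHomotopy_right (barD_bword_last k A 1) z₀ ζ).smul p q c a

variable (k) in
/-- The cochain of the homotopy. -/
def homotopyCochain (n : ℕ) (form : LinearMap.BilinForm k A) (e f : ι → A) (hF : LetterLinear k F)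
    (z : TensorAlgebra k A) : Multi n (Bar k A) :=
  multi (fun c => homotopyMap k (n + 1) form e f hF c z)
    ((hF.homotopyMap (m := n + 1)).map (LinearMap.applyₗ z)) n

theorem ev_homotopyCochain (hF : LetterLinear k F) (z : TensorAlgebra k A) {c : List A}
    (hc : c.length = n) :
    ev (homotopyCochain k n form e f hF z) c = homotopyMap k (n + 1) form e f hF c z :=
  ev_multi _ _ hc

theorem homotopyCochain_mem (hF : ListCocycle k (n + 1) F) (hp : r + 2 = p)
    (hz : z ∈ chains k A r) : homotopyCochain k n form e f hF.linear z ∈ CΩ p n := by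
  refine mem_cochains (fun l hl => ?_) fun p q h => ?_
  · rw [ev_homotopyCochain _ _ hl]
    refine chains_le (S := (Omega k A p).comap (homotopyMap k (n + 1) form e f hF.linear l))
      (fun a t ht => ?_) hz
    rw [Submodule.mem_comap, homotopyMap_word]
    refine bracketHomotopy_mem hF (LetterLinear.barD_bword_last k A 1) _ _ _ _ fun w hw => ?_
    refine barD_mem_Omega ?_
    have := bword_mem_barLength (k := k) (w ++ [1])
    rwa [List.length_append, List.length_singleton, show w.length + 1 = p + 2 by omega] at this
  · rw [ev_homotopyCochain _ _ (by simp only [List.length_append, List.length_cons]; omega)]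
    have : homotopyMap k (n + 1) form e f hF.linear (p ++ 1 :: q) = 0 := ext_word fun l => by
      cases l with
      | nil => exact wordMap_word _ _ _
      | cons z₀ ζ =>
        rw [homotopyMap_word, bracketHomotopy_unit hF (LetterLinear.barD_bword_last k A 1)]
        · rfl
        · intro a p q
          rw [List.cons_append, List.append_assoc]
          cases q with
          | nil => exact barD_bword_unit _ _ _ _
          | cons b q => exact barD_bword_unit _ _ _ _
    rw [this, LinearMap.zero_apply]

/-- Use `bracketHomotopy_boundary` with W = d and β = u ⊗ 1. Multiplying the head is the left
action, and multiplying the last letter of u with the closing 1 is the right action, so the terms in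
β become δ. On a cycle the summand with ∂z vanishes. -/
theorem delta_homotopyCochain [FiniteDimensional k A] (hf : IsSymmetrizing form)
    {g : Multi (n + 1) A} (hF : ListCocycle k (n + 1) (ev g)) (h : IsCasimir form e f)
    (hr : n + 1 ≤ r) (hz : z ∈ chains k A r) {u : List A} (hn : u.length = n + 1)
    {P : TensorAlgebra k A →ₗ[k] Bar k A}
    (hP : ∀ z₀ ζ, ζ.length = r → P (word k (z₀ :: ζ)) = bracketList k (n + 1) e f (ev g) (fun l => barD (bword k l)) z₀ ζ (u ++ [1])) :
    ε ^ r • ev (delta barLeft barRight n (homotopyCochain k n form e f hF.linear z)) u =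
    wordMap _ (hF.linear.bracketHomotopy_left (m := n + 1) (form := form) (e := e) (f := f)
      (LetterLinear.barD_bword k A) (u ++ [1])) (boundary k A z) +
    wordMap _ ((LetterLinear.barD_bword k A).casimirList (e := e) (f := f) (u ++ [1]))
      (cap g (connesB k A z) +
      ε ^ ((n + 1) * r + 1) • connesB k A (capLast (ev g) hF.linear z) -
      ε ^ (n * r) • capLast (ev (bvDelta hf g)) (LetterLinear.ev _) z) - P z := by
  obtain ⟨a, l, rfl⟩ := List.exists_cons_of_length_eq_add_one hn
  have hl : l.length = n := by simpa using hn
  have hW := LetterLinear.barD_bword k A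
  set L := homotopyMap k (n + 1) form e f hF.linear with hL
  set C := wordMap _ (hW.casimirList (e := e) (f := f) (a :: l ++ [1])) with hC
  set H := wordMap _ (hF.linear.bracketHomotopy_left (m := n + 1) (form := form) (e := e) (f := f)
    hW (a :: l ++ [1])) with hH
  let φ : TensorAlgebra k A →ₗ[k] Bar k A := ε ^ r • (barLeft a ∘ₗ L l -
    mergeSum L (a :: l) + ε ^ (n + 1) • onLast (fun p c => barRight c ∘ₗ L p) (a :: l))
  let ψ : TensorAlgebra k A →ₗ[k] Bar k A := H ∘ₗ boundary k A + C ∘ₗ (cap g ∘ₗ connesB k A +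
    ε ^ ((n + 1) * r + 1) • connesB k A ∘ₗ capLast (ev g) hF.linear -
    ε ^ (n * r) • capLast (ev (bvDelta hf g)) (LetterLinear.ev _)) - P
  have hφ : ∀ y, φ y = ε ^ r • (barLeft a (L l y) - mergeSum (fun c => L c y) (a :: l) +
      ε ^ (n + 1) • onLast (fun p c => barRight c (L p y)) (a :: l)) := by
    intro y
    have h1 := linear_mergeSum (LinearMap.applyₗ (R := k) (M₂ := Bar k A) y) L (a :: l)
    have h2 := linear_onLast (LinearMap.applyₗ (R := k) (M₂ := Bar k A) y)
      (fun p c => barRight c ∘ₗ L p) (a :: l)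
    simp only [LinearMap.applyₗ_apply_apply, LinearMap.comp_apply] at h1 h2
    rw [← h1, ← h2]
    rfl
  have key : φ z = ψ z := by
    refine eqOn_chains (fun z₀ ζ hζ => ?_) hz
    have B := bracketHomotopy_boundary (m := n + 1) hf (by omega) hF hW mergeSum_barD_bword
      barD_bword_unit h z₀ ζ (a :: l ++ [1]) (by omega)
    have hb : H (boundary k A (word k (z₀ :: ζ))) = hochSum k (onHead fun z₀ ζ =>
        bracketHomotopy k (n + 1) form e f (ev g) (fun l => barD (bword k l)) z₀ ζ
          (a :: l ++ [1])) (z₀ :: ζ) := by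
      rw [boundary_word, linear_hochSum]
      exact hochSum_congr fun t _ => wordMap_word _ _ _
    have hψ : ψ (word k (z₀ :: ζ)) = H (boundary k A (word k (z₀ :: ζ))) +
        (C (cap g (connesB k A (word k (z₀ :: ζ)))) +
        ε ^ ((n + 1) * r + 1) • C (connesB k A (capLast (ev g) hF.linear (word k (z₀ :: ζ)))) -
        ε ^ (n * r) • C (capLast (ev (bvDelta hf g)) (LetterLinear.ev _)
          (word k (z₀ :: ζ)))) - P (word k (z₀ :: ζ)) := by
      rw [← map_smul C, ← map_smul C, ← map_add C, ← map_sub C]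
      rfl
    rw [hψ, hφ, hb, hP _ _ hζ]
    rw [hζ] at B
    -- The closing 1 is never taken by `g`, so it can be moved into `W`, and d is left linear.
    have c1 : ∀ b, bracketHomotopy k (n + 1) form e f (ev g)
        (headMul b fun l => barD (bword k l)) z₀ ζ (l ++ [1]) =
          barLeft b (L l (word k (z₀ :: ζ))) := by
      intro b
      rw [hL, homotopyMap_word, ← bracketHomotopy_append_singleton hF hW _ _ _ _ (by omega),
        linear_bracketHomotopy]
      congr 1
      funext t
      cases t with
      | nil =>
        rw [show barD (bword k ([] : List A)) = 0 by rw [barD_bword, mergeSum_nil], map_zero]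
        rfl
      | cons c t => rw [headMul_cons, ← barD_barLeft, barLeft_bword]
    -- The product with the closing 1 is split off from the merge sum; it becomes the right action,
    -- with the sign of the last term of δ.
    have c2 : mergeSum (bracketHomotopy k (n + 1) form e f (ev g)
        (fun l => barD (bword k l)) z₀ ζ) (a :: l ++ [1]) =
        mergeSum (fun c => L c (word k (z₀ :: ζ))) (a :: l) -
          ε ^ (n + 1) • onLast (fun p c => barRight c (L p (word k (z₀ :: ζ)))) (a :: l) := by
      rw [mergeSum_append_cons k, hn]
      simp only [onHead_nil, smul_zero, mergeSum_nil, add_zero, sub_zero]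
      congr 1
      · refine mergeSum_congr fun t ht => ?_
        rw [hL, homotopyMap_word, bracketHomotopy_append_singleton hF hW _ _ _ _ (by omega)]
      · congr 1
        refine onLast_congr fun p c hp => ?_
        have hp' : p.length = n := by
          have := congrArg List.length hp
          simp only [List.length_append, List.length_cons, List.length_nil] at this
          omega
        rw [hL, homotopyMap_word, linear_bracketHomotopy, bracketHomotopy_append_singleton hF hW _ _
          _ _ (by omega), mul_one]
        congr 1
        funext t
        rw [← barD_barRight, barRight_bword, one_mul]
    rw [List.cons_append, onHead_cons, c1, ← List.cons_append, c2] at B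
    simp only [Nat.add_sub_cancel] at B
    linear_combination (norm := module) B
  rw [ev_delta, ev_homotopyCochain _ _ hl]
  have e1 : mergeSum (ev (homotopyCochain k n form e f hF.linear z)) (a :: l) =
      mergeSum (fun c => L c z) (a :: l) := mergeSum_congr fun t ht =>
    ev_homotopyCochain _ _ (by omega)
  have e2 : onLast (fun p c => barRight c (ev (homotopyCochain k n form e f hF.linear z) p))
      (a :: l) = onLast (fun p c => barRight c (L p z)) (a :: l) := onLast_congr fun p c hp => by
    rw [ev_homotopyCochain _ _ (by
      have := congrArg List.length hp
      simp only [List.length_append, List.length_cons, List.length_nil] at this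
      omega)]
  rw [e1, e2, ← hL, ← hφ, key]
  rfl

/-! ### The bracket with `κ` -/

theorem splitSum_comm (G : List A → List A → List A → List A → X) (ζ w : List A) :
    splitSum (fun x y => splitSum (G x y) w) ζ =
      splitSum (fun p q => splitSum (fun x y => G x y p q) ζ) w := by
  induction w generalizing G with
  | nil => rfl
  | cons a w ih =>
    simp only [splitSum_cons, splitSum_add]
    rw [ih]

theorem insertLetter_cons (m : ℕ) (F : List A → A) (φ : List A → X) (a : A) (l : List A) :
    insertLetter k m F φ (a :: l) = splitSum (fun u v => φ (F u :: v)) (a :: l) +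
      ε ^ (m + 1) • insertLetter k m F (fun t => φ (a :: t)) l := by
  rw [insertLetter, split3, splitSum_cons, insertLetter, split3, ← splitSum_smul (ε ^ (m + 1))]
  congr 1
  · simp
  · refine splitSum_congr fun x y _ => ?_
    rw [← splitSum_smul (ε ^ (m + 1))]
    refine splitSum_congr fun u v _ => ?_
    rw [smul_smul, ← pow_add, List.length_cons, List.cons_append, mul_add, mul_one, add_comm]

/-- As `w` is shorter than m, an insertion cannot lie entirely behind `c`: it takes place before `c`
or uses it. -/
theorem insertLetter_append_cons (hF : ∀ l : List A, l.length ≠ m → F l = 0)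
    (hφ : ∀ x v, φ (x ++ 0 :: v) = 0) (ζ : List A) (c : A) {w : List A} (hw : w.length < m) :
    insertLetter k m F φ (ζ ++ c :: w) = insertLetter k m F (fun t => φ (t ++ c :: w)) ζ +
      splitSum (fun p q => splitSum (fun x v => ε ^ ((m + 1) * x.length) •
        φ (x ++ F (v ++ c :: p) :: q)) ζ) w := by
  have h0 : splitSum (fun u v => splitSum (fun u' v' =>
      ε ^ ((m + 1) * (ζ ++ c :: u).length) • φ ((ζ ++ c :: u) ++ F u' :: v')) v) w = 0 := by
    rw [← splitSum_zero w]
    refine splitSum_congr fun u v huv => ?_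
    rw [← splitSum_zero v]
    refine splitSum_congr fun u' v' huv' => ?_
    have h1 := congrArg List.length huv
    have h2 := congrArg List.length huv'
    simp only [List.length_append] at h1 h2
    rw [hF u' (by omega), hφ, smul_zero]
  rw [insertLetter, split3, splitSum_append_cons, h0, add_zero, insertLetter, split3, ←
    splitSum_comm (fun x v p q => ε ^ ((m + 1) * x.length) • φ (x ++ F (v ++ c :: p) :: q)), ←
    splitSum_add]
  refine splitSum_congr fun x y _ => ?_
  rw [splitSum_append_cons]
  simp only [List.append_assoc, List.cons_append]

theorem splitSum_append_pair {G : List A → List A → X} {w : List A} (a b : A)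
    (h : ∀ p q, w.length < p.length → G p q = 0) :
    splitSum G (w ++ [a] ++ [b]) = splitSum (fun p q => G p (q ++ [a] ++ [b])) w := by
  rw [List.append_assoc, List.singleton_append, splitSum_append_cons, splitSum_cons, splitSum_nil, h
    _ _ (by simp), h _ _ (by simp), add_zero, add_zero]
  simp only [List.append_assoc, List.singleton_append]

/-- The block taken by F in front must contain `c`, because x is shorter than m, and cannot reach
`d`, because ζ has at least m letters. -/
theorem splitSum_block (hF : ∀ l : List A, l.length ≠ m → F l = 0) (hφ : ∀ v, φ (0 :: v) = 0)
    (x ζ y : List A) (c d : A) (hx : x.length < m) (hζ : m ≤ ζ.length) :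
    splitSum (fun u v => φ (F u :: v)) (x ++ c :: (ζ ++ d :: y)) =
      splitSum (fun u v => φ (F (x ++ c :: u) :: (v ++ d :: y))) ζ := by
  rw [splitSum_append_cons, splitSum_append_cons, splitSum_congr (G := fun _ _ => 0), splitSum_zero,
    zero_add, splitSum_congr (l := y) (G := fun _ _ => 0), splitSum_zero, add_zero]
  · intro p q _
    rw [hF _ (by simp only [List.length_append, List.length_cons]; omega), hφ]
  · intro p q h
    have := congrArg List.length h
    rw [List.length_append] at this
    rw [hF _ (by omega), hφ]

theorem ev_algCochain (g : ZA k A m) (u : List A) : ev (algCochain g).1 u = bword k [ev g.1 u] := by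
  rw [algCochain, ev_comp, bword, word_singleton]
  rfl

theorem bword_zero (x v : List A) : bword k (x ++ 0 :: v) = 0 := (LetterLinear.bword k).map_zero x v

theorem insertSum_algCochain (g : ZA k A m) (l : List A) :
    insertSum (algCochain g) (bword k l) = insertLetter k m (ev g.1) (bword k) l := by
  rw [insertSum_bword, insertLetter, split3]
  refine splitSum_congr fun x y _ => ?_
  rw [← splitSum_smul (ε ^ ((0 + m + 1) * x.length)), zero_add]
  refine splitSum_congr fun u v _ => ?_
  rw [ev_algCochain, ← bword_append, ← bword_append, List.append_assoc, List.singleton_append]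

theorem insertAt_zero_algCochain (g : ZA k A m) (l : List A) :
    insertAt 0 (algCochain g) (bword k l) = splitSum (fun u v => bword k (ev g.1 u :: v)) l := by
  rcases lt_or_ge l.length m with h | h
  · rw [insertAt_bword_of_lt _ _ (by omega), ← splitSum_zero l]
    refine splitSum_congr fun u v huv => ?_
    have := congrArg List.length huv
    rw [List.length_append] at this
    rw [ev_of_ne _ (by omega), ← List.nil_append (0 :: v), bword_zero]
  · obtain ⟨u, v, rfl, hu⟩ : ∃ u v, l = u ++ v ∧ u.length = m :=
      ⟨l.take m, l.drop m, (List.take_append_drop m l).symm, by simp [h]⟩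
    have := insertAt_bword (j := 0) (algCochain g) [] u v rfl hu
    rw [List.nil_append, bword_nil, one_mul, ev_algCochain, ← bword_append] at this
    rw [this, splitSum_eq_of_length _ _ _ fun p q _ hp => ?_]
    · rfl
    · rw [ev_of_ne _ (by omega), ← List.nil_append (0 :: q), bword_zero]

/-- The value of the bracket with `κ(z)` for a cycle `z`, on the letters of `w` and `b`. -/
def bracketMap (e f : ι → A) (r : ℕ) (g : ZA k A m) (w : List A) (b : A) :
    TensorAlgebra k A →ₗ[k] Bar k A :=
  (barD ∘ₗ mulR (bword k [1]) ∘ₗ mulR (bword k [b])) ∘ₗ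
    (insertSum (algCochain g) ∘ₗ mulR (bword k w) +
      insertAt 0 (algCochain g) ∘ₗ splitSum (fun x y => ε ^ (r * x.length) •
        (mulR (bword k y) ∘ₗ mulL (bword k x))) w -
      insertAt 0 (algCochain g) ∘ₗ mulR (bword k w)) ∘ₗ casimirMap k e f

/-- This holds on every word, so the comparison with the homotopy can be made word by word. The
cycle condition enters only in `ev_bracket_kappaCochain`. -/
theorem bracketMap_word (g : ZA k A m) {w : List A} (hw : w.length + 1 = m) (hr : m ≤ r) (b z₀ : A)
    {ζ : List A} (hζ : ζ.length = r) :
    bracketMap e f r g w b (word k (z₀ :: ζ)) =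
      bracketList k m e f (ev g.1) (fun l => barD (bword k l)) z₀ ζ (w ++ [b] ++ [1]) := by
  have hF := (listCocycle_ev g).length
  set F := ev g.1 with hFdef
  -- The insertion in front is subtracted here; it is counted in `h2`, with an empty prefix.
  have h1 : ∀ i, insertSum (algCochain g) (bword k ((e i * z₀) :: ζ ++ [f i]) * bword k w) -
      insertAt 0 (algCochain g) (bword k ((e i * z₀) :: ζ ++ [f i]) * bword k w) =
      ε ^ (m + 1) • (insertLetter k m F (fun t => bword k ((e i * z₀) :: (t ++ f i :: w))) ζ +
        splitSum (fun p q => splitSum (fun x v => ε ^ ((m + 1) * x.length) •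
          bword k ((e i * z₀) :: (x ++ F (v ++ f i :: p) :: q))) ζ) w) := by
    intro i
    rw [← bword_append, insertSum_algCochain, insertAt_zero_algCochain, List.append_assoc,
      List.cons_append, List.singleton_append, insertLetter_cons, add_sub_cancel_left,
      insertLetter_append_cons hF (fun x v => bword_zero (_ :: x) v) _ _ (by omega)]
  have h2 : ∀ i, insertAt 0 (algCochain g) (splitSum (fun x y => ε ^ (r * x.length) •
        (mulR (bword k y) ∘ₗ mulL (bword k x))) w (bword k ((e i * z₀) :: ζ ++ [f i]))) =
      splitSum (fun p q => splitSum (fun x u => ε ^ (p.length * (x.length + u.length)) •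
        bword k (F (p ++ (e i * z₀) :: x) :: (u ++ f i :: q))) ζ) w := by
    intro i
    have e1 := linear_splitSum (LinearMap.applyₗ (R := k) (M₂ := Bar k A)
      (bword k ((e i * z₀) :: ζ ++ [f i]))) (fun x y => ε ^ (r * x.length) •
        (mulR (bword k y) ∘ₗ mulL (bword k x))) w
    rw [LinearMap.applyₗ_apply_apply] at e1
    rw [e1, linear_splitSum]
    refine splitSum_congr fun p q hpq => ?_
    have hp := congrArg List.length hpq
    rw [List.length_append] at hp
    rw [LinearMap.applyₗ_apply_apply, LinearMap.smul_apply, LinearMap.comp_apply, mulL_apply,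
      mulR_apply, ← bword_append, ← bword_append, map_smul, insertAt_zero_algCochain,
      List.append_assoc, List.append_assoc, List.cons_append, List.singleton_append, splitSum_block
      hF (fun v => bword_zero [] v) _ _ _ _ _ (by omega) (by omega), ← splitSum_smul (ε ^ (r *
      p.length))]
    refine splitSum_congr fun x u hxu => ?_
    rw [← hζ, ← hxu, List.length_append, mul_comm]
  have h3 : ∀ t : List A, barD (bword k t * bword k [b] * bword k [1]) =
      barD (bword k (t ++ [b] ++ [1])) := fun t => by rw [bword_append, bword_append]
  have hD : ∀ (x v : List A), barD (bword k (x ++ 0 :: v)) = 0 := fun x v => by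
    rw [bword_zero, map_zero]
  let D : Bar k A →ₗ[k] Bar k A := barD ∘ₗ mulR (bword k [1]) ∘ₗ mulR (bword k [b])
  have hDw : ∀ t : List A, D (bword k t) = barD (bword k (t ++ [b] ++ [1])) := h3
  have key : bracketMap e f r g w b (word k (z₀ :: ζ)) = ∑ i, D (splitSum (fun p q =>
      splitSum (fun x u => ε ^ (p.length * (x.length + u.length)) •
        bword k (F (p ++ (e i * z₀) :: x) :: (u ++ f i :: q))) ζ) w +
      ε ^ (m + 1) • (insertLetter k m F (fun t => bword k ((e i * z₀) :: (t ++ f i :: w))) ζ +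
        splitSum (fun p q => splitSum (fun x v => ε ^ ((m + 1) * x.length) •
          bword k ((e i * z₀) :: (x ++ F (v ++ f i :: p) :: q))) ζ) w)) := by
    change D ((insertSum (algCochain g) ∘ₗ mulR (bword k w) +
      insertAt 0 (algCochain g) ∘ₗ splitSum (fun x y => ε ^ (r * x.length) •
        (mulR (bword k y) ∘ₗ mulL (bword k x))) w -
      insertAt 0 (algCochain g) ∘ₗ mulR (bword k w)) (casimirMap k e f _)) = _
    rw [casimirMap_word, map_sum, map_sum]
    refine Finset.sum_congr rfl fun i _ => ?_
    rw [← h1, ← h2]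
    congr 1
    rw [LinearMap.sub_apply, LinearMap.add_apply, LinearMap.comp_apply, LinearMap.comp_apply,
      LinearMap.comp_apply, mulR_apply]
    abel
  rw [key, bracketList, splitSum_append_pair, splitSum_append_pair]
  · simp only [map_add, map_smul, linear_splitSum, linear_insertLetter, hDw, smul_add,
      Finset.sum_add_distrib, ← Finset.smul_sum, ← splitSum_finsum]
    rw [← add_assoc]
    congr 1
    · congr 1
      · simp only [List.append_assoc, List.cons_append]
      · congr 1
        simp only [insertLetter, split3, Finset.smul_sum, splitSum_finsum, List.append_assoc,
          List.cons_append]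
    · rw [← splitSum_smul (ε ^ (m + 1))]
      refine splitSum_congr fun p q _ => ?_
      rw [← splitSum_smul (ε ^ (m + 1))]
      refine splitSum_congr fun x v _ => ?_
      rw [smul_smul, ← pow_add]
      by_cases hl : v.length + p.length + 1 = m
      · simp only [List.append_assoc, List.cons_append]
        congr 1
        refine neg_one_pow_congr ?_
        simp only [← hl, Nat.even_add, Nat.even_mul, Nat.even_add_one]
        grind
      · rw [Finset.sum_eq_zero fun i _ => ?_, Finset.sum_eq_zero fun i _ => ?_, smul_zero, smul_zero]
        · rw [hF _ (by simp only [List.length_append, List.length_cons]; omega), ← List.cons_append,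
            hD]
        · rw [hF _ (by simp only [List.length_append, List.length_cons]; omega)]
          simp only [List.append_assoc, List.cons_append]
          exact hD (_ :: x) _
  · intro p q hp
    rw [← splitSum_zero ζ]
    refine splitSum_congr fun x v _ => ?_
    rw [Finset.sum_eq_zero fun i _ => ?_, smul_zero]
    rw [hF _ (by simp only [List.length_append, List.length_cons]; omega), ← List.cons_append, hD]
  · intro p q hp
    rw [← splitSum_zero ζ]
    refine splitSum_congr fun x u _ => ?_
    rw [Finset.sum_eq_zero fun i _ => ?_, smul_zero]
    rw [hF _ (by simp only [List.length_append, List.length_cons]; omega)]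
    exact hD [] _

theorem ev_kappaMap_nil (h : IsCasimir form e f) (hz : z ∈ cycles k A (r + 1)) :
    ev (kappaMap k e f 0 z) [] = ε ^ r • casimirMap k e f z := by
  have h0 : boundary k A z = 0 := hz.2
  have h1 : barRight (1 : A) (casimirMap k e f z) = casimirMap k e f z :=
    barRight_unit (casimirMap_mem hz.1)
  rw [ev_kappaMap (u := []) (m := 0) z rfl, bword_nil, mul_one, dOne_apply, barD_mul_letter 1
    (casimirMap_mem hz.1), barD_casimirMap h hz.1, h0, map_zero, zero_mul, zero_add, h1]
  congr 1
  exact neg_one_pow_eq ⟨r + 2, by ring⟩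

/-- κ in degree 1 is θ of κ in degree 0, and on a cycle the latter is ± its Casimir image, a cochain
without arguments; inserting it is multiplication. Insertions of g directly into `w` vanish, because
`w` is shorter than m. -/
theorem ev_bracket_kappaCochain (h : IsCasimir form e f) (g : ZA k A m) (hp : r + 1 + 1 + 1 = p)
    (hz : z ∈ cycles k A (r + 1)) {w : List A} (hw : w.length + 1 = m) (b : A) :
    ev (bracket (algCochain g) (kappaCochain e f (m := 1) hz.1 hp) m) (w ++ [b]) =
      bracketMap e f (r + 1) g w b z := by
  subst hp hw
  set g' := kappaCochain e f (m := 0) hz.1 rfl with hg'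
  have hθ : kappaCochain e f (m := 1) hz.1 rfl = thetaCochain g' :=
    Subtype.ext (theta_kappaCochain hz.1 rfl).symm
  have e0 : ev g'.1 [] = ε ^ r • casimirMap k e f z := ev_kappaMap_nil h hz
  have hmem := bword_mem_barLength (k := k) w
  have h1 : insertAt 0 (algCochain g) (bword k w) = 0 := insertAt_zero_of_lt _ (by omega) hmem
  have h2 : insertSum (algCochain g) (bword k w) = 0 := insertSum_of_lt _ (by omega) hmem
  have h3 : insertAt 0 g' (bword k w) = ε ^ r • (casimirMap k e f z * bword k w) := by
    have := insertAt_bword (j := 0) g' [] [] w rfl rfl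
    rwa [List.nil_append, List.nil_append, bword_nil, one_mul, e0, bar_smul_mul] at this
  have h4 : insertSum g' (bword k w) = ε ^ r • splitSum (fun x y =>
      ε ^ ((r + 1) * x.length) • (mulR (bword k y) ∘ₗ mulL (bword k x))) w
        (casimirMap k e f z) := by
    have e1 := linear_splitSum (LinearMap.applyₗ (R := k) (M₂ := Bar k A) (casimirMap k e f z))
      (fun x y => ε ^ ((r + 1) * x.length) • (mulR (bword k y) ∘ₗ mulL (bword k x))) w
    rw [LinearMap.applyₗ_apply_apply] at e1
    rw [e1, insertSum_bword, ← splitSum_smul (ε ^ r)]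
    refine splitSum_congr fun x y _ => ?_
    have e2 := splitSum_eq_of_length (fun u v => bword k x * ev g'.1 u * bword k v) [] y
      fun p q _ hp => by rw [ev_of_ne _ hp, mul_zero, zero_mul]
    rw [List.nil_append] at e2
    rw [e2, e0, LinearMap.applyₗ_apply_apply, LinearMap.smul_apply, LinearMap.comp_apply,
      mulL_apply, mulR_apply, bar_mul_smul, bar_smul_mul, smul_comm]
    congr 2
    exact neg_one_pow_eq ⟨(r + 2) * x.length, by ring⟩
  rw [hθ, ev_bracket_theta (algCochain g) g' (by omega) rfl w rfl b, headBracket_apply,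
    headCircle_apply, headCircle_apply, h1, h2, h3, h4]
  simp only [map_zero, map_smul, add_zero, sub_zero, smul_zero, ← smul_add, ← smul_sub,
    bar_smul_mul, smul_smul, ← pow_add]
  rw [Even.neg_one_pow ⟨r + 1, by ring⟩, one_smul]
  rfl

/-! ### The bracket under `κ` -/

theorem capLast_mem_chains (hF : LetterLinear k F) (h : ∀ l : List A, l.length ≠ m → F l = 0)
    {x : TensorAlgebra k A} (hx : x ∈ chains k A (r + m)) : capLast F hF x ∈ chains k A r := by
  refine chains_le (S := (chains k A r).comap (capLast F hF)) (fun a l hl => ?_) hx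
  rw [Submodule.mem_comap, capLast_word]
  refine splitSum_mem _ fun p q hpq => ?_
  have hl' := congrArg List.length hpq
  rw [List.length_append] at hl'
  by_cases hq : q.length = m
  · exact word_mem_chains (by rw [List.length_cons]; omega)
  · rw [h q hq, zero_mul, ← List.nil_append (0 :: p), (LetterLinear.word k).map_zero]
    exact zero_mem _

theorem capHomotopy_mem_chains (hF : LetterLinear k F) (h : ∀ l : List A, l.length ≠ m → F l = 0)
    {x : TensorAlgebra k A} (hx : x ∈ chains k A (r + m)) :
    capHomotopy m F hF x ∈ chains k A (r + 1) := by
  refine chains_le (S := (chains k A (r + 1)).comap (capHomotopy m F hF)) (fun a l hl => ?_) hx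
  rw [Submodule.mem_comap, capHomotopy_word]
  refine insertLetter_mem _ fun x u v huv => ?_
  have hl' := congrArg List.length huv
  rw [List.length_append, List.length_append] at hl'
  by_cases hu : u.length = m
  · exact word_mem_chains (by simp only [List.length_cons, List.length_append]; omega)
  · rw [h u hu, ← List.cons_append, (LetterLinear.word k).map_zero]
    exact zero_mem _

theorem wordMap_casimirList {u : List A} (hu : u.length = m) (hz : z ∈ chains k A r) :
    wordMap _ ((LetterLinear.barD_bword k A).casimirList (e := e) (f := f) (u ++ [1])) z =
      ev (kappaMap k e f m z) u := by
  rw [ev_kappaMap z hu]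
  refine eqOn_chains (ψ := dOne ∘ₗ mulR (bword k u) ∘ₗ casimirMap k e f) (fun a l hl => ?_) hz
  rw [wordMap_word, casimirList_cons, LinearMap.comp_apply, LinearMap.comp_apply, casimirMap_word,
    map_sum, map_sum]
  refine Finset.sum_congr rfl fun i _ => ?_
  rw [mulR_apply, dOne_apply, ← bword_append, ← bword_append]
  simp only [List.append_assoc, List.cons_append, List.nil_append]

/-- The comparison on the level of cocycles, with B and Δ paired with the cap product that takes the
last letters, as the homotopy produces it. -/
theorem kappaMap_sub_bracket_mem [FiniteDimensional k A] (hf : IsSymmetrizing form)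
    (h : IsCasimir form e f) (g : ZA k A (n + 1)) (hr : n + 1 ≤ r + 1) (hp : r + 1 + 1 + 1 = p)
    (hz : z ∈ cycles k A (r + 1)) :
    kappaMap k e f (n + 1) (cap g.1 (connesB k A z) +
      ε ^ ((n + 1) * (r + 1) + 1) • connesB k A (capLast (ev g.1) (LetterLinear.ev _) z) -
      ε ^ (n * (r + 1)) • capLast (ev (bvDelta hf g.1)) (LetterLinear.ev _) z) -
      bracket (algCochain g) (kappaCochain e f (m := 1) hz.1 hp) (n + 1) ∈ BOmega k A (n + 1) p := by
  have hF := listCocycle_ev g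
  refine ⟨ε ^ (r + 1) • homotopyCochain k n form e f hF.linear z,
    Submodule.smul_mem _ _ (homotopyCochain_mem hF hp hz.1), ?_⟩
  refine ext_ev fun u hu => ?_
  obtain ⟨w, b, rfl⟩ : ∃ w b, u = w ++ [b] := by
    rcases List.eq_nil_or_concat' u with h | ⟨s, c, h⟩
    · simp [h] at hu
    · exact ⟨s, c, h⟩
  have hw : w.length + 1 = n + 1 := by simpa using hu
  have h0 : boundary k A z = 0 := hz.2
  obtain ⟨s, rfl⟩ : ∃ s, r = s + n := ⟨r - n, by omega⟩
  have hz1 : z ∈ chains k A (s + n + 1) := hz.1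
  have hB := connesB_mem_chains hz1
  rw [map_smul, ev_smul, delta_homotopyCochain hf hF h hr hz.1 hu (fun z₀ ζ hζ => bracketMap_word g
    hw hr b z₀ hζ), h0, map_zero, zero_add, ev_sub, ev_bracket_kappaCochain h g hp hz hw b,
    wordMap_casimirList (r := s + 1) hu]
  refine sub_mem (add_mem ?_ (Submodule.smul_mem _ _ (connesB_mem_chains ?_)))
    (Submodule.smul_mem _ _ ?_)
  · exact cap_mem_chains g.1 ((show s + n + 1 + 1 = s + 1 + (n + 1) by ring) ▸ hB)
  · exact capLast_mem_chains (m := n + 1) _ hF.length hz.1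
  · exact capLast_mem_chains (m := n) _ (fun l hl => ev_of_ne _ hl)
      ((show s + n + 1 = s + 1 + n by ring) ▸ hz1)

/-- The cap products with the last letters are traded for the usual ones by `boundary_capHomotopy`.
The difference is a boundary, and κ sends it to a coboundary. -/
theorem kappaMap_bracket_mem [FiniteDimensional k A] (hf : IsSymmetrizing form)
    (h : IsCasimir form e f) (g : ZA k A (n + 1)) (hg : bvDelta hf g.1 ∈ ZA k A n)
    (hr : n + 1 ≤ r + 1) (hp : r + 1 + 1 + 1 = p) (hz : z ∈ cycles k A (r + 1)) :
    kappaMap k e f (n + 1) (ε ^ (n + 1) • cap (bvDelta hf g.1) z + cap g.1 (connesB k A z) +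
      ε ^ (n + 1 + 1) • connesB k A (cap g.1 z)) -
      bracket (algCochain g) (kappaCochain e f (m := 1) hz.1 hp) (n + 1) ∈ BOmega k A (n + 1) p := by
  have hF := listCocycle_ev g
  have h0 : boundary k A z = 0 := hz.2
  obtain ⟨s, rfl⟩ : ∃ s, r = s + n := ⟨r - n, by omega⟩
  have e1 := boundary_capHomotopy g hz.1
  have e2 := boundary_capHomotopy ⟨_, hg⟩ hz.1
  rw [h0, map_zero, smul_zero, add_zero] at e1 e2
  set D₁ := capHomotopy (n + 1) (ev g.1) (LetterLinear.ev _) z with hD₁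
  set D₂ := capHomotopy n (ev (bvDelta hf g.1)) (LetterLinear.ev _) z with hD₂
  have hz1 : z ∈ chains k A (s + n + 1) := hz.1
  have m1 : connesB k A D₁ ∈ chains k A (s + 1 + 1) := connesB_mem_chains
    (capHomotopy_mem_chains (m := n + 1) _ hF.length hz.1)
  have m2 : D₂ ∈ chains k A (s + 1 + 1) := capHomotopy_mem_chains (m := n) _
    (fun l hl => ev_of_ne _ hl) ((show s + n + 1 = s + 1 + n by ring) ▸ hz1)
  have key := kappaMap_sub_bracket_mem hf h g hr hp hz
  set y := ε ^ (n + 1 + 1) • connesB k A D₁ + ε ^ n • D₂ with hy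
  have hb := kappaMap_mem_BOmega (e := e) (f := f) h (m := n) (r := s + 1) (p := p) (by omega)
    (z := boundary k A y)
    ⟨y, add_mem (Submodule.smul_mem _ _ m1) (Submodule.smul_mem _ _ m2), rfl⟩
  have e3 : capLast (ev g.1) (LetterLinear.ev _) z =
      ε ^ ((n + 1) * (s + n + 1 + 1)) • (cap g.1 z - boundary k A D₁) := by
    rw [e1, sub_sub_cancel, smul_smul, ← pow_add, Even.neg_one_pow ⟨_, rfl⟩, one_smul]
  have e4 : capLast (ev (bvDelta hf g.1)) (LetterLinear.ev _) z =
      ε ^ (n * (s + n + 1 + 1)) • (cap (bvDelta hf g.1) z - boundary k A D₂) := by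
    rw [e2, sub_sub_cancel, smul_smul, ← pow_add, Even.neg_one_pow ⟨_, rfl⟩, one_smul]
  have e5 : cap g.1 (connesB k A z) + ε ^ ((n + 1) * (s + n + 1) + 1) •
      connesB k A (capLast (ev g.1) (LetterLinear.ev _) z) - ε ^ (n * (s + n + 1)) •
        capLast (ev (bvDelta hf g.1)) (LetterLinear.ev _) z =
      ε ^ (n + 1) • cap (bvDelta hf g.1) z + cap g.1 (connesB k A z) +
        ε ^ (n + 1 + 1) • connesB k A (cap g.1 z) + boundary k A y := by
    have s1 : ε ^ ((n + 1) * (s + n + 1) + 1 + (n + 1) * (s + n + 1 + 1)) =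
        ε ^ (n + 1 + 1) := neg_one_pow_eq ⟨(n + 1) * (s + n + 1) + (n + 2), by ring⟩
    have s2 : ε ^ (n * (s + n + 1) + n * (s + n + 1 + 1)) = ε ^ n :=
      neg_one_pow_eq ⟨n * (s + n + 1) + n, by ring⟩
    rw [e3, e4, map_smul, smul_smul, smul_smul, ← pow_add, ← pow_add, s1, s2, map_sub, hy, map_add,
      map_smul, map_smul, boundary_connesB]
    simp only [pow_succ]
    module
  rw [e5, kappaMap_add] at key
  have := sub_mem key hb
  rwa [add_sub_right_comm, add_sub_cancel_right] at this

/-! ### The bracket on cohomology -/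

theorem insertAt_zero_add (g g' : CΩ q l) : insertAt 0 (g + g') = insertAt 0 g + insertAt 0 g' := by
  refine ext_bword fun t => ?_
  rw [LinearMap.add_apply]
  rcases lt_or_ge t.length l with h | h
  · rw [insertAt_bword_of_lt _ _ (by omega), insertAt_bword_of_lt _ _ (by omega),
      insertAt_bword_of_lt _ _ (by omega), add_zero]
  · have key := fun g : CΩ q l => insertAt_bword (j := 0) g [] (t.take l) (t.drop l) rfl
      (show _ = l by simp [h])
    simp only [List.nil_append, List.take_append_drop] at key
    rw [key, key, key, Submodule.coe_add, ev_add, mul_add, add_mul]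

theorem insertSum_add (g g' : CΩ q l) : insertSum (g + g') = insertSum g + insertSum g' := by
  refine ext_bword fun t => ?_
  simp only [LinearMap.add_apply, insertSum_bword, Submodule.coe_add, ev_add, mul_add, add_mul,
    splitSum_add, smul_add]

theorem bracket_add (f : CΩ p m) (g g' : CΩ q l) (hN : N + 1 = m + l) :
    bracket f (g + g') N = bracket f g N + bracket f g' N := by
  refine ext_ev fun u hu => ?_
  rw [ev_add, ev_bracket f _ hN u hu, ev_bracket f _ hN u hu, ev_bracket f _ hN u hu]
  simp only [headBracket_apply, headCircle_apply, insertAt_zero_add, insertSum_add,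
    LinearMap.add_apply, map_add, map_sub, map_smul]
  module

theorem bracket_zero (f : CΩ p m) (hN : N + 1 = m + l) : bracket f (0 : CΩ q l) N = 0 := by
  simpa using bracket_add f (0 : CΩ q l) 0 hN

theorem delta_algCochain (g : ZA k A m) : delta barLeft barRight m (algCochain g).1 = 0 := by
  refine ext_ev fun u hu => ?_
  obtain ⟨a, t, rfl⟩ := List.exists_cons_of_length_eq_add_one hu
  have hb : ∀ x : A, bword k [x] = ((toBar k A).toLinearMap ∘ₗ TensorAlgebra.ι k) x := fun x => by
    rw [bword, word_singleton]
    rfl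
  have h1 := congrArg ((toBar k A).toLinearMap ∘ₗ TensorAlgebra.ι k)
    ((listCocycle_ev g).cocycle (a :: t))
  rw [onHead_cons, map_add, map_sub, map_smul, linear_mergeSum, linear_onLast, map_zero] at h1
  simp only [← hb] at h1
  have e2 : ∀ x c : A, barRight c (bword k [x]) = bword k [x * c] := fun x c =>
    barRight_bword c x []
  rw [ev_delta, ev_zero, ← h1, ev_algCochain, barLeft_bword]
  simp only [e2, ev_algCochain]
  congr 2
  exact mergeSum_congr fun _ _ => ev_algCochain _ _

theorem bracket_mem_ZOmega (f : ZA k A m) (g : CΩ q l) (hg : delta barLeft barRight l g.1 = 0)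
    (hm : 1 ≤ m) (hl : 1 ≤ l) (hq : 1 ≤ q) (hN : N + 1 = m + l) :
    bracket (algCochain f) g N ∈ ZOmega k A N q := by
  refine ⟨bracket_mem _ g hm hl hq hN, ?_⟩
  change delta barLeft barRight N _ = 0
  rw [delta_bracket _ (delta_algCochain f) hm hl g hN, show deltaCochain g = 0 from Subtype.ext hg,
    bracket_zero _ (by omega)]

/-- The primitive of a coboundary of degree 1 has degree 0, which `delta_bracket` excludes. One step
along θ raises the degree, and the injectivity of θ brings the result back. -/
theorem bracket_mem_BOmega (h : IsCasimir form e f) (g : ZA k A m) (w : CΩ q l)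
    (hz : delta barLeft barRight l w.1 = 0) (hw : w.1 ∈ BOmega k A l q) (hm : 1 ≤ m) (hl : 1 ≤ l)
    (hq : 1 ≤ q) (hN : N + 1 = m + l) : bracket (algCochain g) w N ∈ BOmega k A N q := by
  obtain ⟨l, rfl⟩ : ∃ c, l = c + 1 := ⟨l - 1, by omega⟩
  obtain ⟨N, rfl⟩ : ∃ c, N = c + 1 := ⟨N - 1, by omega⟩
  obtain ⟨w', hw', hww'⟩ := hw
  obtain rfl : w = deltaCochain ⟨w', hw'⟩ := Subtype.ext hww'.symm
  set v : CΩ q l := ⟨w', hw'⟩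
  refine theta_injective h ⟨_, bracket_mem_ZOmega g _ hz hm hl hq hN⟩ ?_
  have e1 := bracket_theta (algCochain g) (deltaCochain v) hm hl hq hN
  have e2 : thetaCochain (deltaCochain v) = deltaCochain (thetaCochain v) :=
    Subtype.ext (delta_theta v).symm
  rw [e2, ← delta_bracket _ (delta_algCochain g) hm (by omega) _ (by omega)] at e1
  refine ⟨bracket (algCochain g) (thetaCochain v) (N + 1),
    bracket_mem _ _ hm (by omega) (by omega) (by omega), e1⟩

theorem bracket_sub_mem_BOmega (h : IsCasimir form e f) (g : ZA k A m) {w w' : CΩ q l}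
    (hw : w.1 ∈ ZOmega k A l q) (hw' : w'.1 ∈ ZOmega k A l q) (hww' : w.1 - w'.1 ∈ BOmega k A l q)
    (hm : 1 ≤ m) (hl : 1 ≤ l) (hq : 1 ≤ q) (hN : N + 1 = m + l) :
    bracket (algCochain g) w N - bracket (algCochain g) w' N ∈ BOmega k A N q := by
  have h1 := bracket_add (algCochain g) (w - w') w' hN
  rw [show w - w' + w' = w from Subtype.ext (sub_add_cancel w.1 w'.1)] at h1
  rw [h1, add_sub_cancel_right]
  exact bracket_mem_BOmega h g (w - w') (sub_mem hw hw').2 hww' hm hl hq hN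

/-- Knowledge of the first stage suffices: a cocycle at the next stage is cohomologous to θ(w'), and
the bracket commutes with θ. -/
theorem toSg_bracket (h : IsCasimir form e f) (hm : 1 ≤ m) (g : ZA k A m) {s : ℕ} (hs : 1 ≤ s)
    {i j : ℤ} (hi : ((1 : ℕ) : ℤ) - s = i) (hj : (m : ℤ) - s = j) (Φ : HHsg k A i →ₗ[k] HHsg k A j)
    (hΦ : ∀ (w : ZOmega k A 1 s) (hw : bracket (algCochain g) (omegaCochain w) m ∈ ZOmega k A m s), Φ (toSg 1 s i Nat.one_pos hi (Subquotient.mk _ w)) = toSg m s j hm hj (Subquotient.mk _ ⟨_, hw⟩))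
    (l p : ℕ) (hl : ((l + 1 : ℕ) : ℤ) - p = i) (w : ZOmega k A (l + 1) p) :
    ∃ hw : bracket (algCochain g) (omegaCochain w) (m + l) ∈ ZOmega k A (m + l) p,
      Φ (toSg (l + 1) p i l.succ_pos hl (Subquotient.mk _ w)) =
        toSg (m + l) p j (by omega) (by push_cast at *; omega) (Subquotient.mk _ ⟨_, hw⟩) := by
  induction l generalizing p with
  | zero =>
    obtain rfl : p = s := by push_cast at *; omega
    exact ⟨bracket_mem_ZOmega g _ w.2.2 hm le_rfl hs (by omega), hΦ w _⟩
  | succ l ih =>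
    obtain ⟨p, rfl⟩ : ∃ c, p = c + 1 := ⟨p - 1, by push_cast at *; omega⟩
    have hp : 1 ≤ p := by push_cast at *; omega
    obtain ⟨w', hw'⟩ := theta_surjective h w
    have hl' : ((l + 1 : ℕ) : ℤ) - p = i := by push_cast at *; omega
    obtain ⟨h1, h2⟩ := ih p hl' w'
    have hb := bracket_mem_ZOmega g (omegaCochain w) w.2.2 hm (by omega) (by omega)
      (show m + l + 1 + 1 = m + (l + 1 + 1) by ring)
    refine ⟨hb, ?_⟩
    rw [(Subquotient.mk_eq_mk w ⟨_, theta_mem_ZOmega w'⟩).2 hw', ← toSg_theta l.succ_pos hl', h2,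
      toSg_theta]
    congr 1
    refine (Subquotient.mk_eq_mk _ _).2 ?_
    have e1 := bracket_theta (algCochain g) (omegaCochain w') hm (by omega) hp
      (show m + l + 1 = m + (l + 1) by ring)
    have e2 := bracket_sub_mem_BOmega h g (w := thetaCochain (omegaCochain w')) (w' := omegaCochain w)
      (theta_mem_ZOmega w') w.2 (by rw [← neg_sub]; exact neg_mem hw') hm (by omega) (by omega)
      (show m + l + 1 + 1 = m + (l + 1 + 1) by ring)
    rw [e1] at e2
    exact e2

/-! ### The induced bracket -/

section InducedBracket

variable [FiniteDimensional k A]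

-- Since `br` is given through κ by operations on classes, it is well defined in both arguments from
-- the outset. It remains to recognize it on cocycles: each w is cohomologous to some κ(z), and
-- `kappaMap_bracket_mem` applies.
set_option maxHeartbeats 2000000 in
theorem induces_bracket {hf : IsSymmetrizing form} (hc : casimir hf = ∑ i, e i ⊗ₜ[k] f i)
    (h : IsCasimir form e f) (hm : m ≤ r) {Δ : HH k A (m + 1) →ₗ[k] HH k A m}
    {B₁ : HHhom k A (r + 1) →ₗ[k] HHhom k A (r + 1 + 1)} {B₂ : HHhom k A b →ₗ[k] HHhom k A c}
    {cap₁ : HH k A m →ₗ[k] HHhom k A (r + 1) →ₗ[k] HHhom k A c}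
    {cap₂ : HH k A (m + 1) →ₗ[k] HHhom k A (r + 1 + 1) →ₗ[k] HHhom k A c}
    {cap₃ : HH k A (m + 1) →ₗ[k] HHhom k A (r + 1) →ₗ[k] HHhom k A b}
    {κ₁ : HHhom k A (r + 1) ≃ₗ[k] HHOmega k A 1 (r + 1 + 1 + 1)}
    {κ₂ : HHhom k A c ≃ₗ[k] HHOmega k A (m + 1) (r + 1 + 1 + 1)}
    {br : HH k A (m + 1) →ₗ[k] HHOmega k A 1 (r + 1 + 1 + 1) →ₗ[k] HHOmega k A (m + 1) (r + 1 + 1 + 1)}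
    (hΔ : Induces (fun g => bvDelta hf g.1) Δ) (hB₁ : Induces (fun z => connesB k A z.1) B₁)
    (hB₂ : Induces (fun z => connesB k A z.1) B₂) (hcap₁ : Induces₂ (fun g z => cap g.1 z.1) cap₁)
    (hcap₂ : Induces₂ (fun g z => cap g.1 z.1) cap₂)
    (hcap₃ : Induces₂ (fun g z => cap g.1 z.1) cap₃)
    (hκ₁ : Induces (fun z => kappa hf 1 z.1) κ₁.toLinearMap)
    (hκ₂ : Induces (fun z => kappa hf (m + 1) z.1) κ₂.toLinearMap)
    (hbr : ∀ g α, br g (κ₁ α) = κ₂ (ε ^ (m + 1) • cap₁ (Δ g) α + cap₂ g (B₁ α) + ε ^ (m + 1 + 1) • B₂ (cap₃ g α))) :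
    Induces₂ (fun g w => bracket (algCochain g) (omegaCochain w) (m + 1)) br := by
  intro g w
  have hw := bracket_mem_ZOmega g (omegaCochain w) w.2.2 (Nat.succ_pos m) le_rfl (Nat.succ_pos _)
    (N := m + 1) rfl
  refine ⟨hw, ?_⟩
  obtain ⟨α, hα⟩ := κ₁.surjective (Subquotient.mk _ w)
  obtain ⟨z, rfl⟩ := α.exists_mk
  obtain ⟨z1, z2⟩ := hκ₁ z
  have z3 := (Subquotient.mk_eq_mk _ _).1 (z2.symm.trans hα)
  obtain ⟨Δ1, Δ2⟩ := hΔ g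
  obtain ⟨b1, b2⟩ := hB₁ z
  obtain ⟨c1, c2⟩ := hcap₁ ⟨_, Δ1⟩ z
  obtain ⟨d1, d2⟩ := hcap₂ g ⟨_, b1⟩
  obtain ⟨e1, e2⟩ := hcap₃ g z
  obtain ⟨f1, f2⟩ := hB₂ ⟨_, e1⟩
  rw [← hα, hbr, Δ2, b2, c2, d2, e2, f2, ← map_smul, ← map_smul, ← map_add, ← map_add]
  obtain ⟨g1, g2⟩ := hκ₂ (ε ^ (m + 1) • ⟨_, c1⟩ + ⟨_, d1⟩ + ε ^ (m + 1 + 1) • ⟨_, f1⟩)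
  refine g2.trans ((Subquotient.mk_eq_mk _ _).2 ?_)
  have k1 := kappaMap_bracket_mem hf h g Δ1 (Nat.succ_le_succ hm) rfl z.2
  rw [← kappa_eq hc] at k1
  have e3 : (kappaCochain e f (m := 1) z.2.1 rfl).1 = kappa hf 1 z.1 := (kappa_eq hc 1 z.1).symm
  have k2 := bracket_sub_mem_BOmega h g (N := m + 1) (w := kappaCochain e f (m := 1) z.2.1 rfl)
    (w' := omegaCochain w) (by rw [e3]; exact z1) w.2 (by rw [e3]; exact z3) (Nat.succ_pos m) le_rfl
    (Nat.succ_pos _) rfl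
  have := add_mem k1 k2
  rw [sub_add_sub_cancel] at this
  exact this

end InducedBracket

end SingHoch

end

open SingHoch
open scoped TensorProduct DirectSum
set_option maxHeartbeats 2000000 in
theorem proposition6 {k A : Type*} [Field k] [Ring A] [Algebra k A] [FiniteDimensional k A]
    (form : LinearMap.BilinForm k A) (hf : IsSymmetrizing form)
    (m n : ℕ) (hm : 1 ≤ m) (hn : 2 ≤ n) (hmn : m + 1 ≤ n) :
    ∃ (Δ : HH k A m →ₗ[k] HH k A (m - 1))
      (B₁ : HHhom k A (n - 1) →ₗ[k] HHhom k A n)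
      (B₂ : HHhom k A (n - 1 - m) →ₗ[k] HHhom k A (n - m))
      (cap₁ : HH k A (m - 1) →ₗ[k] HHhom k A (n - 1) →ₗ[k] HHhom k A (n - m))
      (cap₂ : HH k A m →ₗ[k] HHhom k A n →ₗ[k] HHhom k A (n - m))
      (cap₃ : HH k A m →ₗ[k] HHhom k A (n - 1) →ₗ[k] HHhom k A (n - 1 - m))
      (κ₁ : HHhom k A (n - 1) ≃ₗ[k] HHOmega k A 1 (n + 1))
      (κ₂ : HHhom k A (n - m) ≃ₗ[k] HHOmega k A m (n + 1))
      (br : HH k A m →ₗ[k] HHOmega k A 1 (n + 1) →ₗ[k] HHOmega k A m (n + 1))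
      (brSg : HH k A m →ₗ[k] HHsg k A (-(n : ℤ)) →ₗ[k] HHsg k A ((m : ℤ) - n - 1)),
      -- these are the maps on (co)homology that are induced by the maps on (co)chains
      Induces (fun f => bvDelta hf f.1) Δ ∧
      Induces (fun z => connesB k A z.1) B₁ ∧
      Induces (fun z => connesB k A z.1) B₂ ∧
      Induces₂ (fun f z => cap f.1 z.1) cap₁ ∧
      Induces₂ (fun f z => cap f.1 z.1) cap₂ ∧
      Induces₂ (fun f z => cap f.1 z.1) cap₃ ∧
      Induces (fun z => kappa hf 1 z.1) κ₁.toLinearMap ∧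
      Induces (fun z => kappa hf m z.1) κ₂.toLinearMap ∧
      Induces₂ (fun f g => bracket (algCochain f) (omegaCochain g) m) br ∧
      -- the bracket on singular Hochschild cohomology, on all stages `HH^l(A, Ω̄^p(A))`
      (∀ (l p : ℕ) (hl : 0 < l) (hlp : (l : ℤ) - p = -(n : ℤ))
        (f : ZA k A m) (g : ZOmega k A l p),
          ∃ h : bracket (algCochain f) (omegaCochain g) (m + l - 1) ∈ ZOmega k A (m + l - 1) p,
            brSg (Subquotient.mk _ f) (toSg l p (-(n : ℤ)) hl hlp (Subquotient.mk _ g)) =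
              toSg (m + l - 1) p ((m : ℤ) - n - 1) (by omega) (by omega)
                (Subquotient.mk _ ⟨_, h⟩)) ∧
      -- the stages of the isomorphisms `κ` compute singular Hochschild cohomology, and the
      -- brackets agree
      Function.Bijective (toSg (k := k) (A := A) 1 (n + 1) (-(n : ℤ)) (by omega) (by omega)) ∧
      Function.Bijective
        (toSg (k := k) (A := A) m (n + 1) ((m : ℤ) - n - 1) (by omega) (by omega)) ∧
      (∀ (f : HH k A m) (β : HHOmega k A 1 (n + 1)),
        brSg f (toSg 1 (n + 1) (-(n : ℤ)) (by omega) (by omega) β) =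
          toSg m (n + 1) ((m : ℤ) - n - 1) (by omega) (by omega) (br f β)) ∧
      -- the bracket under the isomorphisms `κ`
      ∀ (f : HH k A m) (α : HHhom k A (n - 1)),
        br f (κ₁ α) = κ₂ ((-1 : k) ^ m • cap₁ (Δ f) α + cap₂ f (B₁ α) +
          (-1 : k) ^ (m + 1) • B₂ (cap₃ f α)) := by
  obtain ⟨N, e, f, hc, h⟩ := exists_casimir hf
  obtain ⟨Δ, hΔ⟩ := exists_bvDelta hf hm
  obtain ⟨m, rfl⟩ : ∃ c, m = c + 1 := ⟨m - 1, by omega⟩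
  obtain ⟨r, rfl⟩ : ∃ c, n = c + 1 + 1 := ⟨n - 2, by omega⟩
  obtain ⟨B₁, hB₁⟩ := exists_connes k A (r + 1)
  -- Because m + 1 ≤ n, the truncated difference n − m is the successor of n − 1 − m.
  obtain ⟨B₂, hB₂⟩ : ∃ B : HHhom k A (r + 1 + 1 - 1 - (m + 1)) →ₗ[k] HHhom k A (r + 1 + 1 - (m + 1)),
      Induces (fun z => connesB k A z.1) B := by
    rw [show r + 1 + 1 - (m + 1) = r + 1 + 1 - 1 - (m + 1) + 1 by omega]
    exact exists_connes k A _
  obtain ⟨cap₁, hcap₁⟩ := exists_cap k A (m := m) (r := r + 1) (s := r + 1 + 1 - (m + 1)) (by omega)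
  obtain ⟨cap₂, hcap₂⟩ := exists_cap k A (m := m + 1) (r := r + 1 + 1) (s := r + 1 + 1 - (m + 1))
    (by omega)
  obtain ⟨cap₃, hcap₃⟩ := exists_cap k A (m := m + 1) (r := r + 1) (s := r + 1 + 1 - 1 - (m + 1))
    (by omega)
  obtain ⟨κ₁, hκ₁⟩ := exists_kappaEquiv hc h (m := 1) (r := r + 1) (p := r + 1 + 1 + 1) le_rfl
    (by omega) rfl
  obtain ⟨κ₂, hκ₂⟩ := exists_kappaEquiv hc h (m := m + 1) (r := r + 1 + 1 - (m + 1))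
    (p := r + 1 + 1 + 1) (by omega) (by omega) (by omega)
  have hT₁ := toSg_bijective (k := k) h (m := 1) (p := r + 1 + 1 + 1) (i := -((r + 1 + 1 : ℕ) : ℤ))
    (by omega) (by push_cast; omega) (by omega)
  have hT₂ := toSg_bijective (k := k) h (m := m + 1) (p := r + 1 + 1 + 1)
    (i := ((m + 1 : ℕ) : ℤ) - (r + 1 + 1 : ℕ) - 1) (by omega) (by push_cast; omega) (by omega)
  -- The bracket is defined by the right-hand side of the formula, carried over by κ; that it is
  -- induced by the bracket of cochains is proved afterwards.
  let br : HH k A (m + 1) →ₗ[k] HHOmega k A 1 (r + 1 + 1 + 1) →ₗ[k]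
      HHOmega k A (m + 1) (r + 1 + 1 + 1) :=
    LinearMap.mk₂ k (fun g β => κ₂ ((-1 : k) ^ (m + 1) • cap₁ (Δ g) (κ₁.symm β) +
      cap₂ g (B₁ (κ₁.symm β)) + (-1 : k) ^ (m + 1 + 1) • B₂ (cap₃ g (κ₁.symm β))))
      (fun g g' β => by simp only [map_add, LinearMap.add_apply, smul_add]; abel)
      (fun c g β => by simp only [map_smul, LinearMap.smul_apply, smul_add, smul_comm c, map_add])
      (fun g β β' => by simp only [map_add, smul_add]; abel)
      (fun c g β => by simp only [map_smul, smul_add, smul_comm c, map_add])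
  have hbr : ∀ g α, br g (κ₁ α) = κ₂ ((-1 : k) ^ (m + 1) • cap₁ (Δ g) α + cap₂ g (B₁ α) +
      (-1 : k) ^ (m + 1 + 1) • B₂ (cap₃ g α)) := by
    intro g α
    rw [LinearMap.mk₂_apply, LinearEquiv.symm_apply_apply]
  have hbr' := induces_bracket hc h (by omega) hΔ hB₁ hB₂ hcap₁ hcap₂ hcap₃ hκ₁ hκ₂ hbr
  -- On singular cohomology the bracket is `br` between the two stages with Ω^{n+1}, preceded by the
  -- inverse of one stage map and followed by the other.
  refine ⟨Δ, B₁, B₂, cap₁, cap₂, cap₃, κ₁, κ₂, br,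
    (br.compr₂ (toSg (m + 1) (r + 1 + 1 + 1) _ (by omega) (by push_cast; omega))).compl₂
      (LinearEquiv.ofBijective _ hT₁).symm.toLinearMap, hΔ, hB₁, hB₂, hcap₁, hcap₂, hcap₃, hκ₁, hκ₂,
    hbr', ?_, hT₁, hT₂, ?_, hbr⟩
  · intro l p hl hlp g w
    obtain ⟨l, rfl⟩ : ∃ c, l = c + 1 := ⟨l - 1, by omega⟩
    refine toSg_bracket h (Nat.succ_pos m) g (s := r + 1 + 1 + 1) (by omega) (by push_cast; omega)
      (by push_cast; omega) _ (fun w' hw' => ?_) l p hlp w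
    rw [LinearMap.compl₂_apply, LinearMap.compr₂_apply, LinearEquiv.coe_coe]
    erw [LinearEquiv.ofBijective_symm_apply_apply]
    rw [(hbr' g w').2]
  · intro g β
    rw [LinearMap.compl₂_apply, LinearMap.compr₂_apply, LinearEquiv.coe_coe]
    erw [LinearEquiv.ofBijective_symm_apply_apply]
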